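/- **Conventions.** A commutative DG ring is a $\mathbb{Z}$-graded ring $A=\bigoplus_{i\le 0}A^i$ concentrated in nonpositive degrees, with a degree $1$ differential $d$ satisfying $d^2=0$ and the graded Leibniz rule, such that $ba=(-1)^{ij}ab$ for $a\in A^i$, $b\in A^j$, and $a^2=0$ for $a$ of odd degree. Put $\bar A:=\mathrm{H}^0(A)$, and let $\mathrm{D}(A)$ be the derived category of DG $A$-modules; $\mathrm{D}^-(A)$ consists of the DG modules with cohomology bounded above, and $\mathrm{D}^-_{\mathrm f}(A)$ of those that in addition have all $\mathrm{H}^i$ finitely generated over $\bar A$. The DG ring $A$ is *cohomologically pseudo-noetherian* if $\bar A$ is noetherian and every $\mathrm{H}^i(A)$ is a finitely generated $\bar A$-module. A DG module is *finite semi-free* if it has a finite filtration by DG submodules $0=F_0\subseteq F_1\subseteq\dots\subseteq F_m$, exhausting it, whose successive quotients are finite direct sums of shifts of the base DG ring. For $s\in\bar A$ put $A_s:=S^{-1}A^0\otimes_{A^0}A$, where $S\subseteq A^0$ is the preimage of $\{s^k\}_{k\ge 0}$. A DG $A$-module $P$ is *geometrically perfect* if there are $s_1,\dots,s_n\in\bar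 A$ generating the unit ideal, and for each $i$ a finite semi-free DG $A_{s_i}$-module $P_i$ with $A_{s_i}\otimes_A P\cong P_i$ in $\mathrm{D}(A_{s_i})$. It is *algebraically perfect* if it lies in the smallest full subcategory of $\mathrm{D}(A)$ that contains $A$ and is closed under shifts, cones, and direct summands (hence isomorphisms). For a set $S$ of integers let $\mathrm{con}(S)$ be the smallest integer interval containing $S$, with $\mathrm{con}(\emptyset)=\emptyset$; write $\mathrm{con}\,\mathrm{H}(N)$ for $\mathrm{con}\{i:\mathrm{H}^i(N)\ne 0\}$. The DG module $P$ has *finite projective dimension relative to* $\mathrm{D}(A)$ if there are integers $d_0\le d_1$ with $\mathrm{con}\,\mathrm{H}(\mathrm{RHom}_A(P,N))\subseteq \mathrm{con}\,\mathrm{H}(N)+[-d_1,-d_0]$ for all $N\in\mathrm{D}(A)$. **Theorem.** Let $A$ be a commutative DG ring and let $P$ be a DG $A$-module. The following conditions are equivalent. (i) $P$ is geometrically perfect. (ii) $P$ is in $\mathrm{D}^-(A)$, and $\bar A\otimes^{\mathrm L}_A P$ is a geometrically perfect DG $\bar A$-module. (iii) For all $M,N\in\mathrm{D}(A)$ the canonical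 morphism $$\mathrm{RHom}_A(P,M)\otimes^{\mathrm L}_A N\to\mathrm{RHom}_A(P,M\otimes^{\mathrm L}_A N)$$ in $\mathrm{D}(A)$ is an isomorphism. (For a K-projective resolution $L\to P$ and a K-flat resolution $F\to N$ it is represented by $\mathrm{Hom}_A(L,M)\otimes_A F\to\mathrm{Hom}_A(L,M\otimes_A F)$, sending $\alpha\otimes n$ to $l\mapsto(-1)^{|n||l|}\alpha(l)\otimes n$.) (iv) $P$ is algebraically perfect. (v) $P$ is a compact object of $\mathrm{D}(A)$: for every family $(N_z)_{z\in Z}$ of DG $A$-modules the canonical map $\bigoplus_z\mathrm{Hom}_{\mathrm{D}(A)}(P,N_z)\to\mathrm{Hom}_{\mathrm{D}(A)}(P,\bigoplus_z N_z)$ is bijective. If $A$ is cohomologically pseudo-noetherian, these conditions are also equivalent to (vi) $P$ is in $\mathrm{D}^-_{\mathrm f}(A)$ and has finite projective dimension relative to $\mathrm{D}(A)$. -/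

import Mathlib

universe u

namespace DG

open CategoryTheory

/-- The sign `(-1)^n`, as an integer. -/
def sgn (n : ℤ) : ℤ := ((n.negOnePow : ℤˣ) : ℤ)

lemma sgn_add (m n : ℤ) : sgn (m + n) = sgn m * sgn n := by
  simp [sgn, Int.negOnePow_add]

lemma sgn_even {n : ℤ} (h : Even n) : sgn n = 1 := by simp [sgn, Int.negOnePow_even n h]

lemma sgn_odd {n : ℤ} (h : Odd n) : sgn n = -1 := by simp [sgn, Int.negOnePow_odd n h]

lemma sgn_zero : sgn 0 = 1 := sgn_even (by simp)

lemma sgn_one : sgn 1 = -1 := sgn_odd (by simp)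

lemma sgn_mul_self (m : ℤ) : sgn m * sgn m = 1 := by
  rw [← sgn_add]; exact sgn_even ⟨m, rfl⟩

/-- A commutative DG ring: a graded ring `A = ⨁ A^i`, with a differential of degree `1` satisfying
the graded Leibniz rule, that is nonpositive and strongly commutative.  The homogeneous components
are `X i`; products and differentials land in any component whose index is propositionally equal
to the expected one. -/
structure CommDGRing : Type (u + 1) where
  X : ℤ → Type u
  [grp : ∀ i, AddCommGroup (X i)]
  mul : ∀ {i j k : ℤ}, i + j = k → X i →+ X j →+ X k
  one : X 0
  d : ∀ {i j : ℤ}, i + 1 = j → X i →+ X j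
  one_mul : ∀ {i : ℤ} (h : 0 + i = i) (a : X i), mul h one a = a
  mul_assoc : ∀ {i j k ij jk l : ℤ} (h₁ : i + j = ij) (h₂ : ij + k = l) (h₃ : j + k = jk)
    (h₄ : i + jk = l) (a : X i) (b : X j) (c : X k),
    mul h₂ (mul h₁ a b) c = mul h₄ a (mul h₃ b c)
  comm : ∀ {i j k : ℤ} (h : i + j = k) (h' : j + i = k) (a : X i) (b : X j),
    mul h' b a = sgn (i * j) • mul h a b
  sq_zero : ∀ {i k : ℤ} (h : i + i = k) (a : X i), Odd i → mul h a a = 0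
  d_d : ∀ {i j k : ℤ} (h : i + 1 = j) (h' : j + 1 = k) (a : X i), d h' (d h a) = 0
  leibniz : ∀ {i j k i' j' k' : ℤ} (h : i + j = k) (hi : i + 1 = i') (hj : j + 1 = j')
    (hk : k + 1 = k') (h₁ : i' + j = k') (h₂ : i + j' = k') (a : X i) (b : X j),
    d hk (mul h a b) = mul h₁ (d hi a) b + sgn i • mul h₂ a (d hj b)
  nonpos : ∀ i : ℤ, 0 < i → ∀ a : X i, a = 0

attribute [instance] CommDGRing.grp

/-- A homomorphism of DG rings: a degree `0` ring homomorphism commuting with the differentials. -/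
@[ext]
structure CommDGRing.Hom (A B : CommDGRing.{u}) where
  app : ∀ i, A.X i →+ B.X i
  map_one : app 0 A.one = B.one
  map_mul : ∀ {i j k : ℤ} (h : i + j = k) (a : A.X i) (b : A.X j),
    app k (A.mul h a b) = B.mul h (app i a) (app j b)
  map_d : ∀ {i j : ℤ} (h : i + 1 = j) (a : A.X i), app j (A.d h a) = B.d h (app i a)

/-- The identity homomorphism. -/
def CommDGRing.Hom.id (A : CommDGRing.{u}) : A.Hom A where
  app _ := AddMonoidHom.id _
  map_one := rfl
  map_mul _ _ _ := rfl
  map_d _ _ := rfl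

/-- A (left) DG `A`-module. -/
structure DGMod (A : CommDGRing.{u}) : Type (u + 1) where
  X : ℤ → Type u
  [grp : ∀ i, AddCommGroup (X i)]
  smul : ∀ {i j k : ℤ}, i + j = k → A.X i →+ X j →+ X k
  d : ∀ {i j : ℤ}, i + 1 = j → X i →+ X j
  one_smul : ∀ {i : ℤ} (h : 0 + i = i) (m : X i), smul h A.one m = m
  mul_smul : ∀ {i j k ij jk l : ℤ} (h₁ : i + j = ij) (h₂ : ij + k = l) (h₃ : j + k = jk)
    (h₄ : i + jk = l) (a : A.X i) (b : A.X j) (m : X k),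
    smul h₂ (A.mul h₁ a b) m = smul h₄ a (smul h₃ b m)
  d_d : ∀ {i j k : ℤ} (h : i + 1 = j) (h' : j + 1 = k) (m : X i), d h' (d h m) = 0
  leibniz : ∀ {i j k i' j' k' : ℤ} (h : i + j = k) (hi : i + 1 = i') (hj : j + 1 = j')
    (hk : k + 1 = k') (h₁ : i' + j = k') (h₂ : i + j' = k') (a : A.X i) (m : X j),
    d hk (smul h a m) = smul h₁ (A.d hi a) m + sgn i • smul h₂ a (d hj m)

attribute [instance] DGMod.grp

namespace DGMod

variable {A : CommDGRing.{u}}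

/-- Homomorphisms of DG modules: `A`-linear, of degree `0`, commuting with the differentials. -/
@[ext]
structure Hom (M N : DGMod A) : Type u where
  app : ∀ i, M.X i →+ N.X i
  map_smul : ∀ {i j k : ℤ} (h : i + j = k) (a : A.X i) (m : M.X j),
    app k (M.smul h a m) = N.smul h a (app j m)
  map_d : ∀ {i j : ℤ} (h : i + 1 = j) (m : M.X i), app j (M.d h m) = N.d h (app i m)

/-- The category of DG `A`-modules. -/
instance : Category (DGMod A) where
  Hom M N := Hom M N
  id M :=
    { app := fun _ => AddMonoidHom.id _
      map_smul := fun _ _ _ => rfl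
      map_d := fun _ _ => rfl }
  comp f g :=
    { app := fun i => (g.app i).comp (f.app i)
      map_smul := fun h a m => by simp [f.map_smul, g.map_smul]
      map_d := fun h m => by simp [f.map_d, g.map_d] }

end DGMod

/-- The DG ring `A` as a DG module over itself. -/
def CommDGRing.self (A : CommDGRing.{u}) : DGMod A where
  X := A.X
  smul := A.mul
  d := A.d
  one_smul := A.one_mul
  mul_smul := A.mul_assoc
  d_d := A.d_d
  leibniz := A.leibniz

/-! ### The ring `A^0`, the ring `H^0(A)`, and cohomology -/

/-- The degree zero component is a commutative ring. -/
instance CommDGRing.commRingZero (A : CommDGRing.{u}) : CommRing (A.X 0) :=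
  { A.grp 0 with
    mul := fun a b => A.mul (add_zero 0) a b
    one := A.one
    mul_assoc := fun a b c => A.mul_assoc _ _ _ _ a b c
    one_mul := fun a => A.one_mul _ a
    mul_one := fun a => by
      change A.mul (add_zero 0) a A.one = a
      rw [A.comm (add_zero 0) (add_zero 0) A.one a, A.one_mul]
      simp [sgn_zero]
    left_distrib := fun a b c => by
      change A.mul (add_zero 0) a (b + c) = A.mul (add_zero 0) a b + A.mul (add_zero 0) a c
      simp
    right_distrib := fun a b c => by
      change A.mul (add_zero 0) (a + b) c = A.mul (add_zero 0) a c + A.mul (add_zero 0) b c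
      simp
    zero_mul := fun a => by
      change A.mul (add_zero 0) 0 a = 0
      simp
    mul_zero := fun a => by
      change A.mul (add_zero 0) a 0 = 0
      simp
    mul_comm := fun a b => by
      change A.mul (add_zero 0) a b = A.mul (add_zero 0) b a
      rw [A.comm (add_zero 0) (add_zero 0) b a]
      simp [sgn_zero] }

lemma CommDGRing.d_degreeZero (A : CommDGRing.{u}) {j : ℤ} (h : 0 + 1 = j) (a : A.X 0) :
    A.d h a = 0 := A.nonpos j (by omega) _

/-- The ideal of coboundaries in `A^0`. -/
def CommDGRing.boundaryIdeal (A : CommDGRing.{u}) : Ideal (A.X 0) where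
  carrier := {a | ∃ b : A.X (-1), A.d (by norm_num : (-1 : ℤ) + 1 = 0) b = a}
  zero_mem' := ⟨0, by simp⟩
  add_mem' := by
    rintro _ _ ⟨b, rfl⟩ ⟨c, rfl⟩
    exact ⟨b + c, by simp⟩
  smul_mem' := by
    rintro c _ ⟨b, rfl⟩
    refine ⟨A.mul (zero_add (-1)) c b, ?_⟩
    rw [A.leibniz (zero_add (-1)) (zero_add 1) (by norm_num) (by norm_num) (by norm_num)
      (add_zero 0) c b, A.d_degreeZero]
    simp [sgn_zero]
    rfl

/-- The commutative ring `H^0(A)`.  As `A` is nonpositive, every element of `A^0` is a cocycle. -/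
abbrev CommDGRing.H0 (A : CommDGRing.{u}) : Type u := A.X 0 ⧸ A.boundaryIdeal

namespace DGMod

variable {A : CommDGRing.{u}} (M N : DGMod A)

instance moduleZero (i : ℤ) : Module (A.X 0) (M.X i) where
  smul a m := M.smul (zero_add i) a m
  one_smul m := M.one_smul _ m
  mul_smul a b m := M.mul_smul _ _ _ _ a b m
  smul_zero a := map_zero _
  smul_add a := map_add _
  add_smul a b m := by
    change M.smul (zero_add i) (a + b) m = M.smul (zero_add i) a m + M.smul (zero_add i) b m
    simp
  zero_smul m := by
    change M.smul (zero_add i) 0 m = 0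
    simp

lemma zero_smul_def {i : ℤ} (a : A.X 0) (m : M.X i) : a • m = M.smul (zero_add i) a m := rfl

/-- The differential is `A^0`-linear. -/
def dLin {i j : ℤ} (h : i + 1 = j) : M.X i →ₗ[A.X 0] M.X j where
  toFun := M.d h
  map_add' := map_add _
  map_smul' a m := by
    simp only [zero_smul_def, RingHom.id_apply]
    rw [M.leibniz (zero_add i) rfl h h (by omega) (zero_add j) a m, A.d_degreeZero]
    simp [sgn_zero]

/-- Cocycles. -/
def cocycles (i : ℤ) : Submodule (A.X 0) (M.X i) := LinearMap.ker (M.dLin (rfl : i + 1 = i + 1))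

/-- Coboundaries. -/
def coboundaries (i : ℤ) : Submodule (A.X 0) (M.X i) :=
  LinearMap.range (M.dLin (sub_add_cancel i 1))

/-- The cohomology `H^i(M)`. -/
def H (i : ℤ) : Type u := M.cocycles i ⧸ (M.coboundaries i).submoduleOf (M.cocycles i)

instance (i : ℤ) : AddCommGroup (M.H i) :=
  inferInstanceAs (AddCommGroup (M.cocycles i ⧸ (M.coboundaries i).submoduleOf (M.cocycles i)))

instance (i : ℤ) : Module (A.X 0) (M.H i) :=
  inferInstanceAs (Module (A.X 0) (M.cocycles i ⧸ (M.coboundaries i).submoduleOf (M.cocycles i)))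

lemma H_isTorsion (i : ℤ) : Module.IsTorsionBySet (A.X 0) (M.H i) (A.boundaryIdeal : Set (A.X 0)) := by
  rintro x ⟨_, b, rfl⟩
  obtain ⟨⟨z, hz⟩, rfl⟩ := Submodule.Quotient.mk_surjective _ x
  refine (Submodule.Quotient.mk_eq_zero _).2 ?_
  change _ ∈ M.coboundaries i
  have hz' : M.d rfl z = 0 := hz
  refine ⟨M.smul (show (-1 : ℤ) + i = i - 1 by ring) b z, ?_⟩
  change M.d _ _ = M.smul _ _ _
  rw [M.leibniz (show (-1 : ℤ) + i = i - 1 by ring) (by norm_num) rfl (sub_add_cancel i 1)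
    (zero_add i) (by ring) b z, hz']
  simp

/-- `H^i(M)` is a module over the ring `H^0(A)`. -/
instance (i : ℤ) : Module A.H0 (M.H i) := (M.H_isTorsion i).module

variable {M N}

/-- The map induced on cohomology by a homomorphism of DG modules. -/
def Hmap (f : M ⟶ N) (i : ℤ) : M.H i →+ N.H i :=
  QuotientAddGroup.map _ _
    (((f.app i).comp (M.cocycles i).toAddSubgroup.subtype).codRestrict
      (N.cocycles i).toAddSubgroup (fun z => by
        have hz : M.d rfl z.1 = 0 := z.2
        change N.d rfl (f.app i z.1) = 0
        rw [← f.map_d, hz, map_zero]))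
    (by
      rintro ⟨z, hz⟩ ⟨y, hy⟩
      refine ⟨f.app _ y, ?_⟩
      have hy' : M.d (sub_add_cancel i 1) y = z := hy
      change N.d _ (f.app _ y) = f.app i z
      rw [← f.map_d, hy'])

variable (M)

/-- A DG module with zero cohomology. -/
def Acyclic : Prop := ∀ i, Subsingleton (M.H i)

/-- The set of degrees in which the cohomology of `M` is nonzero. -/
def cohSupport : Set ℤ := {i | Nontrivial (M.H i)}

end DGMod

/-- The class of quasi-isomorphisms. -/
def quasiIso (A : CommDGRing.{u}) : MorphismProperty (DGMod A) :=
  fun _ _ f => ∀ i, Function.Bijective (DGMod.Hmap f i)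

/-- The derived category `D(A)`: the category of DG modules with quasi-isomorphisms inverted. -/
abbrev D (A : CommDGRing.{u}) : Type (u + 1) := (quasiIso A).Localization

/-- The localization functor from DG modules to `D(A)`. -/
abbrev Q (A : CommDGRing.{u}) : DGMod A ⥤ D A := (quasiIso A).Q

lemma sgn_congr {m n : ℤ} (h : Even (m - n)) : sgn m = sgn n := by
  have : m = (m - n) + n := by ring
  rw [this, sgn_add, sgn_even h, one_mul]

namespace DGMod

variable {A : CommDGRing.{u}}

/-! ### Shifts, cones, direct sums -/

/-- The shift `M[n]`, with `M[n]^i = M^{n+i}`, differential `(-1)^n d` and twisted action. -/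
def shift (M : DGMod A) (n : ℤ) : DGMod A where
  X i := M.X (n + i)
  smul {p j k} h := AddMonoidHom.mk' (fun a => sgn (p * n) • M.smul (by omega) a) (by
    intro a b; simp)
  d h := sgn n • M.d (by omega)
  one_smul h m := by
    simp [sgn_zero, M.one_smul]
  mul_smul {i j k ij jk l} h₁ h₂ h₃ h₄ a b m := by
    simp only [AddMonoidHom.mk'_apply, AddMonoidHom.smul_apply, map_zsmul, smul_smul]
    rw [M.mul_smul h₁ (by omega) (by omega : j + (n + k) = n + jk) (by omega), mul_comm (sgn _), ← sgn_add,
      ← add_mul, h₁]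
  d_d h h' m := by
    simp [M.d_d]
  leibniz {i j k i' j' k'} h hi hj hk h₁ h₂ a m := by
    simp only [AddMonoidHom.mk'_apply, AddMonoidHom.smul_apply, map_zsmul, smul_smul]
    rw [M.leibniz (by omega) hi (by omega : n + j + 1 = n + j') (by omega) (by omega) (by omega) a m]
    simp only [smul_add, smul_smul, ← sgn_add]
    congr 2
    · apply sgn_congr; subst hi; exact ⟨0, by ring⟩
    · apply sgn_congr; exact ⟨0, by ring⟩

/-- The identification of components with equal indices. -/
def idx (M : DGMod A) {i j : ℤ} (h : i = j) : M.X i →+ M.X j := h ▸ AddMonoidHom.id _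

@[simp] lemma idx_rfl (M : DGMod A) {i : ℤ} (h : i = i) (m : M.X i) : M.idx h m = m := rfl

/-- The mapping cone of `f : M ⟶ N`: degree `i` component `N^i × M^{i+1}`,
differential `(y, x) ↦ (d y + f x, - d x)`, action `a (y, x) = (a y, (-1)^p a x)` for `a` of
degree `p`. -/
def cone {M N : DGMod A} (f : M ⟶ N) : DGMod A where
  X i := N.X i × M.X (i + 1)
  smul {p j k} h := AddMonoidHom.mk' (fun a => AddMonoidHom.mk'
      (fun x => (N.smul h a x.1, sgn p • M.smul (by omega : p + (j + 1) = k + 1) a x.2))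
      (fun x y => by ext <;> simp)) (fun a b => by ext x <;> simp)
  d {i j} h := AddMonoidHom.mk'
      (fun x => (N.d h x.1 + f.app j (M.idx h x.2), - M.d (by omega : i + 1 + 1 = j + 1) x.2))
      (fun x y => by
        ext
        · simp only [Prod.fst_add, Prod.snd_add, map_add]; abel
        · simp only [Prod.snd_add, map_add]; abel)
  one_smul h m := by
    ext <;> simp [sgn_zero, M.one_smul, N.one_smul]
  mul_smul {i j k ij jk l} h₁ h₂ h₃ h₄ a b m := by
    ext
    · simp [N.mul_smul h₁ h₂ h₃ h₄]
    · simp only [AddMonoidHom.mk'_apply, map_zsmul, smul_smul]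
      rw [M.mul_smul h₁ (by omega) (by omega : j + (k + 1) = jk + 1) (by omega), ← sgn_add, h₁]
  d_d h h' m := by
    subst h h'
    ext
    · simp [N.d_d, f.map_d]
    · simp [M.d_d]
  leibniz {i j k i' j' k'} h hi hj hk h₁ h₂ a m := by
    subst hj hk
    ext
    · simp only [AddMonoidHom.mk'_apply, idx_rfl, N.leibniz h hi rfl rfl h₁ h₂, map_zsmul,
        f.map_smul, smul_add, Prod.fst_add, Prod.smul_fst, map_add]
      abel
    · simp only [AddMonoidHom.mk'_apply, map_zsmul, smul_smul, Prod.snd_add, Prod.smul_snd, map_neg]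
      rw [M.leibniz (by omega : i + (j + 1) = k + 1) hi rfl rfl (by omega) (by omega) a m.2]
      subst hi
      simp [sgn_add, sgn_one, smul_add, smul_smul, sgn_mul_self]
      abel

/-- The direct sum of a family of DG modules. -/
def directSum {ι : Type u} (N : ι → DGMod A) : DGMod A where
  X i := DirectSum ι (fun z => (N z).X i)
  smul h := AddMonoidHom.mk' (fun a => DirectSum.map (fun z => (N z).smul h a)) (by
    intro a b; ext z x : 2; simp)
  d h := DirectSum.map (fun z => (N z).d h)
  one_smul h m := by
    refine DFinsupp.ext fun z => ?_
    exact (N z).one_smul h _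
  mul_smul h₁ h₂ h₃ h₄ a b m := by
    refine DFinsupp.ext fun z => ?_
    exact (N z).mul_smul h₁ h₂ h₃ h₄ a b _
  d_d h h' m := by
    refine DFinsupp.ext fun z => ?_
    exact (N z).d_d h h' _
  leibniz h hi hj hk h₁ h₂ a m := by
    refine DFinsupp.ext fun z => ?_
    exact (N z).leibniz h hi hj hk h₁ h₂ a _

/-- The inclusion of the sub-sum indexed by a finite set of indices. -/
noncomputable def directSumIncl {ι : Type u} (N : ι → DGMod A) (s : Finset ι) :
    directSum (fun z : s => N z) ⟶ directSum N := by
  classical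
  exact
  { app := fun i => DirectSum.toAddMonoid (fun z => DirectSum.of (fun z => (N z).X i) z.1)
    map_smul := fun {i j k} h a m => by
      change ((DirectSum.toAddMonoid _).comp (DirectSum.map _)) m =
        ((DirectSum.map _).comp (DirectSum.toAddMonoid _)) m
      congr 1
      ext z x : 2
      simp
    map_d := fun {i j} h m => by
      change ((DirectSum.toAddMonoid _).comp (DirectSum.map _)) m =
        ((DirectSum.map _).comp (DirectSum.toAddMonoid _)) m
      congr 1
      ext z x : 2
      simp }

/-! ### Submodules, quotients, finite semi-free DG modules -/

/-- A DG submodule. -/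
@[ext]
structure Sub (M : DGMod A) : Type u where
  carrier : ∀ i, AddSubgroup (M.X i)
  smul_mem : ∀ {i j k : ℤ} (h : i + j = k) (a : A.X i) {m : M.X j},
    m ∈ carrier j → M.smul h a m ∈ carrier k
  d_mem : ∀ {i j : ℤ} (h : i + 1 = j) {m : M.X i}, m ∈ carrier i → M.d h m ∈ carrier j

/-- A DG submodule, viewed as a DG module. -/
def Sub.toDGMod {M : DGMod A} (S : M.Sub) : DGMod A where
  X i := S.carrier i
  smul {i j k} h := AddMonoidHom.mk' (fun a =>
      ((M.smul h a).comp (S.carrier j).subtype).codRestrict (S.carrier k)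
        (fun m => S.smul_mem h a m.2)) (by
    intro a b; ext m; simp)
  d {i j} h := ((M.d h).comp (S.carrier i).subtype).codRestrict (S.carrier j)
    (fun m => S.d_mem h m.2)
  one_smul h m := Subtype.ext (M.one_smul h _)
  mul_smul h₁ h₂ h₃ h₄ a b m := Subtype.ext (M.mul_smul h₁ h₂ h₃ h₄ a b _)
  d_d h h' m := Subtype.ext (M.d_d h h' _)
  leibniz h hi hj hk h₁ h₂ a m := Subtype.ext (M.leibniz h hi hj hk h₁ h₂ a _)

/-- The DG submodule `S' ∩ S` of `S`. -/
def Sub.restrict {M : DGMod A} (S' S : M.Sub) : S.toDGMod.Sub where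
  carrier i := (S'.carrier i).addSubgroupOf (S.carrier i)
  smul_mem := fun h a _ hm => S'.smul_mem h a hm
  d_mem := fun h _ hm => S'.d_mem h hm

/-- The quotient of a DG module by a DG submodule. -/
def quotient (M : DGMod A) (S : M.Sub) : DGMod A where
  X i := M.X i ⧸ S.carrier i
  smul {i j k} h := AddMonoidHom.mk' (fun a =>
      QuotientAddGroup.map (S.carrier j) (S.carrier k) (M.smul h a)
        (fun _ hm => S.smul_mem h a hm)) (by
    intro a b; ext m
    exact congrArg _ (by simp : M.smul h (a + b) m = M.smul h a m + M.smul h b m))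
  d {i j} h := QuotientAddGroup.map (S.carrier i) (S.carrier j) (M.d h) (fun _ hm => S.d_mem h hm)
  one_smul h m := by
    obtain ⟨m, rfl⟩ := QuotientAddGroup.mk_surjective m
    exact congrArg _ (M.one_smul h m)
  mul_smul h₁ h₂ h₃ h₄ a b m := by
    obtain ⟨m, rfl⟩ := QuotientAddGroup.mk_surjective m
    exact congrArg _ (M.mul_smul h₁ h₂ h₃ h₄ a b m)
  d_d h h' m := by
    obtain ⟨m, rfl⟩ := QuotientAddGroup.mk_surjective m
    exact congrArg _ (M.d_d h h' m)
  leibniz h hi hj hk h₁ h₂ a m := by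
    obtain ⟨m, rfl⟩ := QuotientAddGroup.mk_surjective m
    exact congrArg _ (M.leibniz h hi hj hk h₁ h₂ a m)

/-- A finite free DG module: isomorphic, as a DG module, to a finite direct sum of shifts of `A`. -/
def IsFiniteFree (M : DGMod A) : Prop :=
  ∃ (r : ℕ) (n : ULift.{u} (Fin r) → ℤ), Nonempty (M ≅ directSum (fun t => A.self.shift (n t)))

/-- A finite semi-free DG module: it has an ascending filtration `ν` by DG submodules, with
`ν_{-1} = 0` and `ν_l = M` for some natural number `l`, and with finite free subquotients
`ν_j / ν_{j-1}`. -/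
def IsFiniteSemiFree (M : DGMod A) : Prop :=
  ∃ ν : ℤ → M.Sub,
    (∀ j k, j ≤ k → ∀ i, (ν j).carrier i ≤ (ν k).carrier i) ∧
    (∀ i, (ν (-1)).carrier i = ⊥) ∧
    (∃ l : ℕ, ∀ i, (ν l).carrier i = ⊤) ∧
    ∀ j, IsFiniteFree ((ν j).toDGMod.quotient ((ν (j - 1)).restrict (ν j)))

end DGMod

namespace DGMod

/-! ### The DG module `Hom_A(L, M)` -/

section Hom

variable {A : CommDGRing.{u}} (L M : DGMod A)

/-- A pair of degrees `i`, `j` with `i + n = j`. -/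
structure DegPair (n : ℤ) where
  i : ℤ
  j : ℤ
  h : i + n = j

/-- Degree `n` homomorphisms `L → M` that are `A`-linear in the graded sense. -/
def homGroup (n : ℤ) : AddSubgroup (∀ T : DegPair n, L.X T.i →+ M.X T.j) where
  carrier := {f | ∀ (p i j i' j' : ℤ) (h : i + n = j) (h' : i' + n = j') (hi : p + i = i')
    (hj : p + j = j') (a : A.X p) (l : L.X i),
    f ⟨i', j', h'⟩ (L.smul hi a l) = sgn (n * p) • M.smul hj a (f ⟨i, j, h⟩ l)}
  zero_mem' := fun p i j i' j' h h' hi hj a l => by simp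
  add_mem' := fun {f g} hf hg p i j i' j' h h' hi hj a l => by
    simp [hf p i j i' j' h h' hi hj a l, hg p i j i' j' h h' hi hj a l]
  neg_mem' := fun {f} hf p i j i' j' h h' hi hj a l => by
    simp [hf p i j i' j' h h' hi hj a l]

variable {L M}

/-- Evaluation of a degree `n` homomorphism. -/
def ev {n i j : ℤ} (f : homGroup L M n) (h : i + n = j) : L.X i →+ M.X j := f.1 ⟨i, j, h⟩

lemma ev_smul {n p i j i' j' : ℤ} (f : homGroup L M n) (h : i + n = j) (h' : i' + n = j')
    (hi : p + i = i') (hj : p + j = j') (a : A.X p) (l : L.X i) :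
    ev f h' (L.smul hi a l) = sgn (n * p) • M.smul hj a (ev f h l) :=
  f.2 p i j i' j' h h' hi hj a l

lemma homGroup_ext {n : ℤ} {f g : homGroup L M n}
    (hfg : ∀ (i j : ℤ) (h : i + n = j) (l : L.X i), ev f h l = ev g h l) : f = g :=
  Subtype.ext (funext fun T => AddMonoidHom.ext fun l => hfg T.i T.j T.h l)

@[simp] lemma ev_add {n i j : ℤ} (f g : homGroup L M n) (h : i + n = j) (l : L.X i) :
    ev (f + g) h l = ev f h l + ev g h l := rfl

@[simp] lemma ev_zsmul {n i j : ℤ} (z : ℤ) (f : homGroup L M n) (h : i + n = j) (l : L.X i) :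
    ev (z • f) h l = z • ev f h l := rfl

@[simp] lemma ev_zero {n i j : ℤ} (h : i + n = j) (l : L.X i) :
    ev (0 : homGroup L M n) h l = 0 := rfl

/-- The action `(a f)(l) = a f(l)`. -/
def homSmul {p n k : ℤ} (h : p + n = k) (a : A.X p) (f : homGroup L M n) : homGroup L M k :=
  ⟨fun T => (M.smul (show p + (T.i + n) = T.j by have := T.h; omega) a).comp (ev f rfl), by
    intro q i j i' j' h₀ h' hi hj b l
    change M.smul _ a (ev f rfl (L.smul hi b l)) = sgn (k * q) • M.smul hj b (M.smul _ a (ev f rfl l))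
    rw [ev_smul f (rfl : i + n = i + n) rfl hi (by omega) b l, map_zsmul,
      ← M.mul_smul (rfl : p + q = p + q) (by omega) (by omega) (by omega),
      ← M.mul_smul (by omega : q + p = p + q) (by omega) (by omega) (by omega),
      A.comm (by omega : q + p = p + q) rfl b a]
    simp only [map_zsmul, AddMonoidHom.smul_apply, smul_smul, ← sgn_add]
    congr 1
    apply sgn_congr; subst h; exact ⟨0, by ring⟩⟩

lemma ev_homSmul {p n k i j j₀ : ℤ} (h : p + n = k) (a : A.X p) (f : homGroup L M n)
    (hij : i + k = j) (h₀ : i + n = j₀) (h₁ : p + j₀ = j) (l : L.X i) :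
    ev (homSmul h a f) hij l = M.smul h₁ a (ev f h₀ l) := by
  subst h₀; rfl

/-- The differential `d f = d ∘ f - (-1)^n f ∘ d`. -/
def homD {n k : ℤ} (h : n + 1 = k) (f : homGroup L M n) : homGroup L M k :=
  ⟨fun T => (M.d (show T.i + n + 1 = T.j by have := T.h; omega)).comp (ev f rfl) -
      sgn n • (ev f (show T.i + 1 + n = T.j by have := T.h; omega)).comp (L.d rfl), by
    intro q i j i' j' h₀ h' hi hj b l
    subst hi
    change M.d _ (ev f rfl (L.smul rfl b l)) - sgn n • ev f _ (L.d rfl (L.smul rfl b l)) =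
      sgn (k * q) • M.smul hj b (M.d _ (ev f rfl l) - sgn n • ev f _ (L.d rfl l))
    rw [ev_smul f (rfl : i + n = i + n) rfl rfl (by omega) b l,
      L.leibniz rfl rfl rfl rfl (by omega) (by omega : q + (i + 1) = q + i + 1) b l, map_add,
      map_zsmul, map_zsmul,
      ev_smul f (rfl : i + n = i + n) (by omega) (by omega) (by omega) (A.d rfl b) l,
      ev_smul f (by omega : i + 1 + n = j) (by omega) (by omega) (by omega) b (L.d rfl l),
      M.leibniz (by omega) rfl (by omega : i + n + 1 = j) (by omega) (by omega) (by omega) b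
        (ev f rfl l)]
    simp only [smul_add, smul_smul, map_sub, map_zsmul, smul_sub, ← sgn_add]
    have e1 : sgn (n + n * (q + 1)) = sgn (n * q) := sgn_congr ⟨n, by ring⟩
    have e2 : sgn (n + (q + n * q)) = sgn (k * q + n) := sgn_congr ⟨0, by subst h; ring⟩
    have e3 : sgn (n * q + q) = sgn (k * q) := sgn_congr ⟨0, by subst h; ring⟩
    simp only [e1, e2, e3]
    abel⟩

lemma ev_homD {n k i j j₀ i₁ : ℤ} (h : n + 1 = k) (f : homGroup L M n) (hij : i + k = j)
    (h₀ : i + n = j₀) (h₁ : j₀ + 1 = j) (h₂ : i + 1 = i₁) (h₃ : i₁ + n = j) (l : L.X i) :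
    ev (homD h f) hij l = M.d h₁ (ev f h₀ l) - sgn n • ev f h₃ (L.d h₂ l) := by
  subst h₀ h₂; rfl

variable (L M)

/-- The DG `A`-module `Hom_A(L, M)`: `(a f)(l) = a f(l)` and `d f = d ∘ f - (-1)^n f ∘ d` for `f`
of degree `n`. -/
def hom : DGMod A where
  X n := homGroup L M n
  smul {p n k} h := AddMonoidHom.mk' (fun a => AddMonoidHom.mk' (fun f => homSmul h a f)
      (by
        intro f g; apply homGroup_ext; intro i j hij l
        simp [ev_homSmul h a _ hij rfl (by omega) l]))
      (by
        intro a b; ext f : 1; apply homGroup_ext; intro i j hij l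
        simp [ev_homSmul h _ _ hij rfl (by omega) l])
  d {n k} h := AddMonoidHom.mk' (fun f => homD h f)
    (by
      intro f g; apply homGroup_ext; intro i j hij l
      simp only [ev_homD h _ hij rfl (by omega) rfl (by omega) l, ev_add, map_add, smul_add]
      abel)
  one_smul {n} h f := by
    apply homGroup_ext; intro i j hij l
    subst hij
    simp [ev_homSmul h _ f rfl rfl (by omega) l, M.one_smul]
  mul_smul {p q n pq qn k} h₁ h₂ h₃ h₄ a b f := by
    apply homGroup_ext; intro i j hij l
    simp only [AddMonoidHom.mk'_apply]
    rw [ev_homSmul h₂ _ f hij rfl (by omega) l, ev_homSmul h₄ _ _ hij rfl (by omega) l,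
      ev_homSmul h₃ _ f rfl rfl (by omega) l]
    exact M.mul_smul _ _ _ _ _ _ _
  d_d {n k k'} h h' f := by
    apply homGroup_ext; intro i j hij l
    simp only [AddMonoidHom.mk'_apply]
    rw [ev_homD h' _ hij rfl (by omega) rfl (by omega) l, ev_homD h f rfl rfl (by omega) rfl (by omega) l,
      ev_homD h f _ (by omega : i + 1 + n = i + k) (by omega) rfl (by omega) (L.d rfl l)]
    subst h
    simp [L.d_d, M.d_d, sgn_add, sgn_one]
  leibniz {p n k p' n' k'} h hp hn hk h₁ h₂ a f := by
    apply homGroup_ext; intro i j hij l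
    simp only [AddMonoidHom.mk'_apply, ev_add, ev_zsmul]
    rw [ev_homD hk _ hij rfl (by omega) rfl (by omega) l, ev_homSmul h a f rfl rfl (by omega) l,
      ev_homSmul h a f _ (by omega : i + 1 + n = i + n + 1) (by omega) _,
      ev_homSmul h₁ _ f hij rfl (by omega) l,
      ev_homSmul h₂ a _ hij (by omega : i + n' = i + n + 1) (by omega) l,
      ev_homD hn f _ rfl rfl rfl (by omega) l,
      M.leibniz (by omega) hp rfl (by omega) (by omega) (by omega) a (ev f rfl l)]
    subst h
    simp only [map_sub, map_zsmul, smul_sub, smul_smul, sgn_add]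
    abel

end Hom

/-! ### Tensor products -/

section Tensor

variable {A B : CommDGRing.{u}} (φ : A.Hom B) (M : DGMod B) (N : DGMod A)

/-- Symbols `m ⊗ n` of degree `k`, with `m ∈ M^i`, `n ∈ N^j` and `i + j = k`. -/
structure TGen (k : ℤ) : Type u where
  i : ℤ
  j : ℤ
  h : i + j = k
  m : M.X i
  n : N.X j

/-- The relations of the tensor product: biadditivity, and `(m a) ⊗ n = m ⊗ (a n)`, where
`m a = (-1)^{ip} φ(a) m` for `m` of degree `i` and `a` of degree `p`. -/
inductive TRel (k : ℤ) : FreeAbelianGroup (TGen M N k) → Prop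
  | add_left (i j : ℤ) (h : i + j = k) (m m' : M.X i) (n : N.X j) :
      TRel k (.of ⟨i, j, h, m + m', n⟩ - .of ⟨i, j, h, m, n⟩ - .of ⟨i, j, h, m', n⟩)
  | add_right (i j : ℤ) (h : i + j = k) (m : M.X i) (n n' : N.X j) :
      TRel k (.of ⟨i, j, h, m, n + n'⟩ - .of ⟨i, j, h, m, n⟩ - .of ⟨i, j, h, m, n'⟩)
  | balance (p i j pi pj : ℤ) (hi : p + i = pi) (hj : p + j = pj) (h : pi + j = k)
      (h' : i + pj = k) (a : A.X p) (m : M.X i) (n : N.X j) :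
      TRel k (.of ⟨pi, j, h, sgn (i * p) • M.smul hi (φ.app p a) m, n⟩ -
        .of ⟨i, pj, h', m, N.smul hj a n⟩)

/-- The degree `k` component of `M ⊗_A N`. -/
def T (k : ℤ) : Type u :=
  FreeAbelianGroup (TGen M N k) ⧸ AddSubgroup.closure {x | TRel φ M N k x}

instance (k : ℤ) : AddCommGroup (T φ M N k) :=
  inferInstanceAs (AddCommGroup
    (FreeAbelianGroup (TGen M N k) ⧸ AddSubgroup.closure {x | TRel φ M N k x}))

variable {M N}

/-- The element `m ⊗ n`. -/
def T.mk {i j k : ℤ} (h : i + j = k) : M.X i →+ N.X j →+ T φ M N k :=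
  AddMonoidHom.mk' (fun m => AddMonoidHom.mk' (fun n =>
      QuotientAddGroup.mk (FreeAbelianGroup.of (⟨i, j, h, m, n⟩ : TGen M N k)))
      (by
        intro n n'
        have := (QuotientAddGroup.eq_zero_iff (N := AddSubgroup.closure {x | TRel φ M N k x}) _).2
          (AddSubgroup.subset_closure (TRel.add_right i j h m n n'))
        rw [QuotientAddGroup.mk_sub, QuotientAddGroup.mk_sub, sub_sub, sub_eq_zero] at this
        exact this))
    (by
      intro m m'
      ext n
      have := (QuotientAddGroup.eq_zero_iff (N := AddSubgroup.closure {x | TRel φ M N k x}) _).2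
        (AddSubgroup.subset_closure (TRel.add_left i j h m m' n))
      rw [QuotientAddGroup.mk_sub, QuotientAddGroup.mk_sub, sub_sub, sub_eq_zero] at this
      exact this)

lemma T.balance {p i j pi pj k : ℤ} (hi : p + i = pi) (hj : p + j = pj) (h : pi + j = k)
    (h' : i + pj = k) (a : A.X p) (m : M.X i) (n : N.X j) :
    T.mk φ h (M.smul hi (φ.app p a) m) n = sgn (i * p) • T.mk φ h' m (N.smul hj a n) := by
  have := (QuotientAddGroup.eq_zero_iff (N := AddSubgroup.closure {x | TRel φ M N k x}) _).2
    (AddSubgroup.subset_closure (TRel.balance p i j pi pj hi hj h h' a m n))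
  rw [QuotientAddGroup.mk_sub, sub_eq_zero] at this
  have h2 : T.mk φ h (sgn (i * p) • M.smul hi (φ.app p a) m) n =
    T.mk φ h' m (N.smul hj a n) := this
  rw [← h2, map_zsmul, AddMonoidHom.smul_apply, smul_smul, sgn_mul_self, _root_.one_smul]

/-- The universal property of the tensor product. -/
def T.lift {k : ℤ} {G : Type*} [AddCommGroup G] (f : ∀ i j : ℤ, i + j = k → M.X i → N.X j → G)
    (hl : ∀ i j h m m' n, f i j h (m + m') n = f i j h m n + f i j h m' n)
    (hr : ∀ i j h m n n', f i j h m (n + n') = f i j h m n + f i j h m n')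
    (hb : ∀ (p i j pi pj : ℤ) (hi : p + i = pi) (hj : p + j = pj) (h : pi + j = k)
      (h' : i + pj = k) (a : A.X p) (m : M.X i) (n : N.X j),
      f pi j h (sgn (i * p) • M.smul hi (φ.app p a) m) n = f i pj h' m (N.smul hj a n)) :
    T φ M N k →+ G :=
  QuotientAddGroup.lift _ (FreeAbelianGroup.lift (fun g : TGen M N k => f g.i g.j g.h g.m g.n)) (by
    rw [AddSubgroup.closure_le]
    rintro x (⟨i, j, h, m, m', n⟩ | ⟨i, j, h, m, n, n'⟩ | ⟨p, i, j, pi, pj, hi, hj, h, h', a, m, n⟩)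
    · simp [hl]
    · simp [hr]
    · simp [hb p i j pi pj hi hj h h'])

@[simp] lemma T.lift_mk {i j k : ℤ} {G : Type*} [AddCommGroup G]
    (f : ∀ i j : ℤ, i + j = k → M.X i → N.X j → G) (hl hr hb) (h : i + j = k) (m : M.X i)
    (n : N.X j) : T.lift φ f hl hr hb (T.mk φ h m n) = f i j h m n :=
  FreeAbelianGroup.lift_apply_of _ _

lemma T.induction {k : ℤ} {P : T φ M N k → Prop} (t : T φ M N k)
    (mk : ∀ (i j : ℤ) (h : i + j = k) (m : M.X i) (n : N.X j), P (T.mk φ h m n))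
    (add : ∀ x y, P x → P y → P (x + y)) : P t := by
  obtain ⟨x, rfl⟩ := QuotientAddGroup.mk_surjective t
  induction x using FreeAbelianGroup.induction_on with
  | zero =>
    have := mk k 0 (add_zero k) 0 0
    rw [map_zero] at this
    exact this
  | of g => exact mk g.i g.j g.h g.m g.n
  | neg g _ =>
    have := mk g.i g.j g.h (-g.m) g.n
    rw [map_neg] at this
    exact this
  | add x y hx hy => exact add _ _ hx hy

lemma T.hom_ext {k : ℤ} {G : Type*} [AddCommGroup G] {f g : T φ M N k →+ G}
    (hfg : ∀ (i j : ℤ) (h : i + j = k) (m : M.X i) (n : N.X j),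
      f (T.mk φ h m n) = g (T.mk φ h m n)) : f = g := by
  ext t
  exact T.induction φ (P := fun t => f t = g t) t hfg (fun x y hx hy => by rw [map_add, map_add, hx, hy])

variable (M N)

/-- The action `b (m ⊗ n) = (b m) ⊗ n`. -/
def T.smul {p k l : ℤ} (h : p + k = l) (b : B.X p) : T φ M N k →+ T φ M N l :=
  T.lift φ (fun i j hij m n => T.mk φ (by omega : (p + i) + j = l) (M.smul rfl b m) n)
    (by intros; simp) (by intros; simp) (by
      intro q i j qi qj hi hj h h' a m n
      rw [map_zsmul, map_zsmul, AddMonoidHom.smul_apply,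
        ← M.mul_smul (rfl : p + q = p + q) (by omega) (by omega) (by omega) b (φ.app q a) m,
        B.comm (by omega : q + p = p + q) rfl (φ.app q a) b, map_zsmul, AddMonoidHom.smul_apply,
        M.mul_smul (by omega : q + p = p + q) (by omega) rfl (by omega : q + (p + i) = p + qi),
        map_zsmul, AddMonoidHom.smul_apply,
        T.balance φ (by omega : q + (p + i) = p + qi) hj (by omega) (by omega) a (M.smul rfl b m) n]
      simp only [smul_smul, ← sgn_add]
      rw [sgn_even, _root_.one_smul]
      exact ⟨i * q + q * p, by ring⟩)

/-- The differential `d (m ⊗ n) = d m ⊗ n + (-1)^i m ⊗ d n` for `m` of degree `i`. -/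
def T.d {k l : ℤ} (h : k + 1 = l) : T φ M N k →+ T φ M N l :=
  T.lift φ (fun i j hij m n => T.mk φ (by omega : (i + 1) + j = l) (M.d rfl m) n +
      sgn i • T.mk φ (by omega : i + (j + 1) = l) m (N.d rfl n))
    (by intros; simp; abel) (by intros; simp; abel) (by
      intro q i j qi qj hi hj h h' a m n
      subst hi hj
      rw [map_zsmul, M.leibniz rfl rfl rfl rfl (by omega) (by omega : q + (i + 1) = q + i + 1)
          (φ.app q a) m,
        N.leibniz rfl rfl rfl rfl (by omega) (by omega : q + (j + 1) = q + j + 1) a n,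
        ← φ.map_d]
      simp only [map_add, map_zsmul, AddMonoidHom.add_apply, AddMonoidHom.smul_apply, smul_add]
      rw [T.balance φ (by omega : q + 1 + i = q + i + 1) (by omega : q + 1 + j = q + j + 1)
          (by omega) (by omega) (A.d rfl a) m n,
        T.balance φ (by omega : q + (i + 1) = q + i + 1) (rfl : q + j = q + j)
          (by omega) (by omega) a (M.d rfl m) n,
        T.balance φ (rfl : q + i = q + i) (by omega : q + (j + 1) = q + j + 1)
          (by omega) (by omega) a m (N.d rfl n)]
      simp only [smul_smul, ← sgn_add]
      have e1 : sgn (i * q + i * (q + 1)) = sgn i := sgn_congr ⟨i * q, by ring⟩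
      have e2 : sgn (i * q + (q + (i + 1) * q)) = sgn 0 := sgn_congr ⟨i * q + q, by ring⟩
      have e3 : sgn (q + i + (i * q + i * q)) = sgn (i + q) := sgn_congr ⟨i * q, by ring⟩
      rw [e1, e2, e3, sgn_zero, _root_.one_smul, add_assoc, add_left_comm])

lemma T.smul_mk {p k l i j pi : ℤ} (h : p + k = l) (b : B.X p) (hij : i + j = k)
    (hpi : p + i = pi) (hpij : pi + j = l)
    (m : M.X i) (n : N.X j) :
    T.smul φ M N h b (T.mk φ hij m n) = T.mk φ hpij (M.smul hpi b m) n := by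
  subst hpi
  exact T.lift_mk φ _ _ _ _ hij m n

lemma T.d_mk {k l i j i' j' : ℤ} (h : k + 1 = l) (hij : i + j = k) (hi : i + 1 = i')
    (hj : j + 1 = j') (h₁ : i' + j = l) (h₂ : i + j' = l)
    (m : M.X i) (n : N.X j) :
    T.d φ M N h (T.mk φ hij m n) = T.mk φ h₁ (M.d hi m) n + sgn i • T.mk φ h₂ m (N.d hj n) := by
  subst hi hj
  exact T.lift_mk φ _ _ _ _ hij m n

/-- The tensor product `M ⊗_A N` of a DG `B`-module `M` and a DG `A`-module `N`, for a homomorphism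
of commutative DG rings `φ : A → B`.  It is a DG `B`-module. -/
def tensor : DGMod B where
  X := T φ M N
  smul h := AddMonoidHom.mk' (fun b => T.smul φ M N h b) (by
    intro a b
    apply T.hom_ext
    intro i j hij m n
    rw [AddMonoidHom.add_apply, T.smul_mk φ M N h _ hij rfl (by omega) m n,
      T.smul_mk φ M N h _ hij rfl (by omega) m n, T.smul_mk φ M N h _ hij rfl (by omega) m n]
    simp)
  d h := T.d φ M N h
  one_smul {k} h t := by
    have : T.smul φ M N h B.one = AddMonoidHom.id _ := by
      apply T.hom_ext
      intro i j hij m n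
      rw [T.smul_mk φ M N h _ hij (zero_add i) hij m n, M.one_smul]
      rfl
    exact DFunLike.congr_fun this t
  mul_smul {p q k pq qk l} h₁ h₂ h₃ h₄ a b t := by
    have : T.smul φ M N h₂ (B.mul h₁ a b) = (T.smul φ M N h₄ a).comp (T.smul φ M N h₃ b) := by
      apply T.hom_ext
      intro i j hij m n
      rw [AddMonoidHom.comp_apply, T.smul_mk φ M N h₂ _ hij rfl (by omega) m n,
        T.smul_mk φ M N h₃ _ hij rfl (by omega) m n,
        T.smul_mk φ M N h₄ _ (by omega) (by omega : p + (q + i) = pq + i) (by omega) _ n,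
        M.mul_smul]
    exact DFunLike.congr_fun this t
  d_d {k k' k''} h h' t := by
    have : (T.d φ M N h').comp (T.d φ M N h) = 0 := by
      apply T.hom_ext
      intro i j hij m n
      rw [AddMonoidHom.comp_apply, T.d_mk φ M N h hij rfl rfl (by omega) (by omega), map_add,
        map_zsmul, T.d_mk φ M N h' _ rfl rfl (by omega) (by omega),
        T.d_mk φ M N h' _ rfl rfl (by omega) (by omega), M.d_d, N.d_d]
      simp [sgn_add, sgn_one]
    exact DFunLike.congr_fun this t
  leibniz {p k l p' k' l'} h hp hk hl h₁ h₂ b t := by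
    have : (T.d φ M N hl).comp (T.smul φ M N h b) =
        T.smul φ M N h₁ (B.d hp b) + sgn p • (T.smul φ M N h₂ b).comp (T.d φ M N hk) := by
      apply T.hom_ext
      intro i j hij m n
      simp only [AddMonoidHom.comp_apply, AddMonoidHom.add_apply, AddMonoidHom.smul_apply]
      rw [T.smul_mk φ M N h _ hij rfl (by omega), T.smul_mk φ M N h₁ _ hij (by omega : p' + i = p + i + 1) (by omega),
        T.d_mk φ M N hl _ rfl rfl (by omega) (by omega),
        T.d_mk φ M N hk hij rfl rfl (by omega) (by omega), map_add, map_zsmul,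
        T.smul_mk φ M N h₂ _ _ (by omega : p + (i + 1) = p + i + 1) (by omega),
        T.smul_mk φ M N h₂ _ _ rfl (by omega),
        M.leibniz rfl hp rfl rfl (by omega) (by omega) b m]
      simp only [map_add, map_zsmul, AddMonoidHom.add_apply, AddMonoidHom.smul_apply, smul_add,
        smul_smul, sgn_add, add_assoc]
    exact DFunLike.congr_fun this t

end Tensor

/-- The tensor product of two DG modules over a commutative DG ring. -/
def tens {A : CommDGRing.{u}} (M N : DGMod A) : DGMod A := tensor (CommDGRing.Hom.id A) M N

/-! ### The tensor-evaluation homomorphism -/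

section TensorEval

variable {A : CommDGRing.{u}} {L M N : DGMod A}

/-- The element `m ⊗ n` of `M ⊗_A N`. -/
def tmk {i j k : ℤ} (h : i + j = k) : M.X i →+ N.X j →+ (tens M N).X k :=
  T.mk (CommDGRing.Hom.id A) h

lemma tmk_balance {p i j pi pj k : ℤ} (hi : p + i = pi) (hj : p + j = pj) (h : pi + j = k)
    (h' : i + pj = k) (a : A.X p) (m : M.X i) (n : N.X j) :
    (tmk h (M.smul hi a m) n : (tens M N).X k) = sgn (i * p) • tmk h' m (N.smul hj a n) :=
  T.balance (CommDGRing.Hom.id A) hi hj h h' a m n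

lemma smul_tmk {p k l i j pi : ℤ} (h : p + k = l) (a : A.X p) (hij : i + j = k)
    (hpi : p + i = pi) (hpij : pi + j = l) (m : M.X i) (n : N.X j) :
    (tens M N).smul h a (tmk hij m n) = tmk hpij (M.smul hpi a m) n :=
  T.smul_mk (CommDGRing.Hom.id A) M N h a hij hpi hpij m n

lemma d_tmk {k l i j i' j' : ℤ} (h : k + 1 = l) (hij : i + j = k) (hi : i + 1 = i')
    (hj : j + 1 = j') (h₁ : i' + j = l) (h₂ : i + j' = l) (m : M.X i) (n : N.X j) :
    (tens M N).d h (tmk hij m n) = tmk h₁ (M.d hi m) n + sgn i • tmk h₂ m (N.d hj n) :=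
  T.d_mk (CommDGRing.Hom.id A) M N h hij hi hj h₁ h₂ m n

/-- The universal property of `M ⊗_A N`. -/
def tensLift {k : ℤ} {G : Type*} [AddCommGroup G] (f : ∀ i j : ℤ, i + j = k → M.X i → N.X j → G)
    (hl : ∀ i j h m m' n, f i j h (m + m') n = f i j h m n + f i j h m' n)
    (hr : ∀ i j h m n n', f i j h m (n + n') = f i j h m n + f i j h m n')
    (hb : ∀ (p i j pi pj : ℤ) (hi : p + i = pi) (hj : p + j = pj) (h : pi + j = k)
      (h' : i + pj = k) (a : A.X p) (m : M.X i) (n : N.X j),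
      f pi j h (sgn (i * p) • M.smul hi a m) n = f i pj h' m (N.smul hj a n)) :
    (tens M N).X k →+ G :=
  T.lift (CommDGRing.Hom.id A) f hl hr hb

lemma tensLift_tmk {i j k : ℤ} {G : Type*} [AddCommGroup G]
    (f : ∀ i j : ℤ, i + j = k → M.X i → N.X j → G) (hl hr hb) (h : i + j = k) (m : M.X i)
    (n : N.X j) : tensLift f hl hr hb (tmk h m n) = f i j h m n :=
  T.lift_mk (CommDGRing.Hom.id A) f hl hr hb h m n

lemma tens_hom_ext {k : ℤ} {G : Type*} [AddCommGroup G] {f g : (tens M N).X k →+ G}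
    (hfg : ∀ (i j : ℤ) (h : i + j = k) (m : M.X i) (n : N.X j), f (tmk h m n) = g (tmk h m n)) :
    f = g :=
  T.hom_ext (CommDGRing.Hom.id A) hfg

/-- Evaluation of an element of `Hom_A(L, M)^n`. -/
def hev {n i j : ℤ} (h : i + n = j) : (hom L M).X n →+ L.X i →+ M.X j :=
  AddMonoidHom.mk' (fun f : homGroup L M n => ev f h) (fun _ _ => rfl)

lemma hev_smul {n p i j i' j' : ℤ} (f : (hom L M).X n) (h : i + n = j) (h' : i' + n = j')
    (hi : p + i = i') (hj : p + j = j') (a : A.X p) (l : L.X i) :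
    hev h' f (L.smul hi a l) = sgn (n * p) • M.smul hj a (hev h f l) :=
  ev_smul f h h' hi hj a l

lemma hom_ext {n : ℤ} {f g : (hom L M).X n}
    (hfg : ∀ (i j : ℤ) (h : i + n = j) (l : L.X i), hev h f l = hev h g l) : f = g :=
  homGroup_ext hfg

lemma smul_hev {p n k i j j₀ : ℤ} (h : p + n = k) (a : A.X p) (f : (hom L M).X n)
    (hij : i + k = j) (h₀ : i + n = j₀) (h₁ : p + j₀ = j) (l : L.X i) :
    hev hij ((hom L M).smul h a f) l = M.smul h₁ a (hev h₀ f l) :=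
  ev_homSmul h a f hij h₀ h₁ l

lemma d_hev {n k i j j₀ i₁ : ℤ} (h : n + 1 = k) (f : (hom L M).X n) (hij : i + k = j)
    (h₀ : i + n = j₀) (h₁ : j₀ + 1 = j) (h₂ : i + 1 = i₁) (h₃ : i₁ + n = j) (l : L.X i) :
    hev hij ((hom L M).d h f) l = M.d h₁ (hev h₀ f l) - sgn n • hev h₃ f (L.d h₂ l) :=
  ev_homD h f hij h₀ h₁ h₂ h₃ l

variable (L M N)

/-- The homomorphism `l ↦ (-1)^{jk} α(l) ⊗ n`, for `n` of degree `j` and `l` of degree `k`. -/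
def evalMk {i j k : ℤ} (h : i + j = k) (α : (hom L M).X i) (n : N.X j) : (hom L (tens M N)).X k :=
  show homGroup L (tens M N) k from
  ⟨fun S => sgn (j * S.i) •
      ((tmk (by have := S.h; omega : (S.i + i) + j = S.j)).flip n).comp (hev rfl α), by
    intro p s t s' t' hs hs' hi ht a l
    subst hi
    simp only [AddMonoidHom.smul_apply, AddMonoidHom.comp_apply, AddMonoidHom.flip_apply]
    rw [hev_smul α (rfl : s + i = s + i) rfl rfl (by omega) a l, map_zsmul, map_zsmul,
      AddMonoidHom.smul_apply,
      smul_tmk ht a _ (by omega : p + (s + i) = p + s + i) (by omega)]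
    simp only [smul_smul, ← sgn_add]
    congr 1
    apply sgn_congr; subst h; exact ⟨0, by ring⟩⟩

lemma hev_evalMk {i j k s t s' : ℤ} (h : i + j = k) (α : (hom L M).X i) (n : N.X j)
    (hst : s + k = t) (hs : s + i = s') (h' : s' + j = t) (l : L.X s) :
    hev hst (evalMk L M N h α n) l = sgn (j * s) • tmk h' (hev hs α l) n := by
  subst hs; rfl

lemma evalMk_add_left {i j k : ℤ} (h : i + j = k) (α β : (hom L M).X i) (n : N.X j) :
    evalMk L M N h (α + β) n = evalMk L M N h α n + evalMk L M N h β n := by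
  apply hom_ext; intro s t hst l
  rw [map_add, AddMonoidHom.add_apply, hev_evalMk L M N h _ _ hst rfl (by omega),
    hev_evalMk L M N h _ _ hst rfl (by omega), hev_evalMk L M N h _ _ hst rfl (by omega), map_add,
    AddMonoidHom.add_apply, map_add, AddMonoidHom.add_apply, smul_add]

lemma evalMk_add_right {i j k : ℤ} (h : i + j = k) (α : (hom L M).X i) (n n' : N.X j) :
    evalMk L M N h α (n + n') = evalMk L M N h α n + evalMk L M N h α n' := by
  apply hom_ext; intro s t hst l
  rw [map_add, AddMonoidHom.add_apply, hev_evalMk L M N h _ _ hst rfl (by omega),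
    hev_evalMk L M N h _ _ hst rfl (by omega), hev_evalMk L M N h _ _ hst rfl (by omega), map_add,
    smul_add]

lemma evalMk_balance (p i j pi pj k : ℤ) (hi : p + i = pi) (hj : p + j = pj) (h : pi + j = k)
    (h' : i + pj = k) (a : A.X p) (α : (hom L M).X i) (n : N.X j) :
    evalMk L M N h (sgn (i * p) • (hom L M).smul hi a α) n =
      evalMk L M N h' α (N.smul hj a n) := by
  apply hom_ext; intro s t hst l
  rw [hev_evalMk L M N h _ _ hst rfl (by omega), hev_evalMk L M N h' _ _ hst rfl (by omega),
    map_zsmul, AddMonoidHom.smul_apply, smul_hev hi a α rfl rfl (by omega), map_zsmul,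
    AddMonoidHom.smul_apply,
    tmk_balance (by omega : p + (s + i) = s + pi) hj (by omega)
      (by omega : s + i + pj = t) a (hev rfl α l) n]
  simp only [smul_smul, ← sgn_add]
  congr 1
  apply sgn_congr; subst hj; exact ⟨i * p, by ring⟩

lemma evalMk_smul {p i j k l pi : ℤ} (h : i + j = k) (hp : p + k = l) (hi : p + i = pi)
    (h' : pi + j = l) (a : A.X p) (α : (hom L M).X i) (n : N.X j) :
    evalMk L M N h' ((hom L M).smul hi a α) n =
      (hom L (tens M N)).smul hp a (evalMk L M N h α n) := by
  apply hom_ext; intro s t hst x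
  rw [hev_evalMk L M N h' _ _ hst rfl (by omega), smul_hev hi a α rfl rfl (by omega),
    smul_hev hp a _ hst rfl (by omega), hev_evalMk L M N h _ _ rfl rfl (by omega), map_zsmul,
    smul_tmk (by omega) a (by omega) (by omega : p + (s + i) = s + pi) (by omega) _ n]

lemma evalMk_d {i j k k' i' j' : ℤ} (h : i + j = k) (hk : k + 1 = k') (hi : i + 1 = i')
    (hj : j + 1 = j') (h₁ : i' + j = k') (h₂ : i + j' = k') (α : (hom L M).X i) (n : N.X j) :
    evalMk L M N h₁ ((hom L M).d hi α) n + sgn i • evalMk L M N h₂ α (N.d hj n) =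
      (hom L (tens M N)).d hk (evalMk L M N h α n) := by
  apply hom_ext; intro s t hst x
  rw [map_add, AddMonoidHom.add_apply, map_zsmul, AddMonoidHom.smul_apply,
    d_hev hk _ hst rfl (by omega) rfl (by omega),
    hev_evalMk L M N h₁ _ _ hst rfl (by omega), hev_evalMk L M N h₂ _ _ hst rfl (by omega),
    hev_evalMk L M N h _ _ rfl rfl (by omega),
    hev_evalMk L M N h _ _ _ (by omega : s + 1 + i = s + i') (by omega),
    d_hev hi _ rfl rfl (by omega) rfl (by omega), map_zsmul,
    d_tmk (by omega : s + k + 1 = t) (by omega : s + i + j = s + k)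
      (by omega : s + i + 1 = s + i') hj (by omega) (by omega) (hev rfl α x) n]
  simp only [map_sub, map_zsmul, AddMonoidHom.sub_apply, AddMonoidHom.smul_apply, smul_add,
    smul_sub, smul_smul, ← sgn_add]
  have e1 : sgn (k + j * (s + 1)) = sgn (j * s + i) := sgn_congr (by subst h; exact ⟨j, by ring⟩)
  have e2 : sgn (i + j' * s) = sgn (j * s + (s + i)) :=
    sgn_congr (by subst hj; exact ⟨0, by ring⟩)
  rw [e1, e2]
  abel

/-- The tensor-evaluation homomorphism in degree `k`. -/
def evalApp (k : ℤ) : (tens (hom L M) N).X k →+ (hom L (tens M N)).X k :=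
  tensLift (fun _ _ h α n => evalMk L M N h α n)
    (fun _ _ h α β n => evalMk_add_left L M N h α β n)
    (fun _ _ h α n n' => evalMk_add_right L M N h α n n')
    (fun p i j pi pj hi hj h h' a α n => evalMk_balance L M N p i j pi pj _ hi hj h h' a α n)

lemma evalApp_tmk {i j k : ℤ} (h : i + j = k) (α : (hom L M).X i) (n : N.X j) :
    evalApp L M N k (tmk h α n) = evalMk L M N h α n :=
  tensLift_tmk _ _ _ _ h α n

/-- The tensor-evaluation homomorphism `Hom_A(L, M) ⊗_A N → Hom_A(L, M ⊗_A N)`, sending `α ⊗ n`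
to `l ↦ (-1)^{jk} α(l) ⊗ n` for `n` of degree `j` and `l` of degree `k`. -/
def tensorEval : tens (hom L M) N ⟶ hom L (tens M N) where
  app := evalApp L M N
  map_smul {p k l} h a t := by
    have : (evalApp L M N l).comp ((tens (hom L M) N).smul h a) =
        ((hom L (tens M N)).smul h a).comp (evalApp L M N k) := by
      apply tens_hom_ext
      intro i j hij α n
      rw [AddMonoidHom.comp_apply, AddMonoidHom.comp_apply, smul_tmk h a hij rfl (by omega),
        evalApp_tmk, evalApp_tmk]
      exact evalMk_smul L M N hij h rfl (by omega) a α n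
    exact DFunLike.congr_fun this t
  map_d {k l} h t := by
    have : (evalApp L M N l).comp ((tens (hom L M) N).d h) =
        ((hom L (tens M N)).d h).comp (evalApp L M N k) := by
      apply tens_hom_ext
      intro i j hij α n
      rw [AddMonoidHom.comp_apply, AddMonoidHom.comp_apply,
        d_tmk h hij rfl rfl (by omega) (by omega), map_add, map_zsmul, evalApp_tmk, evalApp_tmk,
        evalApp_tmk]
      exact evalMk_d L M N hij h rfl rfl (by omega) (by omega) α n
    exact DFunLike.congr_fun this t

end TensorEval

/-! ### Resolutions -/

section Resolutions

variable {A : CommDGRing.{u}}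

/-- `M` is K-projective: `Hom_A(M, N)` is acyclic for every acyclic `N`. -/
def IsKProjective (M : DGMod A) : Prop := ∀ N : DGMod A, N.Acyclic → (hom M N).Acyclic

/-- `M` is K-flat: `N ⊗_A M` is acyclic for every acyclic `N`. -/
def IsKFlat (M : DGMod A) : Prop := ∀ N : DGMod A, N.Acyclic → (tens N M).Acyclic

/-- A K-projective resolution of `M`. -/
structure KProjRes (M : DGMod A) where
  obj : DGMod A
  map : obj ⟶ M
  quasiIso : quasiIso A map
  isKProjective : obj.IsKProjective

/-- A K-flat resolution of `M`. -/
structure KFlatRes (M : DGMod A) where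
  obj : DGMod A
  map : obj ⟶ M
  quasiIso : quasiIso A map
  isKFlat : obj.IsKFlat

end Resolutions

end DGMod

/-! ### Localization and reduction of DG rings -/

namespace CommDGRing

/-- The component of degree `i` of a ring concentrated in degree `0`: it is `R` for `i = 0` and is
zero otherwise. -/
def ofRingX (R : Type u) [CommRing R] (i : ℤ) : AddSubgroup R where
  carrier := {r | i ≠ 0 → r = 0}
  zero_mem' := fun _ => rfl
  add_mem' := fun ha hb h => by rw [ha h, hb h, add_zero]
  neg_mem' := fun ha h => by rw [ha h, neg_zero]

/-- The product of homogeneous elements of a ring concentrated in degree `0`. -/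
def ofRingMul (R : Type u) [CommRing R] {i j k : ℤ} (h : i + j = k) :
    ofRingX R i →+ ofRingX R j →+ ofRingX R k :=
  AddMonoidHom.mk' (fun a => AddMonoidHom.mk' (fun b => (⟨a.1 * b.1, fun hk => by
      by_cases hi : i = 0
      · rw [b.2 (by omega), mul_zero]
      · rw [a.2 hi, zero_mul]⟩ : ofRingX R k))
      (fun b c => Subtype.ext (mul_add a.1 b.1 c.1)))
      (fun a b => AddMonoidHom.ext fun c => Subtype.ext (add_mul a.1 b.1 c.1))

lemma ofRingX_zero {R : Type u} [CommRing R] {i : ℤ} (hi : i ≠ 0) (a : ofRingX R i) : a = 0 :=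
  Subtype.ext (a.2 hi)

/-- A commutative ring, viewed as a DG ring concentrated in degree `0`. -/
def ofRing (R : Type u) [CommRing R] : CommDGRing.{u} where
  X i := ofRingX R i
  mul h := ofRingMul R h
  one := ⟨1, fun h => (h rfl).elim⟩
  d _ := 0
  one_mul h a := Subtype.ext (_root_.one_mul a.1)
  mul_assoc h₁ h₂ h₃ h₄ a b c := Subtype.ext (_root_.mul_assoc a.1 b.1 c.1)
  comm {i j k} h h' a b := by
    by_cases hi : i = 0
    · subst hi
      rw [zero_mul, sgn_zero, one_smul]
      exact Subtype.ext (_root_.mul_comm b.1 a.1)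
    · rw [ofRingX_zero hi a]
      simp
  sq_zero {i k} h a hi := by
    rw [ofRingX_zero (by rintro rfl; simp at hi) a]
    simp
  d_d _ _ _ := rfl
  leibniz _ _ _ _ _ _ _ _ := by simp
  nonpos i hi a := ofRingX_zero hi.ne' a

variable (A : CommDGRing.{u})

/-- The components of the canonical homomorphism `A → H^0(A)`. -/
noncomputable def toH0App (i : ℤ) : A.X i →+ ofRingX A.H0 i := by
  classical
  exact if h : i = 0 then AddMonoidHom.mk' (fun a => (⟨Ideal.Quotient.mk A.boundaryIdeal
      (A.mul (by omega : 0 + i = 0) A.one a), fun h' => (h' h).elim⟩ : ofRingX A.H0 i))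
      (fun a b => Subtype.ext (by
        rw [map_add, map_add]
        rfl)) else 0

lemma toH0App_zero (a : A.X 0) : (A.toH0App 0 a).1 = Ideal.Quotient.mk A.boundaryIdeal a :=
  congrArg _ (A.one_mul (zero_add 0) a)

lemma toH0App_mul {i j k : ℤ} (h : i + j = k) (a : A.X i) (b : A.X j) :
    A.toH0App k (A.mul h a b) = ofRingMul A.H0 h (A.toH0App i a) (A.toH0App j b) := by
  by_cases hk : k = 0
  · by_cases hi : i = 0
    · obtain rfl : j = 0 := by omega
      subst hi hk
      apply Subtype.ext
      rw [toH0App_zero]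
      change _ = (A.toH0App 0 a).1 * (A.toH0App 0 b).1
      rw [toH0App_zero, toH0App_zero, ← map_mul]
      rfl
    · rcases lt_or_gt_of_ne hi with hi' | hi'
      · rw [A.nonpos j (by omega) b, map_zero, map_zero, map_zero, map_zero]
      · rw [A.nonpos i hi' a, map_zero, map_zero, map_zero, AddMonoidHom.zero_apply, map_zero,
          AddMonoidHom.zero_apply]
  · rw [ofRingX_zero hk (A.toH0App k (A.mul h a b)), ofRingX_zero hk (ofRingMul _ _ _ _)]

lemma toH0App_d {i j : ℤ} (h : i + 1 = j) (a : A.X i) : A.toH0App j (A.d h a) = 0 := by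
  by_cases hj : j = 0
  · subst hj
    obtain rfl : i = -1 := by omega
    apply Subtype.ext
    rw [toH0App_zero]
    exact Ideal.Quotient.eq_zero_iff_mem.2 ⟨a, rfl⟩
  · exact ofRingX_zero hj _

/-- The canonical homomorphism `A → H^0(A)`. -/
noncomputable def toH0 : A.Hom (ofRing A.H0) where
  app i := A.toH0App i
  map_one := Subtype.ext (A.toH0App_zero A.one)
  map_mul := A.toH0App_mul
  map_d := A.toH0App_d

/-- The multiplicatively closed set of elements of `A^0` whose image in `H^0(A)` is a power
of `s`. -/
def powersLift (s : A.H0) : Submonoid (A.X 0) :=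
  (Submonoid.powers s).comap (Ideal.Quotient.mk A.boundaryIdeal)

/-- Multiplication, as an `A^0`-bilinear map. -/
def mulLin {i j k : ℤ} (h : i + j = k) :
    A.self.X i →ₗ[A.X 0] A.self.X j →ₗ[A.X 0] A.self.X k :=
  LinearMap.mk₂ (A.X 0) (fun a b => A.mul h a b)
    (fun a a' b => DFunLike.congr_fun (map_add (A.mul h) a a') b)
    (fun c a b => A.mul_assoc (zero_add i) h h (zero_add k) c a b)
    (fun a b b' => map_add (A.mul h a) b b')
    (fun c a b => by
      have h1 := A.mul_assoc (add_zero i) h (zero_add j) h a c b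
      have h2 := A.mul_assoc (zero_add i) h h (zero_add k) c a b
      have h3 := A.comm (zero_add i) (add_zero i) c a
      rw [zero_mul, sgn_zero, one_smul] at h3
      exact h1.symm.trans ((congrArg (fun x => A.mul h x b) h3).trans h2))

lemma mulLin_apply {i j k : ℤ} (h : i + j = k) (a : A.self.X i) (b : A.self.X j) :
    A.mulLin h a b = A.mul h a b := rfl

open TensorProduct

/-- The component of degree `i` of `A^0_s ⊗_{A^0} A`. -/
def LocX (s : A.H0) (i : ℤ) : Type u := Localization (A.powersLift s) ⊗[A.X 0] A.self.X i

noncomputable instance (s : A.H0) (i : ℤ) : AddCommGroup (A.LocX s i) :=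
  TensorProduct.addCommGroup

noncomputable instance (s : A.H0) (i : ℤ) : Module (A.X 0) (A.LocX s i) :=
  TensorProduct.leftModule

variable {A}

/-- The element `x ⊗ a` of `A^0_s ⊗_{A^0} A`. -/
noncomputable def ltmul {s : A.H0} {i : ℤ} (x : Localization (A.powersLift s)) :
    A.X i →+ A.LocX s i :=
  (TensorProduct.mk (A.X 0) (Localization (A.powersLift s)) (A.self.X i) x).toAddMonoidHom

lemma LocX.induction {s : A.H0} {i : ℤ} {P : A.LocX s i → Prop} (t : A.LocX s i)
    (zero : P 0) (tmul : ∀ (x : Localization (A.powersLift s)) (a : A.X i), P (ltmul x a))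
    (add : ∀ t t', P t → P t' → P (t + t')) : P t :=
  TensorProduct.induction_on t zero tmul add

variable (A)

/-- The product `(x ⊗ a) (y ⊗ b) = x y ⊗ a b`. -/
noncomputable def locMul (s : A.H0) {i j k : ℤ} (h : i + j = k) :
    A.LocX s i →+ A.LocX s j →+ A.LocX s k :=
  AddMonoidHom.mk' (fun t => (TensorProduct.map₂
      (LinearMap.mul (A.X 0) (Localization (A.powersLift s))) (A.mulLin h) t).toAddMonoidHom)
    (fun t t' => AddMonoidHom.ext fun u => LinearMap.congr_fun (map_add (TensorProduct.map₂
      (LinearMap.mul (A.X 0) (Localization (A.powersLift s))) (A.mulLin h)) t t') u)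

/-- The differential `d (x ⊗ a) = x ⊗ d a`. -/
noncomputable def locD (s : A.H0) {i j : ℤ} (h : i + 1 = j) : A.LocX s i →+ A.LocX s j :=
  (LinearMap.lTensor (Localization (A.powersLift s)) (A.self.dLin h)).toAddMonoidHom

lemma locMul_ltmul (s : A.H0) {i j k : ℤ} (h : i + j = k) (x y : Localization (A.powersLift s))
    (a : A.X i) (b : A.X j) :
    A.locMul s h (ltmul x a) (ltmul y b) = ltmul (x * y) (A.mul h a b) := rfl

lemma locD_ltmul (s : A.H0) {i j : ℤ} (h : i + 1 = j) (x : Localization (A.powersLift s))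
    (a : A.X i) : A.locD s h (ltmul x a) = ltmul x (A.d h a) := rfl

lemma locMul_comm (s : A.H0) {i j k : ℤ} (h : i + j = k) (h' : j + i = k) (t : A.LocX s i)
    (u : A.LocX s j) : A.locMul s h' u t = sgn (i * j) • A.locMul s h t u := by
  induction t using LocX.induction with
  | zero => simp
  | add t t' ht ht' => rw [map_add, map_add, AddMonoidHom.add_apply, smul_add, ht, ht']
  | tmul x a =>
    induction u using LocX.induction with
    | zero => simp
    | add u u' hu hu' => rw [map_add, map_add, AddMonoidHom.add_apply, smul_add, hu, hu']
    | tmul y b =>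
      rw [locMul_ltmul, locMul_ltmul, _root_.mul_comm, ← map_zsmul, ← A.comm h h' a b]

lemma locMul_assoc (s : A.H0) {i j k ij jk l : ℤ} (h₁ : i + j = ij) (h₂ : ij + k = l)
    (h₃ : j + k = jk) (h₄ : i + jk = l) (t : A.LocX s i) (u : A.LocX s j) (v : A.LocX s k) :
    A.locMul s h₂ (A.locMul s h₁ t u) v = A.locMul s h₄ t (A.locMul s h₃ u v) := by
  induction t using LocX.induction with
  | zero => simp
  | add t t' ht ht' => simp only [map_add, AddMonoidHom.add_apply, ht, ht']
  | tmul x a =>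
    induction u using LocX.induction with
    | zero => simp
    | add u u' hu hu' => simp only [map_add, AddMonoidHom.add_apply, hu, hu']
    | tmul y b =>
      induction v using LocX.induction with
      | zero => simp
      | add v v' hv hv' => simp only [map_add, hv, hv']
      | tmul z c =>
        rw [locMul_ltmul, locMul_ltmul, locMul_ltmul, locMul_ltmul, _root_.mul_assoc,
          A.mul_assoc h₁ h₂ h₃ h₄ a b c]

lemma locMul_self (s : A.H0) {i k : ℤ} (h : i + i = k) (t : A.LocX s i) (hi : Odd i) :
    A.locMul s h t t = 0 := by
  induction t using LocX.induction with
  | zero => simp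
  | add t t' ht ht' =>
    rw [map_add, map_add, AddMonoidHom.add_apply, AddMonoidHom.add_apply, ht, ht',
      locMul_comm A s h h t t', sgn_odd (hi.mul hi)]
    simp
  | tmul x a => rw [locMul_ltmul, A.sq_zero h a hi, map_zero]

lemma locMul_leibniz (s : A.H0) {i j k i' j' k' : ℤ} (h : i + j = k) (hi : i + 1 = i')
    (hj : j + 1 = j') (hk : k + 1 = k') (h₁ : i' + j = k') (h₂ : i + j' = k') (t : A.LocX s i)
    (u : A.LocX s j) : A.locD s hk (A.locMul s h t u) =
      A.locMul s h₁ (A.locD s hi t) u + sgn i • A.locMul s h₂ t (A.locD s hj u) := by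
  induction t using LocX.induction with
  | zero => simp
  | add t t' ht ht' =>
    simp only [map_add, AddMonoidHom.add_apply, smul_add, ht, ht']
    abel
  | tmul x a =>
    induction u using LocX.induction with
    | zero => simp
    | add u u' hu hu' =>
      simp only [map_add, smul_add, hu, hu']
      abel
    | tmul y b =>
      rw [locMul_ltmul, locD_ltmul, locD_ltmul, locD_ltmul, locMul_ltmul, locMul_ltmul,
        A.leibniz h hi hj hk h₁ h₂ a b, map_add, map_zsmul]

lemma locMul_one (s : A.H0) {i : ℤ} (h : 0 + i = i) (t : A.LocX s i) :
    A.locMul s h (ltmul 1 A.one) t = t := by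
  induction t using LocX.induction with
  | zero => simp
  | add t t' ht ht' => rw [map_add, ht, ht']
  | tmul x a => rw [locMul_ltmul, _root_.one_mul, A.one_mul]

lemma locD_locD (s : A.H0) {i j k : ℤ} (h : i + 1 = j) (h' : j + 1 = k) (t : A.LocX s i) :
    A.locD s h' (A.locD s h t) = 0 := by
  induction t using LocX.induction with
  | zero => simp
  | add t t' ht ht' => rw [map_add, map_add, ht, ht', add_zero]
  | tmul x a => rw [locD_ltmul, locD_ltmul, A.d_d, map_zero]

lemma locX_nonpos (s : A.H0) (i : ℤ) (hi : 0 < i) (t : A.LocX s i) : t = 0 := by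
  induction t using LocX.induction with
  | zero => rfl
  | add t t' ht ht' => rw [ht, ht', add_zero]
  | tmul x a => rw [A.nonpos i hi a, map_zero]

/-- The localized DG ring `A_s = A^0_s ⊗_{A^0} A`, for `s` in `H^0(A)`. -/
noncomputable def loc (s : A.H0) : CommDGRing.{u} where
  X i := A.LocX s i
  mul h := A.locMul s h
  one := ltmul 1 A.one
  d h := A.locD s h
  one_mul := A.locMul_one s
  mul_assoc := A.locMul_assoc s
  comm := A.locMul_comm s
  sq_zero := A.locMul_self s
  d_d := A.locD_locD s
  leibniz := A.locMul_leibniz s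
  nonpos := A.locX_nonpos s

/-- The canonical homomorphism `A → A_s`, `a ↦ 1 ⊗ a`. -/
noncomputable def toLoc (s : A.H0) : A.Hom (A.loc s) where
  app i := (ltmul 1 : A.X i →+ A.LocX s i)
  map_one := rfl
  map_mul h a b := by
    have := A.locMul_ltmul s h 1 1 a b
    rw [_root_.mul_one] at this
    exact this.symm
  map_d h a := rfl

end CommDGRing

namespace DGMod

variable {A B : CommDGRing.{u}}

/-- The base change `B ⊗_A M` of a DG `A`-module `M` along a homomorphism `A → B`. -/
def baseChange (φ : A.Hom B) (M : DGMod A) : DGMod B := tensor φ B.self M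

/-- `M` is geometrically perfect: for some covering sequence `(s_1, …, s_n)` of `H^0(A)`, each
`A_{s_i} ⊗_A M` is isomorphic in `D(A_{s_i})` to a finite semi-free DG module. -/
def IsGeometricallyPerfect (M : DGMod A) : Prop :=
  ∃ (n : ℕ) (s : Fin n → A.H0), Ideal.span (Set.range s) = ⊤ ∧
    ∀ i, ∃ P : DGMod (A.loc (s i)), P.IsFiniteSemiFree ∧
      Nonempty ((Q (A.loc (s i))).obj (M.baseChange (A.toLoc (s i))) ≅ (Q (A.loc (s i))).obj P)

/-- `M` is algebraically perfect: it belongs to the smallest class of DG modules that contains `A`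
and is closed under shifts, cones, and direct summands (in particular isomorphisms) in `D(A)`. -/
inductive IsAlgebraicallyPerfect : DGMod A → Prop
  | self : IsAlgebraicallyPerfect A.self
  | shift (M : DGMod A) (n : ℤ) : IsAlgebraicallyPerfect M → IsAlgebraicallyPerfect (M.shift n)
  | cone {M N : DGMod A} (f : M ⟶ N) : IsAlgebraicallyPerfect M → IsAlgebraicallyPerfect N →
      IsAlgebraicallyPerfect (cone f)
  | summand {M N : DGMod A} (r : Retract ((Q A).obj M) ((Q A).obj N)) :
      IsAlgebraicallyPerfect N → IsAlgebraicallyPerfect M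

/-- `M` is a compact object of `D(A)`: every morphism in `D(A)` from `M` to a direct sum factors
through a finite sub-sum, i.e. `⨁ Hom(M, N_z) → Hom(M, ⨁ N_z)`, which is always injective, is
surjective. -/
def IsCompactObject (M : DGMod A) : Prop :=
  ∀ (ι : Type u) (N : ι → DGMod A) (f : (Q A).obj M ⟶ (Q A).obj (directSum N)),
    ∃ (s : Finset ι) (g : (Q A).obj M ⟶ (Q A).obj (directSum (fun z : s => N z))),
      g ≫ (Q A).map (directSumIncl N s) = f

/-- `M` belongs to `D^-(A)`: its cohomology is bounded above. -/
def IsCohBddAbove (M : DGMod A) : Prop := ∃ b : ℤ, ∀ i, b < i → Subsingleton (M.H i)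

/-- `M` belongs to `D_f(A)`: its cohomology modules are finite over `H^0(A)`. -/
def IsCohFinite (M : DGMod A) : Prop := ∀ i, Module.Finite A.H0 (M.H i)

end DGMod

/-- `A` is cohomologically pseudo-noetherian: `H^0(A)` is noetherian and every `H^i(A)` is a finite
`H^0(A)`-module. -/
def CommDGRing.IsCohPseudoNoetherian (A : CommDGRing.{u}) : Prop :=
  IsNoetherianRing A.H0 ∧ A.self.IsCohFinite

namespace DGMod

variable {A : CommDGRing.{u}}

/-- The derived reduction of `M` along `A → H^0(A)` is geometrically perfect.  It is computed by a
K-flat resolution of `M`, and up to isomorphism in `D(H^0(A))` it does not depend on the choice of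
the resolution. -/
def HasPerfectReduction (M : DGMod A) : Prop :=
  ∃ F : KFlatRes M, (F.obj.baseChange A.toH0).IsGeometricallyPerfect

/-- For all `M` and `N`, the canonical morphism `RHom(P, M) ⊗^L N → RHom(P, M ⊗^L N)` is an
isomorphism in `D(A)`.  It is represented by the tensor-evaluation homomorphism of a K-projective
resolution of `P` and a K-flat resolution of `N`, and as a morphism in `D(A)` it does not depend on
the choice of the resolutions. -/
def IsTensorEvalInvertible (P : DGMod A) : Prop :=
  ∀ M N : DGMod A, ∃ (L : KProjRes P) (F : KFlatRes N),
    IsIso ((Q A).map (tensorEval L.obj M F.obj))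

/-- The smallest integer interval containing a set of integers. -/
def con (S : Set ℤ) : Set ℤ := {i | ∃ a ∈ S, ∃ b ∈ S, a ≤ i ∧ i ≤ b}

open scoped Pointwise in
/-- `M` has finite projective dimension relative to `D(A)`: the functor `RHom(M, -)` on `D(A)` has
cohomological displacement at most `-[d₀, d₁]`, for some integers `d₀ ≤ d₁`. -/
def HasFiniteProjDim (M : DGMod A) : Prop :=
  ∃ (L : KProjRes M) (d₀ d₁ : ℤ), d₀ ≤ d₁ ∧ ∀ N : DGMod A,
    con (hom L.obj N).cohSupport ⊆ con N.cohSupport + Set.Icc (-d₁) (-d₀)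

end DGMod

end DG

namespace DG

open CategoryTheory

namespace DGMod

variable {A : CommDGRing.{u}}

/-! ### Homomorphisms of DG modules -/

@[simp] lemma comp_app {M N P : DGMod A} (f : M ⟶ N) (g : N ⟶ P) (i : ℤ) (x : M.X i) :
    (f ≫ g).app i x = g.app i (f.app i x) := rfl

@[simp] lemma id_app (M : DGMod A) (i : ℤ) (x : M.X i) : Hom.app (𝟙 M) i x = x := rfl

lemma hom_ext_app {M N : DGMod A} {f g : M ⟶ N} (h : ∀ i x, f.app i x = g.app i x) : f = g :=
  Hom.ext (funext fun i => AddMonoidHom.ext (h i))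

instance (M N : DGMod A) : Zero (M ⟶ N) :=
  ⟨{ app := fun _ => 0, map_smul := fun _ _ _ => by simp, map_d := fun _ _ => by simp }⟩

instance (M N : DGMod A) : _root_.Sub (M ⟶ N) :=
  ⟨fun f g =>
    { app := fun i => f.app i - g.app i
      map_smul := fun h a m => by simp [f.map_smul, g.map_smul]
      map_d := fun h m => by simp [f.map_d, g.map_d] }⟩

@[simp] lemma zero_app {M N : DGMod A} (i : ℤ) (x : M.X i) : Hom.app (0 : M ⟶ N) i x = 0 := rfl

@[simp] lemma sub_app {M N : DGMod A} (f g : M ⟶ N) (i : ℤ) (x : M.X i) :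
    Hom.app (f - g) i x = f.app i x - g.app i x := rfl

lemma d_idx' (M : DGMod A) {i j k : ℤ} (h : i = j) (hj : j + 1 = k) (x : M.X i) :
    M.d hj (M.idx h x) = M.d (by omega) x := by
  subst h; rfl

lemma idx_d (M : DGMod A) {i k l : ℤ} (hi : i + 1 = l)
    (hl : l = k) (x : M.X i) : M.idx hl (M.d hi x) = M.d (by omega) x := by
  subst hl; rfl

lemma smul_idx (M : DGMod A) {p i j k : ℤ} (h : i = j) (hj : p + j = k) (a : A.X p) (x : M.X i) :
    M.smul hj a (M.idx h x) = M.smul (by omega) a x := by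
  subst h; rfl

@[simp] lemma idx_idx (M : DGMod A) {i j k : ℤ} (h : i = j) (h' : j = k) (x : M.X i) :
    M.idx h' (M.idx h x) = M.idx (h.trans h') x := by
  subst h h'; rfl

lemma d_eq_zero_iff (M : DGMod A) {i j k : ℤ} (h : i + 1 = j) (h' : i + 1 = k) (x : M.X i) :
    M.d h x = 0 ↔ M.d h' x = 0 := by
  subst h h'; rfl

/-- A DG homomorphism that is bijective in each degree is an isomorphism. -/
noncomputable def isoOfBijective {M N : DGMod A} (f : M ⟶ N)
    (hf : ∀ i, Function.Bijective (f.app i)) : M ≅ N where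
  hom := f
  inv :=
    { app := fun i => (AddEquiv.ofBijective (f.app i) (hf i)).symm.toAddMonoidHom
      map_smul := fun {i j k} h a m => by
        apply (hf k).1
        rw [f.map_smul]
        change f.app k ((AddEquiv.ofBijective (f.app k) (hf k)).symm _) =
          N.smul h a (f.app j ((AddEquiv.ofBijective (f.app j) (hf j)).symm _))
        rw [AddEquiv.ofBijective_apply_symm_apply, AddEquiv.ofBijective_apply_symm_apply]
      map_d := fun {i j} h m => by
        apply (hf j).1
        rw [f.map_d]
        change f.app j ((AddEquiv.ofBijective (f.app j) (hf j)).symm _) =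
          N.d h (f.app i ((AddEquiv.ofBijective (f.app i) (hf i)).symm _))
        rw [AddEquiv.ofBijective_apply_symm_apply, AddEquiv.ofBijective_apply_symm_apply] }
  hom_inv_id := hom_ext_app fun i x => (AddEquiv.ofBijective (f.app i) (hf i)).symm_apply_apply x
  inv_hom_id := hom_ext_app fun i x => (AddEquiv.ofBijective (f.app i) (hf i)).apply_symm_apply x

/-! ### Cohomology in terms of elements -/

/-- The class of a cocycle. -/
def Hmk (M : DGMod A) {i : ℤ} (z : M.X i) (hz : M.d rfl z = 0) : M.H i :=
  Submodule.Quotient.mk (⟨z, hz⟩ : M.cocycles i)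

lemma Hmk_surjective (M : DGMod A) {i : ℤ} (x : M.H i) : ∃ z hz, M.Hmk (i := i) z hz = x := by
  obtain ⟨⟨z, hz⟩, rfl⟩ := Submodule.Quotient.mk_surjective _ x
  exact ⟨z, hz, rfl⟩

lemma Hmk_eq_zero_iff (M : DGMod A) {i j : ℤ} (h : j + 1 = i) (z : M.X i) (hz) :
    M.Hmk z hz = 0 ↔ ∃ y, M.d h y = z := by
  obtain rfl : j = i - 1 := by omega
  exact (Submodule.Quotient.mk_eq_zero _).trans Iff.rfl

lemma Hmk_add (M : DGMod A) {i : ℤ} (z w : M.X i) (hz hw) :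
    M.Hmk z hz + M.Hmk w hw = M.Hmk (z + w) (by rw [map_add, hz, hw, add_zero]) := rfl

lemma Hmk_sub (M : DGMod A) {i : ℤ} (z w : M.X i) (hz hw) :
    M.Hmk z hz - M.Hmk w hw = M.Hmk (z - w) (by rw [map_sub, hz, hw, sub_zero]) := rfl

lemma d_zero_smul (M : DGMod A) {i j : ℤ} (h : i + 1 = j) (a : A.X 0) (z : M.X i) :
    M.d h (a • z) = a • M.d h z := (M.dLin h).map_smul a z

lemma Hmk_smul (M : DGMod A) {i : ℤ} (a : A.X 0) (z : M.X i) (hz) :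
    a • M.Hmk z hz = M.Hmk (a • z) (by rw [d_zero_smul, hz, smul_zero]) := rfl

lemma H0_smul_Hmk (M : DGMod A) {i : ℤ} (a : A.X 0) (z : M.X i) (hz) :
    (Ideal.Quotient.mk A.boundaryIdeal a) • M.Hmk z hz =
      M.Hmk (a • z) (by rw [d_zero_smul, hz, smul_zero]) := rfl

lemma Hmk_eq_iff (M : DGMod A) {i j : ℤ} (h : j + 1 = i) (z w : M.X i) (hz hw) :
    M.Hmk z hz = M.Hmk w hw ↔ ∃ y, M.d h y = z - w := by
  rw [← sub_eq_zero, Hmk_sub, Hmk_eq_zero_iff M h]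

lemma Hmap_Hmk {M N : DGMod A} (f : M ⟶ N) {i : ℤ} (z : M.X i) (hz) :
    Hmap f i (M.Hmk z hz) = N.Hmk (f.app i z) (by rw [← f.map_d, hz, map_zero]) := rfl

lemma subsingleton_H_iff (M : DGMod A) {i j k : ℤ} (h : i + 1 = j) (h' : j + 1 = k) :
    Subsingleton (M.H j) ↔ ∀ z : M.X j, M.d h' z = 0 → ∃ y, M.d h y = z := by
  subst h'
  constructor
  · intro hs z hz
    exact (Hmk_eq_zero_iff M h z hz).1 (Subsingleton.elim _ _)
  · intro hs
    refine subsingleton_of_forall_eq 0 fun x => ?_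
    obtain ⟨z, hz, rfl⟩ := M.Hmk_surjective x
    exact (Hmk_eq_zero_iff M h z hz).2 (hs z hz)

lemma Acyclic.exists {M : DGMod A} (hM : M.Acyclic) {i j k : ℤ} (h : i + 1 = j) (h' : j + 1 = k)
    (z : M.X j) (hz : M.d h' z = 0) : ∃ y, M.d h y = z :=
  (subsingleton_H_iff M h h').1 (hM j) z hz

lemma acyclic_of (M : DGMod A) (H : ∀ (i j k : ℤ) (h : i + 1 = j) (h' : j + 1 = k) (z : M.X j),
    M.d h' z = 0 → ∃ y, M.d h y = z) : M.Acyclic := fun j =>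
  (subsingleton_H_iff M (sub_add_cancel j 1) rfl).2 (H _ _ _ _ _)

lemma quasiIso_of {M N : DGMod A} (f : M ⟶ N)
    (hs : ∀ (i j k : ℤ) (h : i + 1 = j) (h' : j + 1 = k) (z : N.X j), N.d h' z = 0 →
      ∃ w y, M.d h' w = 0 ∧ f.app j w = z + N.d h y)
    (hi : ∀ (i j k : ℤ) (h : i + 1 = j) (h' : j + 1 = k) (w : M.X j) (y : N.X i), M.d h' w = 0 →
      f.app j w = N.d h y → ∃ x, M.d h x = w) : quasiIso A f := by
  intro i
  constructor
  · rw [injective_iff_map_eq_zero]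
    intro x hx
    obtain ⟨z, hz, rfl⟩ := M.Hmk_surjective x
    rw [Hmap_Hmk, Hmk_eq_zero_iff N (sub_add_cancel i 1)] at hx
    obtain ⟨y, hy⟩ := hx
    exact (Hmk_eq_zero_iff M (sub_add_cancel i 1) z hz).2 (hi _ _ _ _ rfl z y hz hy.symm)
  · intro x
    obtain ⟨z, hz, rfl⟩ := N.Hmk_surjective x
    obtain ⟨w, y, hw, hy⟩ := hs (i - 1) i _ (by omega) rfl z hz
    refine ⟨M.Hmk w hw, ?_⟩
    rw [Hmap_Hmk, Hmk_eq_iff N (sub_add_cancel i 1)]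
    exact ⟨y, by rw [hy, add_sub_cancel_left]⟩

lemma exists_of_quasiIso {M N : DGMod A} {f : M ⟶ N} (hf : quasiIso A f) {i j k : ℤ}
    (h : i + 1 = j) (h' : j + 1 = k) (z : N.X j) (hz : N.d h' z = 0) :
    ∃ w y, M.d h' w = 0 ∧ f.app j w = z + N.d h y := by
  subst h'
  obtain ⟨x, hx⟩ := (hf j).2 (N.Hmk z hz)
  obtain ⟨w, hw, rfl⟩ := M.Hmk_surjective x
  rw [Hmap_Hmk, Hmk_eq_iff N h] at hx
  obtain ⟨y, hy⟩ := hx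
  exact ⟨w, y, hw, by rw [hy]; abel⟩

lemma exists_of_quasiIso' {M N : DGMod A} {f : M ⟶ N} (hf : quasiIso A f) {i j k : ℤ}
    (h : i + 1 = j) (h' : j + 1 = k) (w : M.X j) (y : N.X i) (hw : M.d h' w = 0)
    (hy : f.app j w = N.d h y) : ∃ x, M.d h x = w := by
  subst h'
  refine (Hmk_eq_zero_iff M h w hw).1 ((hf j).1 (Eq.trans ?_ (map_zero _).symm))
  rw [Hmap_Hmk, Hmk_eq_zero_iff N h]
  exact ⟨y, hy.symm⟩

/-- A quasi-isomorphism that is surjective in each degree has the relative lifting property for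
cells. -/
lemma exists_lift_of_quasiIso {M N : DGMod A} {f : M ⟶ N} (hf : quasiIso A f)
    (hs : ∀ i, Function.Surjective (f.app i)) {i j k : ℤ} (h : i + 1 = j) (h' : j + 1 = k)
    (z : M.X j) (hz : M.d h' z = 0) (y : N.X i) (hy : N.d h y = f.app j z) :
    ∃ x, M.d h x = z ∧ f.app i x = y := by
  obtain ⟨x₀, hx₀⟩ := exists_of_quasiIso' hf h h' z y hz hy.symm
  have hc : N.d h (y - f.app i x₀) = 0 := by rw [map_sub, hy, ← f.map_d, hx₀, sub_self]
  obtain ⟨w, v, hw, hv⟩ := exists_of_quasiIso hf (sub_add_cancel i 1) h _ hc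
  obtain ⟨u, hu⟩ := hs _ v
  refine ⟨x₀ + w - M.d (sub_add_cancel i 1) u, ?_, ?_⟩
  · rw [map_sub, map_add, hx₀, hw, M.d_d]; simp
  · rw [map_sub, map_add, hv, f.map_d, hu]; abel

lemma quasiIso_of_bijective {M N : DGMod A} (f : M ⟶ N)
    (hf : ∀ i, Function.Bijective (f.app i)) : quasiIso A f := by
  refine quasiIso_of f (fun i j k h h' z hz => ?_) (fun i j k h h' w y _ hy => ?_)
  · obtain ⟨w, rfl⟩ := (hf j).2 z
    exact ⟨w, 0, (hf k).1 (by rw [f.map_d, hz, map_zero]), by simp⟩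
  · obtain ⟨x, rfl⟩ := (hf i).2 y
    exact ⟨x, (hf j).1 (by rw [f.map_d, hy])⟩

lemma quasiIso_of_acyclic {M N : DGMod A} (f : M ⟶ N) (hM : M.Acyclic) (hN : N.Acyclic) :
    quasiIso A f := by
  refine quasiIso_of f (fun i j k h h' z hz => ?_) (fun i j k h h' w y hw hy => hM.exists h h' w hw)
  obtain ⟨y, hy⟩ := hN.exists h h' z hz
  exact ⟨0, -y, map_zero _, by rw [map_zero, map_neg, hy, add_neg_cancel]⟩

lemma Hmap_comp {M N P : DGMod A} (f : M ⟶ N) (g : N ⟶ P) (i : ℤ) (x : M.H i) :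
    Hmap (f ≫ g) i x = Hmap g i (Hmap f i x) := by
  obtain ⟨z, hz, rfl⟩ := M.Hmk_surjective x; rfl

lemma Hmap_id (M : DGMod A) (i : ℤ) (x : M.H i) : Hmap (𝟙 M) i x = x := by
  obtain ⟨z, hz, rfl⟩ := M.Hmk_surjective x; rfl

lemma quasiIso_comp {M N P : DGMod A} {f : M ⟶ N} {g : N ⟶ P} (hf : quasiIso A f)
    (hg : quasiIso A g) : quasiIso A (f ≫ g) := fun i => by
  have : ⇑(Hmap (f ≫ g) i) = Hmap g i ∘ Hmap f i := funext (Hmap_comp f g i)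
  rw [this]; exact (hg i).comp (hf i)

lemma quasiIso_of_comp_right {M N P : DGMod A} {f : M ⟶ N} {g : N ⟶ P}
    (hg : quasiIso A g) (hfg : quasiIso A (f ≫ g)) : quasiIso A f := fun i => by
  have : ⇑(Hmap (f ≫ g) i) = Hmap g i ∘ Hmap f i := funext (Hmap_comp f g i)
  have h := hfg i
  rw [this] at h
  exact (Function.Bijective.of_comp_iff' (hg i) _).1 h

lemma Acyclic.of_quasiIso {M N : DGMod A} {f : M ⟶ N} (hf : quasiIso A f) (hN : N.Acyclic) :
    M.Acyclic := fun i => @Function.Injective.subsingleton _ _ _ (hf i).1 (hN i)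

/-! ### Cones -/

section Cone

variable {M N : DGMod A} (f : M ⟶ N)

/-- The first component of an element of a cone. -/
def coneFst {i : ℤ} : (cone f).X i →+ N.X i := AddMonoidHom.fst _ _

/-- The second component of an element of a cone. -/
def coneSnd {i j : ℤ} (h : i + 1 = j) : (cone f).X i →+ M.X j :=
  (M.idx h).comp (AddMonoidHom.snd (N.X i) (M.X (i + 1)))

/-- The element of a cone with given components. -/
def coneMk {i j : ℤ} (h : i + 1 = j) (y : N.X i) (x : M.X j) : (cone f).X i := (y, M.idx h.symm x)

@[simp] lemma coneFst_mk {i j : ℤ} (h : i + 1 = j) (y : N.X i) (x : M.X j) :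
    coneFst f (coneMk f h y x) = y := rfl

@[simp] lemma coneSnd_mk {i j : ℤ} (h : i + 1 = j) (y : N.X i) (x : M.X j) :
    coneSnd f h (coneMk f h y x) = x := by subst h; rfl

variable {f} in
lemma cone_ext {i j : ℤ} (h : i + 1 = j) {z w : (cone f).X i} (h₁ : coneFst f z = coneFst f w)
    (h₂ : coneSnd f h z = coneSnd f h w) : z = w := by
  subst h; exact Prod.ext h₁ h₂

lemma coneFst_d {i j : ℤ} (h : i + 1 = j) (z : (cone f).X i) :
    coneFst f ((cone f).d h z) = N.d h (coneFst f z) + f.app j (coneSnd f h z) := rfl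

lemma coneSnd_d {i j k : ℤ} (h : i + 1 = j) (h' : j + 1 = k) (z : (cone f).X i) :
    coneSnd f h' ((cone f).d h z) = - M.d h' (coneSnd f h z) := by subst h h'; rfl

lemma coneFst_smul {p j k : ℤ} (h : p + j = k) (a : A.X p) (z : (cone f).X j) :
    coneFst f ((cone f).smul h a z) = N.smul h a (coneFst f z) := rfl

lemma coneSnd_smul {p j k j' k' : ℤ} (h : p + j = k) (hj : j + 1 = j') (hk : k + 1 = k')
    (h' : p + j' = k') (a : A.X p) (z : (cone f).X j) :
    coneSnd f hk ((cone f).smul h a z) = sgn p • M.smul h' a (coneSnd f hj z) := by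
  subst hj hk; rfl

lemma cone_d_eq_zero_iff {i j k : ℤ} (h : i + 1 = j) (h' : j + 1 = k) (z : (cone f).X i) :
    (cone f).d h z = 0 ↔
      N.d h (coneFst f z) + f.app j (coneSnd f h z) = 0 ∧ M.d h' (coneSnd f h z) = 0 := by
  rw [← coneFst_d, ← neg_eq_zero (a := M.d h' _), ← coneSnd_d]
  constructor
  · intro hz
    rw [hz, map_zero, map_zero]
    exact ⟨rfl, rfl⟩
  · rintro ⟨h1, h2⟩
    exact cone_ext h' (by rw [h1, map_zero]) (by rw [h2, map_zero])

/-- The inclusion `N → cone f`. -/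
def coneInl : N ⟶ cone f where
  app i := AddMonoidHom.mk' (fun y => coneMk f rfl y 0) (fun y y' => by
    refine cone_ext rfl ?_ ?_ <;> simp only [coneFst_mk, map_add, coneSnd_mk, add_zero])
  map_smul h a m := by
    refine cone_ext rfl ?_ ?_
    · rw [coneFst_smul]; rfl
    · rw [coneSnd_smul f h rfl rfl (by omega)]; simp
  map_d h m := by
    subst h
    refine cone_ext rfl ?_ ?_
    · rw [coneFst_d]; simp
    · rw [coneSnd_d]; simp

lemma coneInl_app {i j : ℤ} (h : i + 1 = j) (y : N.X i) :
    (coneInl f).app i y = coneMk f h y 0 := by subst h; rfl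

@[simp] lemma coneFst_inl {i : ℤ} (y : N.X i) : coneFst f ((coneInl f).app i y) = y := rfl

@[simp] lemma coneSnd_inl {i j : ℤ} (h : i + 1 = j) (y : N.X i) :
    coneSnd f h ((coneInl f).app i y) = 0 := by rw [coneInl_app f h, coneSnd_mk]

lemma quasiIso_iff_acyclic_cone : quasiIso A f ↔ (cone f).Acyclic := by
  constructor
  · intro hf
    refine acyclic_of _ fun i j k h h' z hz => ?_
    obtain ⟨h1, h2⟩ := (cone_d_eq_zero_iff f h' rfl z).1 hz
    obtain ⟨x, hx⟩ := exists_of_quasiIso' hf h' rfl _ (-(coneFst f z)) h2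
      (by rw [map_neg]; exact eq_neg_of_add_eq_zero_right h1)
    have hc : N.d h' (coneFst f z + f.app _ x) = 0 := by rw [map_add, ← f.map_d, hx, h1]
    obtain ⟨v, y, hv, hy⟩ := exists_of_quasiIso hf h h' _ hc
    refine ⟨coneMk f h (-y) (v - x), cone_ext h' ?_ ?_⟩
    · rw [coneFst_d, coneFst_mk, coneSnd_mk, map_sub, map_neg, hy]; abel
    · rw [coneSnd_d, coneSnd_mk, map_sub, hv, hx]; abel
  · intro hc
    refine quasiIso_of f (fun i j k h h' z hz => ?_) (fun i j k h h' w y hw hy => ?_)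
    · obtain ⟨u, hu⟩ := hc.exists h h' (coneMk f h' z 0)
        ((cone_d_eq_zero_iff f h' rfl _).2 (by simp [hz]))
      have h1 := congrArg (coneFst f) hu
      have h2 := congrArg (coneSnd f h') hu
      rw [coneFst_d, coneFst_mk] at h1
      rw [coneSnd_d, coneSnd_mk, neg_eq_zero] at h2
      exact ⟨_, -coneFst f u, h2, by rw [← h1, map_neg]; abel⟩
    · obtain ⟨u, hu⟩ := hc.exists (sub_add_cancel i 1) h (coneMk f h (-y) w)
        ((cone_d_eq_zero_iff f h h' _).2 (by simp [hw, hy]))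
      have h2 := congrArg (coneSnd f h) hu
      rw [coneSnd_d, coneSnd_mk] at h2
      exact ⟨-coneSnd f (sub_add_cancel i 1) u, by rw [map_neg, h2]⟩

lemma acyclic_cone_id (M : DGMod A) : (cone (𝟙 M)).Acyclic :=
  (quasiIso_iff_acyclic_cone _).1 (quasiIso_of_bijective _ fun _ => Function.bijective_id)

end Cone

/-! ### Graded homomorphisms -/

section Graded

variable {K L M N : DGMod A}

/-- Construction of graded homomorphisms. -/
def mkHom {n : ℤ} (f : ∀ i j : ℤ, i + n = j → L.X i →+ M.X j)
    (hf : ∀ (p i j i' j' : ℤ) (h : i + n = j) (h' : i' + n = j') (hi : p + i = i')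
      (hj : p + j = j') (a : A.X p) (l : L.X i),
      f i' j' h' (L.smul hi a l) = sgn (n * p) • M.smul hj a (f i j h l)) : (hom L M).X n :=
  show homGroup L M n from ⟨fun T => f T.i T.j T.h, hf⟩

@[simp] lemma hev_mkHom {n i j : ℤ} (f : ∀ i j : ℤ, i + n = j → L.X i →+ M.X j) (hf)
    (h : i + n = j) : hev h (mkHom f hf) = f i j h := rfl

/-- The graded homomorphism of degree `0` underlying a DG homomorphism. -/
def toHom (f : L ⟶ M) : (hom L M).X 0 :=
  mkHom (fun i _ h => (M.idx (by omega)).comp (f.app i)) (by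
    intro p i j i' j' h h' hi hj a l
    obtain rfl : i = j := by omega
    obtain rfl : i' = j' := by omega
    simp [sgn_zero, f.map_smul])

@[simp] lemma hev_toHom (f : L ⟶ M) {i : ℤ} (h : i + 0 = i) (x : L.X i) :
    hev h (toHom f) x = f.app i x := rfl

lemma hev_toHom' (f : L ⟶ M) {i j : ℤ} (h : i + 0 = j) (x : L.X i) :
    hev h (toHom f) x = M.idx (by omega) (f.app i x) := rfl

lemma d_toHom (f : L ⟶ M) {k : ℤ} (h : 0 + 1 = k) : (hom L M).d h (toHom f) = 0 := by
  apply hom_ext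
  intro i j hij l
  rw [d_hev h _ hij (add_zero i) (by omega) (by omega) (by omega : j + 0 = j)]
  simp [sgn_zero, f.map_d]

/-- The DG homomorphism given by a cocycle of degree `0`. -/
def ofHom (φ : (hom L M).X 0) (hφ : (hom L M).d rfl φ = 0) : L ⟶ M where
  app i := hev (add_zero i) φ
  map_smul h a m := by
    rw [hev_smul φ (add_zero _) (add_zero _) h h]
    simp [sgn_zero]
  map_d {i j} h m := by
    have := d_hev rfl φ (by omega : i + (0 + 1) = j) (add_zero i) h h (add_zero j) m
    rw [hφ] at this
    simp only [map_zero, AddMonoidHom.zero_apply, sgn_zero, _root_.one_smul] at this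
    exact (sub_eq_zero.1 this.symm).symm

@[simp] lemma ofHom_app (φ : (hom L M).X 0) (hφ) (i : ℤ) (x : L.X i) :
    (ofHom φ hφ).app i x = hev (add_zero i) φ x := rfl

@[simp] lemma toHom_ofHom (φ : (hom L M).X 0) (hφ) : toHom (ofHom φ hφ) = φ := by
  apply hom_ext
  intro i j hij l
  obtain rfl : i = j := by omega
  rfl

lemma toHom_injective {f g : L ⟶ M} (h : toHom f = toHom g) : f = g :=
  hom_ext_app fun i x => by rw [← hev_toHom f (add_zero i), h, hev_toHom]

@[simp] lemma toHom_sub (f g : L ⟶ M) : toHom (f - g) = toHom f - toHom g := by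
  apply hom_ext
  intro i j hij l
  obtain rfl : i = j := by omega
  simp

@[simp] lemma toHom_zero : toHom (0 : L ⟶ M) = 0 := by
  apply hom_ext
  intro i j hij l
  obtain rfl : i = j := by omega
  simp

/-- Composition with a DG homomorphism on the left. -/
def post (L : DGMod A) (g : M ⟶ N) : hom L M ⟶ hom L N where
  app n := AddMonoidHom.mk' (fun φ => mkHom (fun i j h => (g.app j).comp (hev h φ)) (by
      intro p i j i' j' h h' hi hj a l
      simp only [AddMonoidHom.comp_apply]
      rw [hev_smul φ h h' hi hj, map_zsmul, g.map_smul])) (fun φ ψ => by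
      apply hom_ext; intro i j hij l; simp)
  map_smul {p n k} h a φ := by
    apply hom_ext; intro i j hij l
    rw [smul_hev h a _ hij rfl (by omega)]
    simp only [AddMonoidHom.mk'_apply, hev_mkHom, AddMonoidHom.comp_apply]
    rw [smul_hev h a φ hij rfl (by omega), g.map_smul]
  map_d {n k} h φ := by
    apply hom_ext; intro i j hij l
    rw [d_hev h _ hij rfl (by omega) rfl (by omega)]
    simp only [AddMonoidHom.mk'_apply, hev_mkHom, AddMonoidHom.comp_apply]
    rw [d_hev h φ hij rfl (by omega) rfl (by omega), map_sub, map_zsmul, g.map_d]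

@[simp] lemma hev_post (g : M ⟶ N) {n i j : ℤ} (h : i + n = j) (φ : (hom L M).X n) (x : L.X i) :
    hev h ((post L g).app n φ) x = g.app j (hev h φ x) := rfl

@[simp] lemma post_toHom (f : L ⟶ M) (g : M ⟶ N) : (post L g).app 0 (toHom f) = toHom (f ≫ g) := by
  apply hom_ext; intro i j hij l
  obtain rfl : i = j := by omega
  simp

lemma post_comp (g : M ⟶ N) (f : K ⟶ M) (n : ℤ) (φ : (hom L K).X n) :
    (post L g).app n ((post L f).app n φ) = (post L (f ≫ g)).app n φ := rfl

/-- The composition of graded homomorphisms. -/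
def gcomp {q r s : ℤ} (h : r + q = s) : (hom M N).X q →+ (hom L M).X r →+ (hom L N).X s :=
  AddMonoidHom.mk' (fun φ => AddMonoidHom.mk' (fun ψ =>
    mkHom (fun i j hij => (hev (by omega : i + r + q = j) φ).comp (hev rfl ψ)) (by
      intro p i j i' j' hij hij' hi hj a l
      simp only [AddMonoidHom.comp_apply]
      rw [hev_smul ψ rfl rfl hi (by omega : p + (i + r) = i' + r), map_zsmul,
        hev_smul φ (by omega) (by omega) (by omega) hj]
      rw [smul_smul, ← sgn_add]
      congr 2; rw [← h]; ring))
    (fun ψ ψ' => by apply hom_ext; intro i j hij l; simp))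
    (fun φ φ' => by ext ψ : 1; apply hom_ext; intro i j hij l; simp)

lemma hev_gcomp {q r s i j k : ℤ} (h : r + q = s) (φ : (hom M N).X q) (ψ : (hom L M).X r)
    (hij : i + s = j) (hik : i + r = k) (hkj : k + q = j) (x : L.X i) :
    hev hij (gcomp h φ ψ) x = hev hkj φ (hev hik ψ x) := by
  subst hik; rfl

lemma d_gcomp {q r s q' r' s' : ℤ} (h : r + q = s) (hq : q + 1 = q') (hr : r + 1 = r')
    (hs : s + 1 = s') (h₁ : r + q' = s') (h₂ : r' + q = s') (φ : (hom M N).X q)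
    (ψ : (hom L M).X r) : (hom L N).d hs (gcomp h φ ψ) =
      gcomp h₁ ((hom M N).d hq φ) ψ + sgn q • gcomp h₂ φ ((hom L M).d hr ψ) := by
  apply hom_ext; intro i j hij l
  subst hq hr hs
  rw [d_hev rfl _ hij rfl (by omega) rfl (by omega), map_add, AddMonoidHom.add_apply, map_zsmul,
    AddMonoidHom.smul_apply,
    hev_gcomp h φ ψ rfl rfl (by omega : i + r + q = i + s),
    hev_gcomp h φ ψ (by omega : i + 1 + s = j) (by omega : i + 1 + r = i + r + 1) (by omega),
    hev_gcomp h₁ _ ψ hij rfl (by omega),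
    hev_gcomp h₂ φ _ hij (by omega : i + (r + 1) = i + r + 1) (by omega),
    d_hev rfl φ (by omega : i + r + (q + 1) = j) (by omega : i + r + q = i + s) (by omega) rfl
      (by omega), d_hev rfl ψ (by omega : i + (r + 1) = i + r + 1) rfl rfl rfl (by omega), map_sub,
    map_zsmul, smul_sub, smul_smul, ← sgn_add]
  have e : sgn (q + r) = sgn s := by rw [← h, add_comm]
  rw [e]
  have key : ∀ a b c : N.X j, a - c = a - b + (b - c) := fun a b c => by abel
  exact key _ _ _

end Graded

/-! ### Homotopies -/

section Homotopy

variable {K L M N : DGMod A}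

/-- A DG homomorphism that is homotopic to zero. -/
def Null (f : L ⟶ M) : Prop := ∃ h : (hom L M).X (-1), (hom L M).d (by norm_num) h = toHom f

lemma Null.post {f : L ⟶ M} (hf : Null f) (g : M ⟶ N) : Null (f ≫ g) := by
  obtain ⟨h, hh⟩ := hf
  exact ⟨(DGMod.post L g).app _ h, by rw [← (DGMod.post L g).map_d, hh, post_toHom]⟩

lemma gcomp_toHom_left {r s : ℤ} (hrs : r + 0 = s) (g : M ⟶ N) (φ : (hom L M).X r) :
    gcomp hrs (toHom g) φ = (hom L N).idx (by omega) ((DGMod.post L g).app r φ) := by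
  obtain rfl : r = s := by omega
  apply hom_ext; intro i j hij l
  rw [hev_gcomp hrs _ _ hij hij (by omega)]
  rfl

lemma hev_gcomp_toHom {q s i j : ℤ} (h : 0 + q = s) (φ : (hom M N).X q) (f : L ⟶ M)
    (hij : i + s = j) (hij' : i + q = j) (x : L.X i) :
    hev hij (gcomp h φ (toHom f)) x = hev hij' φ (f.app i x) := by
  rw [hev_gcomp h φ _ hij (add_zero i) hij', hev_toHom]

lemma d_gcomp_toHom {q q' : ℤ} (h : 0 + q = q) (h' : 0 + q' = q') (hq : q + 1 = q')
    (φ : (hom M N).X q) (f : L ⟶ M) :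
    (hom L N).d hq (gcomp h φ (toHom f)) = gcomp h' ((hom M N).d hq φ) (toHom f) := by
  rw [d_gcomp h hq rfl hq h' (by omega), d_toHom, map_zero, smul_zero, add_zero]

lemma Null.pre {f : L ⟶ M} (hf : Null f) (g : K ⟶ L) : Null (g ≫ f) := by
  obtain ⟨h, hh⟩ := hf
  refine ⟨gcomp (by norm_num) h (toHom g), ?_⟩
  rw [d_gcomp_toHom _ (by norm_num), hh]
  apply hom_ext; intro i j hij l
  obtain rfl : i = j := by omega
  rw [hev_gcomp_toHom _ _ _ hij (add_zero i)]
  simp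

lemma Null.trans {f g k : L ⟶ M} (hf : Null (f - g)) (hg : Null (g - k)) : Null (f - k) := by
  obtain ⟨h, hh⟩ := hf
  obtain ⟨h', hh'⟩ := hg
  exact ⟨h + h', by rw [map_add, hh, hh', toHom_sub, toHom_sub, toHom_sub]; abel⟩

lemma null_zero : Null (0 : L ⟶ M) := ⟨0, by rw [map_zero, toHom_zero]⟩

lemma sub_comp (f g : L ⟶ M) (h : M ⟶ N) : (f - g) ≫ h = f ≫ h - g ≫ h :=
  hom_ext_app fun i x => by simp

lemma comp_sub (f g : L ⟶ M) (h : K ⟶ L) : h ≫ (f - g) = h ≫ f - h ≫ g :=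
  hom_ext_app fun i x => by simp

lemma Null.post_sub {f g : L ⟶ M} (hf : Null (f - g)) (h : M ⟶ N) : Null (f ≫ h - g ≫ h) := by
  rw [← sub_comp]; exact hf.post h

lemma Null.pre_sub {f g : L ⟶ M} (hf : Null (f - g)) (h : K ⟶ L) : Null (h ≫ f - h ≫ g) := by
  rw [← comp_sub]; exact hf.pre h

/-- Homotopic homomorphisms induce the same map in cohomology. -/
lemma Null.exists_app {f g : L ⟶ M} (hf : Null (f - g)) {i j k : ℤ} (h : j + 1 = i)
    (h' : i + 1 = k) (z : L.X i) (hz : L.d h' z = 0) :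
    ∃ y, M.d h y = f.app i z - g.app i z := by
  obtain ⟨s, hs⟩ := hf
  refine ⟨hev (by omega) s z, ?_⟩
  have := d_hev (by norm_num : (-1 : ℤ) + 1 = 0) s (add_zero i) (by omega : i + -1 = j) h h'
    (by omega) z
  rw [hs, hev_toHom, hz, map_zero, smul_zero, sub_zero, sub_app] at this
  exact this.symm

end Homotopy

/-! ### Cones and graded homomorphisms -/

section ConeHom

variable {L M N : DGMod A} (g : M ⟶ N)

/-- The projection of the cone to the target, as a graded homomorphism. -/
def gFst : (hom (cone g) N).X 0 :=
  mkHom (fun i _ h => (N.idx (by omega)).comp (coneFst g)) (by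
    intro p i j i' j' h h' hi hj a l
    obtain rfl : i = j := by omega
    obtain rfl : i' = j' := by omega
    simp [sgn_zero, coneFst_smul])

/-- The projection of the cone to the source. -/
def gSnd : (hom (cone g) M).X 1 :=
  mkHom (fun _ _ h => coneSnd g h) (by
    intro p i j i' j' h h' hi hj a l
    rw [coneSnd_smul g hi h h' hj, one_mul])

/-- The inclusion of the source into the cone. -/
def gInr : (hom M (cone g)).X (-1) :=
  mkHom (fun i j h => AddMonoidHom.mk' (fun x => coneMk g (by omega : j + 1 = i) 0 x) (by
    intro x y
    refine cone_ext (by omega : j + 1 = i) ?_ ?_ <;> simp)) (by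
    intro p i j i' j' h h' hi hj a l
    refine cone_ext (by omega : j' + 1 = i') ?_ ?_
    · simp [coneFst_smul]
    · simp only [AddMonoidHom.mk'_apply, coneSnd_mk, map_zsmul]
      rw [coneSnd_smul g hj (by omega : j + 1 = i) (by omega) hi, coneSnd_mk, smul_smul, ← sgn_add,
        sgn_even, _root_.one_smul]
      exact ⟨0, by ring⟩)

lemma d_gSnd : (hom (cone g) M).d rfl (gSnd g) = 0 := by
  apply hom_ext; intro i j hij l
  rw [d_hev rfl _ hij rfl (by omega) rfl (by omega)]
  simp only [gSnd, hev_mkHom]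
  rw [coneSnd_d g rfl (by omega), sgn_one]
  simp

lemma d_gInr : (hom M (cone g)).d (by norm_num : (-1 : ℤ) + 1 = 0) (gInr g) =
    toHom (g ≫ coneInl g) := by
  apply hom_ext; intro i j hij l
  obtain rfl : i = j := by omega
  rw [d_hev _ _ hij (by omega : i + -1 = i - 1) (by omega) rfl (by omega)]
  simp only [gInr, hev_mkHom, AddMonoidHom.mk'_apply, hev_toHom, comp_app]
  refine cone_ext rfl ?_ ?_
  · rw [map_sub, coneFst_d]; simp
  · rw [map_sub, coneSnd_d]
    simp [sgn_odd (show Odd (-1 : ℤ) from ⟨-1, by norm_num⟩)]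

lemma d_gFst : (hom (cone g) N).d (by norm_num : (0 : ℤ) + 1 = 1) (gFst g) =
    -(post (cone g) g).app 1 (gSnd g) := by
  apply hom_ext; intro i j hij l
  rw [d_hev _ _ hij (add_zero i) hij hij (by omega)]
  simp only [gFst, gSnd, hev_mkHom, hev_post, AddMonoidHom.comp_apply, idx_rfl, sgn_zero,
    _root_.one_smul, map_neg, AddMonoidHom.neg_apply]
  rw [coneFst_d]
  abel

/-- Homomorphisms out of a K-projective DG module preserve quasi-isomorphisms. -/
lemma quasiIso_post (hL : L.IsKProjective) (hg : quasiIso A g) : quasiIso A (post L g) := by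
  have hc := hL _ ((quasiIso_iff_acyclic_cone g).1 hg)
  refine quasiIso_of _ (fun i j k h h' φ hφ => ?_) (fun i j k h h' ψ y hψ hy => ?_)
  · obtain ⟨γ, hγ⟩ := hc.exists h h' ((post L (coneInl g)).app j φ)
      (by rw [← Hom.map_d, hφ, map_zero])
    refine ⟨gcomp h (gSnd g) γ, -(gcomp (add_zero i) (gFst g) γ), ?_, ?_⟩
    · rw [d_gcomp h rfl h h' (by omega) h', d_gSnd, hγ, map_zero, AddMonoidHom.zero_apply,
        zero_add]
      refine (smul_eq_zero_of_right _ ?_)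
      apply hom_ext; intro a b hab l
      rw [hev_gcomp h' _ _ hab rfl (by omega)]
      simp [gSnd]
    · rw [map_neg, d_gcomp (add_zero i) rfl h h h (add_zero j), hγ, d_gFst, sgn_zero,
        _root_.one_smul, map_neg, AddMonoidHom.neg_apply]
      have e1 : gcomp (add_zero j) (gFst g) ((post L (coneInl g)).app j φ) = φ := by
        apply hom_ext; intro a b hab l
        rw [hev_gcomp _ _ _ hab hab (by omega)]
        simp [gFst]
      have e2 : gcomp h ((post (cone g) g).app 1 (gSnd g)) γ =
          (post L g).app j (gcomp h (gSnd g) γ) := by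
        apply hom_ext; intro a b hab l
        rw [hev_gcomp h _ _ hab rfl (by omega), hev_post, hev_post,
          hev_gcomp h _ _ hab rfl (by omega)]
      rw [e1, e2]
      abel
  · obtain ⟨δ, hδ⟩ := hc.exists (by omega : i - 1 + 1 = i) h
      (gcomp (by omega : j + -1 = i) (gInr g) ψ - (post L (coneInl g)).app i y) (by
        rw [map_sub, d_gcomp (by omega : j + -1 = i) (by norm_num : (-1 : ℤ) + 1 = 0) h' h
          (add_zero j) (by omega), hψ, map_zero, smul_zero, add_zero, d_gInr, gcomp_toHom_left,
          ← post_comp, hy, ← (post L _).map_d]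
        exact sub_self _)
    have : gcomp h (gSnd g) ((hom L (cone g)).d (by omega : i - 1 + 1 = i) δ) = ψ := by
      rw [hδ]
      apply hom_ext; intro a b hab l
      rw [hev_gcomp h _ _ hab rfl (by omega), map_sub, AddMonoidHom.sub_apply, map_sub,
        hev_gcomp (by omega : j + -1 = i) _ _ rfl hab (by omega)]
      simp [gSnd, gInr]
    refine ⟨-(gcomp (by omega : i - 1 + 1 = i) (gSnd g) δ), ?_⟩
    rw [map_neg, d_gcomp (by omega : i - 1 + 1 = i) rfl (by omega : i - 1 + 1 = i) h (by omega) h,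
      d_gSnd, map_zero, AddMonoidHom.zero_apply, zero_add, this, sgn_one]
    simp

/-- Lifting along a quasi-isomorphism, up to homotopy. -/
lemma exists_lift_null (hL : L.IsKProjective) (hg : quasiIso A g) (f : L ⟶ N) :
    ∃ f' : L ⟶ M, Null (f' ≫ g - f) := by
  obtain ⟨w, y, hw, hy⟩ := exists_of_quasiIso (quasiIso_post g hL hg)
    (by norm_num : (-1 : ℤ) + 1 = 0) rfl (toHom f) (d_toHom f _)
  refine ⟨ofHom w hw, y, ?_⟩
  rw [toHom_sub, ← post_toHom, toHom_ofHom, hy]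
  abel

end ConeHom

/-! ### Morphisms in the derived category -/

section Derived

variable {L M N : DGMod A}

/-- The binary product of DG modules. -/
def prod (M N : DGMod A) : DGMod A where
  X i := M.X i × N.X i
  smul h := AddMonoidHom.mk' (fun a => (M.smul h a).prodMap (N.smul h a))
    (fun a b => by ext x <;> simp)
  d h := (M.d h).prodMap (N.d h)
  one_smul h m := Prod.ext (M.one_smul h _) (N.one_smul h _)
  mul_smul h₁ h₂ h₃ h₄ a b m := Prod.ext (M.mul_smul h₁ h₂ h₃ h₄ a b _) (N.mul_smul h₁ h₂ h₃ h₄ a b _)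
  d_d h h' m := Prod.ext (M.d_d h h' _) (N.d_d h h' _)
  leibniz h hi hj hk h₁ h₂ a m :=
    Prod.ext (M.leibniz h hi hj hk h₁ h₂ a _) (N.leibniz h hi hj hk h₁ h₂ a _)

/-- Homotopic homomorphisms become equal in the derived category. -/
lemma Q_map_eq_of_null {f g : L ⟶ M} (h : Null (f - g)) : (Q A).map f = (Q A).map g := by
  obtain ⟨s, hs⟩ := h
  let Z := cone (𝟙 L)
  let e : (hom Z M).X 0 := gcomp (add_zero 0) (toHom (f - g)) (gFst (𝟙 L)) +
    gcomp (by norm_num : (1 : ℤ) + -1 = 0) s (gSnd (𝟙 L))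
  have he : (hom Z M).d (by norm_num : (0 : ℤ) + 1 = 1) e = 0 := by
    rw [map_add, d_gcomp (add_zero 0) (by norm_num : (0 : ℤ) + 1 = 1)
      (by norm_num : (0 : ℤ) + 1 = 1) (by norm_num) (by norm_num) (by norm_num),
      d_gcomp (by norm_num : (1 : ℤ) + -1 = 0) (by norm_num : (-1 : ℤ) + 1 = 0) rfl (by norm_num)
        (by norm_num) (by norm_num), d_toHom, hs, d_gSnd, d_gFst]
    simp only [map_zero, AddMonoidHom.zero_apply, zero_add, smul_zero, add_zero, sgn_zero,
      _root_.one_smul, map_neg]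
    rw [neg_add_eq_zero]
    rfl
  have he' : (hom Z M).d rfl e = 0 := he
  let p₀ : prod M Z ⟶ M :=
    { app := fun i => AddMonoidHom.fst _ _
      map_smul := fun _ _ _ => rfl
      map_d := fun _ _ => rfl }
  let p : prod M Z ⟶ M :=
    { app := fun i => (AddMonoidHom.fst _ _) + ((ofHom e he').app i).comp (AddMonoidHom.snd _ _)
      map_smul := fun {i j k} h a m => by
        change M.smul h a m.1 + (ofHom e he').app k (Z.smul h a m.2) =
          M.smul h a (m.1 + (ofHom e he').app j m.2)
        rw [Hom.map_smul, map_add]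
      map_d := fun {i j} h m => by
        change M.d h m.1 + (ofHom e he').app j (Z.d h m.2) =
          M.d h (m.1 + (ofHom e he').app i m.2)
        rw [Hom.map_d, map_add] }
  let σ : M ⟶ prod M Z :=
    { app := fun i => AddMonoidHom.inl _ _
      map_smul := fun h a m => Prod.ext rfl (map_zero (Z.smul h a)).symm
      map_d := fun h m => Prod.ext rfl (map_zero (Z.d h)).symm }
  let t : L ⟶ prod M Z :=
    { app := fun i => (g.app i).prod ((coneInl (𝟙 L)).app i)
      map_smul := fun h a m => Prod.ext (g.map_smul h a m) ((coneInl (𝟙 L)).map_smul h a m)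
      map_d := fun h m => Prod.ext (g.map_d h m) ((coneInl (𝟙 L)).map_d h m) }
  have hσ : quasiIso A σ := by
    have hZ : Z.Acyclic := acyclic_cone_id L
    refine quasiIso_of _ (fun i j k h h' z hz => ?_) (fun i j k h h' w y hw hy => ?_)
    · obtain ⟨y, hy⟩ := hZ.exists h h' z.2 (congrArg Prod.snd hz)
      refine ⟨z.1, ((0 : M.X i), -y), congrArg Prod.fst hz, Prod.ext ?_ ?_⟩
      · change z.1 = z.1 + M.d h 0
        rw [map_zero, add_zero]
      · change 0 = z.2 + Z.d h (-y)
        rw [map_neg, hy, add_neg_cancel]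
    · exact ⟨y.1, (congrArg Prod.fst hy).symm⟩
  have h1 : σ ≫ p = 𝟙 M := hom_ext_app fun i x => by
    change x + (ofHom e he').app i 0 = x
    rw [map_zero, add_zero]
  have h0 : σ ≫ p₀ = 𝟙 M := rfl
  have hf : t ≫ p = f := hom_ext_app fun i x => by
    change g.app i x + hev (add_zero i) e ((coneInl (𝟙 L)).app i x) = f.app i x
    rw [map_add, AddMonoidHom.add_apply, hev_gcomp (add_zero 0) _ _ _ (add_zero i) (add_zero i),
      hev_gcomp (by norm_num : (1 : ℤ) + -1 = 0) _ _ _ rfl (by omega)]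
    have e1 : coneFst (𝟙 L) ((coneInl (𝟙 L)).app i x) = x := rfl
    have e2 : coneSnd (𝟙 L) rfl ((coneInl (𝟙 L)).app i x) = 0 := coneSnd_inl _ _ _
    simp only [gFst, gSnd, hev_mkHom, AddMonoidHom.comp_apply, hev_toHom, idx_rfl, sub_app]
    erw [e1, e2]
    rw [map_zero]; abel
  have hg : t ≫ p₀ = g := rfl
  have hp : (Q A).map p = (Q A).map p₀ := by
    have : IsIso ((Q A).map σ) := Localization.inverts (Q A) (quasiIso A) _ hσ
    rw [← cancel_epi ((Q A).map σ), ← Functor.map_comp, ← Functor.map_comp, h1, h0]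
  rw [← hf, ← hg, Functor.map_comp, Functor.map_comp, hp]

/-- Cohomology as a functor to types. -/
def Hfun (i : ℤ) : DGMod A ⥤ Type u where
  obj M := M.H i
  map f := TypeCat.ofHom (Hmap f i)
  map_id M := by ext x; exact Hmap_id M i x
  map_comp f g := by ext x; exact Hmap_comp f g i x

lemma Hfun_inverted (i : ℤ) : (quasiIso A).IsInvertedBy (Hfun (A := A) i) := fun _ _ _ hf =>
  (CategoryTheory.isIso_iff_bijective _).2 (hf i)

/-- The functor `M ↦ hom(L, M)`. -/
def homFun (L : DGMod A) : DGMod A ⥤ DGMod A where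
  obj M := hom L M
  map f := post L f

/-- A homomorphism that becomes invertible in the derived category is a quasi-isomorphism. -/
lemma quasiIso_of_isIso {f : M ⟶ N} (h : IsIso ((Q A).map f)) : quasiIso A f := by
  intro i
  let F := Localization.lift (Hfun (A := A) i) (Hfun_inverted i) (Q A)
  have : IsIso ((Q A ⋙ F).map f) := by
    rw [Functor.comp_map]; infer_instance
  have := (NatIso.isIso_map_iff (Localization.fac (Hfun (A := A) i) (Hfun_inverted i) (Q A)) f).1 this
  exact (CategoryTheory.isIso_iff_bijective _).1 this

lemma isIso_of_quasiIso {f : M ⟶ N} (h : quasiIso A f) : IsIso ((Q A).map f) :=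
  Localization.inverts (Q A) (quasiIso A) _ h

/-- Every morphism in `D(A)` from a K-projective DG module is represented by a homomorphism. -/
lemma exists_Q_map_eq (hL : L.IsKProjective) (ψ : (Q A).obj L ⟶ (Q A).obj M) :
    ∃ f : L ⟶ M, (Q A).map f = ψ := by
  let P : MorphismProperty (D A) := fun X Y ψ =>
    ∀ (f : L ⟶ (Localization.Construction.objEquiv (quasiIso A)).symm X),
      ∃ g : L ⟶ (Localization.Construction.objEquiv (quasiIso A)).symm Y,
        (show (Q A).obj L ⟶ X from (Q A).map f) ≫ ψ = (show (Q A).obj L ⟶ Y from (Q A).map g)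
  have : P.IsStableUnderComposition := ⟨fun φ ψ hφ hψ f => by
    obtain ⟨g, hg⟩ := hφ f
    obtain ⟨k, hk⟩ := hψ g
    exact ⟨k, by rw [← Category.assoc, hg, hk]⟩⟩
  have key : ∀ (X Y : DGMod A) (w : X ⟶ Y) (hw : quasiIso A w) (f : L ⟶ Y),
      ∃ g : L ⟶ X, (Q A).map f ≫ Localization.Construction.wInv w hw = (Q A).map g := by
    intro X Y w hw f
    obtain ⟨g, hg⟩ := exists_lift_null w hL hw f
    have h1 : (Q A).map g ≫ (Q A).map w = (Q A).map f := by
      rw [← Q_map_eq_of_null hg, Functor.map_comp]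
    have h2 : (Q A).map w ≫ Localization.Construction.wInv w hw = 𝟙 _ :=
      (Localization.Construction.wIso w hw).hom_inv_id
    exact ⟨g, by rw [← h1, Category.assoc, h2, Category.comp_id]⟩
  have hP : P = ⊤ := Localization.Construction.morphismProperty_eq_top P
    (fun X Y h f => ⟨f ≫ h, ((Q A).map_comp f h).symm⟩) (fun X Y w hw f => key X Y w hw f)
  have h : P ψ := by rw [hP]; trivial
  obtain ⟨g, hg⟩ : ∃ g : L ⟶ M, (Q A).map (𝟙 L) ≫ ψ = (Q A).map g := h (𝟙 L)
  exact ⟨g, by rw [← hg, CategoryTheory.Functor.map_id, Category.id_comp]⟩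

lemma homFun_inverted (hL : L.IsKProjective) :
    (quasiIso A).IsInvertedBy (homFun L ⋙ Hfun 0) := fun _ _ _ hf =>
  Hfun_inverted 0 _ (quasiIso_post _ hL hf)

lemma null_of_Q_map_eq (hL : L.IsKProjective) {f g : L ⟶ M} (h : (Q A).map f = (Q A).map g) :
    Null (f - g) := by
  have h1 := CategoryTheory.AreEqualizedByLocalization.map_eq_of_isInvertedBy (W := quasiIso A)
    (f := f) (g := g) h (homFun L ⋙ Hfun 0) (homFun_inverted hL)
  have h2 : Hmap (post L f) 0 ((hom L L).Hmk (toHom (𝟙 L)) (d_toHom _ _)) =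
      Hmap (post L g) 0 ((hom L L).Hmk (toHom (𝟙 L)) (d_toHom _ _)) :=
    congrArg (fun φ => (ConcreteCategory.hom φ) ((hom L L).Hmk (toHom (𝟙 L)) (d_toHom _ _))) h1
  rw [Hmap_Hmk, Hmap_Hmk, Hmk_eq_iff _ (by norm_num : (-1 : ℤ) + 1 = 0)] at h2
  obtain ⟨y, hy⟩ := h2
  exact ⟨y, by rw [hy, post_toHom, post_toHom, toHom_sub]; rfl⟩

/-- A retraction up to homotopy gives a retract in the derived category. -/
def retractOfNull {i : M ⟶ N} {r : N ⟶ M} (h : Null (i ≫ r - 𝟙 M)) :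
    Retract ((Q A).obj M) ((Q A).obj N) where
  i := (Q A).map i
  r := (Q A).map r
  retract := by rw [← Functor.map_comp, Q_map_eq_of_null h, CategoryTheory.Functor.map_id]

/-- A retract in the derived category between K-projective DG modules is a retract up to
homotopy. -/
lemma exists_null_of_retract (hM : M.IsKProjective) (hN : N.IsKProjective)
    (r : Retract ((Q A).obj M) ((Q A).obj N)) :
    ∃ (u : M ⟶ N) (v : N ⟶ M), Null (u ≫ v - 𝟙 M) := by
  obtain ⟨u, hu⟩ := exists_Q_map_eq hM r.i
  obtain ⟨v, hv⟩ := exists_Q_map_eq hN r.r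
  exact ⟨u, v, null_of_Q_map_eq hM (by rw [Functor.map_comp, hu, hv, r.retract, CategoryTheory.Functor.map_id])⟩

end Derived

/-! ### Direct sums -/

lemma hev_idx_right {L M : DGMod A} {n i j k : ℤ} (h : i + n = j) (h' : i + n = k) (hjk : j = k)
    (φ : (hom L M).X n) (x : L.X i) : hev h' φ x = M.idx hjk (hev h φ x) := by
  subst hjk; rfl

section DirectSum

variable {ι : Type u} (N : ι → DGMod A)

open scoped Classical in
/-- The inclusion of a summand. -/
noncomputable def dsIncl (b : ι) : N b ⟶ directSum N where
  app i := DirectSum.of (fun z => (N z).X i) b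
  map_smul {i j k} h a m := (DirectSum.map_of (fun z => (N z).smul h a) b m).symm
  map_d {i j} h m := (DirectSum.map_of (fun z => (N z).d h) b m).symm

/-- The projection to a summand. -/
def dsProj (b : ι) : directSum N ⟶ N b where
  app i := DFinsupp.evalAddMonoidHom b
  map_smul h a m := rfl
  map_d h m := rfl

variable {N}

lemma directSum_ext {i : ℤ} {x y : (directSum N).X i}
    (h : ∀ b, (dsProj N b).app i x = (dsProj N b).app i y) : x = y :=
  DFinsupp.ext h

@[simp] lemma dsProj_incl_same (b : ι) (i : ℤ) (x : (N b).X i) :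
    (dsProj N b).app i ((dsIncl N b).app i x) = x := by
  classical exact DFinsupp.single_eq_same (β := fun z => (N z).X i)

lemma dsProj_incl_ne {b c : ι} (hbc : b ≠ c) (i : ℤ) (x : (N b).X i) :
    (dsProj N c).app i ((dsIncl N b).app i x) = 0 := by
  classical exact DFinsupp.single_eq_of_ne (β := fun z => (N z).X i) hbc.symm

lemma directSum_induction {i : ℤ} {P : (directSum N).X i → Prop} (x : (directSum N).X i)
    (zero : P 0) (of : ∀ b (y : (N b).X i), P ((dsIncl N b).app i y))
    (add : ∀ x y, P x → P y → P (x + y)) : P x := by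
  classical
  refine DirectSum.induction_on (β := fun z => (N z).X i) (motive := P) x zero (fun b y => ?_) add
  exact of b y

open scoped Classical in
/-- The additive map from a component of a direct sum with given restrictions. -/
noncomputable def dsSum {i : ℤ} {G : Type*} [AddCommGroup G] (f : ∀ b, (N b).X i →+ G) :
    (directSum N).X i →+ G :=
  DirectSum.toAddMonoid (β := fun z => (N z).X i) f

@[simp] lemma dsSum_incl {i : ℤ} {G : Type*} [AddCommGroup G] (f : ∀ b, (N b).X i →+ G) (b : ι)
    (x : (N b).X i) : dsSum f ((dsIncl N b).app i x) = f b x := by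
  classical exact DirectSum.toAddMonoid_of (β := fun z => (N z).X i) f b x

lemma dsSum_ext {i : ℤ} {G : Type*} [AddCommGroup G] {f g : (directSum N).X i →+ G}
    (h : ∀ b x, f ((dsIncl N b).app i x) = g ((dsIncl N b).app i x)) : f = g :=
  AddMonoidHom.ext fun x => directSum_induction (P := fun x => f x = g x) x
    (by rw [map_zero, map_zero]) h (fun x y hx hy => by rw [map_add, map_add, hx, hy])

/-- The homomorphism from a direct sum with given components. -/
noncomputable def dsDesc {M : DGMod A} (f : ∀ b, N b ⟶ M) : directSum N ⟶ M where
  app i := dsSum (fun b => (f b).app i)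
  map_smul {i j k} h a m := by
    have : (dsSum (fun b => (f b).app k)).comp ((directSum N).smul h a) =
        (M.smul h a).comp (dsSum (fun b => (f b).app j)) := dsSum_ext fun b x => by
      simp only [AddMonoidHom.comp_apply]
      rw [← (dsIncl N b).map_smul, dsSum_incl, dsSum_incl, (f b).map_smul]
    exact DFunLike.congr_fun this m
  map_d {i j} h m := by
    have : (dsSum (fun b => (f b).app j)).comp ((directSum N).d h) =
        (M.d h).comp (dsSum (fun b => (f b).app i)) := dsSum_ext fun b x => by
      simp only [AddMonoidHom.comp_apply]
      rw [← (dsIncl N b).map_d, dsSum_incl, dsSum_incl, (f b).map_d]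
    exact DFunLike.congr_fun this m

@[simp] lemma dsDesc_incl {M : DGMod A} (f : ∀ b, N b ⟶ M) (b : ι) (i : ℤ) (x : (N b).X i) :
    (dsDesc f).app i ((dsIncl N b).app i x) = (f b).app i x := dsSum_incl _ _ _

lemma directSum_hom_ext {M : DGMod A} {f g : directSum N ⟶ M}
    (h : ∀ b, dsIncl N b ≫ f = dsIncl N b ≫ g) : f = g :=
  Hom.ext (funext fun i => dsSum_ext fun b x => by rw [← comp_app, h, comp_app])

end DirectSum

/-! ### Cells -/

section Shift

variable {M : DGMod A} {m : ℤ}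

/-- The element of `M` underlying an element of `M[m]`. -/
def ofShift {i k : ℤ} (h : m + i = k) : (M.shift m).X i →+ M.X k := M.idx h

/-- The element of `M[m]` given by an element of `M`. -/
def toShift {i k : ℤ} (h : m + i = k) : M.X k →+ (M.shift m).X i := M.idx h.symm

@[simp] lemma ofShift_toShift {i k : ℤ} (h : m + i = k) (x : M.X k) :
    ofShift h (toShift h x : (M.shift m).X i) = x := by subst h; rfl

@[simp] lemma toShift_ofShift {i k : ℤ} (h : m + i = k) (x : (M.shift m).X i) :
    toShift h (ofShift h x) = x := by subst h; rfl

lemma ofShift_injective {i k : ℤ} (h : m + i = k) :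
    Function.Injective (ofShift h : (M.shift m).X i →+ M.X k) :=
  Function.LeftInverse.injective (g := toShift h) (toShift_ofShift h)

lemma ofShift_smul {p i j k l : ℤ} (h : p + i = j) (hi : m + i = k) (hj : m + j = l)
    (h' : p + k = l) (a : A.X p) (x : (M.shift m).X i) :
    ofShift hj ((M.shift m).smul h a x) = sgn (p * m) • M.smul h' a (ofShift hi x) := by
  subst hi hj; rfl

lemma ofShift_d {i j k l : ℤ} (h : i + 1 = j) (hi : m + i = k) (hj : m + j = l)
    (h' : k + 1 = l) (x : (M.shift m).X i) :
    ofShift hj ((M.shift m).d h x) = sgn m • M.d h' (ofShift hi x) := by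
  subst hi hj; rfl

/-- The element of `A` underlying an element of `A[m]`. -/
def ofCell {i k : ℤ} (h : m + i = k) : (A.self.shift m).X i →+ A.X k := ofShift (M := A.self) h

/-- The element of `A[m]` given by an element of `A`. -/
def toCell {i k : ℤ} (h : m + i = k) : A.X k →+ (A.self.shift m).X i := toShift (M := A.self) h

@[simp] lemma ofCell_toCell {i k : ℤ} (h : m + i = k) (x : A.X k) :
    ofCell h (toCell h x) = x := ofShift_toShift (M := A.self) h x

@[simp] lemma toCell_ofCell {i k : ℤ} (h : m + i = k) (x : (A.self.shift m).X i) :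
    toCell h (ofCell h x) = x := toShift_ofShift (M := A.self) h x

lemma ofCell_smul {p i j k l : ℤ} (h : p + i = j) (hi : m + i = k) (hj : m + j = l)
    (h' : p + k = l) (a : A.X p) (x : (A.self.shift m).X i) :
    ofCell hj ((A.self.shift m).smul h a x) = sgn (p * m) • A.mul h' a (ofCell hi x) :=
  ofShift_smul (M := A.self) h hi hj h' a x

lemma ofCell_d {i j k l : ℤ} (h : i + 1 = j) (hi : m + i = k) (hj : m + j = l)
    (h' : k + 1 = l) (x : (A.self.shift m).X i) :
    ofCell hj ((A.self.shift m).d h x) = sgn m • A.d h' (ofCell hi x) :=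
  ofShift_d (M := A.self) h hi hj h' x

/-- The homomorphism from a shift of `A` given by a cocycle. -/
def fromShift {X : DGMod A} {k : ℤ} (hk : m + k = 0) (z : X.X k) (hz : X.d rfl z = 0) :
    A.self.shift m ⟶ X where
  app i := sgn (m * (m + i)) • ((X.smul (by omega : m + i + k = i)).flip z).comp (ofCell rfl)
  map_smul {p i j} h a x := by
    simp only [AddMonoidHom.smul_apply, AddMonoidHom.comp_apply, AddMonoidHom.flip_apply,
      map_zsmul]
    rw [ofCell_smul h rfl rfl (by omega), map_zsmul, AddMonoidHom.smul_apply, smul_smul,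
      ← sgn_add, X.mul_smul _ _ (by omega : m + i + k = i) h]
    congr 1
    apply sgn_congr; subst h; exact ⟨p * m, by ring⟩
  map_d {i j} h x := by
    simp only [AddMonoidHom.smul_apply, AddMonoidHom.comp_apply, AddMonoidHom.flip_apply,
      map_zsmul]
    rw [ofCell_d h rfl rfl (by omega), map_zsmul, AddMonoidHom.smul_apply, smul_smul, ← sgn_add,
      X.leibniz (by omega : m + i + k = i) (by omega : m + i + 1 = m + j) rfl h (by omega)
        (by omega), hz, map_zero, smul_zero, add_zero]
    congr 1
    apply sgn_congr; subst h; exact ⟨m, by ring⟩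

lemma fromShift_app {X : DGMod A} {k : ℤ} (hk : m + k = 0) (z : X.X k) (hz : X.d rfl z = 0)
    {i l : ℤ} (h : m + i = l) (h' : l + k = i) (x : (A.self.shift m).X i) :
    (fromShift hk z hz).app i x = sgn (m * l) • X.smul h' (ofCell h x) z := by
  subst h; rfl

end Shift

section Cells

variable {X X' : DGMod A} {ι : Type u}

/-- The map `(x, c) ↦ j x + ∑ c_b e_b`. -/
noncomputable def cellMap (j : X ⟶ X') (n : ι → ℤ) (e : ∀ b, X'.X (n b)) (k : ℤ) :
    X.X k × DirectSum ι (fun b => A.X (k - n b)) →+ X'.X k :=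
  (j.app k).coprod (letI := Classical.decEq ι
    DirectSum.toAddMonoid fun b => (X'.smul (sub_add_cancel k (n b))).flip (e b))

lemma cellMap_inl (j : X ⟶ X') (n : ι → ℤ) (e : ∀ b, X'.X (n b)) (k : ℤ) (x : X.X k) :
    cellMap j n e k (x, 0) = j.app k x := by
  simp [cellMap]

lemma cellMap_of [inst : DecidableEq ι] (j : X ⟶ X') (n : ι → ℤ) (e : ∀ b, X'.X (n b)) (k : ℤ) (b : ι)
    (a : A.X (k - n b)) : cellMap j n e k (0, DirectSum.of (fun b => A.X (k - n b)) b a) =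
      X'.smul (sub_add_cancel k (n b)) a (e b) := by
  obtain rfl : inst = Classical.decEq ι := Subsingleton.elim _ _
  simp only [cellMap, AddMonoidHom.coprod_apply, map_zero, zero_add]
  letI := Classical.decEq ι
  exact DirectSum.toAddMonoid_of (β := fun b => A.X (k - n b)) _ _ _

/-- `X'` is obtained from `X` by attaching cells: it is freely generated over `X`, as a graded
module, by elements `e_b` of degree `n_b` with differentials in `X`. -/
structure CellExt (j : X ⟶ X') (n : ι → ℤ) (e : ∀ b, X'.X (n b)) : Prop where
  bij : ∀ k, Function.Bijective (cellMap j n e k)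
  d_mem : ∀ b, ∃ z : X.X (n b + 1), X'.d rfl (e b) = j.app _ z

variable {j : X ⟶ X'} {n : ι → ℤ} {e : ∀ b, X'.X (n b)}

lemma cellMap_induction {k : ℤ} {P : X.X k × DirectSum ι (fun b => A.X (k - n b)) → Prop} (t)
    (hj : ∀ x, P (x, 0))
    (he : ∀ [DecidableEq ι] (b : ι) (a : A.X (k - n b)), P (0, DirectSum.of (fun b => A.X (k - n b)) b a))
    (hadd : ∀ x y, P x → P y → P (x + y)) : P t := by
  classical
  obtain ⟨x, c⟩ := t
  have : P (0, c) := by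
    induction c using DirectSum.induction_on with
    | zero => exact hj 0
    | of b a => exact he b a
    | add c c' hc hc' => simpa using hadd _ _ hc hc'
  simpa using hadd _ _ (hj x) this

lemma CellExt.induction (h : CellExt j n e) {k : ℤ} {P : X'.X k → Prop} (t : X'.X k)
    (hj : ∀ x, P (j.app k x))
    (he : ∀ b (p : ℤ) (hp : p + n b = k) (a : A.X p), P (X'.smul hp a (e b)))
    (hadd : ∀ x y, P x → P y → P (x + y)) : P t := by
  obtain ⟨t, rfl⟩ := (h.bij k).2 t
  refine cellMap_induction (P := fun t => P (cellMap j n e k t)) t (fun x => ?_) (fun b a => ?_)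
    (fun x y hx hy => ?_)
  · rw [cellMap_inl]; exact hj x
  · rw [cellMap_of]; exact he _ _ _ _
  · rw [map_add]; exact hadd _ _ hx hy

lemma CellExt.injective (h : CellExt j n e) (k : ℤ) : Function.Injective (j.app k) := by
  intro x y hxy
  rw [← cellMap_inl j n e, ← cellMap_inl j n e] at hxy
  exact congrArg Prod.fst ((h.bij k).1 hxy)

/-- Graded homomorphisms from a cell extension are determined by their restriction and by the
values on the cells. -/
lemma CellExt.hom_ext (h : CellExt j n e) {N : DGMod A} {q : ℤ} {φ ψ : (hom X' N).X q}
    (hj : ∀ (i k : ℤ) (hik : i + q = k) x, hev hik φ (j.app i x) = hev hik ψ (j.app i x))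
    (he : ∀ b, hev rfl φ (e b) = hev rfl ψ (e b)) : φ = ψ := by
  apply DGMod.hom_ext
  intro i k hik t
  refine h.induction (P := fun t => hev hik φ t = hev hik ψ t) t (hj i k hik)
    (fun b p hp a => ?_) (fun x y hx hy => by rw [map_add, map_add, hx, hy])
  rw [hev_smul φ rfl hik hp (by omega), hev_smul ψ rfl hik hp (by omega), he]

open scoped Classical in
/-- Graded homomorphisms extend to a cell extension, with arbitrary values on the cells. -/
lemma CellExt.exists_extend (h : CellExt j n e) {N : DGMod A} {q : ℤ} (φ : (hom X N).X q)
    (w : ∀ b, N.X (n b + q)) : ∃ φ' : (hom X' N).X q,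
      (∀ (i k : ℤ) (hik : i + q = k) x, hev hik φ' (j.app i x) = hev hik φ x) ∧
        ∀ b, hev rfl φ' (e b) = w b := by
  let E : ∀ k, X.X k × DirectSum ι (fun b => A.X (k - n b)) ≃+ X'.X k := fun k =>
    AddEquiv.ofBijective (cellMap j n e k) (h.bij k)
  let V : ∀ i k : ℤ, i + q = k → (X.X i × DirectSum ι (fun b => A.X (i - n b)) →+ N.X k) :=
    fun i k hik => (hev hik φ).coprod (DirectSum.toAddMonoid fun b =>
      sgn (q * (i - n b)) • (N.smul (by omega : i - n b + (n b + q) = k)).flip (w b))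
  have hVj : ∀ i k hik x, V i k hik (x, 0) = hev hik φ x := fun i k hik x => by simp [V]
  have hVe : ∀ i k hik b a, V i k hik (0, DirectSum.of (fun b => A.X (i - n b)) b a) =
      sgn (q * (i - n b)) • N.smul (by omega : i - n b + (n b + q) = k) a (w b) :=
    fun i k hik b a => by
      simp only [V, AddMonoidHom.coprod_apply, map_zero, zero_add]
      exact DirectSum.toAddMonoid_of _ _ _
  have hV : ∀ i k hik x, (V i k hik) ((E i).symm (j.app i x)) = hev hik φ x := fun i k hik x => by
    rw [← hVj]
    congr 1
    rw [AddEquiv.symm_apply_eq]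
    exact (cellMap_inl j n e i x).symm
  have hV' : ∀ i k hik b p (hp : p + n b = i) a, (V i k hik) ((E i).symm (X'.smul hp a (e b))) =
      sgn (q * p) • N.smul (by omega : p + (n b + q) = k) a (w b) := fun i k hik b p hp a => by
    obtain rfl : p = i - n b := by omega
    rw [← hVe i k hik]
    congr 1
    rw [AddEquiv.symm_apply_eq]
    exact (cellMap_of j n e i b a).symm
  refine ⟨mkHom (fun i k hik => (V i k hik).comp (E i).symm.toAddMonoidHom) ?_, ?_, ?_⟩
  · intro p i k i' k' hik hik' hi hk a l
    change V i' k' hik' ((E i').symm (X'.smul hi a l)) = sgn (q * p) •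
      N.smul hk a (V i k hik ((E i).symm l))
    refine h.induction (P := fun l => V i' k' hik' ((E i').symm (X'.smul hi a l)) = sgn (q * p) •
      N.smul hk a (V i k hik ((E i).symm l))) l (fun x => ?_) (fun b r hr c => ?_)
      (fun x y hx hy => ?_)
    · rw [← j.map_smul, hV, hV, hev_smul φ hik hik' hi hk]
    · rw [hV', ← X'.mul_smul rfl (by omega) hr hi, hV', map_zsmul, smul_smul, ← sgn_add,
        N.mul_smul rfl (by omega) (by omega) hk, mul_add]
    · simp only [map_add, smul_add, hx, hy]
  · exact hV
  · intro b
    change V _ _ _ ((E _).symm (e b)) = w b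
    conv_lhs => rw [← X'.one_smul (zero_add _) (e b)]
    rw [hV', mul_zero, sgn_zero, _root_.one_smul, N.one_smul]

/-- DG homomorphisms extend to a cell extension, with prescribed values on the cells. -/
lemma CellExt.exists_desc (h : CellExt j n e) {N : DGMod A} (f : X ⟶ N)
    (z : ∀ b, X.X (n b + 1)) (hz : ∀ b, X'.d rfl (e b) = j.app _ (z b)) (w : ∀ b, N.X (n b))
    (hw : ∀ b, N.d rfl (w b) = f.app _ (z b)) :
    ∃ f' : X' ⟶ N, j ≫ f' = f ∧ ∀ b, f'.app _ (e b) = w b := by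
  obtain ⟨φ, hφ, hφ'⟩ := h.exists_extend (toHom f) (fun b => N.idx (add_zero (n b)).symm (w b))
  have he : ∀ b, hev (add_zero _) φ (e b) = w b := fun b => by
    rw [hev_idx_right rfl (add_zero _) (add_zero _), hφ', idx_idx, idx_rfl]
  have hd : (hom X' N).d rfl φ = 0 := by
    refine h.hom_ext (fun i k hik x => ?_) (fun b => ?_)
    · rw [d_hev rfl φ hik (add_zero i) (by omega) (by omega) (by omega : k + 0 = k), ← j.map_d,
        hφ, hφ]
      simp [sgn_zero, f.map_d]
    · rw [d_hev rfl φ rfl (add_zero _) (by omega) (by omega : n b + 1 = n b + (0 + 1)) (by omega),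
        he, hz, hφ (n b + 1) _ (by omega), hev_toHom', ← hw, idx_d]
      simp [sgn_zero]
  refine ⟨ofHom φ hd, hom_ext_app fun i x => ?_, fun b => ?_⟩
  · exact (hφ _ _ _ _).trans (hev_toHom _ _ _)
  · exact he b

end Cells

/-! ### Attaching cells -/

section Attach

variable {X X' X'' : DGMod A} {ι : Type u}

lemma CellExt.dg_hom_ext {j : X ⟶ X'} {n : ι → ℤ} {e : ∀ b, X'.X (n b)} (h : CellExt j n e)
    {N : DGMod A} {f g : X' ⟶ N} (hj : j ≫ f = j ≫ g) (he : ∀ b, f.app _ (e b) = g.app _ (e b)) :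
    f = g :=
  hom_ext_app fun i t => h.induction (P := fun t => f.app i t = g.app i t) t
    (fun x => by rw [← comp_app, hj, comp_app])
    (fun b p hp a => by rw [f.map_smul, g.map_smul, he])
    (fun x y hx hy => by rw [map_add, map_add, hx, hy])

lemma comp_cellMap {j : X ⟶ X'} {n : ι → ℤ} {e : ∀ b, X'.X (n b)} (f : X' ⟶ X'') {k : ℤ} (t) :
    f.app k (cellMap j n e k t) = cellMap (j ≫ f) n (fun b => f.app _ (e b)) k t := by
  refine cellMap_induction (P := fun t => f.app k (cellMap j n e k t) =
    cellMap (j ≫ f) n (fun b => f.app _ (e b)) k t) t (fun x => ?_) (fun b a => ?_)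
    (fun x y hx hy => ?_)
  · rw [cellMap_inl, cellMap_inl, comp_app]
  · rw [cellMap_of, cellMap_of, f.map_smul]
  · rw [map_add, map_add, hx, hy, map_add]

/-- Two extensions by cells with the same attaching cocycles are isomorphic. -/
lemma CellExt.exists_iso {j : X ⟶ X'} {j' : X ⟶ X''} {n : ι → ℤ} {e : ∀ b, X'.X (n b)}
    {e' : ∀ b, X''.X (n b)} (h : CellExt j n e) (h' : CellExt j' n e')
    (z : ∀ b, X.X (n b + 1)) (hz : ∀ b, X'.d rfl (e b) = j.app _ (z b))
    (hz' : ∀ b, X''.d rfl (e' b) = j'.app _ (z b)) :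
    ∃ i : X' ≅ X'', j ≫ i.hom = j' ∧ ∀ b, i.hom.app _ (e b) = e' b := by
  obtain ⟨f, hf, hfe⟩ := h.exists_desc j' z hz e' hz'
  refine ⟨isoOfBijective f fun k => ?_, hf, hfe⟩
  have key : f.app k ∘ cellMap j n e k = cellMap j' n e' k := funext fun t => by
    rw [Function.comp_apply, comp_cellMap]
    subst hf
    obtain rfl : (fun b => f.app _ (e b)) = e' := funext hfe
    rfl
  have := h'.bij k
  rw [← key] at this
  exact (Function.Bijective.of_comp_iff _ (h.bij k)).1 this

lemma CellExt.of_iso {j : X ⟶ X'} {n : ι → ℤ} {e : ∀ b, X'.X (n b)} (h : CellExt j n e)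
    (i : X' ≅ X'') : CellExt (j ≫ i.hom) n (fun b => i.hom.app _ (e b)) where
  bij k := by
    have key : cellMap (j ≫ i.hom) n (fun b => i.hom.app _ (e b)) k =
      (i.hom.app k) ∘ cellMap j n e k := funext fun t => (comp_cellMap _ t).symm
    rw [key]
    refine Function.Bijective.comp ?_ (h.bij k)
    refine Function.bijective_iff_has_inverse.2 ⟨i.inv.app k, fun x => ?_, fun x => ?_⟩
    · rw [← comp_app, i.hom_inv_id, id_app]
    · rw [← comp_app, i.inv_hom_id, id_app]
  d_mem b := by
    obtain ⟨z, hz⟩ := h.d_mem b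
    exact ⟨z, by rw [← i.hom.map_d, hz, comp_app]⟩

variable (X) (n : ι → ℤ) (z : ∀ b, X.X (n b + 1)) (hz : ∀ b, X.d rfl (z b) = 0)

/-- The attaching map given by a family of cocycles. -/
noncomputable def attachMap : directSum (fun b => A.self.shift (-n b - 1)) ⟶ X :=
  dsDesc (fun b => fromShift (k := n b + 1) (by omega) (z b) (hz b))

lemma attachMap_incl (b : ι) {i : ℤ} (x : (A.self.shift (-n b - 1)).X i) :
    (attachMap X n z hz).app i ((dsIncl _ b).app i x) =
      (fromShift (k := n b + 1) (by omega) (z b) (hz b)).app i x := dsDesc_incl _ _ _ _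

/-- The DG module obtained by attaching cells along a family of cocycles. -/
noncomputable abbrev attach : DGMod A := cone (attachMap X n z hz)

/-- The inclusion of a DG module into the result of attaching cells. -/
noncomputable abbrev attachInl : X ⟶ attach X n z hz := coneInl _

/-- The cells. -/
noncomputable def attachCell (b : ι) : (attach X n z hz).X (n b) :=
  coneMk _ rfl 0 ((dsIncl (fun b => A.self.shift (-n b - 1)) b).app (n b + 1)
    (toCell (by omega : -n b - 1 + (n b + 1) = 0) A.one))

lemma d_attachCell (b : ι) : (attach X n z hz).d rfl (attachCell X n z hz b) =
    (attachInl X n z hz).app _ (z b) := by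
  refine cone_ext rfl ?_ ?_
  · refine (coneFst_d _ rfl _).trans ?_
    simp only [attachCell, coneFst_mk, coneSnd_mk, map_zero, zero_add]
    rw [attachMap_incl, fromShift_app _ _ _ (by omega : -n b - 1 + (n b + 1) = 0) (by omega), mul_zero, sgn_zero,
      ofCell_toCell, _root_.one_smul, X.one_smul]
    rfl
  · refine (coneSnd_d _ rfl rfl _).trans ?_
    simp only [attachCell, coneSnd_mk, attachInl, coneSnd_inl]
    rw [← Hom.map_d, neg_eq_zero]
    refine (congrArg _ ?_).trans (map_zero _)
    apply ofShift_injective (M := A.self) (rfl : -n b - 1 + (n b + 1 + 1) = -n b - 1 + (n b + 1 + 1))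
    change ofCell _ _ = _
    rw [ofCell_d rfl (by omega : -n b - 1 + (n b + 1) = 0) _ (by omega), ofCell_toCell,
      A.d_degreeZero, smul_zero, map_zero]
    rfl

lemma mul_one' {p : ℤ} (h : p + 0 = p) (a : A.X p) : A.mul h a A.one = a := by
  rw [A.comm (zero_add p) h A.one a, A.one_mul, zero_mul, sgn_zero, _root_.one_smul]

lemma smul_attachCell {b : ι} {p k : ℤ} (h : p + n b = k) (a : A.X p) :
    (attach X n z hz).smul h a (attachCell X n z hz b) =
      coneMk _ rfl 0 ((dsIncl (fun b => A.self.shift (-n b - 1)) b).app (k + 1)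
        (sgn (p + p * (-n b - 1)) • toCell (by omega : -n b - 1 + (k + 1) = p) a)) := by
  refine cone_ext rfl ?_ ?_
  · refine (coneFst_smul _ h a _).trans ?_
    simp [attachCell]
  · refine (coneSnd_smul _ h rfl rfl (by omega) a _).trans ?_
    simp only [attachCell, coneSnd_mk, map_zsmul]
    rw [sgn_add, ← smul_smul, ← map_zsmul ((dsIncl _ b).app (k + 1)), ← Hom.map_smul]
    congr 2
    apply ofShift_injective (M := A.self) (by omega : -n b - 1 + (k + 1) = p)
    change ofCell _ _ = ofCell _ _
    rw [ofCell_smul (by omega) (by omega : -n b - 1 + (n b + 1) = 0) _ (by omega), ofCell_toCell,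
      map_zsmul, ofCell_toCell, mul_one']

lemma attach_cellExt : CellExt (attachInl X n z hz) n (attachCell X n z hz) where
  d_mem b := ⟨z b, d_attachCell X n z hz b⟩
  bij k := by
    have h1 : ∀ t, coneFst _ (cellMap (attachInl X n z hz) n (attachCell X n z hz) k t) = t.1 := by
      intro t
      refine cellMap_induction (P := fun t => coneFst (attachMap X n z hz)
        (cellMap (attachInl X n z hz) n (attachCell X n z hz) k t) = t.1) t (fun x => ?_)
        (fun b a => ?_) (fun x y hx hy => ?_)
      · rw [cellMap_inl]; rfl
      · rw [cellMap_of, smul_attachCell, coneFst_mk]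
      · rw [map_add, map_add, hx, hy]; rfl
    have h2 : ∀ t b, (dsProj _ b).app (k + 1) (coneSnd _ rfl
        (cellMap (attachInl X n z hz) n (attachCell X n z hz) k t)) =
          sgn (k - n b + (k - n b) * (-n b - 1)) •
            toCell (by omega : -n b - 1 + (k + 1) = k - n b) (t.2 b) := by
      intro t c
      refine cellMap_induction (P := fun t => (dsProj _ c).app (k + 1)
        (coneSnd (attachMap X n z hz) rfl
        (cellMap (attachInl X n z hz) n (attachCell X n z hz) k t)) =
          sgn (k - n c + (k - n c) * (-n c - 1)) •
            toCell (by omega : -n c - 1 + (k + 1) = k - n c) (t.2 c)) t (fun x => ?_)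
        (fun b a => ?_) (fun x y hx hy => ?_)
      · rw [cellMap_inl]
        simp [attachInl]
      · rw [cellMap_of, smul_attachCell, coneSnd_mk]
        by_cases hbc : b = c
        · subst hbc
          simp
        · rw [dsProj_incl_ne hbc]
          simp [DirectSum.of_eq_of_ne _ _ _ (Ne.symm hbc)]
      · simp only [map_add, hx, hy, Prod.snd_add, DirectSum.add_apply, smul_add]
    constructor
    · rw [injective_iff_map_eq_zero]
      intro t ht
      refine Prod.ext ?_ (DFinsupp.ext fun b => ?_)
      · rw [← h1 t, ht, map_zero]; rfl
      · have := h2 t b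
        rw [ht, map_zero, map_zero] at this
        have h3 := congrArg (fun v => sgn (k - n b + (k - n b) * (-n b - 1)) •
          ofCell (by omega : -n b - 1 + (k + 1) = k - n b) v) this.symm
        simpa [smul_smul, sgn_mul_self] using h3
    · intro v
      have key : ∀ y, ∃ c, coneSnd (attachMap X n z hz) rfl (cellMap (attachInl X n z hz) n
          (attachCell X n z hz) k (0, c)) = y := by
        intro y
        refine directSum_induction (P := fun y => ∃ c, coneSnd (attachMap X n z hz) rfl
          (cellMap (attachInl X n z hz) n (attachCell X n z hz) k (0, c)) = y) y ⟨0, ?_⟩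
          (fun b y => ?_) ?_
        · rw [Prod.mk_zero_zero, map_zero, map_zero]
        · classical
          refine ⟨DirectSum.of (fun b => A.X (k - n b)) b
            (sgn (k - n b + (k - n b) * (-n b - 1)) •
              ofCell (by omega : -n b - 1 + (k + 1) = k - n b) y), ?_⟩
          rw [cellMap_of, smul_attachCell, coneSnd_mk, map_zsmul, map_zsmul, map_zsmul, smul_smul,
            sgn_mul_self,
            _root_.one_smul, toCell_ofCell]
        · rintro x y ⟨c, rfl⟩ ⟨c', rfl⟩
          refine ⟨c + c', ?_⟩
          rw [← map_add, ← map_add, Prod.mk_add_mk, add_zero]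
      obtain ⟨c, hc⟩ := key (coneSnd _ rfl v)
      refine ⟨(coneFst _ v, c), cone_ext rfl (h1 _) ?_⟩
      rw [← hc]
      have : ((coneFst _ v, c) : X.X k × _) = (coneFst _ v, 0) + (0, c) := by simp
      rw [this, map_add, map_add, cellMap_inl]
      simp [attachInl]

end Attach

/-! ### Cofibrant DG modules -/

section Cofib

/-- The relative lifting property against surjective quasi-isomorphisms. -/
def HasLift {X X' : DGMod A} (j : X ⟶ X') : Prop :=
  ∀ {M N : DGMod A} (p : M ⟶ N), quasiIso A p → (∀ i, Function.Surjective (p.app i)) →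
    ∀ (g : X ⟶ M) (f : X' ⟶ N), g ≫ p = j ≫ f → ∃ g' : X' ⟶ M, j ≫ g' = g ∧ g' ≫ p = f

/-- The lifting property against surjective quasi-isomorphisms. -/
def Cofib (X : DGMod A) : Prop :=
  ∀ {M N : DGMod A} (p : M ⟶ N), quasiIso A p → (∀ i, Function.Surjective (p.app i)) →
    ∀ (f : X ⟶ N), ∃ g : X ⟶ M, g ≫ p = f

lemma CellExt.hasLift {X X' : DGMod A} {ι : Type u} {j : X ⟶ X'} {n : ι → ℤ}
    {e : ∀ b, X'.X (n b)} (h : CellExt j n e) : HasLift j := by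
  intro M N p hp hs g f hgf
  choose z hz using h.d_mem
  have key : ∀ b, ∃ w, M.d rfl w = g.app _ (z b) ∧ p.app (n b) w = f.app _ (e b) := fun b => by
    have hj : j.app _ (X.d rfl (z b)) = 0 := by rw [j.map_d, ← hz, X'.d_d]
    refine exists_lift_of_quasiIso hp hs rfl rfl (g.app _ (z b)) ?_ _ ?_
    · rw [← g.map_d, h.injective _ (hj.trans (map_zero _).symm), map_zero]
    · rw [← f.map_d, hz, ← comp_app, ← hgf, comp_app]
  choose w hw hw' using key
  obtain ⟨g', hg', he⟩ := h.exists_desc g z hz w hw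
  refine ⟨g', hg', h.dg_hom_ext ?_ fun b => ?_⟩
  · rw [← Category.assoc, hg', hgf]
  · rw [comp_app, he, hw']

lemma HasLift.cofib {X X' : DGMod A} {j : X ⟶ X'} (hj : HasLift j) (hX : Cofib X) : Cofib X' := by
  intro M N p hp hs f
  obtain ⟨g, hg⟩ := hX p hp hs (j ≫ f)
  obtain ⟨g', -, h⟩ := hj p hp hs g f hg
  exact ⟨g', h⟩

/-- A graded homomorphism to a shift. -/
def homToShift {L N : DGMod A} {q i k : ℤ} (h : q + i = k) :
    (hom L N).X k →+ (hom L (N.shift q)).X i :=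
  AddMonoidHom.mk' (fun φ => mkHom (fun a b hab => (toShift rfl).comp (hev (by omega) φ)) (by
      intro p a b a' b' hab hab' ha hb c l
      apply ofShift_injective (rfl : q + b' = q + b')
      simp only [AddMonoidHom.comp_apply, ofShift_toShift, map_zsmul]
      rw [ofShift_smul hb rfl rfl (by omega), ofShift_toShift, hev_smul φ (by omega : a + k = q + b) _ ha
        (by omega : p + (q + b) = q + b'), smul_smul, ← sgn_add]
      congr 2; subst h; ring)) (fun φ ψ => by
    apply hom_ext; intro a b hab l; simp)

/-- The graded homomorphism underlying a homomorphism to a shift. -/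
def homOfShift {L N : DGMod A} {q i k : ℤ} (h : q + i = k) :
    (hom L (N.shift q)).X i →+ (hom L N).X k :=
  AddMonoidHom.mk' (fun φ => mkHom (fun a b hab => (ofShift (by omega)).comp (hev rfl φ)) (by
      intro p a b a' b' hab hab' ha hb c l
      simp only [AddMonoidHom.comp_apply]
      rw [hev_smul φ rfl _ ha (by omega), map_zsmul, ofShift_smul _ (by omega) _ hb, smul_smul,
        ← sgn_add]
      congr 2; subst h; ring)) (fun φ ψ => by
    apply hom_ext; intro a b hab l; simp)

lemma hev_homToShift {L N : DGMod A} {q i k a b c : ℤ} (h : q + i = k) (φ : (hom L N).X k)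
    (hab : a + i = b) (hbc : q + b = c) (hac : a + k = c) (x : L.X a) :
    ofShift hbc (hev hab (homToShift h φ) x) = hev hac φ x := by
  subst hbc; exact ofShift_toShift rfl _

lemma hev_homOfShift {L N : DGMod A} {q i k a b c : ℤ} (h : q + i = k)
    (φ : (hom L (N.shift q)).X i) (hab : a + i = b) (hbc : q + b = c) (hac : a + k = c)
    (x : L.X a) : hev hac (homOfShift h φ) x = ofShift hbc (hev hab φ x) := by
  subst hab; rfl

@[simp] lemma homOfShift_toShift {L N : DGMod A} {q i k : ℤ} (h : q + i = k) (φ : (hom L N).X k) :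
    homOfShift h (homToShift h φ) = φ := by
  apply hom_ext; intro a b hab x
  rw [hev_homOfShift h _ rfl (by omega), hev_homToShift h φ]

@[simp] lemma homToShift_ofShift {L N : DGMod A} {q i k : ℤ} (h : q + i = k)
    (φ : (hom L (N.shift q)).X i) : homToShift h (homOfShift h φ) = φ := by
  apply hom_ext; intro a b hab x
  apply ofShift_injective rfl
  rw [hev_homToShift h _ hab rfl (by omega), hev_homOfShift h _ hab]

lemma d_homToShift {L N : DGMod A} {q i k i' k' : ℤ} (h : q + i = k) (hi : i + 1 = i')
    (hk : k + 1 = k') (h' : q + i' = k') (φ : (hom L N).X k) :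
    (hom L (N.shift q)).d hi (homToShift h φ) = sgn q • homToShift h' ((hom L N).d hk φ) := by
  apply hom_ext; intro a b hab x
  apply ofShift_injective rfl
  rw [map_zsmul, AddMonoidHom.smul_apply, map_zsmul, hev_homToShift h' _ hab rfl (by omega),
    d_hev hi _ hab rfl (by omega) rfl (by omega), map_sub, map_zsmul,
    ofShift_d (by omega) rfl rfl (by omega), hev_homToShift h φ rfl rfl (by omega),
    hev_homToShift h φ _ rfl (by omega), d_hev hk φ (by omega) (by omega : a + k = q + (a + i))
      (by omega) rfl (by omega), smul_sub, smul_smul, ← sgn_add]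
  rw [sgn_congr (m := i) (n := q + k) ⟨-q, by subst h; ring⟩]

lemma d_homOfShift {L N : DGMod A} {q i k i' k' : ℤ} (h : q + i = k) (hi : i + 1 = i')
    (hk : k + 1 = k') (h' : q + i' = k') (φ : (hom L (N.shift q)).X i) :
    (hom L N).d hk (homOfShift h φ) = sgn q • homOfShift h' ((hom L (N.shift q)).d hi φ) := by
  conv_rhs => rw [← homToShift_ofShift h φ, d_homToShift h hi hk h', map_zsmul,
    homOfShift_toShift, smul_smul, sgn_mul_self, _root_.one_smul]

lemma zsmul_sgn_eq_zero {G : Type*} [AddCommGroup G] {q : ℤ} {x : G} : sgn q • x = 0 ↔ x = 0 :=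
  ⟨fun h => by rw [← _root_.one_smul ℤ x, ← sgn_mul_self q, ← smul_smul, h, smul_zero],
    fun h => by rw [h, smul_zero]⟩

lemma Acyclic.shift {N : DGMod A} (hN : N.Acyclic) (q : ℤ) : (N.shift q).Acyclic := by
  refine acyclic_of _ fun i j k h h' z hz => ?_
  have h0 := ofShift_d h' (rfl : q + j = q + j) (rfl : q + k = q + k) (by omega) z
  rw [hz, map_zero] at h0
  have h1 := zsmul_sgn_eq_zero.1 h0.symm
  obtain ⟨y, hy⟩ := hN.exists (by omega : q + i + 1 = q + j) (by omega : q + j + 1 = q + k) _ h1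
  refine ⟨sgn q • toShift rfl y, ofShift_injective rfl ?_⟩
  rw [ofShift_d h rfl rfl (by omega), map_zsmul, ofShift_toShift, map_zsmul, smul_smul,
    sgn_mul_self, _root_.one_smul, hy]

/-- K-projectivity can be tested on homomorphisms of degree `0`. -/
lemma isKProjective_of {L : DGMod A} (hL : ∀ N : DGMod A, N.Acyclic → ∀ f : L ⟶ N, Null f) :
    L.IsKProjective := by
  intro N hN
  refine acyclic_of _ fun i j k h h' φ hφ => ?_
  obtain ⟨ψ, hψ⟩ := hL _ (hN.shift j) (ofHom (homToShift (add_zero j) φ) (by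
    rw [d_homToShift (add_zero j) rfl h' (by omega), hφ, map_zero, smul_zero]))
  rw [toHom_ofHom] at hψ
  refine ⟨sgn j • homOfShift (by omega) ψ, ?_⟩
  rw [map_zsmul, d_homOfShift (by omega) (by norm_num) h (add_zero j), hψ, homOfShift_toShift,
    smul_smul, sgn_mul_self, _root_.one_smul]

/-- The projection to `N` of the cone of the identity of `N[-1]`. -/
def pathMap (N : DGMod A) : cone (𝟙 (N.shift (-1))) ⟶ N where
  app i := (ofShift (by omega)).comp (coneSnd (𝟙 (N.shift (-1))) (rfl : i + 1 = i + 1))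
  map_smul {p j k} h a x := by
    simp only [AddMonoidHom.comp_apply]
    rw [coneSnd_smul _ h rfl rfl (by omega), map_zsmul, ofShift_smul _ (by omega) _ h, smul_smul,
      ← sgn_add, sgn_even ⟨0, by ring⟩, _root_.one_smul]
  map_d {i j} h x := by
    subst h
    simp only [AddMonoidHom.comp_apply]
    rw [coneSnd_d _ rfl rfl, map_neg, ofShift_d _ (by omega : -1 + (i + 1) = i) _ rfl,
      sgn_odd ⟨-1, by norm_num⟩, neg_smul, _root_.one_smul, neg_neg]

lemma Cofib.isKProjective {L : DGMod A} (hL : Cofib L) : L.IsKProjective := by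
  refine isKProjective_of fun N hN f => ?_
  obtain ⟨g, hg⟩ := hL (pathMap N) (quasiIso_of_acyclic _ (acyclic_cone_id _) hN) (fun i y =>
    ⟨coneMk _ rfl 0 (toShift (by omega) y), by simp [pathMap]⟩) f
  refine ⟨mkHom (fun i j h => (ofShift (by omega)).comp ((coneFst _).comp (g.app i))) ?_, ?_⟩
  · intro p i j i' j' h h' hi hj a x
    simp only [AddMonoidHom.comp_apply]
    rw [g.map_smul, coneFst_smul, ofShift_smul _ (by omega : -1 + i = j) _ hj]
    congr 2; ring
  · apply hom_ext; intro i j hij x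
    obtain rfl : i = j := by omega
    rw [d_hev _ _ hij (rfl : i + -1 = i + -1) (by omega) rfl (by omega), hev_mkHom, hev_mkHom,
      hev_toHom]
    simp only [AddMonoidHom.comp_apply]
    rw [g.map_d, coneFst_d, map_add, id_app, ofShift_d _ (by omega : -1 + i = i + -1) _ (by omega),
      sgn_odd ⟨-1, by norm_num⟩, ← hg, comp_app]
    simp [pathMap]

end Cofib

/-! ### Sequential colimits -/

section Colim

variable (F : ℕ ⥤ DGMod A)

/-- The transition maps of a sequence of DG modules. -/
def trans {i j : ℕ} (h : i ≤ j) : F.obj i ⟶ F.obj j := F.map (homOfLE h)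

@[simp] lemma trans_rfl (i : ℕ) (k : ℤ) (x : (F.obj i).X k) : (trans F le_rfl).app k x = x := by
  have : trans F (le_refl i) = 𝟙 _ := F.map_id i
  rw [this, id_app]

lemma trans_comp {i j l : ℕ} (h : i ≤ j) (h' : j ≤ l) : trans F h ≫ trans F h' =
    trans F (h.trans h') := (F.map_comp _ _).symm

lemma trans_trans {i j l : ℕ} (h : i ≤ j) (h' : j ≤ l) (k : ℤ) (x : (F.obj i).X k) :
    (trans F h').app k ((trans F h).app k x) = (trans F (h.trans h')).app k x := by
  rw [← comp_app, trans_comp]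

/-- The components of the colimit of a sequence of DG modules. -/
abbrev SeqX (k : ℤ) : Type u :=
  AddCommGroup.DirectLimit (fun n => (F.obj n).X k) (fun i j h => (trans F h).app k)

/-- The canonical maps to the colimit. -/
noncomputable def seqOf (n : ℕ) (k : ℤ) : (F.obj n).X k →+ SeqX F k :=
  AddCommGroup.DirectLimit.of (fun n => (F.obj n).X k) (fun i j h => (trans F h).app k) n

lemma seqOf_trans {i j : ℕ} (h : i ≤ j) (k : ℤ) (x : (F.obj i).X k) :
    seqOf F j k ((trans F h).app k x) = seqOf F i k x :=
  AddCommGroup.DirectLimit.of_f (G := fun n => (F.obj n).X k)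
    (f := fun i j h => (trans F h).app k) h x

lemma SeqX.exists {k : ℤ} (t : SeqX F k) : ∃ n x, seqOf F n k x = t :=
  AddCommGroup.DirectLimit.induction_on (C := fun t => ∃ n x, seqOf F n k x = t) t
    fun n x => ⟨n, x, rfl⟩

/-- The map from the colimit with given components. -/
noncomputable def seqLift {k : ℤ} {G : Type*} [AddCommGroup G] (g : ∀ n, (F.obj n).X k →+ G)
    (hg : ∀ i j h x, g j ((trans F h).app k x) = g i x) : SeqX F k →+ G :=
  AddCommGroup.DirectLimit.lift (fun n => (F.obj n).X k) (fun i j h => (trans F h).app k) G g hg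

@[simp] lemma seqLift_of {k : ℤ} {G : Type*} [AddCommGroup G] (g : ∀ n, (F.obj n).X k →+ G) (hg)
    (n : ℕ) (x) : seqLift F g hg (seqOf F n k x) = g n x :=
  AddCommGroup.DirectLimit.lift_of (G := fun n => (F.obj n).X k)
    (f := fun i j h => (trans F h).app k) G g hg n x

lemma seq_hom_ext {k : ℤ} {G : Type*} [AddCommGroup G] {f g : SeqX F k →+ G}
    (h : ∀ n x, f (seqOf F n k x) = g (seqOf F n k x)) : f = g :=
  AddMonoidHom.ext fun t => by obtain ⟨n, x, rfl⟩ := SeqX.exists F t; exact h n x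

lemma seqOf_eq_zero {n : ℕ} {k : ℤ} {x : (F.obj n).X k} (hx : seqOf F n k x = 0) :
    ∃ (m : ℕ) (h : n ≤ m), (trans F h).app k x = 0 := by
  have : DirectedSystem (fun n => (F.obj n).X k) (fun i j h => (trans F h).app k) :=
    ⟨fun i x => trans_rfl F i k x, fun i j l h h' x => trans_trans F h h' k x⟩
  exact AddCommGroup.DirectLimit.of.zero_exact (G := fun n => (F.obj n).X k)
    (f := fun i j h => (trans F h).app k) n x hx

/-- The colimit of a sequence of DG modules. -/
noncomputable def seqColim : DGMod A where
  X := SeqX F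
  smul {p k l} h := AddMonoidHom.mk' (fun a => seqLift F
    (fun n => (seqOf F n l).comp ((F.obj n).smul h a)) (fun i j hij x => by
      simp only [AddMonoidHom.comp_apply]
      rw [← Hom.map_smul, seqOf_trans])) (fun a b => seq_hom_ext F fun n x => by simp)
  d {k l} h := seqLift F (fun n => (seqOf F n l).comp ((F.obj n).d h)) (fun i j hij x => by
      simp only [AddMonoidHom.comp_apply]
      rw [← Hom.map_d, seqOf_trans])
  one_smul h m := by
    obtain ⟨n, x, rfl⟩ := SeqX.exists F m
    simp [DGMod.one_smul]
  mul_smul h₁ h₂ h₃ h₄ a b m := by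
    obtain ⟨n, x, rfl⟩ := SeqX.exists F m
    simp [(F.obj n).mul_smul h₁ h₂ h₃ h₄]
  d_d h h' m := by
    obtain ⟨n, x, rfl⟩ := SeqX.exists F m
    simp [DGMod.d_d]
  leibniz h hi hj hk h₁ h₂ a m := by
    obtain ⟨n, x, rfl⟩ := SeqX.exists F m
    simp [(F.obj n).leibniz h hi hj hk h₁ h₂]

/-- The canonical homomorphisms to the colimit. -/
noncomputable def seqIncl (n : ℕ) : F.obj n ⟶ seqColim F where
  app k := seqOf F n k
  map_smul {p k l} h a x := (seqLift_of F (fun n => (seqOf F n l).comp ((F.obj n).smul h a)) _ n x).symm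
  map_d {k l} h x := (seqLift_of F (fun n => (seqOf F n l).comp ((F.obj n).d h)) _ n x).symm

lemma trans_incl {i j : ℕ} (h : i ≤ j) : trans F h ≫ seqIncl F j = seqIncl F i :=
  hom_ext_app fun k x => seqOf_trans F h k x

lemma seqIncl_trans {i j : ℕ} (h : i ≤ j) (k : ℤ) (x : (F.obj i).X k) :
    (seqIncl F j).app k ((trans F h).app k x) = (seqIncl F i).app k x := seqOf_trans F h k x

lemma exists_seqIncl {k : ℤ} (t : (seqColim F).X k) : ∃ n x, (seqIncl F n).app k x = t :=
  SeqX.exists F t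

lemma seqIncl_eq_zero {n : ℕ} {k : ℤ} {x : (F.obj n).X k} (hx : (seqIncl F n).app k x = 0) :
    ∃ (m : ℕ) (h : n ≤ m), (trans F h).app k x = 0 := seqOf_eq_zero F hx

lemma exists_seqDesc {N : DGMod A} (f : ∀ n, F.obj n ⟶ N)
    (hf : ∀ n, trans F n.le_succ ≫ f (n + 1) = f n) :
    ∃ g : seqColim F ⟶ N, ∀ n, seqIncl F n ≫ g = f n := by
  have hf' : ∀ i j (h : i ≤ j), trans F h ≫ f j = f i := by
    intro i j h
    induction j, h using Nat.le_induction with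
    | base =>
      have : trans F (le_refl i) = 𝟙 _ := F.map_id i
      rw [this, Category.id_comp]
    | succ j h ih => rw [← trans_comp F h j.le_succ, Category.assoc, hf, ih]
  have hc : ∀ k i j (h : i ≤ j) x, (f j).app k ((trans F h).app k x) = (f i).app k x :=
    fun k i j h x => by rw [← comp_app, hf']
  have hl : ∀ k n x, seqLift F (fun n => (f n).app k) (hc k) (seqOf F n k x) = (f n).app k x :=
    fun k n x => seqLift_of F _ _ n x
  refine ⟨{ app := fun k => seqLift F (fun n => (f n).app k) (hc k),
            map_smul := ?_, map_d := ?_ }, ?_⟩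
  · intro p k l h a t
    obtain ⟨n, x, rfl⟩ := exists_seqIncl F t
    rw [← (seqIncl F n).map_smul]
    exact (hl _ _ _).trans (((f n).map_smul h a x).trans (congrArg _ (hl _ _ _).symm))
  · intro k l h t
    obtain ⟨n, x, rfl⟩ := exists_seqIncl F t
    rw [← (seqIncl F n).map_d]
    exact (hl _ _ _).trans (((f n).map_d h x).trans (congrArg _ (hl _ _ _).symm))
  · intro n
    exact hom_ext_app fun k x => hl _ _ _

lemma seqColim_hom_ext {N : DGMod A} {f g : seqColim F ⟶ N}
    (h : ∀ n, seqIncl F n ≫ f = seqIncl F n ≫ g) : f = g :=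
  hom_ext_app fun k t => by
    obtain ⟨n, x, rfl⟩ := exists_seqIncl F t
    rw [← comp_app, h, comp_app]

lemma cofib_seqColim (h0 : Cofib (F.obj 0)) (hs : ∀ n : ℕ, HasLift (trans F n.le_succ)) :
    Cofib (seqColim F) := by
  intro M N p hp hsurj f
  have step : ∀ n (g : {g : F.obj n ⟶ M // g ≫ p = seqIncl F n ≫ f}),
      ∃ g' : {g : F.obj (n + 1) ⟶ M // g ≫ p = seqIncl F (n + 1) ≫ f},
        trans F n.le_succ ≫ g'.1 = g.1 := by
    intro n g
    obtain ⟨g', h, h'⟩ := hs n p hp hsurj g.1 (seqIncl F (n + 1) ≫ f)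
      (by rw [g.2, ← Category.assoc, trans_incl])
    exact ⟨⟨g', h'⟩, h⟩
  choose nxt hnxt using step
  obtain ⟨g0, hg0⟩ := h0 p hp hsurj (seqIncl F 0 ≫ f)
  let g : ∀ n, {g : F.obj n ⟶ M // g ≫ p = seqIncl F n ≫ f} := fun n =>
    Nat.rec ⟨g0, hg0⟩ (fun n g => nxt n g) n
  obtain ⟨G, hG⟩ := exists_seqDesc F (fun n => (g n).1) (fun n => hnxt n (g n))
  exact ⟨G, seqColim_hom_ext F fun n => by rw [← Category.assoc, hG, (g n).2]⟩

end Colim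

/-! ### Resolutions -/

section Resolution

variable (A) in
/-- The zero DG module. -/
def zeroMod : DGMod A where
  X _ := PUnit
  smul _ := 0
  d _ := 0
  one_smul _ _ := rfl
  mul_smul _ _ _ _ _ _ _ := rfl
  d_d _ _ _ := rfl
  leibniz _ _ _ _ _ _ _ _ := rfl

/-- A DG module all of whose components are trivial. -/
def IsTrivial (M : DGMod A) : Prop := ∀ i (x : M.X i), x = 0

lemma isTrivial_zeroMod : (zeroMod A).IsTrivial := fun _ _ => rfl

lemma IsTrivial.cofib {X : DGMod A} (hX : X.IsTrivial) : Cofib X := by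
  intro M N p hp hs f
  refine ⟨0, hom_ext_app fun i x => ?_⟩
  rw [hX i x, map_zero, map_zero]

/-- The sequence is obtained from `0` by successively attaching cells. -/
structure IsCellTower (F : ℕ ⥤ DGMod A) : Prop where
  zero : (F.obj 0).IsTrivial
  step : ∀ n : ℕ, ∃ (ι : Type u) (m : ι → ℤ) (e : ∀ b, (F.obj (n + 1)).X (m b)),
    CellExt (trans F n.le_succ) m e

lemma IsCellTower.cofib {F : ℕ ⥤ DGMod A} (hF : IsCellTower F) : Cofib (seqColim F) :=
  cofib_seqColim F hF.zero.cofib fun n => by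
    obtain ⟨ι, m, e, h⟩ := hF.step n
    exact h.hasLift

variable (P : DGMod A)

/-- The cocycles of the cone of a homomorphism. -/
def ConeCocycle {X : DGMod A} (g : X ⟶ P) : Type u :=
  Σ i : ℤ, {c : (cone g).X i // (cone g).d rfl c = 0}

lemma ConeCocycle.d_snd {X : DGMod A} {g : X ⟶ P} (b : ConeCocycle P g) :
    X.d rfl (coneSnd g rfl b.2.1) = 0 :=
  ((cone_d_eq_zero_iff g rfl rfl _).1 b.2.2).2

/-- The next step of the construction of a resolution. -/
lemma exists_step {X : DGMod A} (g : X ⟶ P) :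
    ∃ g' : attach X _ _ (ConeCocycle.d_snd P (g := g)) ⟶ P, attachInl X _ _ _ ≫ g' = g ∧
      ∀ b, g'.app _ (attachCell X _ _ _ b) = -coneFst g b.2.1 := by
  refine (attach_cellExt X _ _ (ConeCocycle.d_snd P (g := g))).exists_desc g _
    (d_attachCell X _ _ _) _ fun b => ?_
  have := ((cone_d_eq_zero_iff g rfl rfl _).1 b.2.2).1
  rw [map_neg]
  exact neg_eq_of_add_eq_zero_right this

/-- The next stage of the construction of a resolution. -/
noncomputable def nextStage (s : Σ X : DGMod A, X ⟶ P) : Σ X : DGMod A, X ⟶ P :=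
  ⟨_, (exists_step P s.2).choose⟩

/-- The stages of the construction of a resolution. -/
noncomputable def stage (n : ℕ) : Σ X : DGMod A, X ⟶ P :=
  Nat.rec ⟨zeroMod A, 0⟩ (fun _ s => nextStage P s) n

/-- The tower of stages of a resolution. -/
noncomputable def stageTower : ℕ ⥤ DGMod A :=
  Functor.ofSequence (X := fun n => (stage P n).1) (fun n => attachInl (stage P n).1 _ _
    (ConeCocycle.d_snd P (g := (stage P n).2)))

lemma trans_stageTower (n : ℕ) : trans (stageTower P) n.le_succ = attachInl (stage P n).1 _ _
    (ConeCocycle.d_snd P (g := (stage P n).2)) :=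
  Functor.ofSequence_map_homOfLE_succ _ n

lemma isCellTower_stageTower : IsCellTower (stageTower P) where
  zero := isTrivial_zeroMod
  step n := ⟨_, _, _, by
    rw [trans_stageTower]
    exact attach_cellExt _ _ _ _⟩

lemma exists_stage_maps : ∃ (F : ℕ ⥤ DGMod A) (g : ∀ n, F.obj n ⟶ P), IsCellTower F ∧
    (∀ n : ℕ, trans F n.le_succ ≫ g (n + 1) = g n) ∧
    ∀ (n : ℕ) (i : ℤ) (y : P.X i) (x : (F.obj n).X (i + 1)), (F.obj n).d rfl x = 0 →
      P.d rfl y + (g n).app _ x = 0 → ∃ e : (F.obj (n + 1)).X i,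
        (F.obj (n + 1)).d rfl e = (trans F n.le_succ).app _ x ∧ (g (n + 1)).app _ e = -y := by
  refine ⟨stageTower P, fun n => (stage P n).2, isCellTower_stageTower P, fun n => ?_,
    fun n i y x hx hy => ?_⟩
  · rw [trans_stageTower]
    exact (exists_step P (stage P n).2).choose_spec.1
  · let b : ConeCocycle P (stage P n).2 := ⟨i, coneMk _ rfl y x,
      (cone_d_eq_zero_iff _ rfl rfl _).2 ⟨hy, hx⟩⟩
    refine ⟨attachCell _ _ _ (ConeCocycle.d_snd P (g := (stage P n).2)) b, ?_, ?_⟩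
    · rw [trans_stageTower]
      exact d_attachCell _ _ _ _ b
    · exact (exists_step P (stage P n).2).choose_spec.2 b

/-- Every DG module has a resolution by a cell tower. -/
lemma exists_cellTower : ∃ (F : ℕ ⥤ DGMod A) (g : seqColim F ⟶ P), IsCellTower F ∧
    quasiIso A g := by
  obtain ⟨F, gs, hF, hgs, hcell⟩ := exists_stage_maps P
  obtain ⟨g, hg'⟩ := exists_seqDesc F gs hgs
  have hgn : ∀ n k x, g.app k ((seqIncl F n).app k x) = (gs n).app k x := fun n k x => by
    rw [← hg' n]; rfl
  refine ⟨F, g, hF, quasiIso_of g (fun i j k h h' z hz => ?_)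
    (fun i j k h h' w y hw hy => ?_)⟩
  · subst h'
    obtain ⟨e, he, he'⟩ := hcell 0 j z 0 (map_zero _) (by rw [hz, map_zero, add_zero])
    refine ⟨-(seqIncl F 1).app j e, 0, ?_, ?_⟩
    · rw [map_neg, ← Hom.map_d, he, map_zero, map_zero, neg_zero]
    · rw [map_neg, hgn, he', map_zero, neg_neg, add_zero]
  · subst h h'
    obtain ⟨n, x, rfl⟩ := exists_seqIncl F w
    rw [← Hom.map_d] at hw
    obtain ⟨m, hnm, hm⟩ := seqIncl_eq_zero F hw
    rw [← seqIncl_trans F hnm] at hy ⊢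
    rw [Hom.map_d] at hm
    generalize (trans F hnm).app _ x = x' at hm hy ⊢
    rw [hgn] at hy
    obtain ⟨e, he, he'⟩ := hcell m i (-y) x' hm (by rw [map_neg, hy, neg_add_cancel])
    refine ⟨(seqIncl F (m + 1)).app i e, ?_⟩
    rw [← Hom.map_d, he, seqIncl_trans]

/-- Every DG module has a cofibrant resolution. -/
lemma exists_cofib_resolution : ∃ (L : DGMod A) (g : L ⟶ P), Cofib L ∧ quasiIso A g := by
  obtain ⟨F, g, hF, hg⟩ := exists_cellTower P
  exact ⟨_, g, hF.cofib, hg⟩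

end Resolution

/-! ### K-flatness of K-projective DG modules -/

section Flat

lemma exists_character_factor {G H : Type u} [AddCommGroup G] [AddCommGroup H] (v : G →+ H)
    (f : G →+ AddCircle (1 : ℚ)) (hf : ∀ x, v x = 0 → f x = 0) :
    ∃ g : H →+ AddCircle (1 : ℚ), ∀ x, g (v x) = f x := by
  let f' : (G ⧸ v.ker) →+ AddCircle (1 : ℚ) := QuotientAddGroup.lift _ f hf
  obtain ⟨g, hg⟩ := (Module.Baer.of_divisible (AddCircle (1 : ℚ))).extension_property_addMonoidHom
    (QuotientAddGroup.kerLift v) (QuotientAddGroup.kerLift_injective v) f'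
  exact ⟨g, fun x => DFunLike.congr_fun hg (QuotientAddGroup.mk x)⟩

/-- The Pontryagin dual of a DG module. -/
noncomputable def dual (N : DGMod A) : DGMod A where
  X i := N.X (-i) →+ AddCircle (1 : ℚ)
  smul {p i k} h := AddMonoidHom.mk' (fun a => AddMonoidHom.mk' (fun f =>
      sgn (p * i) • f.comp (N.smul (by omega : p + -k = -i) a))
    (fun f g => by ext x; simp)) (fun a b => by ext f x; simp)
  d {i k} h := AddMonoidHom.mk' (fun f => -(sgn i • f.comp (N.d (by omega : -k + 1 = -i))))
    (fun f g => by ext x; simp; abel)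
  one_smul h f := by ext x; simp [sgn_zero, N.one_smul]
  mul_smul {i j k ij jk l} h₁ h₂ h₃ h₄ a b f := by
    ext x
    simp only [AddMonoidHom.mk'_apply, AddMonoidHom.smul_apply, AddMonoidHom.comp_apply, smul_smul]
    rw [A.comm (by omega : j + i = ij) h₁ b a, map_zsmul, AddMonoidHom.smul_apply, map_zsmul,
      N.mul_smul (by omega) _ (by omega : i + -l = -jk) (by omega), smul_smul, ← sgn_add, ← sgn_add]
    congr 1
    apply sgn_congr; subst h₁ h₃; exact ⟨0, by ring⟩
  d_d h h' f := by ext x; simp [N.d_d]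
  leibniz {i j k i' j' k'} h hi hj hk h₁ h₂ a f := by
    ext x
    simp only [AddMonoidHom.mk'_apply, AddMonoidHom.smul_apply, AddMonoidHom.comp_apply, smul_smul,
      AddMonoidHom.neg_apply, AddMonoidHom.add_apply, smul_neg]
    rw [N.leibniz (by omega : i + -k' = -j') hi (by omega : -k' + 1 = -k) (by omega : -j' + 1 = -j)
      (by omega) (by omega) a x, map_add, map_zsmul, smul_add, smul_smul, ← sgn_add, ← sgn_add,
      ← sgn_add]
    have e1 : sgn (i + (i * j' + j)) = sgn (i' * j) := by
      apply sgn_congr; subst hj hi; exact ⟨i, by ring⟩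
    have e2 : sgn (i + (i * j' + j) + i) = sgn (k + i * j) := by
      apply sgn_congr; subst hj h; exact ⟨i, by ring⟩
    have key : ∀ (s t : ℤ) (X Y : AddCircle (1 : ℚ)),
        -((s * t) • Y) = s • X + (-(s • X) + -((s * t) • Y)) := fun s t X Y => by abel
    rw [← e1, ← e2, sgn_add _ i, neg_add, ← add_assoc i (i * j') j]
    exact key _ _ _ _

/-- Evaluation of an element of the dual. -/
noncomputable def dualEv {N : DGMod A} {i j : ℤ} (h : i + j = 0) :
    N.dual.X i →+ N.X j →+ AddCircle (1 : ℚ) :=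
  AddMonoidHom.mk' (fun f => (show N.X (-i) →+ AddCircle (1 : ℚ) from f).comp
    (N.idx (by omega))) (fun _ _ => rfl)

/-- The element of the dual given by a character. -/
noncomputable def dualMk {N : DGMod A} {i j : ℤ} (h : i + j = 0) :
    (N.X j →+ AddCircle (1 : ℚ)) →+ N.dual.X i :=
  AddMonoidHom.mk' (fun f => (show N.dual.X i from f.comp (N.idx (by omega)))) (fun _ _ => rfl)

@[simp] lemma dualEv_mk {N : DGMod A} {i j : ℤ} (h : i + j = 0) (f : N.X j →+ AddCircle (1 : ℚ)) :
    dualEv h (dualMk h f) = f := by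
  obtain rfl : j = -i := by omega
  rfl

lemma dualEv_smul {N : DGMod A} {p i k j l : ℤ} (h : p + i = k) (hk : k + j = 0) (hi : i + l = 0)
    (h' : p + j = l) (a : A.X p) (f : N.dual.X i) (x : N.X j) :
    dualEv hk (N.dual.smul h a f) x = sgn (p * i) • dualEv hi f (N.smul h' a x) := by
  obtain rfl : j = -k := by omega
  obtain rfl : l = -i := by omega
  rfl

lemma dualEv_d {N : DGMod A} {i k j l : ℤ} (h : i + 1 = k) (hk : k + j = 0) (hi : i + l = 0)
    (h' : j + 1 = l) (f : N.dual.X i) (x : N.X j) :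
    dualEv hk (N.dual.d h f) x = -(sgn i • dualEv hi f (N.d h' x)) := by
  obtain rfl : j = -k := by omega
  obtain rfl : l = -i := by omega
  rfl

lemma dual_ext {N : DGMod A} {i j : ℤ} (h : i + j = 0) {f g : N.dual.X i}
    (hfg : ∀ x, dualEv h f x = dualEv h g x) : f = g := by
  obtain rfl : j = -i := by omega
  exact AddMonoidHom.ext hfg

lemma Acyclic.dual {N : DGMod A} (hN : N.Acyclic) : N.dual.Acyclic := by
  refine acyclic_of _ fun i j k h h' f hf => ?_
  obtain ⟨g, hg⟩ := exists_character_factor (N.d (by omega : -j + 1 = -i))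
      (dualEv (by omega) f) fun x hx => by
    obtain ⟨y, rfl⟩ := hN.exists (by omega : -k + 1 = -j) (by omega : -j + 1 = -i) x hx
    have := dualEv_d h' (by omega : k + -k = 0) (by omega : j + -j = 0) (by omega) f y
    rw [hf, map_zero, AddMonoidHom.zero_apply] at this
    exact zsmul_sgn_eq_zero.1 (neg_eq_zero.1 this.symm)
  refine ⟨-(sgn i • dualMk (by omega) g), dual_ext (by omega : j + -j = 0) fun x => ?_⟩
  rw [dualEv_d h _ (by omega : i + -i = 0) (by omega), ← hg, map_neg, map_zsmul,
    AddMonoidHom.neg_apply, AddMonoidHom.smul_apply, dualEv_mk, smul_neg, neg_neg, smul_smul,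
    sgn_mul_self, _root_.one_smul]

end Flat

/-- The components of a homomorphism out of a tensor product. -/
def tensHomApp {M N P : DGMod A} (f : ∀ i j k : ℤ, i + j = k → M.X i →+ N.X j →+ P.X k)
    (hb : ∀ (p i j pi pj k : ℤ) (hi : p + i = pi) (hj : p + j = pj) (h : pi + j = k)
      (h' : i + pj = k) (a : A.X p) (m : M.X i) (n : N.X j),
      f pi j k h (M.smul hi a m) n = sgn (i * p) • f i pj k h' m (N.smul hj a n)) (k : ℤ) :
    (tens M N).X k →+ P.X k :=
  tensLift (fun i j h m n => f i j k h m n)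
    (by intros; simp) (by intros; simp) (by
      intro p i j pi pj hi hj h h' a m n
      rw [map_zsmul, AddMonoidHom.smul_apply, hb p i j pi pj k hi hj h h', smul_smul, sgn_mul_self,
        _root_.one_smul])

lemma tensHomApp_tmk {M N P : DGMod A} (f : ∀ i j k : ℤ, i + j = k → M.X i →+ N.X j →+ P.X k)
    (hb) {i j k : ℤ} (h : i + j = k) (m : M.X i) (n : N.X j) :
    tensHomApp f hb k (tmk h m n) = f i j k h m n :=
  tensLift_tmk (fun i j h m n => f i j k h m n) _ _ _ h m n

/-- Homomorphisms out of a tensor product. -/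
def tensHom {M N P : DGMod A} (f : ∀ i j k : ℤ, i + j = k → M.X i →+ N.X j →+ P.X k)
    (hb : ∀ (p i j pi pj k : ℤ) (hi : p + i = pi) (hj : p + j = pj) (h : pi + j = k)
      (h' : i + pj = k) (a : A.X p) (m : M.X i) (n : N.X j),
      f pi j k h (M.smul hi a m) n = sgn (i * p) • f i pj k h' m (N.smul hj a n))
    (hs : ∀ (p i j k pi pk : ℤ) (h : i + j = k) (hi : p + i = pi) (hk : p + k = pk)
      (h' : pi + j = pk) (a : A.X p) (m : M.X i) (n : N.X j),
      f pi j pk h' (M.smul hi a m) n = P.smul hk a (f i j k h m n))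
    (hd : ∀ (i j k i' j' k' : ℤ) (h : i + j = k) (hi : i + 1 = i') (hj : j + 1 = j')
      (hk : k + 1 = k') (h₁ : i' + j = k') (h₂ : i + j' = k') (m : M.X i) (n : N.X j),
      P.d hk (f i j k h m n) = f i' j k' h₁ (M.d hi m) n + sgn i • f i j' k' h₂ m (N.d hj n)) :
    tens M N ⟶ P :=
  { app := tensHomApp f hb
    map_smul := fun {p k l} h a t => by
      have : (tensHomApp f hb l).comp ((tens M N).smul h a) =
          (P.smul h a).comp (tensHomApp f hb k) := tens_hom_ext fun i j hij m n => by
        rw [AddMonoidHom.comp_apply, AddMonoidHom.comp_apply, smul_tmk h a hij rfl (by omega),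
          tensHomApp_tmk, tensHomApp_tmk, hs p i j k _ l hij rfl h]
      exact DFunLike.congr_fun this t
    map_d := fun {k l} h t => by
      have : (tensHomApp f hb l).comp ((tens M N).d h) = (P.d h).comp (tensHomApp f hb k) :=
        tens_hom_ext fun i j hij m n => by
          rw [AddMonoidHom.comp_apply, AddMonoidHom.comp_apply,
            d_tmk h hij rfl rfl (by omega) (by omega), map_add, map_zsmul, tensHomApp_tmk,
            tensHomApp_tmk, tensHomApp_tmk, hd i j k _ _ l hij rfl rfl h]
      exact DFunLike.congr_fun this t }

@[simp] lemma tensHom_tmk {M N P : DGMod A} (f : ∀ i j k : ℤ, i + j = k → M.X i →+ N.X j →+ P.X k)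
    (hb hs hd) {i j k : ℤ} (h : i + j = k) (m : M.X i) (n : N.X j) :
    (tensHom f hb hs hd).app k (tmk h m n) = f i j k h m n :=
  tensHomApp_tmk f hb h m n

/-- The symmetry of the tensor product. -/
def tensSwap (M N : DGMod A) : tens M N ⟶ tens N M :=
  tensHom (fun i j k h => sgn (i * j) • (tmk (by omega : j + i = k)).flip)
    (by
      intro p i j pi pj k hi hj h h' a m n
      simp only [AddMonoidHom.smul_apply, AddMonoidHom.flip_apply]
      rw [tmk_balance hj hi _ (by omega : j + pi = k) a n m, smul_smul, smul_smul, ← sgn_add,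
        ← sgn_add]
      congr 1
      apply sgn_congr; subst hi hj; simp only [parity_simps]; tauto)
    (by
      intro p i j k pi pk h hi hk h' a m n
      simp only [AddMonoidHom.smul_apply, AddMonoidHom.flip_apply, map_zsmul]
      rw [smul_tmk hk a (by omega) rfl (by omega), tmk_balance rfl hi _ (by omega) a n m, smul_smul,
        ← sgn_add]
      congr 1
      apply sgn_congr; subst hi; simp only [parity_simps]; tauto)
    (by
      intro i j k i' j' k' h hi hj hk h₁ h₂ m n
      simp only [AddMonoidHom.smul_apply, AddMonoidHom.flip_apply, map_zsmul]
      rw [d_tmk hk (by omega) hj hi (by omega) (by omega), smul_add, smul_smul, smul_smul,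
        ← sgn_add, ← sgn_add, add_comm]
      congr 2
      · apply sgn_congr; subst hi; simp only [parity_simps]; tauto
      · apply sgn_congr; subst hj; simp only [parity_simps]; tauto)

lemma tensSwap_tmk {M N : DGMod A} {i j k : ℤ} (h : i + j = k) (h' : j + i = k) (m : M.X i)
    (n : N.X j) : (tensSwap M N).app k (tmk h m n) = sgn (i * j) • tmk h' n m :=
  tensHom_tmk _ _ _ _ _ _ _

lemma tensSwap_swap (M N : DGMod A) (k : ℤ) (t : (tens M N).X k) :
    (tensSwap N M).app k ((tensSwap M N).app k t) = t := by
  refine DFunLike.congr_fun (f := ((tensSwap N M).app k).comp ((tensSwap M N).app k))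
    (g := AddMonoidHom.id _) (tens_hom_ext fun i j hij m n => ?_) t
  rw [AddMonoidHom.comp_apply, tensSwap_tmk hij (by omega), map_zsmul, tensSwap_tmk _ hij,
    smul_smul, ← sgn_add, sgn_even ⟨i * j, by ring⟩, _root_.one_smul]
  rfl

lemma quasiIso_tensSwap (M N : DGMod A) : quasiIso A (tensSwap M N) :=
  quasiIso_of_bijective _ fun i => Function.bijective_iff_has_inverse.2
    ⟨_, tensSwap_swap M N i, tensSwap_swap N M i⟩

section Flat

variable {L N : DGMod A}

/-- The graded homomorphism from `L` to the dual of `N` given by a functional on `N ⊗ L`. -/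
noncomputable def dualHom {k : ℤ} (χ : (tens N L).X k →+ AddCircle (1 : ℚ)) :
    (hom L N.dual).X (-k) :=
  mkHom (fun b c hbc => AddMonoidHom.mk' (fun x =>
    dualMk (by omega : c + -c = 0) (sgn (b * (k + 1)) • χ.comp
      ((tmk (by omega : -c + b = k)).flip x))) (fun x y => by
      simp only [map_add, AddMonoidHom.comp_add, smul_add])) (by
      intro p b c b' c' hbc hbc' hb hc a x
      apply dual_ext (by omega : c' + -c' = 0)
      intro n
      simp only [AddMonoidHom.mk'_apply, dualEv_mk, map_zsmul, AddMonoidHom.smul_apply,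
        AddMonoidHom.comp_apply, AddMonoidHom.flip_apply]
      rw [dualEv_smul hc _ (by omega : c + -c = 0) (by omega), dualEv_mk]
      simp only [AddMonoidHom.comp_apply, AddMonoidHom.flip_apply]
      rw [tmk_balance (by omega : p + -c' = -c) hb (by omega : -c + b = k)
        (by omega : -c' + b' = k) a n x, map_zsmul, smul_smul, smul_smul, smul_smul, ← sgn_add,
        ← sgn_add, ← sgn_add]
      congr 1
      apply sgn_congr; subst hc hb hbc
      simp only [parity_simps, even_neg, Int.not_even_one]; tauto)

lemma dualEv_dualHom {k b c d : ℤ} (χ : (tens N L).X k →+ AddCircle (1 : ℚ)) (hbc : b + -k = c)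
    (hcd : c + d = 0) (hd : d + b = k) (x : L.X b) (n : N.X d) :
    dualEv hcd (hev hbc (dualHom χ) x) n = sgn (b * (k + 1)) • χ (tmk hd n x) := by
  obtain rfl : d = -c := by omega
  exact DFunLike.congr_fun (dualEv_mk _ _) n

lemma d_dualHom {i k : ℤ} (h : i + 1 = k) (χ : (tens N L).X k →+ AddCircle (1 : ℚ))
    (hχ : ∀ x, χ ((tens N L).d h x) = 0) : (hom L N.dual).d rfl (dualHom χ) = 0 := by
  apply hom_ext; intro b c hbc x
  apply dual_ext (by omega : c + (-c) = 0); intro n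
  rw [d_hev rfl _ hbc (rfl : b + -k = b + -k) (by omega) rfl (by omega), map_sub,
    AddMonoidHom.sub_apply, map_zsmul, AddMonoidHom.smul_apply,
    dualEv_d (by omega) _ (by omega : b + -k + (-c + 1) = 0) rfl,
    dualEv_dualHom χ rfl _ (by omega), dualEv_dualHom χ _ _ (by omega)]
  have h1 := hχ (tmk (by omega : -c + b = i) n x)
  rw [d_tmk h _ rfl rfl (by omega) (by omega), map_add, map_zsmul] at h1
  rw [eq_neg_of_add_eq_zero_left h1]
  simp only [map_zero, AddMonoidHom.zero_apply, smul_neg, neg_neg, smul_smul, ← sgn_add]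
  rw [sub_eq_zero]
  congr 1
  apply sgn_congr
  obtain rfl : c = b + -k + 1 := by omega
  simp only [parity_simps, even_neg, Int.not_even_one]; tauto

/-- The functional on `N ⊗ L` given by a graded homomorphism from `L` to the dual of `N`. -/
lemma exists_functional {k l : ℤ} (h' : k + 1 = l) (ψ : (hom L N.dual).X (-k - 1)) :
    ∃ χ' : (tens N L).X l →+ AddCircle (1 : ℚ), ∀ b c d hbc hcd hd (x : L.X b) (n : N.X d),
      χ' (tmk hd n x) = sgn (b * k) •
        dualEv (hcd : c + d = 0) (hev (hbc : b + (-k - 1) = c) ψ x) n := by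
  refine ⟨tensLift (fun d b hd n x => sgn (b * k) • dualEv (by omega : -d + d = 0)
    (hev (by omega : b + (-k - 1) = -d) ψ x) n) (by intros; simp) (by intros; simp) ?_, ?_⟩
  · intro p d b pd pb hd hb hh hh' a n x
    rw [hev_smul ψ (by omega : b + (-k - 1) = - pd) _ hb (by omega), map_zsmul, map_zsmul,
      AddMonoidHom.smul_apply, dualEv_smul (by omega : p + -pd = -d) _ (by omega) hd, smul_smul,
      smul_smul, smul_smul, ← sgn_add, ← sgn_add, ← sgn_add]
    congr 1
    apply sgn_congr; subst hb hd
    simp only [parity_simps, even_neg, Int.not_even_one]; tauto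
  · intro b c d hbc hcd hd x n
    obtain rfl : c = -d := by omega
    exact tensLift_tmk _ _ _ _ _ _ _

lemma dualHom_eq_d {k l : ℤ} (h' : k + 1 = l) (χ : (tens N L).X k →+ AddCircle (1 : ℚ))
    (ψ : (hom L N.dual).X (-k - 1)) (hψ : (hom L N.dual).d (by omega) ψ = dualHom χ) :
    ∃ χ' : (tens N L).X l →+ AddCircle (1 : ℚ), χ = χ'.comp ((tens N L).d h') := by
  obtain ⟨χ', hχ'⟩ := exists_functional h' ψ
  refine ⟨sgn k • χ', ?_⟩
  apply tens_hom_ext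
  intro d b hd n x
  have h1 := dualEv_dualHom χ (by omega) (by omega : -d + d = 0) hd x n
  rw [← hψ, d_hev _ ψ _ (rfl : b + (-k - 1) = b + (-k - 1)) (by omega) rfl (by omega), map_sub,
    AddMonoidHom.sub_apply, map_zsmul, AddMonoidHom.smul_apply,
    dualEv_d (by omega) _ (by omega : b + (-k - 1) + (d + 1) = 0) rfl] at h1
  rw [AddMonoidHom.comp_apply, AddMonoidHom.smul_apply, d_tmk h' hd rfl rfl (by omega) (by omega),
    map_add, map_zsmul, hχ' b (b + (-k - 1)) (d + 1) rfl (by omega),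
    hχ' (b + 1) (-d) d (by omega) (by omega), smul_add, smul_smul, smul_smul, smul_smul,
    ← sgn_add, ← sgn_add, ← sgn_add]
  have h2 := congrArg (fun v => sgn (b * (k + 1)) • v) h1
  simp only [smul_smul, sgn_mul_self, _root_.one_smul, smul_sub, smul_neg, ← sgn_add] at h2
  have hm : ∀ m : ℤ, -sgn m = sgn (1 + m) := fun m => by rw [sgn_add, sgn_one, neg_one_mul]
  rw [← h2, sub_eq_add_neg, ← neg_smul, ← neg_smul, hm, hm]
  congr 2
  · apply sgn_congr; simp only [parity_simps, even_neg, Int.not_even_one]; tauto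
  · apply sgn_congr; obtain rfl : d = k - b := by omega
    simp only [parity_simps, even_neg, Int.not_even_one]; tauto

/-- K-projective DG modules are K-flat. -/
lemma IsKProjective.isKFlat (hL : L.IsKProjective) : L.IsKFlat := by
  intro N hN
  refine acyclic_of _ fun i k l h h' t ht => ?_
  by_contra hcon
  obtain ⟨χ, hχ, hχt⟩ : ∃ χ : (tens N L).X k →+ AddCircle (1 : ℚ),
      (∀ x, χ ((tens N L).d h x) = 0) ∧ χ t ≠ 0 := by
    let q := QuotientAddGroup.mk' ((tens N L).d h).range
    have : q t ≠ 0 := fun h0 => hcon ((QuotientAddGroup.eq_zero_iff t).1 h0)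
    obtain ⟨c, hc⟩ := CharacterModule.exists_character_apply_ne_zero_of_ne_zero this
    refine ⟨AddMonoidHom.comp c q, fun x => ?_, hc⟩
    have : q ((tens N L).d h x) = 0 := (QuotientAddGroup.eq_zero_iff _).2 ⟨x, rfl⟩
    change c (q _) = 0
    rw [this, map_zero]
  obtain ⟨ψ, hψ⟩ := (hL _ hN.dual).exists (by omega : -k - 1 + 1 = -k) rfl (dualHom χ)
    (d_dualHom h χ hχ)
  obtain ⟨χ', rfl⟩ := dualHom_eq_d h' χ ψ hψ
  exact hχt (by rw [AddMonoidHom.comp_apply, ht, map_zero])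

lemma IsKProjective.tens_acyclic (hL : L.IsKProjective) (hN : N.Acyclic) :
    (tens L N).Acyclic :=
  Acyclic.of_quasiIso (quasiIso_tensSwap L N) (hL.isKFlat N hN)

end Flat

/-! ### Finite cell modules -/

section FinCell

/-- DG modules obtained from `0` by attaching finitely many cells, one at a time. -/
inductive FinCell : DGMod A → Prop
  | trivial {X : DGMod A} : X.IsTrivial → FinCell X
  | cell {X X' : DGMod A} (j : X ⟶ X') (n : ℤ) (e : X'.X n) :
      CellExt j (fun _ : PUnit.{u + 1} => n) (fun _ => e) → FinCell X → FinCell X'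

lemma FinCell.of_iso {X Y : DGMod A} (hX : FinCell X) (i : X ≅ Y) : FinCell Y := by
  cases hX with
  | trivial h =>
    refine .trivial fun k y => ?_
    rw [← id_app Y k y, ← i.inv_hom_id, comp_app, h k (i.inv.app k y), map_zero]
  | cell j n e h hX => exact .cell _ n _ (h.of_iso i) hX

lemma FinCell.cofib {X : DGMod A} (hX : FinCell X) : Cofib X := by
  induction hX with
  | trivial h => exact h.cofib
  | cell j n e h _ ih => exact HasLift.cofib h.hasLift ih

lemma FinCell.isKProjective {X : DGMod A} (hX : FinCell X) : X.IsKProjective :=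
  Cofib.isKProjective hX.cofib

lemma CellExt.exists_iso_attach {X X' : DGMod A} {ι : Type u} {j : X ⟶ X'} {n : ι → ℤ}
    {e : ∀ b, X'.X (n b)} (h : CellExt j n e) :
    ∃ (z : ∀ b, X.X (n b + 1)) (hz : ∀ b, X.d rfl (z b) = 0),
      (∀ b, X'.d rfl (e b) = j.app _ (z b)) ∧ Nonempty (attach X n z hz ≅ X') := by
  choose z hz using h.d_mem
  have hz' : ∀ b, X.d rfl (z b) = 0 := fun b => h.injective _ (by
    rw [map_zero, j.map_d, ← hz, X'.d_d])
  obtain ⟨i, -⟩ := (attach_cellExt X n z hz').exists_iso h z (d_attachCell X n z hz') hz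
  exact ⟨z, hz', hz, ⟨i⟩⟩

lemma finCell_attach_of_equiv {α β : Type u} (σ : α ≃ β)
    (H : ∀ (X : DGMod A) (n : α → ℤ) z hz, FinCell X → FinCell (attach X n z hz))
    (X : DGMod A) (n : β → ℤ) (z hz) (hX : FinCell X) : FinCell (attach X n z hz) := by
  have h1 := attach_cellExt X n z hz
  have h2 := attach_cellExt X (fun a => n (σ a)) (fun a => z (σ a)) (fun a => hz _)
  obtain ⟨f, hf, hfe⟩ := h2.exists_desc (attachInl X n z hz) _ (d_attachCell X _ _ _)
    (fun a => attachCell X n z hz (σ a)) (fun a => d_attachCell X n z hz _)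
  have hn : ∀ b, n (σ (σ.symm b)) = n b := fun b => by rw [σ.apply_symm_apply]
  have hcell : ∀ (a : α) (b : β) (hab : σ a = b) (hh : n (σ a) = n b),
      f.app _ (DGMod.idx _ hh (attachCell X (fun a => n (σ a)) (fun a => z (σ a))
        (fun a => hz _) a)) = attachCell X n z hz b := by
    rintro a _ rfl hh
    exact hfe a
  obtain ⟨g, hg, hge⟩ := h1.exists_desc
    (attachInl X (fun a => n (σ a)) (fun a => z (σ a)) (fun a => hz _)) _ (d_attachCell X n z hz)
    (fun b => DGMod.idx _ (hn b) (attachCell X (fun a => n (σ a)) (fun a => z (σ a))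
        (fun a => hz _) (σ.symm b))) (fun b => by
      have : ∀ (a : α) (b : β) (hab : σ a = b) (hh : n (σ a) = n b),
          (attach X (fun a => n (σ a)) (fun a => z (σ a)) (fun a => hz _)).d rfl
            (DGMod.idx _ hh (attachCell X (fun a => n (σ a)) (fun a => z (σ a))
              (fun a => hz _) a)) = (attachInl X (fun a => n (σ a)) (fun a => z (σ a))
                (fun a => hz _)).app _ (z b) := by
        rintro a _ rfl hh
        exact d_attachCell X (fun a => n (σ a)) (fun a => z (σ a)) (fun a => hz _) a
      exact this _ b (σ.apply_symm_apply b) _)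
  refine (H X (fun a => n (σ a)) (fun a => z (σ a)) (fun a => hz _) hX).of_iso ⟨f, g, ?_, ?_⟩
  · refine h2.dg_hom_ext (by rw [← Category.assoc, hf, hg, Category.comp_id]) fun a => ?_
    rw [comp_app, hfe, hge, id_app]
    have : ∀ (a a' : α) (h' : a' = a) (hh : n (σ a') = n (σ a)),
        DGMod.idx _ hh (attachCell X (fun a => n (σ a)) (fun a => z (σ a)) (fun a => hz _) a') =
          attachCell X (fun a => n (σ a)) (fun a => z (σ a)) (fun a => hz _) a := by
      rintro a _ rfl hh; rfl
    exact this _ _ (σ.symm_apply_apply a) _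
  · refine h1.dg_hom_ext (by rw [← Category.assoc, hg, hf, Category.comp_id]) fun b => ?_
    rw [comp_app, hge, id_app]
    exact hcell _ _ (σ.apply_symm_apply b) _

lemma finCell_attach_option {α : Type u}
    (H : ∀ (X : DGMod A) (n : α → ℤ) z hz, FinCell X → FinCell (attach X n z hz))
    (X : DGMod A) (n : Option α → ℤ) (z hz) (hX : FinCell X) : FinCell (attach X n z hz) := by
  have h0 := attach_cellExt X n z hz
  let X1 := attach X (fun _ : PUnit.{u + 1} => n none) (fun _ => z none) (fun _ => hz none)
  let j1 : X ⟶ X1 := attachInl X (fun _ => n none) (fun _ => z none) (fun _ => hz none)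
  let e1 : X1.X (n none) := attachCell X (fun _ : PUnit.{u + 1} => n none) (fun _ => z none)
    (fun _ => hz none) ⟨⟩
  have h1 : CellExt j1 (fun _ : PUnit.{u + 1} => n none) (fun _ => e1) := attach_cellExt X _ _ _
  have hd1 : X1.d rfl e1 = j1.app _ (z none) :=
    d_attachCell X (fun _ => n none) (fun _ => z none) (fun _ => hz none) _
  have hX1 : FinCell X1 := .cell j1 (n none) e1 h1 hX
  have hz2 : ∀ a, X1.d rfl (j1.app _ (z (some a))) = 0 := fun a => by
    rw [← j1.map_d, hz, map_zero]
  let X2 := attach X1 (fun a => n (some a)) (fun a => j1.app _ (z (some a))) hz2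
  let j2 : X1 ⟶ X2 := attachInl X1 (fun a => n (some a)) (fun a => j1.app _ (z (some a))) hz2
  let e2 : ∀ a, X2.X (n (some a)) := attachCell X1 _ _ hz2
  have h2 : CellExt j2 _ e2 := attach_cellExt X1 _ _ hz2
  have hd2 : ∀ a, X2.d rfl (e2 a) = j2.app _ (j1.app _ (z (some a))) := d_attachCell X1 _ _ hz2
  let e : ∀ b, X2.X (n b) := fun b => match b with
    | none => j2.app _ e1
    | some a => e2 a
  obtain ⟨g, hg, hge⟩ := h0.exists_desc (j1 ≫ j2) _ (d_attachCell X n z hz) e (by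
    rintro (_ | a)
    · change X2.d rfl (j2.app _ e1) = j2.app _ (j1.app _ _)
      rw [← j2.map_d, hd1]
    · exact hd2 a)
  obtain ⟨f1, hf1, hfe1⟩ := h1.exists_desc (attachInl X n z hz) _ (fun _ => hd1)
    (fun _ => attachCell X n z hz none) (fun _ => d_attachCell X n z hz none)
  obtain ⟨f2, hf2, hfe2⟩ := h2.exists_desc f1 _ hd2
    (fun a => attachCell X n z hz (some a)) (fun a => by
      rw [← comp_app, hf1]
      exact d_attachCell X n z hz _)
  refine (H X1 (fun a => n (some a)) _ hz2 hX1).of_iso ⟨f2, g, ?_, ?_⟩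
  · refine h2.dg_hom_ext ?_ fun a => ?_
    · rw [← Category.assoc, hf2, Category.comp_id]
      refine h1.dg_hom_ext (by rw [← Category.assoc, hf1, hg]) fun _ => ?_
      rw [comp_app, hfe1 ⟨⟩]
      exact hge none
    · rw [comp_app, hfe2]
      exact hge (some a)
  · refine h0.dg_hom_ext ?_ ?_
    · rw [← Category.assoc, hg, Category.comp_id, Category.assoc, hf2, hf1]
    · rintro (_ | a)
      · rw [comp_app, hge, id_app]
        change f2.app _ (j2.app _ e1) = _
        rw [← comp_app, hf2]
        exact hfe1 ⟨⟩
      · rw [comp_app, hge, id_app]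
        exact hfe2 a

lemma FinCell.attach {ι : Type u} [Finite ι] (X : DGMod A) (n : ι → ℤ) (z hz) (hX : FinCell X) :
    FinCell (attach X n z hz) := by
  refine Finite.induction_empty_option (P := fun ι : Type u => ∀ (X : DGMod A) (n : ι → ℤ) z hz,
    FinCell X → FinCell (DGMod.attach X n z hz)) (fun σ H => finCell_attach_of_equiv σ H) ?_
    (fun H => finCell_attach_option H) ι X n z hz hX
  intro X n z hz hX
  have h := attach_cellExt X n z hz
  refine hX.of_iso (isoOfBijective (attachInl X n z hz) fun k => ⟨h.injective k, fun y => ?_⟩)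
  induction y using h.induction with
  | hj x => exact ⟨x, rfl⟩
  | he b => exact b.elim
  | hadd x y hx hy =>
    obtain ⟨x, rfl⟩ := hx
    obtain ⟨y, rfl⟩ := hy
    exact ⟨x + y, map_add _ _ _⟩

/-- Attaching finitely many cells to a finite cell module. -/
lemma FinCell.of_cellExt {ι : Type u} [Finite ι] {X X' : DGMod A} {j : X ⟶ X'} {n : ι → ℤ}
    {e : ∀ b, X'.X (n b)} (h : CellExt j n e) (hX : FinCell X) : FinCell X' := by
  obtain ⟨z, hz, -, ⟨i⟩⟩ := h.exists_iso_attach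
  exact (hX.attach X n z hz).of_iso i

/-! ### Finite cell modules are algebraically perfect -/

lemma IsAlgebraicallyPerfect.of_iso {X Y : DGMod A} (hX : X.IsAlgebraicallyPerfect)
    (i : (Q A).obj X ≅ (Q A).obj Y) : Y.IsAlgebraicallyPerfect :=
  .summand ⟨i.inv, i.hom, i.inv_hom_id⟩ hX

lemma IsTrivial.isAlgebraicallyPerfect {X : DGMod A} (hX : X.IsTrivial) :
    X.IsAlgebraicallyPerfect := by
  refine .summand (retractOfNull (i := (0 : X ⟶ A.self)) (r := 0) ?_) .self
  rw [show (0 : X ⟶ A.self) ≫ 0 - 𝟙 X = 0 from hom_ext_app fun i x => by rw [hX i x, map_zero, map_zero]]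
  exact null_zero

lemma FinCell.isAlgebraicallyPerfect {X : DGMod A} (hX : FinCell X) :
    X.IsAlgebraicallyPerfect := by
  induction hX with
  | trivial h => exact h.isAlgebraicallyPerfect
  | cell j n e h _ ih =>
    obtain ⟨z, hz, -, ⟨i⟩⟩ := h.exists_iso_attach
    refine .of_iso (.cone _ (.of_iso (.shift A.self (-n - 1) .self) ((Q A).mapIso (isoOfBijective
      (dsIncl (fun _ : PUnit.{u + 1} => A.self.shift (-n - 1)) ⟨⟩) fun k => ⟨?_, ?_⟩))) ih)
      ((Q A).mapIso i)
    · intro x y hxy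
      rw [← dsProj_incl_same (N := fun _ : PUnit.{u + 1} => A.self.shift (-n - 1)) ⟨⟩ k x, hxy,
        dsProj_incl_same]
    · intro y
      induction y using directSum_induction with
      | zero => exact ⟨0, map_zero _⟩
      | of b y => exact ⟨y, rfl⟩
      | add x y hx hy =>
        obtain ⟨x, rfl⟩ := hx
        obtain ⟨y, rfl⟩ := hy
        exact ⟨x + y, map_add _ _ _⟩

/-! ### Finite graded bases -/

/-- A finite homogeneous basis, given together with the coordinate functions. -/
structure FinBasis (X : DGMod A) where
  ι : Type u
  [fintype : Fintype ι]
  n : ι → ℤ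
  e : ∀ b, X.X (n b)
  c : ∀ (b : ι) {p k : ℤ}, p + n b = k → X.X k →+ A.X p
  c_smul : ∀ (b : ι) {p q k r l : ℤ} (hk : p + n b = k) (hq : q + k = l) (hr : q + p = r)
    (hl : r + n b = l) (a : A.X q) (x : X.X k), c b hl (X.smul hq a x) = A.mul hr a (c b hk x)
  sum : ∀ {k : ℤ} (x : X.X k),
    ∑ b, X.smul (sub_add_cancel k (n b)) (c b (sub_add_cancel k (n b)) x) (e b) = x

attribute [instance] FinBasis.fintype

lemma FinCell.nonempty_finBasis {X : DGMod A} (hX : FinCell X) : Nonempty (FinBasis X) := by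
  induction hX with
  | trivial h =>
    exact ⟨⟨PEmpty, PEmpty.elim, fun b => b.elim, fun b => b.elim, fun b => b.elim,
      fun x => by rw [h _ x]; rfl⟩⟩
  | @cell X X' j n e h _ ih =>
    obtain ⟨B⟩ := ih
    obtain ⟨ρ, hρ, hρe⟩ := h.exists_extend (toHom (𝟙 X)) (fun _ => 0)
    obtain ⟨o, ho⟩ : ∃ o : A.self.X 0, o = A.one := ⟨_, rfl⟩
    obtain ⟨γ, hγ, hγe⟩ := h.exists_extend (N := A.self) (q := -n) 0
      (fun _ => A.self.idx (by omega : 0 = n + -n) o)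
    let c : ∀ {p k : ℤ}, p + n = k → X'.X k →+ A.X p := fun {p k} hk =>
      sgn (n * p) • hev (by omega : k + -n = p) γ
    have hc : ∀ {p q k r l : ℤ} (hk : p + n = k) (hq : q + k = l) (hr : q + p = r)
      (hl : r + n = l) (a : A.X q) (x : X'.X k), c hl (X'.smul hq a x) = A.mul hr a (c hk x) := by
      intro p q k r l hk hq hr hl a x
      change sgn _ • hev _ γ _ = A.self.smul hr a (sgn _ • hev _ γ x)
      rw [hev_smul γ (by omega : k + -n = p) _ hq hr, map_zsmul, smul_smul, ← sgn_add]
      refine congrArg₂ _ (sgn_congr ?_) rfl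
      subst hr; exact ⟨0, by ring⟩
    refine ⟨⟨Option B.ι, fun b => b.elim n B.n, fun b => match b with
        | none => e
        | some b => j.app _ (B.e b), fun b => match b with
        | none => c
        | some b => fun hk => (B.c b hk).comp (hev (add_zero _) ρ), ?_, ?_⟩⟩
    · rintro (_ | b) p q k r l hk hq hr hl a x
      · exact hc hk hq hr hl a x
      · change B.c b _ (hev _ ρ (X'.smul _ _ _)) = A.mul hr a (B.c b _ (hev _ ρ x))
        rw [hev_smul ρ (add_zero k) _ hq hq, zero_mul, sgn_zero, _root_.one_smul]
        exact B.c_smul b hk hq hr hl a _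
    · intro k x
      rw [Fintype.sum_option]
      change X'.smul (sub_add_cancel k n) (c (sub_add_cancel k n) x) e +
        ∑ b, X'.smul (sub_add_cancel k (B.n b)) (B.c b (sub_add_cancel k (B.n b))
          (hev (add_zero k) ρ x)) (j.app _ (B.e b)) = x
      simp only [← j.map_smul, ← map_sum, B.sum]
      induction x using h.induction with
      | hj x =>
        change X'.smul _ (sgn _ • hev _ γ _) e + _ = _
        rw [hρ k k (add_zero k), hev_toHom, id_app, hγ, map_zero, AddMonoidHom.zero_apply,
          smul_zero]
        exact (congrArg (· + _) (DFunLike.congr_fun (map_zero (X'.smul _)) e)).trans (zero_add _)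
      | he b p hp a =>
        obtain rfl : p = k - n := by omega
        rw [hc (zero_add n) hp (add_zero _) hp a e, hev_smul ρ (add_zero n) _ hp hp]
        have h1 : hev (add_zero n) ρ e = 0 := by
          rw [hev_idx_right (rfl : n + 0 = n + 0) _ (by omega), hρe ⟨⟩, map_zero]
        have h2 : c (zero_add n) e = A.one := by
          change sgn _ • hev _ γ e = _
          rw [hev_idx_right (rfl : n + -n = n + -n) _ (by omega), hγe ⟨⟩, idx_idx, idx_rfl,
            mul_zero, sgn_zero, _root_.one_smul, ho]
        rw [h1, h2, map_zero, smul_zero, map_zero, add_zero, mul_one']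
      | hadd x y hx hy =>
        rw [map_add, map_add, map_add, map_add, AddMonoidHom.add_apply, add_add_add_comm, hx, hy]

end FinCell

/-! ### Finite semi-free DG modules are the finite cell modules -/

section SemiFree

lemma d_one {j : ℤ} (h : 0 + 1 = j) : A.d h A.one = 0 := A.d_degreeZero h _

lemma smul_toCell_one {m n p k : ℤ} (hn : m + n = 0) (h : p + n = k) (h' : m + k = p)
    (a : A.X p) : (A.self.shift m).smul h a (toCell hn A.one) = sgn (p * m) • toCell h' a := by
  refine ofShift_injective (M := A.self) (m := m) h' ?_
  change ofCell h' _ = ofCell h' _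
  rw [ofCell_smul h hn h' (by omega : p + 0 = p), ofCell_toCell, mul_one',
    map_zsmul, ofCell_toCell]

/-- The inclusion of a DG submodule. -/
def Sub.incl {M : DGMod A} (S : M.Sub) : S.toDGMod ⟶ M where
  app i := (S.carrier i).subtype
  map_smul _ _ _ := rfl
  map_d _ _ := rfl

/-- The projection to a quotient. -/
def quotMap (M : DGMod A) (S : M.Sub) : M ⟶ M.quotient S where
  app i := QuotientAddGroup.mk' _
  map_smul _ _ _ := rfl
  map_d _ _ := rfl

lemma quotMap_surjective (M : DGMod A) (S : M.Sub) (i : ℤ) :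
    Function.Surjective ((quotMap M S).app i) := QuotientAddGroup.mk_surjective

lemma quotMap_eq_zero (M : DGMod A) (S : M.Sub) {i : ℤ} (x : M.X i) :
    (quotMap M S).app i x = 0 ↔ x ∈ S.carrier i := QuotientAddGroup.eq_zero_iff x

lemma nonempty_quotient_iso {M N : DGMod A} (S : M.Sub) (p : M ⟶ N)
    (hs : ∀ i, Function.Surjective (p.app i)) (hp : ∀ i x, p.app i x = 0 ↔ x ∈ S.carrier i) :
    Nonempty (M.quotient S ≅ N) := by
  let f : M.quotient S ⟶ N :=
    { app := fun i => QuotientAddGroup.lift _ (p.app i) (fun x hx => (hp i x).2 hx)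
      map_smul := fun h a m => by
        obtain ⟨m, rfl⟩ := quotMap_surjective M S _ m
        exact p.map_smul h a m
      map_d := fun h m => by
        obtain ⟨m, rfl⟩ := quotMap_surjective M S _ m
        exact p.map_d h m }
  refine ⟨isoOfBijective f fun i => ⟨?_, fun y => ?_⟩⟩
  · refine (injective_iff_map_eq_zero _).2 fun x hx => ?_
    obtain ⟨m, rfl⟩ := quotMap_surjective M S _ x
    exact (quotMap_eq_zero M S m).2 ((hp i m).1 hx)
  · obtain ⟨x, rfl⟩ := hs i y
    exact ⟨(quotMap M S).app i x, rfl⟩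

lemma CellExt.of_exact {X X' Y : DGMod A} {ι : Type u} {m : ι → ℤ} (j : X ⟶ X') (p : X' ⟶ Y)
    (i : Y ≅ directSum (fun t => A.self.shift (m t)))
    (hj : ∀ k, Function.Injective (j.app k)) (hp : ∀ k, Function.Surjective (p.app k))
    (hjp : ∀ k x, p.app k x = 0 ↔ ∃ y, j.app k y = x) :
    ∃ e : ∀ t, X'.X (-m t), CellExt j (fun t => -m t) e := by
  classical
  let q := p ≫ i.hom
  have hi : ∀ k, Function.Bijective (i.hom.app k) := fun k =>
    Function.bijective_iff_has_inverse.2 ⟨i.inv.app k, fun x => by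
      rw [← comp_app, i.hom_inv_id, id_app], fun x => by rw [← comp_app, i.inv_hom_id, id_app]⟩
  have hq : ∀ k, Function.Surjective (q.app k) := fun k => (hi k).2.comp (hp k)
  have hjq : ∀ k x, q.app k x = 0 ↔ ∃ y, j.app k y = x := fun k x => by
    rw [← hjp, comp_app]
    exact ⟨fun h => (hi k).1 (h.trans (map_zero _).symm), fun h => by rw [h, map_zero]⟩
  choose e he using fun t => hq (-m t) ((dsIncl (fun t => A.self.shift (m t)) t).app _
    (toCell (by omega : m t + -m t = 0) A.one))
  have hqe : ∀ {k : ℤ} (c : DirectSum ι (fun t => A.X (k - -m t))),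
      q.app k (cellMap j _ e k (0, c)) = DirectSum.map
        (fun t => sgn ((k - -m t) * m t) • toCell (by omega : m t + k = k - -m t)) c := by
    intro k c
    let F : DirectSum ι (fun t => A.X (k - -m t)) →+ DirectSum ι (fun t => (A.self.shift (m t)).X k) :=
      (q.app k).comp ((cellMap j _ e k).comp (AddMonoidHom.inr _ _))
    refine DFunLike.congr_fun (f := F) (DirectSum.addHom_ext fun t a => ?_) c
    rw [DirectSum.map_of]
    change q.app k (cellMap j _ e k (0, _)) = _
    rw [cellMap_of, q.map_smul, he, ← Hom.map_smul, smul_toCell_one _ _ (by omega)]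
    rfl
  have hqj : ∀ {k : ℤ} x, q.app k (j.app k x) = 0 := fun x => (hjq _ _).2 ⟨x, rfl⟩
  have hsplit : ∀ {k : ℤ} x (c : DirectSum ι (fun t => A.X (k - -m t))),
      cellMap j _ e k (x, c) = j.app k x + cellMap j _ e k (0, c) := fun x c => by
    rw [← cellMap_inl j (fun t => -m t) e, ← map_add, Prod.mk_add_mk, add_zero, zero_add]
  have hcell : ∀ (k : ℤ) t, Function.Bijective
      (sgn ((k - -m t) * m t) • toCell (by omega : m t + k = k - -m t) :
        A.X (k - -m t) →+ (A.self.shift (m t)).X k) := fun k t =>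
    Function.bijective_iff_has_inverse.2 ⟨fun x => sgn ((k - -m t) * m t) • ofCell (by omega) x,
      fun x => by
        simp only [AddMonoidHom.smul_apply, map_zsmul, ofCell_toCell]
        rw [smul_smul, sgn_mul_self, _root_.one_smul], fun x => by
        simp only [AddMonoidHom.smul_apply, map_zsmul, toCell_ofCell]
        rw [smul_smul, sgn_mul_self, _root_.one_smul]⟩
  refine ⟨e, fun k => ⟨?_, fun x => ?_⟩, fun t => ?_⟩
  · refine (injective_iff_map_eq_zero _).2 ?_
    rintro ⟨x, c⟩ hxc
    have h1 := congrArg (q.app k) hxc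
    rw [hsplit, map_add, hqj, zero_add, hqe, map_zero] at h1
    have h2 : c = 0 := (DirectSum.map_injective _).2 (fun t => (hcell k t).1)
      (h1.trans (map_zero _).symm)
    subst h2
    rw [cellMap_inl] at hxc
    rw [hj k (hxc.trans (map_zero _).symm)]
    rfl
  · obtain ⟨c, hc⟩ := (DirectSum.map_surjective _).2 (fun t => (hcell k t).2) (q.app k x)
    obtain ⟨y, hy⟩ := (hjq k (x - cellMap j _ e k (0, c))).1 (by
      rw [map_sub, hqe, hc, sub_self])
    exact ⟨(y, c), by rw [hsplit, hy, sub_add_cancel]⟩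
  · obtain ⟨z, hz⟩ := (hjq _ (X'.d rfl (e t))).1 (by
      rw [q.map_d, he, ← Hom.map_d]
      rw [show (A.self.shift (m t)).d rfl (toCell (by omega : m t + -m t = 0) A.one) = 0 from ?_,
        map_zero]
      refine ofShift_injective (M := A.self) (m := m t) (rfl : m t + (-m t + 1) = _) ?_
      change ofCell _ _ = ofCell _ _
      rw [ofCell_d rfl (by omega : m t + -m t = 0) rfl (by omega), ofCell_toCell, d_one, smul_zero,
        map_zero])
    exact ⟨z, hz.symm⟩

lemma IsFiniteSemiFree.finCell {M : DGMod A} (hM : M.IsFiniteSemiFree) : FinCell M := by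
  obtain ⟨ν, hmono, hbot, ⟨l, htop⟩, hfree⟩ := hM
  have key : ∀ k : ℕ, FinCell (ν (k - 1)).toDGMod := by
    intro k
    induction k with
    | zero => exact .trivial fun i x => Subtype.ext (by
        have := x.2
        simp only [Nat.cast_zero, zero_sub, hbot i] at this
        exact AddSubgroup.mem_bot.1 this)
    | succ k ih =>
      obtain ⟨r, m, ⟨i⟩⟩ := hfree k
      have hle := hmono (k - 1 : ℤ) k (by omega)
      let j : (ν (k - 1)).toDGMod ⟶ (ν k).toDGMod :=
        { app := fun i => AddSubgroup.inclusion (hle i)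
          map_smul := fun _ _ _ => rfl
          map_d := fun _ _ => rfl }
      obtain ⟨e, he⟩ := CellExt.of_exact j (quotMap _ _) i
        (fun i => AddSubgroup.inclusion_injective (hle i)) (quotMap_surjective _ _) (fun i x => by
          rw [quotMap_eq_zero]
          exact ⟨fun h => ⟨⟨x.1, h⟩, rfl⟩, by rintro ⟨y, rfl⟩; exact y.2⟩)
      have := FinCell.of_cellExt he ih
      rwa [show ((k + 1 : ℕ) - 1 : ℤ) = k by push_cast; ring]
  have h1 := key (l + 1)
  rw [show ((l + 1 : ℕ) - 1 : ℤ) = l by push_cast; ring] at h1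
  exact h1.of_iso (isoOfBijective (ν l).incl fun i => ⟨Subtype.val_injective, fun x =>
    ⟨⟨x, by rw [htop]; trivial⟩, rfl⟩⟩)

lemma IsTrivial.isFiniteFree {M : DGMod A} (hM : M.IsTrivial) : IsFiniteFree M := by
  refine ⟨0, fun _ => 0, ⟨isoOfBijective 0 fun i => ⟨fun x y _ => by rw [hM i x, hM i y],
    fun y => ⟨0, directSum_ext fun b => b.down.elim0⟩⟩⟩⟩

/-- The image of a DG submodule. -/
def Sub.image {M N : DGMod A} (j : M ⟶ N) (S : M.Sub) : N.Sub where
  carrier i := (S.carrier i).map (j.app i)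
  smul_mem := by
    rintro _ _ _ h a _ ⟨x, hx, rfl⟩
    exact ⟨_, S.smul_mem h a hx, j.map_smul h a x⟩
  d_mem := by
    rintro _ _ h _ ⟨x, hx, rfl⟩
    exact ⟨_, S.d_mem h hx, j.map_d h x⟩

/-- The largest DG submodule. -/
def Sub.total (M : DGMod A) : M.Sub where
  carrier _ := ⊤
  smul_mem _ _ _ _ := trivial
  d_mem _ _ _ := trivial

lemma isFiniteFree_quotient_image {M N : DGMod A} (j : M ⟶ N)
    (hj : ∀ i, Function.Injective (j.app i)) (S S' : M.Sub)
    (h : IsFiniteFree (S'.toDGMod.quotient (S.restrict S'))) :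
    IsFiniteFree ((S'.image j).toDGMod.quotient ((S.image j).restrict (S'.image j))) := by
  obtain ⟨r, m, ⟨i⟩⟩ := h
  let f : S'.toDGMod ⟶ (S'.image j).toDGMod :=
    { app := fun i => ((j.app i).comp (S'.carrier i).subtype).codRestrict _ (fun x =>
        ⟨x.1, x.2, rfl⟩)
      map_smul := fun h a x => Subtype.ext (j.map_smul h a x.1)
      map_d := fun h x => Subtype.ext (j.map_d h x.1) }
  let g := isoOfBijective f fun i => ⟨fun x y hxy => Subtype.ext (hj i (congrArg Subtype.val hxy)),
    by rintro ⟨_, x, hx, rfl⟩; exact ⟨⟨x, hx⟩, rfl⟩⟩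
  have hg : ∀ k x, f.app k (g.inv.app k x) = x := fun k x => by
    change g.hom.app k _ = x
    rw [← comp_app, g.inv_hom_id, id_app]
  obtain ⟨i'⟩ := nonempty_quotient_iso ((S.image j).restrict (S'.image j)) (g.inv ≫ quotMap _ (S.restrict S'))
    (fun k y => by
      obtain ⟨x, rfl⟩ := quotMap_surjective _ _ k y
      refine ⟨g.hom.app k x, ?_⟩
      rw [comp_app, ← comp_app g.hom, g.hom_inv_id, id_app])
    (fun k x => by
      rw [comp_app, quotMap_eq_zero]
      conv_rhs => rw [← hg k x]
      constructor
      · intro h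
        exact ⟨_, h, rfl⟩
      · rintro ⟨y, hy, hy'⟩
        have := hj k hy'
        subst this
        exact hy)
  exact ⟨r, m, ⟨i' ≪≫ i⟩⟩

lemma isFiniteFree_quotient_cell {X X' : DGMod A} (j : X ⟶ X') (n : ℤ) (e : X'.X n)
    (h : CellExt j (fun _ : PUnit.{u + 1} => n) (fun _ => e)) :
    IsFiniteFree ((Sub.total X').toDGMod.quotient (((Sub.total X).image j).restrict
      (Sub.total X'))) := by
  obtain ⟨z, hz⟩ := h.d_mem ⟨⟩
  obtain ⟨f, hf, hfe⟩ := h.exists_desc (N := A.self.shift (-n)) 0 (fun _ => z) (fun _ => hz)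
    (fun _ => toCell (by omega : -n + n = 0) A.one) (fun _ => by
      refine ofShift_injective (M := A.self) (m := -n) (rfl : -n + (n + 1) = _) ?_
      change ofCell _ _ = ofCell _ _
      rw [ofCell_d rfl (by omega : -n + n = 0) rfl (by omega), ofCell_toCell, d_one, smul_zero,
        zero_app, map_zero])
  have hfa : ∀ (p k : ℤ) (hp : p + n = k) (a : A.X p), f.app k (X'.smul hp a e) =
      sgn (p * -n) • toCell (by omega : -n + k = p) a := fun p k hp a => by
    rw [f.map_smul, hfe ⟨⟩]
    exact smul_toCell_one _ _ _ a
  have dec : ∀ (k : ℤ) (x : X'.X k), ∃ y a, x = j.app k y + X'.smul (sub_add_cancel k n) a e := by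
    intro k x
    induction x using h.induction with
    | hj y => exact ⟨y, 0, by rw [map_zero, AddMonoidHom.zero_apply, add_zero]⟩
    | he b p hp a =>
      obtain rfl : p = k - n := by omega
      exact ⟨0, a, by rw [map_zero, zero_add]⟩
    | hadd x y hx hy =>
      obtain ⟨x, a, rfl⟩ := hx
      obtain ⟨y, b, rfl⟩ := hy
      exact ⟨x + y, a + b, by rw [map_add, map_add, AddMonoidHom.add_apply, add_add_add_comm]⟩
  have hfj : ∀ k x, f.app k (j.app k x) = 0 := fun k x => by rw [← comp_app, hf, zero_app]
  let N : ULift.{u} (Fin 1) → DGMod A := fun _ => A.self.shift (-n)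
  refine ⟨1, fun _ => -n, nonempty_quotient_iso (((Sub.total X).image j).restrict (Sub.total X'))
    ((Sub.total X').incl ≫ f ≫ dsIncl N ⟨0⟩) (fun k y => ?_) (fun k x => ?_)⟩
  · refine ⟨⟨X'.smul (sub_add_cancel k n) (sgn ((k - n) * -n) • ofCell (by omega)
      ((dsProj N ⟨0⟩).app k y)) e, _root_.trivial⟩, directSum_ext fun b => ?_⟩
    obtain rfl : b = ⟨0⟩ := by ext; simp
    change (dsProj N ⟨0⟩).app k ((dsIncl N ⟨0⟩).app k (f.app k (X'.smul _ _ e))) = _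
    rw [dsProj_incl_same, hfa, map_zsmul, smul_smul, sgn_mul_self, _root_.one_smul, toCell_ofCell]
  · obtain ⟨y, a, hx⟩ := dec k x.1
    have h0 : ((Sub.total X').incl ≫ f ≫ dsIncl N ⟨0⟩).app k x = 0 ↔ a = 0 := by
      change (dsIncl N ⟨0⟩).app k (f.app k x.1) = 0 ↔ _
      rw [hx, map_add, hfj, zero_add, hfa]
      constructor
      · intro h0
        have h1 := congrArg ((dsProj N ⟨0⟩).app k) h0
        rw [dsProj_incl_same, map_zero, zsmul_sgn_eq_zero] at h1
        have h2 := congrArg (ofCell (by omega : -n + k = k - n)) h1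
        rwa [ofCell_toCell, map_zero] at h2
      · rintro rfl
        rw [map_zero, smul_zero, map_zero]
    rw [h0]
    constructor
    · rintro rfl
      refine ⟨y, _root_.trivial, Eq.symm (hx.trans ?_)⟩
      rw [map_zero, AddMonoidHom.zero_apply, add_zero]
    · rintro ⟨y', -, hy'⟩
      refine h0.1 ?_
      change (dsIncl N ⟨0⟩).app k (f.app k x.1) = 0
      rw [show x.1 = j.app k y' from hy'.symm, hfj, map_zero]

lemma FinCell.isFiniteSemiFree {M : DGMod A} (hM : FinCell M) : M.IsFiniteSemiFree := by
  induction hM with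
  | @trivial X h =>
    exact ⟨fun _ => Sub.total X, fun _ _ _ _ => le_rfl, fun i => by
      ext x; rw [h i x]; simp, ⟨0, fun _ => rfl⟩, fun _ => IsTrivial.isFiniteFree fun i x => by
        obtain ⟨x, rfl⟩ := quotMap_surjective _ _ i x
        exact (quotMap_eq_zero _ _ x).2 _root_.trivial⟩
  | @cell X X' j n e h _ ih =>
    obtain ⟨ν, hmono, hbot, ⟨l, htop⟩, hfree⟩ := ih
    classical
    refine ⟨fun k => if k ≤ l then (ν k).image j else Sub.total X', ?_, ?_, ⟨l + 1, ?_⟩, ?_⟩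
    · intro k k' hk i
      dsimp only
      split_ifs with h1 h2 h2
      · exact AddSubgroup.map_mono (hmono k k' hk i)
      · exact le_top
      · omega
      · exact le_rfl
    · intro i
      dsimp only
      rw [if_pos (by omega)]
      change AddSubgroup.map _ _ = _
      rw [hbot, AddSubgroup.map_bot]
    · intro i
      dsimp only
      rw [if_neg (by push_cast; omega)]
      rfl
    · intro k
      dsimp only
      rcases lt_trichotomy k (l + 1 : ℤ) with hk | rfl | hk
      · rw [if_pos (by omega), if_pos (by omega)]
        exact isFiniteFree_quotient_image j h.injective _ _ (hfree k)
      · rw [if_neg (by omega), if_pos (by omega), add_sub_cancel_right,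
          show ν l = Sub.total X from Sub.ext (funext htop)]
        exact isFiniteFree_quotient_cell j n e h
      · rw [if_neg (by omega), if_neg (by omega)]
        exact IsTrivial.isFiniteFree fun i x => by
          obtain ⟨x, rfl⟩ := quotMap_surjective _ _ i x
          exact (quotMap_eq_zero _ _ x).2 _root_.trivial

end SemiFree

/-! ### Locally finite families of graded homomorphisms -/

section LocFin

variable {ι : Type u} {N N' : ι → DGMod A} {K L : DGMod A}

/-- A family of graded homomorphisms, only finitely many of which are nonzero on each element. -/
def LocFin {q : ℤ} (f : ∀ z, (hom L (N z)).X q) : Prop :=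
  ∀ (i j : ℤ) (h : i + q = j) (x : L.X i), {z | hev h (f z) x ≠ 0}.Finite

lemma LocFin.mono {q : ℤ} {f : ∀ z, (hom L (N z)).X q} (hf : LocFin f) {r : ℤ}
    {g : ∀ z, (hom K (N' z)).X r} (hg : ∀ (i j : ℤ) (h : i + r = j) (x : K.X i),
      ∃ (i' j' : ℤ) (h' : i' + q = j') (x' : L.X i'), ∀ z, hev h' (f z) x' = 0 → hev h (g z) x = 0) :
    LocFin g := by
  intro i j h x
  obtain ⟨i', j', h', x', hx⟩ := hg i j h x
  exact (hf i' j' h' x').subset fun z hz hz' => hz (hx z hz')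

lemma LocFin.add {q : ℤ} {f g : ∀ z, (hom L (N z)).X q} (hf : LocFin f) (hg : LocFin g) :
    LocFin (fun z => f z + g z) := by
  intro i j h x
  refine ((hf i j h x).union (hg i j h x)).subset fun z hz => ?_
  by_contra hcon
  rw [Set.mem_union, not_or] at hcon
  exact hz (by rw [map_add, AddMonoidHom.add_apply, not_not.1 hcon.1, not_not.1 hcon.2, add_zero])

lemma LocFin.zsmul {q : ℤ} {f : ∀ z, (hom L (N z)).X q} (hf : LocFin f) (c : ℤ) :
    LocFin (fun z => c • f z) :=
  hf.mono fun i j h x => ⟨i, j, h, x, fun z hz => by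
    rw [map_zsmul, AddMonoidHom.smul_apply, hz, smul_zero]⟩

lemma LocFin.neg {q : ℤ} {f : ∀ z, (hom L (N z)).X q} (hf : LocFin f) :
    LocFin (fun z => -f z) :=
  hf.mono fun i j h x => ⟨i, j, h, x, fun z hz => by
    rw [map_neg, AddMonoidHom.neg_apply, hz, neg_zero]⟩

lemma LocFin.sub {q : ℤ} {f g : ∀ z, (hom L (N z)).X q} (hf : LocFin f) (hg : LocFin g) :
    LocFin (fun z => f z - g z) := by
  simpa only [sub_eq_add_neg] using hf.add hg.neg

lemma LocFin.comp {q r s : ℤ} (h : r + q = s) {f : ∀ z, (hom L (N z)).X q} (hf : LocFin f)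
    (ψ : (hom K L).X r) : LocFin (fun z => gcomp h (f z) ψ) :=
  hf.mono fun i j hij x => ⟨i + r, j, by omega, hev rfl ψ x, fun z hz => by
    rw [hev_gcomp h _ _ hij rfl (by omega), hz]⟩

lemma LocFin.post_comp {q r s : ℤ} (h : r + q = s) (φ : ∀ z, (hom (N z) (N' z)).X q)
    {f : ∀ z, (hom L (N z)).X r} (hf : LocFin f) : LocFin (fun z => gcomp h (φ z) (f z)) :=
  hf.mono fun i j hij x => ⟨i, i + r, rfl, x, fun z hz => by
    rw [hev_gcomp h _ _ hij rfl (by omega), hz, map_zero]⟩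

lemma LocFin.post {q : ℤ} (φ : ∀ z, N z ⟶ N' z)
    {f : ∀ z, (hom L (N z)).X q} (hf : LocFin f) :
    LocFin (fun z => (DGMod.post L (φ z)).app q (f z)) :=
  hf.mono fun i j hij x => ⟨i, j, hij, x, fun z hz => by rw [hev_post, hz, map_zero]⟩

lemma LocFin.ite {q : ℤ} {f : ∀ z, (hom L (N z)).X q} (hf : LocFin f) (T : Set ι)
    [DecidablePred (· ∈ T)] : LocFin (fun z => if z ∈ T then 0 else f z) :=
  hf.mono fun i j h x => ⟨i, j, h, x, fun z hz => by
    split_ifs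
    · rw [map_zero, AddMonoidHom.zero_apply]
    · exact hz⟩

lemma exists_directSum_of_finite {j : ℤ} (x : ∀ z, (N z).X j) (hx : {z | x z ≠ 0}.Finite) :
    ∃ y : (directSum N).X j, ∀ z, (dsProj N z).app j y = x z := by
  classical
  refine ⟨(DFinsupp.mk hx.toFinset (fun z => x z) : DirectSum ι (fun z => (N z).X j)),
    fun z => ?_⟩
  refine (DFinsupp.mk_apply (β := fun z => (N z).X j) (s := hx.toFinset)
    (x := fun z => x z) (i := z)).trans ?_
  split_ifs with hz
  · rfl
  · by_contra hcon
    exact hz ((Set.Finite.mem_toFinset _).2 fun h' => hcon h'.symm)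

lemma finite_dsProj {j : ℤ} (y : (directSum N).X j) : {z | (dsProj N z).app j y ≠ 0}.Finite := by
  classical
  let y' : DirectSum ι (fun z => (N z).X j) := y
  exact (DFinsupp.support y').finite_toSet.subset fun z hz => DFinsupp.mem_support_iff.2 hz

/-- A graded homomorphism to a direct sum gives a locally finite family. -/
lemma locFin_proj {q : ℤ} (F : (hom L (directSum N)).X q) :
    LocFin (fun z => (DGMod.post L (dsProj N z)).app q F) := by
  intro i j h x
  refine (finite_dsProj (hev h F x)).subset fun z hz => ?_
  rw [Set.mem_ofPred_eq, hev_post] at hz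
  exact hz

/-- A locally finite family gives a graded homomorphism to the direct sum. -/
lemma LocFin.exists_hom {q : ℤ} {f : ∀ z, (hom L (N z)).X q} (hf : LocFin f) :
    ∃ F : (hom L (directSum N)).X q, ∀ z, (DGMod.post L (dsProj N z)).app q F = f z := by
  choose y hy using fun i j h x => exists_directSum_of_finite _ (hf i j h x)
  refine ⟨mkHom (fun i j h => AddMonoidHom.mk' (y i j h) fun x x' => ?_) ?_, fun z => ?_⟩
  · exact directSum_ext fun z => by rw [map_add, hy, hy, hy, map_add]
  · intro p i j i' j' h h' hi hj a x
    refine directSum_ext fun z => ?_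
    simp only [AddMonoidHom.mk'_apply]
    rw [hy, map_zsmul, Hom.map_smul, hy, hev_smul (f z) h h' hi hj]
  · apply hom_ext; intro i j h x
    rw [hev_post, hev_mkHom]
    exact hy i j h x z

lemma directSum_hom_ext_proj {q : ℤ} {F G : (hom L (directSum N)).X q}
    (h : ∀ z, (post L (dsProj N z)).app q F = (post L (dsProj N z)).app q G) : F = G := by
  apply hom_ext; intro i j hij x
  refine directSum_ext fun z => ?_
  rw [← hev_post, h z, hev_post]

/-- Every locally finite family of cocycles with values in members of a class of DG modules
becomes zero in cohomology, up to finitely many members, in a locally finite way. -/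
def Cpt (L : DGMod A) (𝒩 : DGMod A → Prop) : Prop :=
  ∀ (ι : Type u) (N : ι → DGMod A), (∀ z, 𝒩 (N z)) → ∀ (q' q : ℤ) (hq : q' + 1 = q)
    (f : ∀ z, (hom L (N z)).X q), LocFin f → (∀ z, (hom L (N z)).d rfl (f z) = 0) →
    ∃ T : Set ι, T.Finite ∧ ∃ h : ∀ z, (hom L (N z)).X q', LocFin h ∧
      ∀ z, z ∉ T → (hom L (N z)).d hq (h z) = f z

lemma directSum_acyclic (hN : ∀ z, (N z).Acyclic) : (directSum N).Acyclic := by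
  classical
  refine acyclic_of _ fun i j k h h' x hx => ?_
  have key : ∀ z, ∃ y, (N z).d h y = (dsProj N z).app j x := fun z =>
    (hN z).exists h h' _ (by rw [← Hom.map_d, hx, map_zero])
  choose y hy using key
  obtain ⟨w, hw⟩ := exists_directSum_of_finite
    (fun z => if (dsProj N z).app j x = 0 then 0 else y z)
    ((finite_dsProj x).subset fun z hz hz' => hz (if_pos hz'))
  refine ⟨w, directSum_ext fun z => ?_⟩
  rw [Hom.map_d, hw]
  split_ifs with hz
  · rw [map_zero, hz]
  · exact hy z

lemma cpt_acyclic (hL : L.IsKProjective) : Cpt L Acyclic := by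
  intro ι N hN q' q hq f hf hd
  obtain ⟨F, hF⟩ := hf.exists_hom
  obtain ⟨H, hH⟩ := (hL _ (directSum_acyclic hN)).exists hq rfl F (directSum_hom_ext_proj fun z => by
    rw [Hom.map_d, hF, hd, map_zero])
  exact ⟨∅, Set.finite_empty, _, locFin_proj H, fun z _ => by rw [← Hom.map_d, hH, hF]⟩

/-- Compactness passes to retracts up to homotopy. -/
lemma Cpt.of_retract {G : DGMod A} {𝒩 : DGMod A → Prop} (hG : Cpt G 𝒩) {u : L ⟶ G} {v : G ⟶ L}
    (huv : Null (u ≫ v - 𝟙 L)) : Cpt L 𝒩 := by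
  intro ι N hN q' q hq f hf hd
  obtain ⟨T, hT, h, hh, hfh⟩ := hG ι N hN q' q hq (fun z => gcomp (zero_add q) (f z) (toHom v))
    (hf.comp _ _) (fun z => by
      rw [d_gcomp_toHom _ (zero_add (q + 1)), hd, map_zero, AddMonoidHom.zero_apply])
  obtain ⟨s, hs⟩ := huv
  refine ⟨T, hT, fun z => gcomp (zero_add q') (h z) (toHom u) -
    sgn q • gcomp (by omega : -1 + q = q') (f z) s,
    (hh.comp (zero_add q') (toHom u)).sub
      ((hf.comp (by omega : -1 + q = q') s).zsmul (sgn q)), fun z hz => ?_⟩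
  have e1 := d_gcomp (by omega : -1 + q = q') rfl (by norm_num : (-1 : ℤ) + 1 = 0) hq
    (by omega) (by omega) (f z) s
  rw [hd, map_zero, AddMonoidHom.zero_apply, zero_add, hs] at e1
  rw [map_sub, map_zsmul, e1, smul_smul, sgn_mul_self, _root_.one_smul,
    d_gcomp_toHom _ (zero_add q), hfh z hz]
  apply hom_ext; intro i j hij x
  rw [map_sub, AddMonoidHom.sub_apply, hev_gcomp_toHom _ _ _ _ hij, hev_gcomp_toHom _ _ _ _ hij,
    hev_gcomp_toHom _ _ _ _ hij, ← map_sub, sub_app, comp_app, id_app, sub_sub_cancel]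

/-! ### Compact objects of the derived category -/

lemma toAddMonoid_of_any {γ : Type*} (i₁ i₂ : DecidableEq γ) {β : γ → Type*}
    [∀ z, AddCommGroup (β z)] {G : Type*} [AddCommGroup G] (φ : ∀ z, β z →+ G) (z : γ) (x : β z) :
    (letI := i₁; DirectSum.toAddMonoid φ) (letI := i₂; DirectSum.of β z x) = φ z x := by
  obtain rfl := Subsingleton.elim i₁ i₂
  exact DirectSum.toAddMonoid_of _ _ _

lemma directSumIncl_incl (T : Finset ι) (z : T) (i : ℤ) (x : (N z).X i) :
    (directSumIncl N T).app i ((dsIncl (fun z : T => N z) z).app i x) = (dsIncl N z.1).app i x := by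
  exact toAddMonoid_of_any (β := fun z : T => (N z).X i) _ _
    (fun z : T => (dsIncl N z.1).app i) z x

lemma exists_factor_directSumIncl (T : Finset ι) (f : L ⟶ directSum N)
    (hf : ∀ z, z ∉ T → f ≫ dsProj N z = 0) :
    ∃ g : L ⟶ directSum (fun z : T => N z), g ≫ directSumIncl N T = f := by
  classical
  let r : directSum N ⟶ directSum (fun z : T => N z) :=
    dsDesc (fun z => if hz : z ∈ T then dsIncl (fun z : T => N z) ⟨z, hz⟩ else 0)
  have key : ∀ z : ι, (r ≫ directSumIncl N T) ≫ dsProj N z = if z ∈ T then dsProj N z else 0 := by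
    intro z
    refine directSum_hom_ext fun w => hom_ext_app fun i x => ?_
    simp only [comp_app]
    by_cases hw : w ∈ T
    · rw [dsDesc_incl, dif_pos hw, directSumIncl_incl T ⟨w, hw⟩]
      by_cases hz : z ∈ T
      · rw [if_pos hz]
      · rw [if_neg hz, zero_app, dsProj_incl_ne (by rintro rfl; exact hz hw)]
    · rw [dsDesc_incl, dif_neg hw, zero_app, map_zero, map_zero]
      split_ifs with hz
      · rw [dsProj_incl_ne (by rintro rfl; exact hw hz)]
      · rw [zero_app]
  refine ⟨f ≫ r, hom_ext_app fun i x => directSum_ext fun z => ?_⟩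
  have h1 := congrArg (fun g => Hom.app g i (f.app i x)) (key z)
  simp only [comp_app] at h1 ⊢
  rw [h1]
  split_ifs with hz
  · rfl
  · rw [zero_app, ← comp_app, hf z hz, zero_app]

lemma Cpt.isCompactObject {P : DGMod A} {g : L ⟶ P} (hL : L.IsKProjective) (hg : quasiIso A g)
    (hc : Cpt L fun _ => True) : P.IsCompactObject := by
  classical
  intro ι N f
  have : IsIso ((Q A).map g) := isIso_of_quasiIso hg
  obtain ⟨f0, hf0⟩ := exists_Q_map_eq hL ((Q A).map g ≫ f)
  obtain ⟨T, hT, h, hh, hfh⟩ := hc ι N (fun _ => trivial) (-1) 0 (by norm_num)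
    (fun z => (post L (dsProj N z)).app 0 (toHom f0)) (locFin_proj _)
    (fun z => by rw [← Hom.map_d, d_toHom, map_zero])
  obtain ⟨H, hH⟩ := (hh.ite T).exists_hom
  let f1 : L ⟶ directSum N := ofHom (toHom f0 - (hom L _).d (by norm_num) H) (by
    rw [map_sub, d_toHom, d_d, sub_zero])
  have hf1 : (Q A).map f0 = (Q A).map f1 := Q_map_eq_of_null ⟨H, by
    rw [toHom_sub, toHom_ofHom, sub_sub_cancel]⟩
  obtain ⟨g1, hg1⟩ := exists_factor_directSumIncl hT.toFinset f1 (fun z hz => by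
    apply toHom_injective
    rw [Set.Finite.mem_toFinset] at hz
    rw [← post_toHom, toHom_ofHom, map_sub, Hom.map_d, hH, if_neg hz, hfh z hz, sub_self, toHom_zero])
  refine ⟨hT.toFinset, inv ((Q A).map g) ≫ (Q A).map g1, ?_⟩
  rw [Category.assoc, ← Functor.map_comp, hg1, ← hf1, hf0, IsIso.inv_hom_id_assoc]

lemma IsCompactObject.cpt {P : DGMod A} (hP : P.IsCompactObject) {g : L ⟶ P}
    (hL : L.IsKProjective) (hg : quasiIso A g) : Cpt L fun _ => True := by
  classical
  intro ι N _ q' q hq f hf hd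
  have : IsIso ((Q A).map g) := isIso_of_quasiIso hg
  have hf' : LocFin (fun z => homToShift (add_zero q) (f z)) := hf.mono fun i j h x =>
    ⟨i, q + j, by omega, x, fun z hz => ofShift_injective (rfl : q + j = q + j) (by
      rw [hev_homToShift _ _ _ _ (by omega), hz, map_zero])⟩
  obtain ⟨F, hF⟩ := hf'.exists_hom
  have hFd : (hom L _).d rfl F = 0 := directSum_hom_ext_proj fun z => by
    rw [Hom.map_d, hF, d_homToShift _ _ rfl (by omega), hd, map_zero, smul_zero, map_zero]
  obtain ⟨T, g1, hg1⟩ := hP ι (fun z => (N z).shift q) (inv ((Q A).map g) ≫ (Q A).map (ofHom F hFd))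
  obtain ⟨g2, hg2⟩ := exists_Q_map_eq hL ((Q A).map g ≫ g1)
  obtain ⟨H, hH⟩ := null_of_Q_map_eq hL (f := ofHom F hFd) (g := g2 ≫ directSumIncl (fun z => (N z).shift q) T) (by
    rw [Functor.map_comp, hg2, Category.assoc, hg1, IsIso.hom_inv_id_assoc])
  have hz0 : ∀ z, z ∉ T → directSumIncl (fun z => (N z).shift q) T ≫ dsProj _ z = 0 := fun z hz => by
    refine directSum_hom_ext fun w => hom_ext_app fun i x => ?_
    rw [comp_app, comp_app, directSumIncl_incl, dsProj_incl_ne (by rintro rfl; exact hz w.2), comp_app, zero_app]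
  refine ⟨T, T.finite_toSet, fun z => sgn q • homOfShift (by omega : q + -1 = q')
    ((post L (dsProj _ z)).app _ H), ((locFin_proj H).mono fun i j h x => ?_).zsmul _,
    fun z hz => ?_⟩
  · exact ⟨i, j - q, by omega, x, fun z hz => by
      rw [hev_homOfShift _ _ (by omega) (by omega : q + (j - q) = j), hz, map_zero]⟩
  · rw [map_zsmul, d_homOfShift _ (by norm_num : (-1 : ℤ) + 1 = 0) hq (by omega), smul_smul,
      sgn_mul_self, _root_.one_smul, ← Hom.map_d, hH, toHom_sub, toHom_ofHom, map_sub, hF,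
      post_toHom, Category.assoc, hz0 z hz,
      show g2 ≫ (0 : directSum (fun z : T => (N z).shift q) ⟶ (N z).shift q) = 0 from
        hom_ext_app fun i x => rfl, toHom_zero, sub_zero, homOfShift_toShift]

end LocFin

/-! ### Algebraically perfect DG modules are compact -/

section ConeMap

variable {M N M' N' : DGMod A}

/-- The homomorphism of cones induced by a square that commutes up to a homotopy. -/
def coneMap (f : M ⟶ N) (f' : M' ⟶ N') (u : M ⟶ M') (v : N ⟶ N') (s : (hom M N').X (-1))
    (hs : (hom M N').d (by norm_num) s = toHom (f ≫ v - u ≫ f')) : cone f ⟶ cone f' where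
  app i := AddMonoidHom.mk' (fun z => coneMk f' rfl
      (v.app i (coneFst f z) + hev (by omega) s (coneSnd f rfl z)) (u.app _ (coneSnd f rfl z)))
    (fun z w => cone_ext rfl (by simp only [coneFst_mk, map_add]; abel)
      (by simp only [coneSnd_mk, map_add]))
  map_smul {p j k} h a z := by
    refine cone_ext rfl ?_ ?_
    · simp only [AddMonoidHom.mk'_apply]
      rw [coneFst_mk, coneFst_smul, coneFst_smul, coneFst_mk, coneSnd_smul f h rfl rfl (by omega),
        map_zsmul, hev_smul s (by omega : j + 1 + -1 = j) _ (by omega) h, smul_smul, ← sgn_add,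
        sgn_even ⟨0, by ring⟩, _root_.one_smul, map_add, v.map_smul]
    · simp only [AddMonoidHom.mk'_apply]
      rw [coneSnd_mk, coneSnd_smul f h rfl rfl (by omega), coneSnd_smul f' h rfl rfl (by omega),
        coneSnd_mk, map_zsmul, u.map_smul]
  map_d {i j} h z := by
    subst h
    refine cone_ext rfl ?_ ?_
    · simp only [AddMonoidHom.mk'_apply]
      have h1 := DFunLike.congr_fun (congrArg (hev (add_zero (i + 1))) hs) (coneSnd f rfl z)
      rw [hev_toHom, d_hev _ s _ (by omega : i + 1 + -1 = i) rfl rfl (by omega),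
        sgn_odd ⟨-1, by norm_num⟩, sub_app, comp_app, comp_app, neg_smul, _root_.one_smul,
        sub_neg_eq_add] at h1
      rw [coneFst_mk, coneFst_d, coneFst_d, coneFst_mk, coneSnd_mk, coneSnd_d f rfl rfl, map_neg,
        map_add, v.map_d, map_add, eq_sub_of_add_eq h1]
      abel
    · simp only [AddMonoidHom.mk'_apply]
      rw [coneSnd_mk, coneSnd_d f rfl rfl, coneSnd_d f' rfl rfl, coneSnd_mk, map_neg, u.map_d]

lemma quasiIso_coneMap (f : M ⟶ N) (f' : M' ⟶ N') (u : M ⟶ M') (v : N ⟶ N')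
    (s : (hom M N').X (-1)) (hs : (hom M N').d (by norm_num) s = toHom (f ≫ v - u ≫ f'))
    (hu : quasiIso A u) (hv : quasiIso A v) : quasiIso A (coneMap f f' u v s hs) := by
  have hF : ∀ (i : ℤ) (z : (cone f).X i), coneFst f' ((coneMap f f' u v s hs).app i z) =
    v.app i (coneFst f z) + hev (by omega) s (coneSnd f rfl z) := fun i z => rfl
  have hS : ∀ (i : ℤ) (z : (cone f).X i), coneSnd f' rfl ((coneMap f f' u v s hs).app i z) =
    u.app _ (coneSnd f rfl z) := fun i z => rfl
  have hD : ∀ (i : ℤ) (x : M.X (i + 1)), M.d rfl x = 0 →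
      N'.d rfl (hev (by omega : i + 1 + -1 = i) s x) =
        v.app _ (f.app _ x) - f'.app _ (u.app _ x) := fun i x hx => by
    have h1 := DFunLike.congr_fun (congrArg (hev (add_zero (i + 1))) hs) x
    rwa [hev_toHom, d_hev _ s _ (by omega : i + 1 + -1 = i) rfl rfl (by omega), hx, map_zero,
      smul_zero, sub_zero, sub_app, comp_app, comp_app] at h1
  have hD' : ∀ (i : ℤ) (x : M.X (i + 1)),
      N'.d rfl (hev (by omega : i + 1 + -1 = i) s x) + hev (by omega) s (M.d rfl x) =
        v.app _ (f.app _ x) - f'.app _ (u.app _ x) := fun i x => by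
    have h1 := DFunLike.congr_fun (congrArg (hev (add_zero (i + 1))) hs) x
    rwa [hev_toHom, d_hev _ s _ (by omega : i + 1 + -1 = i) rfl rfl (by omega),
      sgn_odd ⟨-1, by norm_num⟩, sub_app, comp_app, comp_app, neg_smul, _root_.one_smul,
        sub_neg_eq_add] at h1
  refine quasiIso_of _ ?_ ?_
  · rintro i j k rfl rfl z hz
    obtain ⟨hz1, hz2⟩ := (cone_d_eq_zero_iff f' rfl rfl _).1 hz
    obtain ⟨x, x1, hx, hux⟩ := exists_of_quasiIso hu rfl rfl _ hz2
    obtain ⟨y0, hy0⟩ := exists_of_quasiIso' hv rfl rfl (f.app _ x)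
      (-coneFst f' z + f'.app _ x1 + hev (by omega) s x) (by rw [← f.map_d, hx, map_zero]) (by
        rw [map_add, map_add, map_neg, ← f'.map_d, hD _ x hx, hux, map_add,
          eq_neg_of_add_eq_zero_left hz1]
        abel)
    obtain ⟨t0, y, ht0, hvt⟩ := exists_of_quasiIso hv rfl rfl
      (-v.app _ y0 + hev (by omega) s x - coneFst f' z + f'.app _ x1) (by
        rw [map_add, map_sub, map_add, map_neg, ← v.map_d, hy0, hD _ x hx, ← f'.map_d, hux, map_add,
          eq_neg_of_add_eq_zero_left hz1]
        abel)
    refine ⟨coneMk f rfl (-y0 - t0) x, coneMk f' rfl (-y) (-x1), ?_, ?_⟩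
    · rw [cone_d_eq_zero_iff f rfl rfl, coneFst_mk, coneSnd_mk, map_sub, map_neg, hy0, ht0]
      exact ⟨by abel, hx⟩
    · refine cone_ext rfl ?_ ?_
      · rw [hF, coneFst_mk, coneSnd_mk, map_add, coneFst_d, coneFst_mk, coneSnd_mk, map_neg,
          map_neg, map_sub, map_neg, hvt]
        abel
      · rw [hS, coneSnd_mk, map_add, coneSnd_d f' rfl rfl, coneSnd_mk, map_neg, hux, neg_neg]
  · rintro i j k rfl rfl w t hw ht
    obtain ⟨hw1, hw2⟩ := (cone_d_eq_zero_iff f rfl rfl _).1 hw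
    have ht1 := congrArg (coneFst f') ht
    have ht2 := congrArg (coneSnd f' rfl) ht
    rw [hF, coneFst_d] at ht1
    rw [hS, coneSnd_d f' rfl rfl, ← map_neg] at ht2
    obtain ⟨x0, hx0⟩ := exists_of_quasiIso' hu rfl rfl _ _ hw2 ht2
    obtain ⟨x2, x3, hx2, hux2⟩ := exists_of_quasiIso hu rfl rfl (coneSnd f' rfl t + u.app _ x0) (by
      rw [map_add, ← u.map_d, hx0, ht2, map_neg, add_neg_cancel])
    have hD0 := hD' _ x0
    rw [hx0] at hD0
    obtain ⟨y2, hy2⟩ := exists_of_quasiIso' hv rfl rfl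
      (coneFst f w + f.app _ x0 - f.app _ x2)
      (coneFst f' t + hev (by omega) s x0 - f'.app _ x3 - hev (by omega) s x2) (by
        rw [map_sub, map_add, ← f.map_d, ← f.map_d, hx0, hx2, map_zero, sub_zero, hw1]) (by
        have h3 := congrArg (f'.app _) hux2
        simp only [map_add] at h3
        simp only [map_sub, map_add]
        rw [hD _ x2 hx2, ← f'.map_d, eq_sub_of_add_eq hD0, eq_sub_of_add_eq ht1, h3]
        abel)
    refine ⟨coneMk f rfl y2 (x2 - x0), cone_ext rfl ?_ ?_⟩
    · rw [coneFst_d, coneFst_mk, coneSnd_mk, hy2, map_sub]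
      abel
    · rw [coneSnd_d f rfl rfl, coneSnd_mk, map_sub, hx2, hx0, zero_sub, neg_neg]

end ConeMap

section ConeCompact

variable {L₁ L₂ N : DGMod A} (f : L₁ ⟶ L₂)

/-- The restriction to `L₁` of a cocycle on a cone, corrected by a primitive of its restriction
to `L₂`. -/
def coneRes {q' q : ℤ} (hq : q' + 1 = q) (φ : (hom (cone f) N).X q) (h : (hom L₂ N).X q') :
    (hom L₁ N).X q' :=
  gcomp (by omega) φ (gInr f) - sgn q • gcomp (zero_add q') h (toHom f)

lemma hev_gInr {i j : ℤ} (h : i + -1 = j) (x : L₁.X i) :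
    hev h (gInr f) x = coneMk f (by omega : j + 1 = i) 0 x := by
  refine cone_ext (by omega : j + 1 = i) ?_ ?_ <;> simp [gInr]

lemma hev_coneRes {q' q i j : ℤ} (hq : q' + 1 = q) (φ : (hom (cone f) N).X q)
    (h : (hom L₂ N).X q') (hij : i + q' = j) (x : L₁.X i) : hev hij (coneRes f hq φ h) x =
      hev (by omega : i - 1 + q = j) φ (coneMk f (by omega) 0 x) - sgn q • hev hij h (f.app i x) := by
  rw [coneRes, map_sub, AddMonoidHom.sub_apply, map_zsmul, AddMonoidHom.smul_apply,
    hev_gcomp_toHom _ _ _ _ hij, hev_gcomp _ _ _ hij rfl (by omega), hev_gInr]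

lemma d_coneRes {q' q : ℤ} (hq : q' + 1 = q) (φ : (hom (cone f) N).X q) (h : (hom L₂ N).X q')
    (hφ : (hom (cone f) N).d rfl φ = 0)
    (hh : (hom L₂ N).d hq h = gcomp (zero_add q) φ (toHom (coneInl f))) :
    (hom L₁ N).d hq (coneRes f hq φ h) = 0 := by
  rw [coneRes, map_sub, map_zsmul, d_gcomp (by omega) rfl (by norm_num : (-1 : ℤ) + 1 = 0) hq
    (by omega) (by omega), hφ, d_gInr, d_gcomp_toHom _ (zero_add q), hh, map_zero,
    AddMonoidHom.zero_apply, zero_add, ← smul_sub]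
  rw [show ∀ x y : (hom L₁ N).X q, x = y → sgn q • (x - y) = 0 from fun x y hxy => by
    rw [hxy, sub_self, smul_zero]]
  apply hom_ext; intro i j hij x
  rw [hev_gcomp_toHom _ _ _ _ hij, hev_gcomp_toHom _ _ _ _ hij, hev_gcomp_toHom _ _ _ _ hij,
    comp_app]

lemma hom_cone_eq_d {q'' q' q : ℤ} (hq' : q'' + 1 = q') (hq : q' + 1 = q)
    (φ : (hom (cone f) N).X q) (h : (hom L₂ N).X q')
    (hh : (hom L₂ N).d hq h = gcomp (zero_add q) φ (toHom (coneInl f)))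
    (k : (hom L₁ N).X q'') (hk : (hom L₁ N).d hq' k = coneRes f hq φ h) :
    (hom (cone f) N).d hq (gcomp (zero_add q') h (gFst f) + gcomp (by omega) k (gSnd f)) = φ := by
  apply hom_ext; intro i j hij z
  have e1 : ∀ (i j : ℤ) (hij : i + q' = j) (z : (cone f).X i),
      hev hij (gcomp (zero_add q') h (gFst f) + gcomp (by omega) k (gSnd f)) z =
        hev hij h (coneFst f z) + hev (by omega) k (coneSnd f rfl z) := fun i j hij z => by
    rw [map_add, AddMonoidHom.add_apply, hev_gcomp (zero_add q') _ _ hij (add_zero i) hij,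
      hev_gcomp (by omega) _ _ hij rfl (by omega)]
    simp [gFst, gSnd]
  have h1 := DFunLike.congr_fun (congrArg (hev hij) hh) (coneFst f z)
  rw [d_hev hq h hij rfl (by omega) rfl (by omega), hev_gcomp_toHom _ _ _ _ hij] at h1
  have h2 := DFunLike.congr_fun (congrArg (hev (by omega : i + 1 + q' = j)) hk) (coneSnd f rfl z)
  rw [d_hev hq' k _ (by omega : i + 1 + q'' = i + q') (by omega) rfl (by omega), hev_coneRes] at h2
  have h3 : z = (coneInl f).app i (coneFst f z) + coneMk f rfl 0 (coneSnd f rfl z) :=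
    cone_ext rfl (by simp) (by simp)
  have h4 : hev hij φ z = hev hij φ ((coneInl f).app i (coneFst f z)) +
      hev (by omega : i + 1 - 1 + q = j) φ (coneMk f (by omega) 0 (coneSnd f rfl z)) := by
    conv_lhs => rw [h3, map_add]
    have : ∀ (i' : ℤ) (hi : i' = i), hev hij φ (coneMk f rfl 0 (coneSnd f rfl z)) =
        hev (by omega : i' + q = j) φ (coneMk f (by omega) 0 (coneSnd f rfl z)) := by
      rintro _ rfl; rfl
    rw [this (i + 1 - 1) (by omega)]
  rw [d_hev hq _ hij rfl (by omega) rfl (by omega), e1, e1, coneFst_d, coneSnd_d f rfl rfl, map_add,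
    map_add, map_neg, h4, ← h1, eq_add_of_sub_eq' h2.symm]
  have hs : sgn q = -sgn q' := by rw [← hq, sgn_add, sgn_one, mul_neg_one]
  have hs' : sgn q' = -sgn q'' := by rw [← hq', sgn_add, sgn_one, mul_neg_one]
  rw [hs, hs']
  simp only [neg_neg, neg_smul, smul_add, smul_neg]
  abel

lemma isKProjective_cone (h₁ : L₁.IsKProjective) (h₂ : L₂.IsKProjective) :
    (cone f).IsKProjective := by
  intro N hN
  refine acyclic_of _ ?_
  rintro i j k hi rfl φ hφ
  obtain ⟨h, hh⟩ := (h₂ N hN).exists hi rfl (gcomp (zero_add j) φ (toHom (coneInl f))) (by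
    rw [d_gcomp_toHom _ (zero_add _), hφ, map_zero, AddMonoidHom.zero_apply])
  obtain ⟨k, hk⟩ := (h₁ N hN).exists (sub_add_cancel i 1) hi (coneRes f hi φ h)
    (d_coneRes f hi φ h hφ hh)
  exact ⟨_, hom_cone_eq_d f _ hi φ h hh k hk⟩

lemma Cpt.cone {𝒩 : DGMod A → Prop} (h₁ : Cpt L₁ 𝒩) (h₂ : Cpt L₂ 𝒩) : Cpt (cone f) 𝒩 := by
  classical
  intro ι N hN q' q hq φ hφ hd
  obtain ⟨T₂, hT₂, h, hh, hhd⟩ := h₂ ι N hN q' q hq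
    (fun z => gcomp (zero_add q) (φ z) (toHom (coneInl f))) (hφ.comp _ _) (fun z => by
      rw [d_gcomp_toHom _ (zero_add _), hd, map_zero, AddMonoidHom.zero_apply])
  have hψ : LocFin (fun z => coneRes f hq (φ z) (h z)) :=
    (hφ.comp _ _).sub ((hh.comp _ _).zsmul _)
  obtain ⟨T₁, hT₁, k, hk, hkd⟩ := h₁ ι N hN (q' - 1) q' (by omega) _ (hψ.ite T₂) (fun z => by
    split_ifs with hz
    · exact map_zero _
    · exact (d_eq_zero_iff _ hq rfl _).1 (d_coneRes f hq _ _ (hd z) (hhd z hz)))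
  refine ⟨T₁ ∪ T₂, hT₁.union hT₂, fun z => gcomp (zero_add q') (h z) (gFst f) +
    gcomp (by omega : 1 + (q' - 1) = q') (k z) (gSnd f), (hh.comp (zero_add q') (gFst f)).add
      (hk.comp (by omega : 1 + (q' - 1) = q') (gSnd f)), fun z hz => ?_⟩
  rw [Set.mem_union, not_or] at hz
  refine hom_cone_eq_d f (by omega) hq _ _ (hhd z hz.2) _ ?_
  rw [hkd z hz.1, if_neg hz.2]

end ConeCompact

section Shift

variable {L M N : DGMod A}

/-- Graded homomorphisms from a shift. -/
def homUnshift {n q r : ℤ} (h : r + n = q) : (hom (L.shift n) N).X q →+ (hom L N).X r :=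
  AddMonoidHom.mk' (fun φ => mkHom (fun i j hij =>
    (hev (by omega : i - n + q = j) φ).comp (toShift (by omega : n + (i - n) = i))) (by
      intro p i j i' j' hij hij' hi hj a x
      simp only [AddMonoidHom.comp_apply]
      have e1 : toShift (by omega : n + (i' - n) = i') (L.smul hi a x) =
          sgn (p * n) • (L.shift n).smul (by omega : p + (i - n) = i' - n) a
            (toShift (by omega : n + (i - n) = i) x) := by
        refine ofShift_injective (by omega : n + (i' - n) = i') ?_
        rw [ofShift_toShift, map_zsmul, ofShift_smul _ (by omega : n + (i - n) = i) _ hi, smul_smul,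
          sgn_mul_self, _root_.one_smul, ofShift_toShift]
      rw [e1, map_zsmul, hev_smul φ (by omega : i - n + q = j) _ _ hj, smul_smul, ← sgn_add]
      congr 1
      apply sgn_congr; subst h; exact ⟨p * n, by ring⟩)) (fun φ ψ => hom_ext fun i j hij x => by
        simp)

lemma hev_homUnshift {n q r i j k : ℤ} (h : r + n = q) (φ : (hom (L.shift n) N).X q)
    (hij : i + r = j) (hk : n + k = i) (hkj : k + q = j) (x : L.X i) :
    hev hij (homUnshift h φ) x = hev hkj φ (toShift hk x) := by
  obtain rfl : k = i - n := by omega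
  simp [homUnshift]

lemma toShift_d {n i j k l : ℤ} (h : i + 1 = j) (hk : n + k = i) (hl : n + l = j)
    (h' : k + 1 = l) (x : L.X i) :
    (toShift hl (L.d h x) : (L.shift n).X l) = sgn n • (L.shift n).d h' (toShift hk x) := by
  refine ofShift_injective hl ?_
  rw [ofShift_toShift, map_zsmul, ofShift_d h' hk hl h, smul_smul, sgn_mul_self, _root_.one_smul,
    ofShift_toShift]

lemma d_homUnshift {n q r q' r' : ℤ} (h : r + n = q) (hq : q + 1 = q') (hr : r + 1 = r')
    (h' : r' + n = q') (φ : (hom (L.shift n) N).X q) :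
    (hom L N).d hr (homUnshift h φ) = homUnshift h' ((hom (L.shift n) N).d hq φ) := by
  apply hom_ext; intro i j hij x
  rw [d_hev hr _ hij rfl (by omega) rfl (by omega),
    hev_homUnshift h _ _ (by omega : n + (i - n) = i) (by omega),
    hev_homUnshift h _ _ (by omega : n + (i - n + 1) = i + 1) (by omega),
    hev_homUnshift h' _ _ (by omega : n + (i - n) = i) (by omega),
    d_hev hq φ _ (by omega : i - n + q = i + r) (by omega) rfl (by omega),
    toShift_d rfl (by omega : n + (i - n) = i) _ rfl, map_zsmul, smul_smul, ← sgn_add, h]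

lemma homUnshift_bijective {n q r : ℤ} (h : r + n = q) :
    Function.Bijective (homUnshift h : (hom (L.shift n) N).X q →+ (hom L N).X r) := by
  constructor
  · intro φ ψ hφψ
    apply hom_ext; intro i j hij x
    have := DFunLike.congr_fun (congrArg (hev (by omega : n + i + r = j)) hφψ) (ofShift rfl x)
    rwa [hev_homUnshift h _ _ rfl hij, hev_homUnshift h _ _ rfl hij, toShift_ofShift] at this
  · intro ψ
    refine ⟨mkHom (fun i j hij => (hev (by omega : n + i + r = j) ψ).comp (ofShift rfl)) ?_, ?_⟩
    · intro p i j i' j' hij hij' hi hj a x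
      simp only [AddMonoidHom.comp_apply]
      rw [ofShift_smul hi rfl rfl (by omega : p + (n + i) = n + i'), map_zsmul,
        hev_smul ψ (by omega : n + i + r = j) _ _ hj, smul_smul, ← sgn_add]
      congr 1
      apply sgn_congr; subst h; exact ⟨0, by ring⟩
    · apply hom_ext; intro i j hij x
      rw [hev_homUnshift h _ _ (by omega : n + (i - n) = i) (by omega), hev_mkHom,
        AddMonoidHom.comp_apply]
      obtain ⟨k, rfl⟩ : ∃ k, i = n + k := ⟨i - n, by omega⟩
      have : ∀ (k' : ℤ) (hk : n + k' = n + k), hev (by omega : n + k' + r = j) ψ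
          (ofShift rfl (toShift hk x : (L.shift n).X k')) = hev hij ψ x := by
        intro k' hk
        obtain rfl : k' = k := by omega
        rw [ofShift_toShift]
      exact this _ _

lemma IsKProjective.shift (hL : L.IsKProjective) (n : ℤ) : (L.shift n).IsKProjective := by
  intro N hN
  refine acyclic_of _ fun i j k h h' φ hφ => ?_
  obtain ⟨ψ, hψ⟩ := (hL N hN).exists (by omega : i - n + 1 = j - n) (rfl : _ = j - n + 1)
    (homUnshift (by omega) φ) (by
      rw [d_homUnshift _ h' rfl (by omega), hφ, map_zero])
  obtain ⟨ψ, rfl⟩ := (homUnshift_bijective (by omega : i - n + n = i)).2 ψ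
  exact ⟨ψ, (homUnshift_bijective (by omega : j - n + n = j)).1 (by
    rw [← hψ, d_homUnshift _ h _ (by omega)])⟩

lemma Cpt.shift {𝒩 : DGMod A → Prop} (hL : Cpt L 𝒩) (n : ℤ) : Cpt (L.shift n) 𝒩 := by
  intro ι N hN q' q hq f hf hd
  obtain ⟨T, hT, h, hh, hhd⟩ := hL ι N hN (q' - n) (q - n) (by omega)
    (fun z => homUnshift (by omega) (f z))
    (hf.mono fun i j hij x => ⟨i - n, j, by omega, toShift (by omega) x, fun z hz => by
      rw [hev_homUnshift (by omega) _ _ (by omega : n + (i - n) = i) (by omega), hz]⟩) (fun z => by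
      rw [d_homUnshift (by omega) rfl rfl (by omega), hd, map_zero])
  choose k hk using fun z => (homUnshift_bijective (L := L) (N := N z)
    (by omega : q' - n + n = q')).2 (h z)
  refine ⟨T, hT, k, hh.mono fun i j hij x => ⟨n + i, j, by omega, ofShift rfl x, fun z hz => ?_⟩,
    fun z hz => (homUnshift_bijective (by omega : q - n + n = q)).1 ?_⟩
  · rwa [← hk, hev_homUnshift _ _ _ rfl hij, toShift_ofShift] at hz
  · rw [← hhd z hz, ← hk, d_homUnshift _ hq _ (by omega)]

/-- The shift of a homomorphism. -/
def shiftMap (f : M ⟶ N) (n : ℤ) : M.shift n ⟶ N.shift n where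
  app i := (toShift rfl).comp ((f.app (n + i)).comp (ofShift rfl))
  map_smul {p j k} h a m := ofShift_injective (rfl : n + k = _) (by
    simp only [AddMonoidHom.comp_apply, ofShift_toShift]
    rw [ofShift_smul h rfl rfl (by omega), ofShift_smul h rfl rfl (by omega), map_zsmul,
      f.map_smul, ofShift_toShift])
  map_d {i j} h m := ofShift_injective (rfl : n + j = _) (by
    simp only [AddMonoidHom.comp_apply, ofShift_toShift]
    rw [ofShift_d h rfl rfl (by omega), ofShift_d h rfl rfl (by omega), map_zsmul,
      f.map_d, ofShift_toShift])

lemma ofShift_shiftMap (f : M ⟶ N) {n i k : ℤ} (h : n + i = k) (x : (M.shift n).X i) :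
    ofShift h ((shiftMap f n).app i x) = f.app k (ofShift h x) := by
  subst h; rfl

lemma shift_d_eq_iff {n i j k l : ℤ} (h : i + 1 = j) (hi : n + i = k) (hj : n + j = l)
    (h' : k + 1 = l) (x : (M.shift n).X i) (y : (M.shift n).X j) :
    (M.shift n).d h x = y ↔ M.d h' (ofShift hi x) = sgn n • ofShift hj y := by
  rw [← (ofShift_injective hj).eq_iff, ofShift_d h hi hj h']
  constructor
  · intro h; rw [← h, smul_smul, sgn_mul_self, _root_.one_smul]
  · intro h; rw [h, smul_smul, sgn_mul_self, _root_.one_smul]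

lemma quasiIso_shiftMap {f : M ⟶ N} (hf : quasiIso A f) (n : ℤ) : quasiIso A (shiftMap f n) := by
  refine quasiIso_of _ ?_ ?_
  · rintro i j k rfl rfl z hz
    rw [shift_d_eq_iff rfl rfl rfl (by omega), map_zero, smul_zero] at hz
    obtain ⟨w, y, hw, hy⟩ := exists_of_quasiIso hf (by omega : n + i + 1 = n + (i + 1)) _ _ hz
    refine ⟨toShift rfl w, sgn n • toShift rfl y, ?_, ofShift_injective rfl ?_⟩
    · rw [shift_d_eq_iff rfl rfl rfl (by omega), map_zero, smul_zero, ofShift_toShift, hw]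
    · rw [ofShift_shiftMap, ofShift_toShift, map_add, ofShift_d _ rfl rfl (by omega), map_zsmul,
        ofShift_toShift, map_zsmul, smul_smul, sgn_mul_self, _root_.one_smul, hy]
  · rintro i j k rfl rfl w y hw hy
    rw [shift_d_eq_iff rfl rfl rfl (by omega), map_zero, smul_zero] at hw
    rw [← (ofShift_injective (rfl : n + (i + 1) = _)).eq_iff, ofShift_shiftMap,
      ofShift_d _ rfl rfl (by omega), ← map_zsmul] at hy
    obtain ⟨x, hx⟩ := exists_of_quasiIso' hf _ (by omega) _ _ hw hy
    refine ⟨sgn n • toShift rfl x, ?_⟩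
    rw [shift_d_eq_iff rfl rfl rfl (by omega), map_zsmul, map_zsmul, ofShift_toShift, hx]

end Shift

lemma exists_kprojective_resolution (P : DGMod A) :
    ∃ (L : DGMod A) (g : L ⟶ P), L.IsKProjective ∧ quasiIso A g := by
  obtain ⟨L, g, hL, hg⟩ := exists_cofib_resolution P
  exact ⟨L, g, hL.isKProjective, hg⟩

lemma cofib_self : Cofib A.self := by
  intro M N p hp hs f
  obtain ⟨o, ho⟩ : ∃ o : A.self.X 0, o = A.one := ⟨_, rfl⟩
  have hdo : ∀ {j : ℤ} (h : 0 + 1 = j), A.self.d h o = 0 := fun h => by rw [ho]; exact d_one h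
  have hao : ∀ (i : ℤ) (a : A.self.X i), A.self.smul (add_zero i) a o = a := fun i a => by
    rw [ho]; exact mul_one' _ a
  obtain ⟨x, hx, hpx⟩ := exists_lift_of_quasiIso hp hs (rfl : 0 + 1 = (0 + 1 : ℤ)) rfl 0
    (map_zero _) (f.app 0 o) (by rw [← f.map_d, hdo, map_zero, map_zero])
  refine ⟨{ app := fun i => (M.smul (add_zero i)).flip x
            map_smul := fun {i j k} h a b => M.mul_smul _ _ _ _ a b x
            map_d := fun {i j} h (a : A.X i) => ?_ }, hom_ext_app fun i (a : A.X i) => ?_⟩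
  · change M.smul _ (A.d h a) x = M.d h (M.smul _ a x)
    rw [M.leibniz (add_zero i) h rfl h (add_zero j) (by omega), hx, map_zero, smul_zero, add_zero]
  · change p.app i (M.smul _ a x) = _
    rw [p.map_smul, hpx, ← f.map_smul]
    exact congrArg _ (hao i a)

lemma cpt_self (𝒩 : DGMod A → Prop) : Cpt A.self 𝒩 := by
  intro ι N hN q' q hq f hf hd
  obtain ⟨o, ho⟩ : ∃ o : A.self.X 0, o = A.one := ⟨_, rfl⟩
  have hao : ∀ (i : ℤ) (a : A.self.X i), A.self.smul (add_zero i) a o = a := fun i a => by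
    rw [ho]; exact mul_one' _ a
  refine ⟨_, hf 0 q (zero_add q) o, fun _ => 0, fun i j h x => ?_, fun z hz => ?_⟩
  · simp
  · rw [map_zero]
    apply Eq.symm
    apply hom_ext; intro i j hij a
    have key : ∀ a : A.X i, hev hij (f z) (A.self.smul (add_zero i) a o) = 0 := fun a => by
      rw [hev_smul (f z) (zero_add q) _ _ hij, not_not.1 hz, map_zero, smul_zero]
    rw [← hao i a, map_zero, AddMonoidHom.zero_apply]
    exact key a

/-- Algebraically perfect DG modules have compact K-projective resolutions. -/
lemma IsAlgebraicallyPerfect.exists_cpt {P : DGMod A} (hP : P.IsAlgebraicallyPerfect) :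
    ∃ (L : DGMod A) (g : L ⟶ P), L.IsKProjective ∧ quasiIso A g ∧ Cpt L fun _ => True := by
  induction hP with
  | self => exact ⟨A.self, 𝟙 _, cofib_self.isKProjective, fun i => by
      rw [show Hmap (𝟙 A.self) i = AddMonoidHom.id _ from AddMonoidHom.ext fun x => Hmap_id _ i x]
      exact Function.bijective_id, cpt_self _⟩
  | shift M n _ ih =>
    obtain ⟨L, g, hL, hg, hc⟩ := ih
    exact ⟨L.shift n, shiftMap g n, hL.shift n, quasiIso_shiftMap hg n, hc.shift n⟩
  | @cone M N f _ _ ih₁ ih₂ =>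
    obtain ⟨L₁, g₁, hL₁, hg₁, hc₁⟩ := ih₁
    obtain ⟨L₂, g₂, hL₂, hg₂, hc₂⟩ := ih₂
    obtain ⟨f', s, hs⟩ := exists_lift_null g₂ hL₁ hg₂ (g₁ ≫ f)
    exact ⟨DGMod.cone f', coneMap f' f g₁ g₂ s hs, isKProjective_cone f' hL₁ hL₂,
      quasiIso_coneMap f' f g₁ g₂ s hs hg₁ hg₂, hc₁.cone f' hc₂⟩
  | @summand M N r _ ih =>
    obtain ⟨G, g, hG, hg, hc⟩ := ih
    obtain ⟨L, k, hL, hk⟩ := exists_kprojective_resolution M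
    have := isIso_of_quasiIso hg
    have := isIso_of_quasiIso hk
    obtain ⟨u, v, huv⟩ := exists_null_of_retract hL hG (r := ⟨(Q A).map k ≫ r.i ≫ inv ((Q A).map g),
      (Q A).map g ≫ r.r ≫ inv ((Q A).map k), by simp⟩)
    exact ⟨L, k, hL, hk, hc.of_retract huv⟩

lemma IsAlgebraicallyPerfect.isCompactObject {P : DGMod A} (hP : P.IsAlgebraicallyPerfect) :
    P.IsCompactObject := by
  obtain ⟨L, g, hL, hg, hc⟩ := hP.exists_cpt
  exact hc.isCompactObject hL hg

/-! ### Compact DG modules are retracts of finite cell modules -/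

section Lift

variable {L M N : DGMod A}

/-- The homomorphism to the cone of an identity given by a graded homomorphism. -/
def coneHom (φ : (hom L M).X 0) : L ⟶ cone (𝟙 M) where
  app i := AddMonoidHom.mk' (fun x => coneMk _ rfl (hev (add_zero i) φ x)
      (-hev rfl ((hom L M).d (zero_add 1) φ) x)) (fun x y => cone_ext rfl (by simp) (by
        simp only [coneSnd_mk, map_add, neg_add]))
  map_smul {p j k} h a x := by
    refine cone_ext rfl ?_ ?_
    · simp only [AddMonoidHom.mk'_apply]
      rw [coneFst_mk, coneFst_smul, coneFst_mk, hev_smul φ (add_zero j) _ h h, zero_mul, sgn_zero,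
        _root_.one_smul]
    · simp only [AddMonoidHom.mk'_apply]
      rw [coneSnd_mk, coneSnd_smul _ h rfl rfl (by omega), coneSnd_mk,
        hev_smul _ (rfl : j + 1 = j + 1) _ h (by omega), _root_.one_mul, map_neg, smul_neg]
  map_d {i j} h x := by
    subst h
    refine cone_ext rfl ?_ ?_
    · simp only [AddMonoidHom.mk'_apply]
      rw [coneFst_mk, coneFst_d, coneFst_mk, coneSnd_mk, map_neg, id_app,
        d_hev _ φ _ (add_zero i) rfl rfl (by omega), sgn_zero, _root_.one_smul, neg_sub,
        add_sub_cancel]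
    · simp only [AddMonoidHom.mk'_apply]
      rw [coneSnd_mk, coneSnd_d _ rfl rfl, coneSnd_mk, map_neg, neg_neg,
        d_hev _ φ _ (add_zero (i + 1)) rfl rfl (by omega), L.d_d, map_zero, smul_zero, sub_zero,
        d_hev _ φ _ (add_zero i) rfl rfl (by omega), map_sub, M.d_d, zero_sub, sgn_zero,
        _root_.one_smul]

/-- Graded homomorphisms from a cofibrant DG module lift along surjections. -/
lemma Cofib.exists_lift (hL : Cofib L) {g : M ⟶ N} (hg : ∀ i, Function.Surjective (g.app i))
    {q : ℤ} (φ : (hom L N).X q) : ∃ ψ : (hom L M).X q, (post L g).app q ψ = φ := by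
  let G := coneMap (𝟙 (M.shift q)) (𝟙 (N.shift q)) (shiftMap g q) (shiftMap g q) 0 (by
    rw [map_zero, Category.id_comp, Category.comp_id,
      show shiftMap g q - shiftMap g q = 0 from hom_ext_app fun i x => by simp, toHom_zero])
  have hG : ∀ i, Function.Surjective (G.app i) := fun i z => by
    obtain ⟨y, hy⟩ := hg _ (ofShift rfl (coneFst _ z))
    obtain ⟨x, hx⟩ := hg _ (ofShift rfl (coneSnd _ rfl z))
    refine ⟨coneMk _ rfl (toShift rfl y) (toShift rfl x), cone_ext rfl ?_ ?_⟩
    · change (shiftMap g q).app i (toShift rfl y) + _ = _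
      rw [map_zero, AddMonoidHom.zero_apply, add_zero]
      exact ofShift_injective rfl (by rw [ofShift_shiftMap, ofShift_toShift, hy])
    · exact ofShift_injective rfl ((ofShift_shiftMap g rfl _).trans (by rw [coneSnd_mk, ofShift_toShift, hx]))
  obtain ⟨H, hH⟩ := hL G (quasiIso_of_acyclic _ (acyclic_cone_id _) (acyclic_cone_id _)) hG
    (coneHom (homToShift (add_zero q) φ))
  refine ⟨homOfShift (add_zero q) (mkHom (fun i j hij => (coneFst _).comp
    ((H.app j).comp (L.idx (by omega)))) ?_), ?_⟩
  · intro p i j i' j' hij hij' hi hj a x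
    obtain rfl : i = j := by omega
    obtain rfl : i' = j' := by omega
    simp only [AddMonoidHom.comp_apply, idx_rfl]
    rw [H.map_smul, coneFst_smul, zero_mul, sgn_zero, _root_.one_smul]
  · apply hom_ext; intro i j hij x
    rw [hev_post, hev_homOfShift _ _ (add_zero i) (by omega : q + i = j), hev_mkHom]
    simp only [AddMonoidHom.comp_apply, idx_rfl]
    rw [← ofShift_shiftMap]
    have h1 := congrArg (coneFst _) (congrArg (fun f => Hom.app f i x) hH)
    have h2 : (shiftMap g q).app i (coneFst _ (H.app i x)) =
        hev (add_zero i) (homToShift (add_zero q) φ) x := by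
      refine Eq.trans ?_ h1
      change _ = (shiftMap g q).app i (coneFst _ (H.app i x)) + _
      rw [map_zero, AddMonoidHom.zero_apply, add_zero]
    rw [h2, hev_homToShift]

end Lift

section Factor

variable {L M N : DGMod A}

lemma exists_factor_of_injective (j : M ⟶ N) (hj : ∀ i, Function.Injective (j.app i)) (w : L ⟶ N)
    (hw : ∀ i x, ∃ y, j.app i y = w.app i x) : ∃ v : L ⟶ M, v ≫ j = w := by
  choose v hv using hw
  refine ⟨⟨fun i => AddMonoidHom.mk' (v i) fun x y => hj _ ?_, fun h a m => hj _ ?_,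
    fun h m => hj _ ?_⟩, hom_ext_app hv⟩
  · rw [hv, map_add, map_add, hv, hv]
  · simp only [AddMonoidHom.mk'_apply]
    rw [hv, j.map_smul, hv, w.map_smul]
  · simp only [AddMonoidHom.mk'_apply]
    rw [hv, j.map_d, hv, w.map_d]

lemma IsCellTower.trans_injective {F : ℕ ⥤ DGMod A} (hF : IsCellTower F) {m n : ℕ} (h : m ≤ n)
    (i : ℤ) : Function.Injective ((trans F h).app i) := by
  induction n, h using Nat.le_induction with
  | base => intro x y hxy; simpa using hxy
  | succ n h ih =>
    obtain ⟨ι, m', e, he⟩ := hF.step n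
    intro x y hxy
    rw [← trans_trans F h n.le_succ, ← trans_trans F h n.le_succ] at hxy
    exact ih (he.injective i hxy)

lemma IsCellTower.seqIncl_injective {F : ℕ ⥤ DGMod A} (hF : IsCellTower F) (n : ℕ) (i : ℤ) :
    Function.Injective ((seqIncl F n).app i) := by
  refine (injective_iff_map_eq_zero _).2 fun x hx => ?_
  obtain ⟨m, h, hm⟩ := seqIncl_eq_zero F hx
  exact hF.trans_injective h i (hm.trans (map_zero _).symm)

/-- The identity of a compact cell module factors up to homotopy through a finite stage. -/
lemma IsCellTower.exists_retract_stage {F : ℕ ⥤ DGMod A} (hF : IsCellTower F)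
    (hc : Cpt (seqColim F) fun _ => True) :
    ∃ (n : ℕ) (v : seqColim F ⟶ F.obj n), Null (v ≫ seqIncl F n - 𝟙 _) := by
  let S : ULift.{u} ℕ → (seqColim F).Sub := fun n => (Sub.total _).image (seqIncl F n.down)
  obtain ⟨T, hT, h, -, hh⟩ := hc (ULift.{u} ℕ) (fun n => (seqColim F).quotient (S n))
    (fun _ => trivial) (-1) 0 (by norm_num) (fun n => toHom (quotMap _ (S n))) (fun i j hij x => by
      obtain rfl : i = j := by omega
      obtain ⟨m, y, rfl⟩ := exists_seqIncl F x
      refine ((Set.finite_lt_nat m).preimage ULift.down_injective.injOn).subset fun n hn => ?_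
      by_contra hmn
      refine hn ?_
      rw [hev_toHom, quotMap_eq_zero]
      exact ⟨(trans F (not_lt.1 hmn)).app i y, trivial, seqIncl_trans F _ i y⟩)
    (fun n => d_toHom _ _)
  obtain ⟨n, hn⟩ := hT.infinite_compl.nonempty
  obtain ⟨h', hh'⟩ := Cofib.exists_lift (IsCellTower.cofib hF) (quotMap_surjective _ (S n)) (h n)
  let w : seqColim F ⟶ seqColim F := ofHom (toHom (𝟙 _) - (hom _ _).d (by norm_num) h') (by
    rw [map_sub, d_toHom, d_d, sub_zero])
  have hw : w ≫ quotMap _ (S n) = 0 := toHom_injective (by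
    rw [← post_toHom, toHom_ofHom, map_sub, Hom.map_d, hh', hh n hn, post_toHom, Category.id_comp,
      sub_self, toHom_zero])
  obtain ⟨v, hv⟩ := exists_factor_of_injective (seqIncl F n.down) (hF.seqIncl_injective _) w
    (fun i x => by
      have h1 : (quotMap _ (S n)).app i (w.app i x) = 0 := by rw [← comp_app, hw, zero_app]
      obtain ⟨y, -, hy⟩ := (quotMap_eq_zero _ _ _).1 h1
      exact ⟨y, hy⟩)
  refine ⟨n.down, v, -h', ?_⟩
  rw [hv, toHom_sub, toHom_ofHom, map_neg, sub_sub_cancel_left]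

end Factor

section Coordinates

/-- The graded homomorphism from a shift of `A` with a prescribed value. -/
def cellHom {X : DGMod A} {m k : ℤ} (hk : m + k = 0) (z : X.X k) :
    (hom (A.self.shift m) X).X 0 :=
  mkHom (fun i j h => AddMonoidHom.mk' (fun x =>
    sgn (m * (m + i)) • X.smul (by omega : m + i + k = j) (ofCell rfl x) z) (fun x y => by
      rw [map_add, map_add, AddMonoidHom.add_apply, smul_add])) (by
    intro p i j i' j' h h' hi hj a x
    simp only [AddMonoidHom.mk'_apply]
    rw [ofCell_smul hi rfl rfl (by omega), map_zsmul, AddMonoidHom.smul_apply, smul_smul,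
      X.mul_smul _ _ (by omega : m + i + k = j) hj, map_zsmul, smul_smul, ← sgn_add, ← sgn_add]
    congr 1
    apply sgn_congr; subst hi; exact ⟨m * p, by ring⟩)

lemma hev_cellHom {X : DGMod A} {m k i j p : ℤ} (hk : m + k = 0) (z : X.X k) (h : i + 0 = j)
    (hp : m + i = p) (hpk : p + k = j) (x : (A.self.shift m).X i) :
    hev h (cellHom hk z) x = sgn (m * p) • X.smul hpk (ofCell hp x) z := by
  subst hp; rfl

variable {X X' : DGMod A} {ι : Type u} {j : X ⟶ X'} {n : ι → ℤ} {e : ∀ b, X'.X (n b)}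

/-- Coordinates on the result of attaching cells. -/
structure Coords (j : X ⟶ X') (n : ι → ℤ) (e : ∀ b, X'.X (n b)) where
  z : ∀ b, X.X (n b + 1)
  hz : ∀ b, X'.d rfl (e b) = j.app _ (z b)
  ρ : (hom X' X).X 0
  ρ_inl : ∀ {k : ℤ} (x : X.X k), hev (add_zero k) ρ (j.app k x) = x
  ρ_cell : ∀ {p k : ℤ} b (h : p + n b = k) (a : A.X p), hev (add_zero k) ρ (X'.smul h a (e b)) = 0
  g : ∀ b, X' ⟶ A.self.shift (-n b)
  g_inl : ∀ b {k : ℤ} (x : X.X k), (g b).app k (j.app k x) = 0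
  g_cell : ∀ b {k : ℤ} (y : (A.self.shift (-n b)).X k),
    (g b).app k (hev (add_zero k) (cellHom (by omega) (e b)) y) = y
  g_cell_ne : ∀ b c, b ≠ c → ∀ {p k : ℤ} (h : p + n b = k) (a : A.X p),
    (g c).app k (X'.smul h a (e b)) = 0
  sum : ∀ {k : ℤ} (x : X'.X k), ∃ s : Finset ι, (∀ b, b ∉ s → (g b).app k x = 0) ∧
    x = j.app k (hev (add_zero k) ρ x) +
      ∑ b ∈ s, hev (add_zero k) (cellHom (by omega) (e b)) ((g b).app k x)

lemma CellExt.nonempty_coords (h : CellExt j n e) : Nonempty (Coords j n e) := by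
  classical
  choose z hz using h.d_mem
  obtain ⟨ρ, hρ, hρe⟩ := h.exists_extend (toHom (𝟙 X)) (fun _ => 0)
  have hg : ∀ b, ∃ g : X' ⟶ A.self.shift (-n b), (∀ k x, g.app k (j.app k x) = 0) ∧
      g.app _ (e b) = toCell (by omega : -n b + n b = 0) A.one ∧
      ∀ c, c ≠ b → g.app _ (e c) = 0 := fun b => by
    let w : ∀ c, (A.self.shift (-n b)).X (n c) := fun c =>
      if hc : b = c then DGMod.idx _ (by rw [hc]) (toCell (by omega : -n b + n b = 0) A.one) else 0
    obtain ⟨g, hg, hge⟩ := h.exists_desc (N := A.self.shift (-n b)) 0 z hz w (fun c => by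
      rw [zero_app]
      by_cases hc : b = c
      · subst hc
        simp only [w, dif_pos, idx_rfl]
        refine ofShift_injective (M := A.self) (rfl : -n b + (n b + 1) = _) ?_
        change ofCell _ _ = ofCell _ _
        rw [ofCell_d rfl (by omega : -n b + n b = 0) rfl (by omega), ofCell_toCell, d_one,
          smul_zero, map_zero]
      · simp only [w, dif_neg hc, map_zero])
    refine ⟨g, fun k x => by rw [← comp_app, hg, zero_app], ?_, fun c hc => ?_⟩
    · rw [hge]; simp [w]
    · rw [hge]; simp [w, Ne.symm hc]
  choose g hgj hge hgc using hg
  have hρj : ∀ {k : ℤ} (x : X.X k), hev (add_zero k) ρ (j.app k x) = x := fun x => by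
    rw [hρ, hev_toHom, id_app]
  have hρc : ∀ {p k : ℤ} b (h : p + n b = k) (a : A.X p),
      hev (add_zero k) ρ (X'.smul h a (e b)) = 0 := fun {p k} b h a => by
    rw [hev_smul ρ (add_zero (n b)) _ h h, hev_idx_right (rfl : n b + 0 = n b + 0) _ (by omega),
      hρe, map_zero, map_zero, smul_zero]
  have hgcell : ∀ b {k : ℤ} (y : (A.self.shift (-n b)).X k),
      (g b).app k (hev (add_zero k) (cellHom (by omega) (e b)) y) = y := fun b k y => by
    rw [hev_cellHom _ _ _ (rfl : -n b + k = _) (by omega), map_zsmul, Hom.map_smul, hge,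
      smul_toCell_one _ _ rfl, smul_smul, mul_comm (-n b + k), sgn_mul_self, _root_.one_smul,
      toCell_ofCell]
  have hgne : ∀ b c, b ≠ c → ∀ {p k : ℤ} (h : p + n b = k) (a : A.X p),
      (g c).app k (X'.smul h a (e b)) = 0 := fun b c hbc p k h a => by
    rw [Hom.map_smul, hgc c b hbc, map_zero]
  refine ⟨⟨z, hz, ρ, hρj, hρc, g, fun b => hgj b _, hgcell, hgne, fun {k} x => ?_⟩⟩
  obtain ⟨⟨y, c⟩, rfl⟩ := (h.bij k).2 x
  have hx : cellMap j n e k (y, c) = j.app k y +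
      ∑ b ∈ DFinsupp.support c, X'.smul (sub_add_cancel k (n b)) (c b) (e b) := by
    have h1 : (y, c) = (y, 0) + ∑ b ∈ DFinsupp.support c,
        ((0 : X.X k), DirectSum.of (fun b => A.X (k - n b)) b (c b)) := by
      have h2 : ∑ b ∈ DFinsupp.support c,
          ((0 : X.X k), DirectSum.of (fun b => A.X (k - n b)) b (c b)) = (0, c) := by
        refine Prod.ext ?_ ?_
        · rw [Prod.fst_sum]; exact Finset.sum_const_zero
        · rw [Prod.snd_sum]; exact DirectSum.sum_support_of c
      rw [h2, Prod.mk_add_mk, add_zero, zero_add]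
    rw [h1, map_add, map_sum, cellMap_inl]
    simp only [cellMap_of]
  have hρx : hev (add_zero k) ρ (cellMap j n e k (y, c)) = y := by
    rw [hx, map_add, map_sum, hρj, Finset.sum_eq_zero (fun b _ => hρc b _ _), add_zero]
  have hcell : ∀ b, X'.smul (sub_add_cancel k (n b)) (c b) (e b) =
      hev (add_zero k) (cellHom (by omega) (e b))
        (sgn (-n b * (k - n b)) • toCell (by omega : -n b + k = k - n b) (c b)) := fun b => by
    rw [map_zsmul, hev_cellHom _ _ _ (by omega : -n b + k = k - n b) (by omega), ofCell_toCell,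
      smul_smul, sgn_mul_self, _root_.one_smul]
  have hgx : ∀ b, b ∈ DFinsupp.support c → (g b).app k (cellMap j n e k (y, c)) =
      sgn (-n b * (k - n b)) • toCell (by omega : -n b + k = k - n b) (c b) := fun b hb => by
    rw [hx, map_add, map_sum, hgj, zero_add, Finset.sum_eq_single_of_mem b hb
      (fun c _ hc => hgne _ _ hc _ _), hcell, hgcell]
  refine ⟨DFinsupp.support c, fun b hb => ?_, ?_⟩
  · rw [hx, map_add, map_sum, hgj, zero_add]
    exact Finset.sum_eq_zero fun b' hb' => hgne _ _ (by rintro rfl; exact hb hb') _ _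
  · rw [hρx]
    conv_lhs => rw [hx]
    congr 1
    exact Finset.sum_congr rfl fun b hb => by rw [hgx b hb, hcell]

end Coordinates

section FiniteSubcomplexes

variable {X X' : DGMod A} {ι : Type u} {j : X ⟶ X'} {n : ι → ℤ} {e : ∀ b, X'.X (n b)}

lemma Coords.g_cell_other (C : Coords j n e) {b c : ι} (hbc : b ≠ c) {k : ℤ}
    (y : (A.self.shift (-n b)).X k) :
    (C.g c).app k (hev (add_zero k) (cellHom (by omega) (e b)) y) = 0 := by
  rw [hev_cellHom _ _ _ (rfl : -n b + k = _) (by omega), map_zsmul, C.g_cell_ne b c hbc, smul_zero]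

lemma Coords.ρ_cellHom (C : Coords j n e) {b : ι} {k : ℤ} (y : (A.self.shift (-n b)).X k) :
    hev (add_zero k) C.ρ (hev (add_zero k) (cellHom (by omega) (e b)) y) = 0 := by
  rw [hev_cellHom _ _ _ (rfl : -n b + k = _) (by omega), map_zsmul, C.ρ_cell, smul_zero]

lemma Coords.ρ_d_sub_mem (C : Coords j n e) (S : X.Sub) (T : Finset ι)
    (hT : ∀ b ∈ T, C.z b ∈ S.carrier _) {k l : ℤ} (h : k + 1 = l) (x : X'.X k)
    (hx : ∀ b, b ∉ T → (C.g b).app k x = 0) :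
    hev (add_zero l) C.ρ (X'.d h x) - X.d h (hev (add_zero k) C.ρ x) ∈ S.carrier l := by
  let E : X'.X k →+ X.X l := (hev (add_zero l) C.ρ).comp (X'.d h) -
    (X.d h).comp (hev (add_zero k) C.ρ)
  change E x ∈ _
  obtain ⟨s, hs, hxs⟩ := C.sum x
  rw [hxs, map_add, map_sum]
  refine add_mem ?_ (sum_mem fun b _ => ?_)
  · change hev _ _ (X'.d h (j.app k _)) - X.d h (hev _ _ (j.app k _)) ∈ _
    rw [← j.map_d, C.ρ_inl, C.ρ_inl, sub_self]
    exact zero_mem _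
  · by_cases hb : b ∈ T
    · change hev _ _ (X'.d h (hev _ _ _)) - X.d h (hev _ _ (hev _ _ _)) ∈ _
      rw [C.ρ_cellHom, map_zero, sub_zero, hev_cellHom _ _ _ (rfl : -n b + k = _) (by omega),
        map_zsmul, X'.leibniz _ rfl rfl h (by omega) (by omega : -n b + k + (n b + 1) = l), C.hz,
        ← j.map_smul, map_zsmul, map_add, C.ρ_cell, zero_add, map_zsmul, C.ρ_inl]
      exact zsmul_mem (zsmul_mem (S.smul_mem _ _ (hT b hb)) _) _
    · rw [hx b hb, map_zero, map_zero]
      exact zero_mem _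

/-- The submodule of the elements with coordinates in `S` and supported on the cells in `T`. -/
def Coords.sub (C : Coords j n e) (S : X.Sub) (T : Finset ι)
    (hT : ∀ b ∈ T, C.z b ∈ S.carrier _) : X'.Sub where
  carrier k :=
    { carrier := {x | hev (add_zero k) C.ρ x ∈ S.carrier k ∧ ∀ b, b ∉ T → (C.g b).app k x = 0}
      zero_mem' := ⟨by rw [map_zero]; exact zero_mem _, fun b _ => map_zero _⟩
      add_mem' := fun {x y} hx hy => ⟨by rw [map_add]; exact add_mem hx.1 hy.1,
        fun b hb => by rw [map_add, hx.2 b hb, hy.2 b hb, add_zero]⟩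
      neg_mem' := fun {x} hx => ⟨by rw [map_neg]; exact neg_mem hx.1,
        fun b hb => by rw [map_neg, hx.2 b hb, neg_zero]⟩ }
  smul_mem {p i k} h a x hx := ⟨by
      rw [hev_smul C.ρ (add_zero i) _ h h]
      exact zsmul_mem (S.smul_mem _ _ hx.1) _,
    fun b hb => by rw [Hom.map_smul, hx.2 b hb, map_zero]⟩
  d_mem {i k} h x hx := ⟨by
      have := add_mem (C.ρ_d_sub_mem S T hT h x hx.2) (S.d_mem h hx.1)
      rwa [sub_add_cancel] at this,
    fun b hb => by rw [Hom.map_d, hx.2 b hb, map_zero]⟩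

lemma Coords.finCell_sub (C : Coords j n e) (S : X.Sub) (T : Finset ι)
    (hT : ∀ b ∈ T, C.z b ∈ S.carrier _) (hS : FinCell S.toDGMod) :
    FinCell (C.sub S T hT).toDGMod := by
  let R := C.sub S T hT
  obtain ⟨jS, hjS⟩ := exists_factor_of_injective R.incl (fun i => Subtype.val_injective)
    (S.incl ≫ j) (fun i x => ⟨⟨j.app i x.1, by
      rw [C.ρ_inl]; exact x.2,
      fun b _ => C.g_inl b _⟩, rfl⟩)
  have hjS' : ∀ k x, R.incl.app k (jS.app k x) = j.app k x.1 := fun k x => by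
    rw [← comp_app, hjS]; rfl
  obtain ⟨F, hF⟩ := LocFin.exists_hom (L := R.toDGMod) (N := fun t : {b // b ∈ T} =>
    A.self.shift (-n t.1)) (f := fun t => toHom (R.incl ≫ C.g t.1))
    (fun _ _ _ _ => Set.toFinite _)
  let p := ofHom F (directSum_hom_ext_proj fun z => by
    rw [Hom.map_d, hF, d_toHom, map_zero])
  have hp : ∀ t k x, (dsProj _ t).app k (p.app k x) = (C.g t.1).app k (R.incl.app k x) :=
    fun t k x => by
      have h := congrArg (fun f => hev (add_zero k) f x) (hF t)
      simpa [p] using h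
  obtain ⟨e', he'⟩ := CellExt.of_exact jS p (Iso.refl _)
    (fun k x y hxy => Subtype.ext (by
      have h := congrArg (fun z => hev (add_zero k) C.ρ (R.incl.app k z)) hxy
      simp only [hjS', C.ρ_inl] at h
      exact h))
    (fun k y => by
      induction y using directSum_induction with
      | zero => exact ⟨0, map_zero _⟩
      | add x y hx hy =>
        obtain ⟨x', rfl⟩ := hx
        obtain ⟨y', rfl⟩ := hy
        exact ⟨x' + y', map_add _ _ _⟩
      | of b y =>
        have hy : hev (add_zero k) (cellHom (by omega) (e b.1)) y ∈ R.carrier k :=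
          ⟨by rw [C.ρ_cellHom]; exact zero_mem _,
            fun c hc => C.g_cell_other (by rintro rfl; exact hc b.2) y⟩
        obtain ⟨x, hx⟩ : ∃ x, R.incl.app k x =
          hev (add_zero k) (cellHom (by omega) (e b.1)) y := ⟨⟨_, hy⟩, rfl⟩
        · refine ⟨x, directSum_ext fun c => ?_⟩
          rw [hp, hx]
          by_cases hbc : b = c
          · subst hbc
            rw [dsProj_incl_same]
            exact C.g_cell _ y
          · rw [dsProj_incl_ne hbc]
            exact C.g_cell_other (fun h => hbc (Subtype.ext h)) y)
    (fun k x => by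
      constructor
      · intro hx
        have hg : ∀ b, (C.g b).app k (R.incl.app k x) = 0 := fun b => by
          by_cases hb : b ∈ T
          · rw [← hp ⟨b, hb⟩, hx, map_zero]
          · exact x.2.2 b hb
        obtain ⟨s, -, hs⟩ := C.sum (R.incl.app k x)
        refine ⟨⟨_, x.2.1⟩, Subtype.ext ((hjS' k _).trans ?_)⟩
        refine Eq.trans ?_ hs.symm
        rw [Finset.sum_eq_zero (fun b _ => by rw [hg, map_zero]), add_zero]
        rfl
      · rintro ⟨y, rfl⟩
        refine directSum_ext fun c => ?_
        rw [hp, hjS', C.g_inl, map_zero])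
  exact FinCell.of_cellExt he' hS

/-- The graded homomorphism from the sum of the cells. -/
noncomputable def Coords.desc (_ : Coords j n e) :
    (hom (directSum fun b => A.self.shift (-n b)) X').X 0 :=
  mkHom (fun _ _ h => dsSum fun b => hev h (cellHom (by omega) (e b))) (by
    intro p i k i' k' h h' hi hk a x
    induction x using directSum_induction with
    | zero => simp
    | of b y =>
      rw [← Hom.map_smul, dsSum_incl, dsSum_incl, hev_smul _ h h' hi hk]
    | add x y hx hy => simp only [map_add, smul_add, hx, hy])

lemma Coords.g_desc (C : Coords j n e) (b : ι) {k : ℤ} (y) :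
    (C.g b).app k (hev (add_zero k) C.desc y) = (dsProj _ b).app k y := by
  induction y using directSum_induction with
  | zero => simp only [map_zero]
  | add x y hx hy => simp only [map_add, hx, hy]
  | of c y =>
    rw [Coords.desc, hev_mkHom, dsSum_incl]
    by_cases hbc : c = b
    · subst hbc
      rw [C.g_cell, dsProj_incl_same]
    · rw [C.g_cell_other hbc, dsProj_incl_ne hbc]

/-- `X` is exhausted by finite cell submodules, and up to coboundaries homomorphisms from `L` with
coboundary in one of them take values in one of them. -/
def HasFinSubs (L X : DGMod A) : Prop :=
  ∃ 𝒥 : Set X.Sub, 𝒥.Nonempty ∧ (∀ S ∈ 𝒥, FinCell S.toDGMod) ∧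
    (∀ S ∈ 𝒥, ∀ (k : ℤ) (x : X.X k),
      ∃ S' ∈ 𝒥, (∀ i, S.carrier i ≤ S'.carrier i) ∧ x ∈ S'.carrier k) ∧
    ∀ S ∈ 𝒥, ∀ (q' q r : ℤ) (hq : q' + 1 = q) (hr : q + 1 = r) (f : (hom L X).X q),
      (∀ i k (h : i + r = k) x, hev h ((hom L X).d hr f) x ∈ S.carrier k) →
      ∃ S' ∈ 𝒥, (∀ i, S.carrier i ≤ S'.carrier i) ∧ ∃ h : (hom L X).X q',
        ∀ i k (hik : i + q = k) x, hev hik (f - (hom L X).d hq h) x ∈ S'.carrier k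

lemma IsTrivial.hasFinSubs (L : DGMod A) {X : DGMod A} (hX : X.IsTrivial) : HasFinSubs L X := by
  refine ⟨{Sub.total X}, ⟨_, rfl⟩, ?_, ?_, ?_⟩
  · rintro S rfl
    refine .trivial fun i x => Subtype.ext (hX i _)
  · rintro S rfl k x
    exact ⟨_, rfl, fun _ => le_rfl, _root_.trivial⟩
  · rintro S rfl q' q r hq hr f -
    exact ⟨_, rfl, fun _ => le_rfl, 0, fun _ _ _ _ => _root_.trivial⟩

lemma CellExt.hasFinSubs {L : DGMod A} (hL : Cpt L fun _ => True) (hj : CellExt j n e)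
    (hX : HasFinSubs L X) : HasFinSubs L X' := by
  classical
  obtain ⟨C⟩ := hj.nonempty_coords
  obtain ⟨𝒥, ⟨S₀, hS₀⟩, hfin, hcov, hhom⟩ := hX
  have henl : ∀ (T : Finset ι), ∀ S ∈ 𝒥, ∃ S' ∈ 𝒥, (∀ i, S.carrier i ≤ S'.carrier i) ∧
      ∀ b ∈ T, C.z b ∈ S'.carrier _ := by
    intro T
    induction T using Finset.induction_on with
    | empty => exact fun S hS => ⟨S, hS, fun _ => le_rfl, by simp⟩
    | insert b T hb ih =>
      intro S hS
      obtain ⟨S₁, hS₁, h₁, hT⟩ := ih S hS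
      obtain ⟨S₂, hS₂, h₂, hz⟩ := hcov S₁ hS₁ _ (C.z b)
      refine ⟨S₂, hS₂, fun i => (h₁ i).trans (h₂ i), fun c hc => ?_⟩
      rcases Finset.mem_insert.1 hc with rfl | hc
      · exact hz
      · exact h₂ _ (hT c hc)
  have hmono : ∀ {S S' : X.Sub} {T T' : Finset ι} (hT : ∀ b ∈ T, C.z b ∈ S.carrier _)
      (hT' : ∀ b ∈ T', C.z b ∈ S'.carrier _), (∀ i, S.carrier i ≤ S'.carrier i) → T ⊆ T' →
      ∀ i, (C.sub S T hT).carrier i ≤ (C.sub S' T' hT').carrier i :=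
    fun hT hT' hS hTT' i x hx => ⟨hS i hx.1, fun b hb => hx.2 b fun hb' => hb (hTT' hb')⟩
  refine ⟨{R | ∃ S ∈ 𝒥, ∃ T hT, R = C.sub S T hT}, ⟨_, S₀, hS₀, ∅, by simp, rfl⟩, ?_, ?_, ?_⟩
  · rintro _ ⟨S, hS, T, hT, rfl⟩
    exact C.finCell_sub S T hT (hfin S hS)
  · rintro _ ⟨S, hS, T, hT, rfl⟩ k x
    obtain ⟨s, hs, -⟩ := C.sum x
    obtain ⟨S₁, hS₁, h₁, hx⟩ := hcov S hS k (hev (add_zero k) C.ρ x)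
    obtain ⟨S₂, hS₂, h₂, hT₂⟩ := henl (T ∪ s) S₁ hS₁
    exact ⟨_, ⟨S₂, hS₂, T ∪ s, hT₂, rfl⟩,
      hmono _ _ (fun i => (h₁ i).trans (h₂ i)) Finset.subset_union_left,
      h₂ _ hx, fun b hb => hs b fun hb' => hb (Finset.mem_union_right _ hb')⟩
  · rintro _ ⟨S, hS, T, hT, rfl⟩ q' q r hq hr f hf
    let f' : ∀ b, (hom L (A.self.shift (-n b))).X q := fun b => (post L (C.g b)).app q f
    have hf' : LocFin f' := fun i k h x => by
      obtain ⟨s, hs, -⟩ := C.sum (hev h f x)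
      refine s.finite_toSet.subset fun b hb => ?_
      by_contra hbs
      exact hb ((hev_post _ _ _ _).trans (hs b hbs))
    have hf'd : ∀ b, b ∉ T → (hom L (A.self.shift (-n b))).d hr (f' b) = 0 := fun b hb => by
      rw [← Hom.map_d]
      refine DGMod.hom_ext fun i k hik x => ?_
      rw [hev_post, (hf i k hik x).2 b hb, map_zero, AddMonoidHom.zero_apply]
    obtain ⟨T₂, hT₂, h, hh, hhf⟩ := hL ι _ (fun _ => _root_.trivial) q' q hq _
      (hf'.ite (T : Set ι)) (fun b => by
        by_cases hb : b ∈ (T : Set ι)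
        · rw [if_pos hb, map_zero]
        · rw [if_neg hb, d_eq_zero_iff _ rfl hr]
          exact hf'd b hb)
    let T₁ : Finset ι := T ∪ hT₂.toFinset
    obtain ⟨F, hF⟩ := (hh.ite (T₁ : Set ι)).exists_hom
    let H : (hom L X').X q' := gcomp (add_zero q') C.desc F
    have hgH : ∀ b, (post L (C.g b)).app q' H = if b ∈ (T₁ : Set ι) then 0 else h b := fun b => by
      rw [← hF b]
      refine DGMod.hom_ext fun i k hik x => ?_
      rw [hev_post, hev_gcomp _ _ _ hik hik (add_zero k), C.g_desc, hev_post]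
    obtain ⟨f₁, hf₁⟩ : ∃ f₁, f₁ = f - (hom L X').d hq H := ⟨_, rfl⟩
    have hgf₁ : ∀ b, b ∉ T₁ → (post L (C.g b)).app q f₁ = 0 := fun b hb => by
      have h₁ : b ∉ T := fun h => hb (Finset.mem_union_left _ h)
      have h₂ : b ∉ T₂ := fun h => hb (Finset.mem_union_right _ (hT₂.mem_toFinset.2 h))
      rw [hf₁, map_sub, Hom.map_d, hgH, if_neg (by exact_mod_cast hb), hhf b h₂,
        if_neg (by exact_mod_cast h₁), sub_self]
    have hgf₁' : ∀ b, b ∉ T₁ → ∀ {i k : ℤ} (hik : i + q = k) x, (C.g b).app k (hev hik f₁ x) = 0 :=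
      fun b hb i k hik x => by
        rw [← hev_post, hgf₁ b hb, map_zero, AddMonoidHom.zero_apply]
    have hdf₁ : (hom L X').d hr f₁ = (hom L X').d hr f := by
      rw [hf₁, map_sub, d_d, sub_zero]
    obtain ⟨S₁, hS₁, hSS₁, hz⟩ := henl T₁ S hS
    obtain ⟨S₂, hS₂, hSS₂, h₃, hh₃⟩ := hhom S₁ hS₁ q' q r hq hr (gcomp (add_zero q) C.ρ f₁)
      (fun i k hik x => by
        have h₁ := hSS₁ _ (hf i k hik x).1
        rw [← hdf₁, d_hev hr _ hik rfl (by omega) rfl (by omega), map_sub, map_zsmul] at h₁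
        have h₂ := C.ρ_d_sub_mem S₁ T₁ hz (by omega : i + q + 1 = k) (hev rfl f₁ x)
          (fun b hb => hgf₁' b hb rfl x)
        rw [d_hev hr _ hik rfl (by omega) rfl (by omega), hev_gcomp _ _ _ rfl rfl (add_zero _),
          hev_gcomp _ _ _ _ (by omega) (add_zero k)]
        have := sub_mem h₁ h₂
        rwa [sub_sub_sub_cancel_left] at this)
    have hz₂ : ∀ b ∈ T₁, C.z b ∈ S₂.carrier _ := fun b hb => hSS₂ _ (hz b hb)
    refine ⟨_, ⟨S₂, hS₂, T₁, hz₂, rfl⟩, hmono hT hz₂ (fun i => (hSS₁ i).trans (hSS₂ i))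
      Finset.subset_union_left, H + (post L j).app q' h₃, fun i k hik x => ?_⟩
    rw [map_add, ← sub_sub, ← hf₁, ← Hom.map_d]
    have hx := hh₃ i k hik x
    rw [map_sub, AddMonoidHom.sub_apply] at hx ⊢
    rw [hev_gcomp _ _ _ hik hik (add_zero k)] at hx
    rw [hev_post]
    refine ⟨?_, fun b hb => ?_⟩
    · rw [map_sub, C.ρ_inl]
      exact hx
    · rw [map_sub, hgf₁' b hb, C.g_inl, sub_zero]

lemma IsCellTower.hasFinSubs {F : ℕ ⥤ DGMod A} (hF : IsCellTower F) {L : DGMod A}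
    (hL : Cpt L fun _ => True) (n : ℕ) : HasFinSubs L (F.obj n) := by
  induction n with
  | zero => exact hF.zero.hasFinSubs L
  | succ n ih =>
    obtain ⟨ι, m, e, he⟩ := hF.step n
    exact he.hasFinSubs hL ih

lemma IsCompactObject.exists_finCell {P : DGMod A} (hP : P.IsCompactObject) :
    ∃ (L G : DGMod A) (g : L ⟶ P) (u : L ⟶ G) (v : G ⟶ L), Cofib L ∧ quasiIso A g ∧ FinCell G ∧
      Null (u ≫ v - 𝟙 L) := by
  obtain ⟨F, g, hF, hg⟩ := exists_cellTower P
  have hL : Cofib (seqColim F) := hF.cofib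
  have hc := hP.cpt hL.isKProjective hg
  obtain ⟨n, v, hv⟩ := hF.exists_retract_stage hc
  obtain ⟨𝒥, ⟨S₀, hS₀⟩, hfin, -, hhom⟩ := hF.hasFinSubs hc n
  obtain ⟨S, hS, -, h, hh⟩ := hhom S₀ hS₀ (-1) 0 1 (by norm_num) (by norm_num) (toHom v)
    (fun i k hik x => by
      rw [d_toHom, map_zero, AddMonoidHom.zero_apply]
      exact zero_mem _)
  let w : seqColim F ⟶ F.obj n := ofHom (toHom v - (hom _ _).d (by norm_num) h) (by
    rw [map_sub, d_toHom, d_d, sub_zero])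
  have hw : Null (w - v) := ⟨-h, by
    rw [toHom_sub, toHom_ofHom, map_neg, sub_sub_cancel_left]⟩
  obtain ⟨w', hw'⟩ := exists_factor_of_injective S.incl (fun i => Subtype.val_injective) w
    (fun i x => ⟨⟨_, hh i i (add_zero i) x⟩, rfl⟩)
  refine ⟨_, S.toDGMod, g, w', S.incl ≫ seqIncl F n, hL, hg, hfin S hS, ?_⟩
  rw [← Category.assoc, hw']
  exact (hw.post_sub _).trans hv

end FiniteSubcomplexes

section TensorFunctoriality

variable {L L' M M' N : DGMod A}

/-- The components of `tensLeft`. -/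
def tensLeftApp (N : DGMod A) {q : ℤ} (f : (hom M M').X q) {k l : ℤ} (hkl : k + q = l) :
    (tens M N).X k →+ (tens M' N).X l :=
  tensLift (fun i j hij m n => tmk (by omega : (i + q) + j = l) (hev rfl f m) n)
    (by intros; simp) (by intros; simp) (by
      intro p i j pi pj hi hj h h' a m n
      rw [map_zsmul, map_zsmul, AddMonoidHom.smul_apply,
        hev_smul f (rfl : i + q = i + q) rfl hi (by omega : p + (i + q) = pi + q), map_zsmul,
        AddMonoidHom.smul_apply, tmk_balance _ hj _ (by omega), smul_smul, smul_smul, ← sgn_add,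
        ← sgn_add, sgn_even, _root_.one_smul]
      exact ⟨i * p + q * p, by ring⟩)

lemma tensLeftApp_tmk {q i j k l iq : ℤ} (f : (hom M M').X q) (hkl : k + q = l) (hij : i + j = k)
    (hi : i + q = iq) (h : iq + j = l) (m : M.X i) (n : N.X j) :
    tensLeftApp N f hkl (tmk hij m n) = tmk h (hev hi f m) n := by
  subst hi
  exact tensLift_tmk _ _ _ _ hij m n

/-- The functoriality of the tensor product in graded homomorphisms of the left factor. -/
def tensLeft (N : DGMod A) {q : ℤ} (f : (hom M M').X q) : (hom (tens M N) (tens M' N)).X q :=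
  mkHom (fun _ _ hkl => tensLeftApp N f hkl) (by
    intro p k l k' l' h h' hk hl a t
    have : (tensLeftApp N f h').comp ((tens M N).smul hk a) =
        sgn (q * p) • ((tens M' N).smul hl a).comp (tensLeftApp N f h) :=
      tens_hom_ext fun i j hij m n => by
        rw [AddMonoidHom.comp_apply, AddMonoidHom.smul_apply, AddMonoidHom.comp_apply,
          smul_tmk hk a hij rfl (by omega), tensLeftApp_tmk f h' _ rfl (by omega),
          tensLeftApp_tmk f h _ rfl (by omega),
          smul_tmk hl a _ (by omega : p + (i + q) = p + i + q) (by omega),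
          hev_smul f rfl rfl rfl (by omega), map_zsmul, AddMonoidHom.smul_apply]
    exact DFunLike.congr_fun this t)

lemma hev_tensLeft {q i j k l iq : ℤ} (f : (hom M M').X q) (hkl : k + q = l) (hij : i + j = k)
    (hi : i + q = iq) (h : iq + j = l) (m : M.X i) (n : N.X j) :
    hev hkl (tensLeft N f) (tmk hij m n) = tmk h (hev hi f m) n := by
  rw [tensLeft, hev_mkHom, tensLeftApp_tmk f hkl hij hi h]

lemma tens_induction {k : ℤ} {P : (tens M N).X k → Prop} (t : (tens M N).X k)
    (mk : ∀ (i j : ℤ) (h : i + j = k) (m : M.X i) (n : N.X j), P (tmk h m n))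
    (add : ∀ x y, P x → P y → P (x + y)) : P t :=
  T.induction (CommDGRing.Hom.id A) (P := P) t mk add

lemma tens_hom_hom_ext {P : DGMod A} {q : ℤ} {f g : (hom (tens M N) P).X q}
    (h : ∀ (i j k l : ℤ) (hij : i + j = k) (hkl : k + q = l) (m : M.X i) (n : N.X j),
      hev hkl f (tmk hij m n) = hev hkl g (tmk hij m n)) : f = g :=
  hom_ext fun k l hkl t => DFunLike.congr_fun
    (tens_hom_ext fun i j hij m n => h i j k l hij hkl m n) t

lemma tensLeft_sub {q : ℤ} (f g : (hom M M').X q) :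
    tensLeft N (f - g) = tensLeft N f - tensLeft N g :=
  tens_hom_hom_ext fun i j k l hij hkl m n => by
    rw [map_sub, AddMonoidHom.sub_apply, hev_tensLeft _ _ _ rfl (by omega),
      hev_tensLeft _ _ _ rfl (by omega), hev_tensLeft _ _ _ rfl (by omega), map_sub,
      AddMonoidHom.sub_apply, map_sub, AddMonoidHom.sub_apply]

lemma tensLeft_zero {q : ℤ} : tensLeft N (0 : (hom M M').X q) = 0 := by
  have := tensLeft_sub (N := N) (0 : (hom M M').X q) 0
  rwa [sub_self, sub_self] at this

lemma d_tensLeft {q r : ℤ} (h : q + 1 = r) (f : (hom M M').X q) :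
    (hom (tens M N) (tens M' N)).d h (tensLeft N f) = tensLeft N ((hom M M').d h f) :=
  tens_hom_hom_ext fun i j k l hij hkl m n => by
    have e : sgn q * sgn i = sgn (i + q) := by rw [← sgn_add, add_comm]
    rw [d_hev h _ hkl rfl (by omega) rfl (by omega), hev_tensLeft _ _ _ rfl (by omega),
      hev_tensLeft _ _ _ rfl (by omega), d_tmk rfl hij rfl rfl (by omega) (by omega), map_add,
      map_zsmul, hev_tensLeft _ _ _ (by omega : i + 1 + q = i + r) (by omega),
      hev_tensLeft _ _ _ (rfl : i + q = i + q) (by omega),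
      d_tmk _ _ (by omega : i + q + 1 = i + r) rfl (by omega) (by omega),
      d_hev h f rfl rfl (by omega : i + q + 1 = i + r) rfl (by omega), map_sub,
      AddMonoidHom.sub_apply, map_zsmul, AddMonoidHom.smul_apply, smul_add, smul_smul, e]
    abel

/-- The functoriality of the tensor product in the left factor. -/
def tensMap (f : M ⟶ M') (N : DGMod A) : tens M N ⟶ tens M' N :=
  ofHom (tensLeft N (toHom f)) (by
    rw [d_tensLeft, d_toHom, tensLeft_zero])

lemma tensMap_tmk (f : M ⟶ M') {i j k : ℤ} (h : i + j = k) (m : M.X i) (n : N.X j) :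
    (tensMap f N).app k (tmk h m n) = tmk h (f.app i m) n := by
  rw [tensMap, ofHom_app, hev_tensLeft _ _ _ (add_zero i) h, hev_toHom]

lemma tens_dg_hom_ext {P : DGMod A} {f g : tens M N ⟶ P}
    (h : ∀ (i j k : ℤ) (hij : i + j = k) (m : M.X i) (n : N.X j),
      f.app k (tmk hij m n) = g.app k (tmk hij m n)) : f = g :=
  hom_ext_app fun k t => DFunLike.congr_fun (tens_hom_ext fun i j hij m n => h i j k hij m n) t

lemma Null.tensMap {f : M ⟶ M'} (hf : Null f) (N : DGMod A) : Null (tensMap f N) := by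
  obtain ⟨h, hh⟩ := hf
  exact ⟨tensLeft N h, by rw [d_tensLeft, hh, DGMod.tensMap, toHom_ofHom]⟩

/-- Precomposition with a homomorphism. -/
def preComp (u : L ⟶ L') (M : DGMod A) : hom L' M ⟶ hom L M :=
  { app := fun n => AddMonoidHom.mk' (fun φ => gcomp (zero_add n) φ (toHom u))
      (fun φ ψ => by rw [map_add, AddMonoidHom.add_apply])
    map_smul := fun {p n k} h a φ => hom_ext fun i j hij x => by
      simp only [AddMonoidHom.mk'_apply]
      rw [hev_gcomp_toHom _ _ _ hij hij, smul_hev h a φ hij rfl (by omega),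
        smul_hev h a _ hij rfl (by omega), hev_gcomp_toHom _ _ _ _ rfl]
    map_d := fun h φ => (d_gcomp_toHom (zero_add _) (zero_add _) h φ u).symm }

lemma hev_preComp (u : L ⟶ L') {n i j : ℤ} (h : i + n = j) (φ : (hom L' M).X n) (x : L.X i) :
    hev h ((preComp u M).app n φ) x = hev h φ (u.app i x) :=
  hev_gcomp_toHom (zero_add n) _ _ h h x

lemma Null.preComp {w : L ⟶ L'} (hw : Null w) (M : DGMod A) : Null (preComp w M) := by
  obtain ⟨s, hs⟩ := hw
  refine ⟨mkHom (fun q r h => sgn q • AddMonoidHom.mk' (fun φ => gcomp (by omega) φ s)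
    (fun φ ψ => by rw [map_add, AddMonoidHom.add_apply])) ?_, ?_⟩
  · intro p i j i' j' h h' hi hj a φ
    refine hom_ext fun k l hkl x => ?_
    simp only [AddMonoidHom.smul_apply, AddMonoidHom.mk'_apply, map_zsmul]
    rw [smul_hev hj a _ hkl rfl (by omega), hev_gcomp _ _ _ hkl rfl (by omega),
      smul_hev hi a φ _ (by omega : k + -1 + i = k + j) (by omega), hev_gcomp _ _ _ rfl rfl (by omega),
      smul_smul, ← sgn_add]
    congr 1
    apply sgn_congr; subst hi; exact ⟨p, by ring⟩
  · refine hom_ext fun q r h φ => ?_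
    obtain rfl : q = r := by omega
    rw [hev_toHom, d_hev _ _ h rfl (by omega) rfl (by omega)]
    simp only [hev_mkHom, AddMonoidHom.smul_apply, AddMonoidHom.mk'_apply, map_zsmul]
    rw [d_gcomp _ rfl (by omega : (-1 : ℤ) + 1 = 0) _ (by omega) (by omega), hs, smul_add,
      smul_smul, sgn_mul_self, _root_.one_smul, sgn_odd (by decide : Odd (-1 : ℤ)), sgn_add,
      sgn_one]
    simp only [mul_neg, mul_one, neg_smul, _root_.one_smul, sub_neg_eq_add]
    rw [add_comm (sgn q • _), add_assoc, add_neg_cancel, add_zero]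
    rfl

lemma quasiIso_of_retract {X Y X' Y' : DGMod A} {f : X ⟶ Y} {f' : X' ⟶ Y'} {u : X ⟶ X'}
    {v : X' ⟶ X} {u' : Y ⟶ Y'} {v' : Y' ⟶ Y} (hu : f ≫ u' = u ≫ f') (hv : f' ≫ v' = v ≫ f)
    (huv : Null (u ≫ v - 𝟙 X)) (huv' : Null (u' ≫ v' - 𝟙 Y)) (hf' : quasiIso A f') :
    quasiIso A f := by
  have := isIso_of_quasiIso hf'
  have h₁ := Q_map_eq_of_null huv
  have h₂ := Q_map_eq_of_null huv'
  simp only [Functor.map_comp, CategoryTheory.Functor.map_id] at h₁ h₂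
  refine quasiIso_of_isIso ⟨(Q A).map u' ≫ inv ((Q A).map f') ≫ (Q A).map v, ?_, ?_⟩
  · rw [← Category.assoc, ← Functor.map_comp, hu, Functor.map_comp, Category.assoc,
      IsIso.hom_inv_id_assoc, h₁]
  · rw [Category.assoc, Category.assoc, ← Functor.map_comp, ← hv, Functor.map_comp,
      IsIso.inv_hom_id_assoc, h₂]

end TensorFunctoriality

section TensorEvaluation

variable {L G M N : DGMod A}

lemma hev_tensorEval {i j k s t s' : ℤ} (h : i + j = k) (α : (hom L M).X i) (n : N.X j)
    (hst : s + k = t) (hs : s + i = s') (h' : s' + j = t) (l : L.X s) :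
    hev hst ((tensorEval L M N).app k (tmk h α n)) l = sgn (j * s) • tmk h' (hev hs α l) n := by
  change hev hst (evalApp L M N k (tmk h α n)) l = _
  rw [evalApp_tmk, hev_evalMk L M N h α n hst hs h']

lemma tensorEval_natural {L' : DGMod A} (u : L ⟶ L') (M N : DGMod A) :
    tensorEval L' M N ≫ preComp u (tens M N) = tensMap (preComp u M) N ≫ tensorEval L M N :=
  tens_dg_hom_ext fun i j k hij α n => hom_ext fun s t hst x => by
    rw [comp_app, comp_app, hev_preComp, hev_tensorEval hij α n hst rfl (by omega), tensMap_tmk,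
      hev_tensorEval hij _ n hst rfl (by omega), hev_preComp]

/-- The homomorphism that sends a basis element to `m` and the others to zero. -/
def FinBasis.single (C : FinBasis G) (b : C.ι) {r q : ℤ} (h : q + C.n b = r) :
    M.X r →+ (hom G M).X q :=
  AddMonoidHom.mk' (fun m => mkHom (fun i j hij => AddMonoidHom.mk' (fun x =>
      sgn (q * (i - C.n b)) • M.smul (by omega : i - C.n b + r = j)
        (C.c b (sub_add_cancel i (C.n b)) x) m) (fun x y => by
          rw [map_add, map_add, AddMonoidHom.add_apply, smul_add])) (by
    intro p i j i' j' hij hij' hi hj a x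
    simp only [AddMonoidHom.mk'_apply]
    rw [C.c_smul b (sub_add_cancel i (C.n b)) hi (by omega : p + (i - C.n b) = i' - C.n b),
      M.mul_smul _ _ (by omega : i - C.n b + r = j) hj, map_zsmul, smul_smul, ← sgn_add]
    congr 1
    apply sgn_congr; subst hi; exact ⟨0, by ring⟩)) (fun m m' => hom_ext fun i j hij x => by
      rw [map_add, AddMonoidHom.add_apply]
      simp only [hev_mkHom, AddMonoidHom.mk'_apply, map_add, smul_add])

lemma FinBasis.hev_single (C : FinBasis G) (b : C.ι) {r q i j p : ℤ} (h : q + C.n b = r)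
    (hij : i + q = j) (hp : p + C.n b = i) (hpr : p + r = j) (m : M.X r) (x : G.X i) :
    hev hij (C.single b h m) x = sgn (q * p) • M.smul hpr (C.c b hp x) m := by
  obtain rfl : p = i - C.n b := by omega
  rfl

lemma FinBasis.sum_single (C : FinBasis G) {q : ℤ} (α : (hom G M).X q) :
    let _ := C.fintype
    ∑ b, C.single b rfl (hev (add_comm (C.n b) q) α (C.e b)) = α := by
  let _ := C.fintype
  refine hom_ext fun i j hij x => ?_
  rw [map_sum, AddMonoidHom.finsetSum_apply]
  conv_rhs => rw [← C.sum x, map_sum]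
  refine Finset.sum_congr rfl fun b _ => ?_
  rw [C.hev_single b rfl hij (sub_add_cancel i (C.n b)) (by omega),
    hev_smul α (add_comm (C.n b) q) hij _ (by omega)]

lemma FinBasis.single_smul (C : FinBasis G) (b : C.ι) {p r q pr pq : ℤ} (h : q + C.n b = r)
    (h' : pq + C.n b = pr) (hr : p + r = pr) (hq : p + q = pq) (a : A.X p) (m : M.X r) :
    C.single b h' (M.smul hr a m) = (hom G M).smul hq a (C.single b h m) :=
  hom_ext fun i j hij x => by
    obtain ⟨s, hs⟩ : ∃ s, s + C.n b = i := ⟨i - C.n b, by omega⟩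
    rw [smul_hev hq a _ hij rfl (by omega), C.hev_single b h' hij hs (by omega),
      C.hev_single b h rfl hs (by omega), map_zsmul,
      ← M.mul_smul (rfl : s + p = s + p) (by omega) hr, A.comm (by omega : p + s = s + p),
      map_zsmul, AddMonoidHom.smul_apply, M.mul_smul _ _ (by omega : s + r = i + q) (by omega),
      smul_smul, ← sgn_add]
    congr 1
    apply sgn_congr; subst hq; exact ⟨p * s, by ring⟩

/-- The contribution of a basis element to the inverse of the tensor-evaluation homomorphism. -/
def FinBasis.evalInvApp (C : FinBasis G) (M N : DGMod A) (b : C.ι) {k l : ℤ} (h : l + C.n b = k) :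
    (tens M N).X k →+ (tens (hom G M) N).X l :=
  tensLift (fun i j hij m n => sgn (j * C.n b) •
      tmk (by omega : (i - C.n b) + j = l) (C.single b (sub_add_cancel i (C.n b)) m) n)
    (by intros; simp) (by intros; simp) (by
      intro p i j pi pj hi hj h h' a m n
      rw [map_zsmul, C.single_smul b (sub_add_cancel i (C.n b)) _ hi (by omega), map_zsmul,
        AddMonoidHom.smul_apply, tmk_balance _ hj _ (by omega), smul_smul, smul_smul, ← sgn_add,
        ← sgn_add]
      congr 1
      apply sgn_congr; subst hj; simp only [parity_simps]; tauto)

lemma FinBasis.evalInvApp_tmk (C : FinBasis G) (b : C.ι) {i j k l q : ℤ} (h : l + C.n b = k)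
    (hij : i + j = k) (hq : q + C.n b = i) (hqj : q + j = l) (m : M.X i) (n : N.X j) :
    C.evalInvApp M N b h (tmk hij m n) = sgn (j * C.n b) • tmk hqj (C.single b hq m) n := by
  obtain rfl : q = i - C.n b := by omega
  exact tensLift_tmk _ _ _ _ hij m n

lemma FinBasis.tensorEval_evalInvApp (C : FinBasis G) (b : C.ι) {k l s t p : ℤ}
    (h : l + C.n b = k) (hst : s + l = t) (hp : p + C.n b = s) (hpt : p + k = t)
    (y : (tens M N).X k) (x : G.X s) :
    hev hst ((tensorEval G M N).app l (C.evalInvApp M N b h y)) x =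
      sgn (l * p) • (tens M N).smul hpt (C.c b hp x) y := by
  refine DFunLike.congr_fun (f := ((hev hst).flip x).comp (((tensorEval G M N).app l).comp
    (C.evalInvApp M N b h))) (g := sgn (l * p) • (tens M N).smul hpt (C.c b hp x))
    (tens_hom_ext fun i j hij m n => ?_) y
  obtain ⟨q, hq⟩ : ∃ q, q + C.n b = i := ⟨i - C.n b, by omega⟩
  rw [AddMonoidHom.comp_apply, AddMonoidHom.comp_apply, AddMonoidHom.smul_apply,
    AddMonoidHom.flip_apply, C.evalInvApp_tmk b h hij hq (by omega), map_zsmul, map_zsmul,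
    AddMonoidHom.smul_apply, hev_tensorEval _ _ n hst rfl (by omega), C.hev_single b hq _ hp
    (by omega : p + i = s + q), smul_tmk hpt _ hij (by omega : p + i = s + q) (by omega), map_zsmul, AddMonoidHom.smul_apply,
    smul_smul, smul_smul, ← sgn_add, ← sgn_add]
  congr 1
  apply sgn_congr
  obtain rfl : l = q + j := by omega
  subst hp
  exact ⟨j * C.n b, by ring⟩

lemma FinBasis.tensorEval_bijective (C : FinBasis G) (M N : DGMod A) (k : ℤ) :
    Function.Bijective ((tensorEval G M N).app k) := by
  let _ := C.fintype
  refine Function.bijective_iff_has_inverse.2 ⟨fun φ => ∑ b, C.evalInvApp M N b (add_comm k (C.n b))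
    (hev rfl φ (C.e b)), fun t => ?_, fun φ => hom_ext fun i j hij x => ?_⟩
  · let s : (hom G (tens M N)).X k →+ (tens (hom G M) N).X k :=
      ∑ b, (C.evalInvApp M N b (add_comm k (C.n b))).comp ((hev rfl).flip (C.e b))
    have hs : ∀ φ, s φ = ∑ b, C.evalInvApp M N b (add_comm k (C.n b)) (hev rfl φ (C.e b)) :=
      fun φ => by
        simp only [s, AddMonoidHom.finsetSum_apply]
        rfl
    change ∑ b, C.evalInvApp M N b (add_comm k (C.n b)) (hev rfl _ (C.e b)) = t
    rw [← hs]
    refine DFunLike.congr_fun (f := s.comp ((tensorEval G M N).app k)) (g := AddMonoidHom.id _)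
      (tens_hom_ext fun i j hij α n => ?_) t
    rw [AddMonoidHom.comp_apply, hs, AddMonoidHom.id_apply]
    conv_rhs => rw [← C.sum_single α, map_sum, AddMonoidHom.finsetSum_apply]
    refine Finset.sum_congr rfl fun b _ => ?_
    rw [hev_tensorEval hij α n _ (add_comm (C.n b) i) (by omega), map_zsmul,
      C.evalInvApp_tmk b _ _ rfl hij, smul_smul, sgn_mul_self, _root_.one_smul]
  · change hev hij ((tensorEval G M N).app k (∑ b, _)) x = _
    rw [map_sum, map_sum, AddMonoidHom.finsetSum_apply]
    conv_rhs => rw [← C.sum x, map_sum]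
    refine Finset.sum_congr rfl fun b _ => ?_
    rw [C.tensorEval_evalInvApp b _ hij (sub_add_cancel i (C.n b)) (by omega),
      hev_smul φ rfl hij _ (by omega)]

end TensorEvaluation

lemma Null.preComp_retract {u : L ⟶ G} {v : G ⟶ L} (huv : Null (u ≫ v - 𝟙 L)) (M : DGMod A) :
    Null (DGMod.preComp v M ≫ DGMod.preComp u M - 𝟙 (hom L M)) := by
  convert huv.preComp M using 1
  refine hom_ext_app fun n φ => hom_ext fun i j hij x => ?_
  rw [hev_preComp, sub_app, sub_app, comp_app, id_app, map_sub, map_sub, AddMonoidHom.sub_apply,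
    hev_preComp, hev_preComp, comp_app, id_app]

/-- `P` is a retract in the homotopy category, after a resolution, of a finite cell module. -/
def IsFinCellRetract (P : DGMod A) : Prop :=
  ∃ (L G : DGMod A) (g : L ⟶ P) (u : L ⟶ G) (v : G ⟶ L), Cofib L ∧ quasiIso A g ∧ FinCell G ∧
    Null (u ≫ v - 𝟙 L)

lemma IsFinCellRetract.isAlgebraicallyPerfect {P : DGMod A} (hP : P.IsFinCellRetract) :
    P.IsAlgebraicallyPerfect := by
  obtain ⟨L, G, g, u, v, -, hg, hG, huv⟩ := hP
  have := isIso_of_quasiIso hg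
  exact (hG.isAlgebraicallyPerfect.summand (retractOfNull huv)).of_iso (asIso ((Q A).map g))

lemma IsFinCellRetract.isTensorEvalInvertible {P : DGMod A} (hP : P.IsFinCellRetract) :
    P.IsTensorEvalInvertible := by
  obtain ⟨L, G, g, u, v, hL, hg, hG, huv⟩ := hP
  intro M N
  obtain ⟨F, f, hF, hf⟩ := exists_cofib_resolution N
  obtain ⟨C⟩ := hG.nonempty_finBasis
  refine ⟨⟨L, g, hg, hL.isKProjective⟩, ⟨F, f, hf, hF.isKProjective.isKFlat⟩, isIso_of_quasiIso ?_⟩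
  refine quasiIso_of_retract (tensorEval_natural v M F) (tensorEval_natural u M F).symm.symm ?_
    (huv.preComp_retract _) (quasiIso_of_bijective _ (C.tensorEval_bijective M F))
  convert (huv.preComp_retract M).tensMap F using 1
  refine tens_dg_hom_ext fun i j k hij m n => ?_
  rw [tensMap_tmk, sub_app, sub_app, comp_app, comp_app, tensMap_tmk, tensMap_tmk, id_app, id_app,
    map_sub, AddMonoidHom.sub_apply]

/-- The elements of `A`, viewed as elements of the DG module `A`. -/
def toSelf {i : ℤ} : A.X i →+ A.self.X i := AddMonoidHom.id _

/-- The elements of the DG module `A`, viewed as elements of `A`. -/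
def ofSelf {i : ℤ} : A.self.X i →+ A.X i := AddMonoidHom.id _

@[simp] lemma ofSelf_toSelf {i : ℤ} (a : A.X i) : ofSelf (toSelf a) = a := rfl

@[simp] lemma toSelf_ofSelf {i : ℤ} (a : A.self.X i) : toSelf (ofSelf a) = a := rfl

lemma smul_toSelf {p i k : ℤ} (h : p + i = k) (a : A.X p) (b : A.X i) :
    A.self.smul h a (toSelf b) = toSelf (A.mul h a b) := rfl

lemma ofSelf_smul {p i k : ℤ} (h : p + i = k) (a : A.X p) (b : A.self.X i) :
    ofSelf (A.self.smul h a b) = A.mul h a (ofSelf b) := rfl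

lemma ofSelf_d {i k : ℤ} (h : i + 1 = k) (b : A.self.X i) :
    ofSelf (A.self.d h b) = A.d h (ofSelf b) := rfl

lemma smul_toSelf_one {p : ℤ} (h : p + 0 = p) (a : A.self.X p) :
    A.self.smul h (ofSelf a) (toSelf A.one) = a := by
  rw [smul_toSelf, mul_one', toSelf_ofSelf]

/-- The action `A ⊗ M ⟶ M`. -/
def tensSelf (M : DGMod A) : tens A.self M ⟶ M :=
  tensHom (fun _ _ _ h => (M.smul h).comp ofSelf)
    (fun p i j pi pj k hi hj h h' a b m => by
      rw [AddMonoidHom.comp_apply, AddMonoidHom.comp_apply, ofSelf_smul,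
        A.comm (by omega : i + p = pi) hi (ofSelf b) a, map_zsmul, AddMonoidHom.smul_apply,
        M.mul_smul _ _ hj h'])
    (fun p i j k pi pk h hi hk h' a b m => M.mul_smul _ _ _ _ a (ofSelf b) m)
    (fun i j k i' j' k' h hi hj hk h₁ h₂ b m => M.leibniz h hi hj hk h₁ h₂ (ofSelf b) m)

lemma tensSelf_tmk (M : DGMod A) {i j k : ℤ} (h : i + j = k) (a : A.self.X i)
    (m : M.X j) : (tensSelf M).app k (tmk h a m) = M.smul h (ofSelf a) m :=
  tensHom_tmk _ _ _ _ h (M := A.self) a m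

lemma exists_eq_tmk_one {M : DGMod A} {k : ℤ} (t : (tens A.self M).X k) :
    ∃ m : M.X k, t = tmk (zero_add k) (toSelf A.one) m := by
  induction t using tens_induction with
  | mk i j h a m =>
    refine ⟨M.smul h (ofSelf a) m, ?_⟩
    have h₁ := tmk_balance (M := A.self) (add_zero i) h h (zero_add k) (ofSelf a)
      (toSelf A.one) m
    rwa [smul_toSelf_one, zero_mul, sgn_zero, _root_.one_smul] at h₁
  | add x y hx hy =>
    obtain ⟨m, rfl⟩ := hx
    obtain ⟨m', rfl⟩ := hy
    exact ⟨m + m', (map_add _ _ _).symm⟩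

lemma tensSelf_bijective (M : DGMod A) (k : ℤ) : Function.Bijective ((tensSelf M).app k) := by
  refine ⟨(injective_iff_map_eq_zero _).2 fun t ht => ?_,
    fun m => ⟨tmk (zero_add k) (toSelf A.one) m, ?_⟩⟩
  · obtain ⟨m, rfl⟩ := exists_eq_tmk_one t
    rw [tensSelf_tmk, ofSelf_toSelf, M.one_smul] at ht
    rw [ht, map_zero]
  · rw [tensSelf_tmk, ofSelf_toSelf, M.one_smul]

lemma IsTensorEvalInvertible.isCompactObject {P : DGMod A} (hP : P.IsTensorEvalInvertible) :
    P.IsCompactObject := by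
  classical
  intro ι N f
  obtain ⟨⟨L, g, hg, hL⟩, ⟨F, s, hs, hF⟩, hε⟩ := hP A.self (directSum N)
  have hε' := quasiIso_of_isIso hε
  have hgi : IsIso ((Q A).map g) := isIso_of_quasiIso hg
  obtain ⟨f₀, hf₀⟩ := exists_Q_map_eq hL ((Q A).map g ≫ f)
  have hμ : quasiIso A (tensSelf F ≫ s) :=
    quasiIso_comp (quasiIso_of_bijective _ (tensSelf_bijective F)) hs
  obtain ⟨f₁, hf₁⟩ := exists_lift_null _ hL hμ f₀
  obtain ⟨t, y, ht, hty⟩ := exists_of_quasiIso hε' (by norm_num : (-1 : ℤ) + 1 = 0) rfl (toHom f₁)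
    (d_toHom _ _)
  let f₂ : L ⟶ tens A.self F := ofHom ((tensorEval L A.self F).app 0 t) (by
    rw [← Hom.map_d, ht, map_zero])
  have hf₂ : Null (f₂ - f₁) := ⟨y, by rw [toHom_sub, toHom_ofHom, hty, add_sub_cancel_left]⟩
  have key : ∀ (k : ℤ) (t : (tens (hom L A.self) F).X k), ∃ T : Finset ι, ∀ z, z ∉ T →
      ∀ (i j : ℤ) (hij : i + k = j) (x : L.X i), (dsProj N z).app j ((tensSelf F ≫ s).app j
        (hev hij ((tensorEval L A.self F).app k t) x)) = 0 := fun k t => by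
    induction t using tens_induction with
    | mk p q h α n =>
      refine ⟨(finite_dsProj (s.app q n)).toFinset, fun z hz i j hij x => ?_⟩
      rw [Set.Finite.mem_toFinset, Set.mem_ofPred_eq, not_not] at hz
      rw [hev_tensorEval h α n hij rfl (by omega), map_zsmul, map_zsmul, comp_app, tensSelf_tmk,
        Hom.map_smul, Hom.map_smul, hz, map_zero, smul_zero]
    | add t t' ht ht' =>
      obtain ⟨T, hT⟩ := ht
      obtain ⟨T', hT'⟩ := ht'
      refine ⟨T ∪ T', fun z hz i j hij x => ?_⟩
      rw [Finset.mem_union, not_or] at hz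
      rw [map_add, map_add, AddMonoidHom.add_apply, map_add, map_add, hT z hz.1, hT' z hz.2,
        add_zero]
  obtain ⟨T, hT⟩ := key 0 t
  obtain ⟨g₁, hg₁⟩ := exists_factor_directSumIncl T (f₂ ≫ tensSelf F ≫ s) (fun z hz =>
    hom_ext_app fun i x => hT z hz i i (add_zero i) x)
  refine ⟨T, inv ((Q A).map g) ≫ (Q A).map g₁, ?_⟩
  rw [Category.assoc, ← Functor.map_comp, hg₁,
    Q_map_eq_of_null ((hf₂.post_sub (tensSelf F ≫ s)).trans hf₁), hf₀, IsIso.inv_hom_id_assoc]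

/-! ### Restriction and extension of scalars -/

section Scalars

variable {B : CommDGRing.{u}} (φ : A.Hom B)

/-- The restriction of scalars of a DG module along a homomorphism of DG rings. -/
def res (N : DGMod B) : DGMod A where
  X := N.X
  smul h := (N.smul h).comp (φ.app _)
  d := N.d
  one_smul h m := by
    rw [AddMonoidHom.comp_apply, φ.map_one, N.one_smul]
  mul_smul h₁ h₂ h₃ h₄ a b m := by
    rw [AddMonoidHom.comp_apply, φ.map_mul]
    exact N.mul_smul _ _ _ _ _ _ _
  d_d := N.d_d
  leibniz h hi hj hk h₁ h₂ a m := by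
    rw [AddMonoidHom.comp_apply, N.leibniz h hi hj hk h₁ h₂, ← φ.map_d]
    rfl

variable {φ} {M N : DGMod B} {K L L' : DGMod A}

/-- The elements of a restriction of scalars. -/
def toRes {i : ℤ} : N.X i →+ (res φ N).X i := AddMonoidHom.id _

/-- The elements of a restriction of scalars. -/
def ofRes {i : ℤ} : (res φ N).X i →+ N.X i := AddMonoidHom.id _

@[simp] lemma ofRes_toRes {i : ℤ} (x : N.X i) : ofRes (toRes x : (res φ N).X i) = x := rfl

lemma ofRes_injective {i : ℤ} : Function.Injective (ofRes : (res φ N).X i →+ N.X i) := fun _ _ h => h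

lemma ofRes_smul {p i k : ℤ} (h : p + i = k) (a : A.X p) (x : (res φ N).X i) :
    ofRes ((res φ N).smul h a x) = N.smul h (φ.app p a) (ofRes x) := rfl

lemma ofRes_d {i k : ℤ} (h : i + 1 = k) (x : (res φ N).X i) :
    ofRes ((res φ N).d h x) = N.d h (ofRes x) := rfl

/-- The restriction of scalars of a homomorphism. -/
def resMap (f : M ⟶ N) : res φ M ⟶ res φ N :=
  { app := f.app
    map_smul := fun h a m => f.map_smul h (φ.app _ a) m
    map_d := f.map_d }

lemma ofRes_resMap (f : M ⟶ N) {i : ℤ} (x : (res φ M).X i) :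
    ofRes ((resMap (φ := φ) f).app i x) = f.app i (ofRes x) := rfl

lemma quasiIso_resMap_iff {f : M ⟶ N} : quasiIso A (resMap (φ := φ) f) ↔ quasiIso B f :=
  ⟨fun h => quasiIso_of _ (fun _ _ _ h₁ h₂ z hz => exists_of_quasiIso h h₁ h₂ z hz)
      (fun _ _ _ h₁ h₂ w y hw hy => exists_of_quasiIso' h h₁ h₂ w y hw hy),
    fun h => quasiIso_of _ (fun _ _ _ h₁ h₂ z hz => exists_of_quasiIso h h₁ h₂ z hz)
      (fun _ _ _ h₁ h₂ w y hw hy => exists_of_quasiIso' h h₁ h₂ w y hw hy)⟩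

variable (φ) in
/-- The element `b ⊗ m` of a base change. -/
def bmk {i j k : ℤ} (h : i + j = k) : B.X i →+ L.X j →+ (L.baseChange φ).X k :=
  (T.mk φ h (M := B.self) (N := L)).comp toSelf

lemma smul_bmk {p i j k l pi : ℤ} (h : p + k = l) (hij : i + j = k) (hi : p + i = pi)
    (hl : pi + j = l) (b : B.X p) (c : B.X i) (x : L.X j) :
    (L.baseChange φ).smul h b (bmk φ hij c x) = bmk φ hl (B.mul hi b c) x :=
  T.smul_mk φ B.self L h b hij hi hl (toSelf c) x

lemma bmk_mul {p i j k pi pj : ℤ} (hi : i + p = pi) (hj : p + j = pj) (h : pi + j = k)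
    (h' : i + pj = k) (c : B.X i) (a : A.X p) (x : L.X j) :
    bmk φ h (B.mul hi c (φ.app p a)) x = bmk φ h' c (L.smul hj a x) := by
  have h₁ := T.balance φ (by omega : p + i = pi) hj h h' a (toSelf c) x
  rw [smul_toSelf, B.comm hi (by omega) c, map_zsmul, map_zsmul, AddMonoidHom.smul_apply] at h₁
  have h₂ := congrArg (fun t => sgn (i * p) • t) h₁
  simp only [smul_smul, sgn_mul_self, _root_.one_smul] at h₂
  exact h₂

lemma d_bmk {i j k l i' j' : ℤ} (h : k + 1 = l) (hij : i + j = k) (hi : i + 1 = i')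
    (hj : j + 1 = j') (h₁ : i' + j = l) (h₂ : i + j' = l) (b : B.X i) (x : L.X j) :
    (L.baseChange φ).d h (bmk φ hij b x) = bmk φ h₁ (B.d hi b) x + sgn i • bmk φ h₂ b (L.d hj x) :=
  T.d_mk φ B.self L h hij hi hj h₁ h₂ (toSelf b) x

lemma bmk_induction {k : ℤ} {P : (L.baseChange φ).X k → Prop} (t : (L.baseChange φ).X k)
    (mk : ∀ (i j : ℤ) (h : i + j = k) (b : B.X i) (x : L.X j), P (bmk φ h b x))
    (add : ∀ x y, P x → P y → P (x + y)) : P t :=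
  T.induction φ (P := P) t mk add

variable (φ L) in
/-- The unit `x ↦ 1 ⊗ x` of the adjunction. -/
def bcUnit : L ⟶ res φ (L.baseChange φ) :=
  { app := fun i => toRes.comp (bmk φ (zero_add i) B.one)
    map_smul := fun {p j k} h a x => ofRes_injective (by
      rw [AddMonoidHom.comp_apply, ofRes_toRes, ofRes_smul, AddMonoidHom.comp_apply, ofRes_toRes,
        smul_bmk h (zero_add j) (add_zero p) h, mul_one', ← bmk_mul (zero_add p) h h,
        B.one_mul])
    map_d := fun {i j} h x => ofRes_injective (by
      rw [AddMonoidHom.comp_apply, ofRes_toRes, ofRes_d, AddMonoidHom.comp_apply, ofRes_toRes,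
        d_bmk h (zero_add i) rfl h (by omega) (zero_add j), d_one, map_zero,
        AddMonoidHom.zero_apply, zero_add, sgn_zero, _root_.one_smul]) }

lemma ofRes_bcUnit {i : ℤ} (x : L.X i) :
    ofRes ((bcUnit φ L).app i x) = bmk φ (zero_add i) B.one x := rfl

lemma bmk_eq_smul {i j k : ℤ} (h : i + j = k) (b : B.X i) (x : L.X j) :
    bmk φ h b x = (L.baseChange φ).smul h b (bmk φ (zero_add j) B.one x) := by
  rw [smul_bmk h (zero_add j) (add_zero i) h, mul_one']

/-- The restriction of a graded homomorphism along the unit. -/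
def restrictHom {q : ℤ} : (hom (L.baseChange φ) N).X q →+ (hom L (res φ N)).X q :=
  AddMonoidHom.mk' (fun g => mkHom (fun i j h =>
      toRes.comp ((hev h g).comp (ofRes.comp ((bcUnit φ L).app i)))) (by
    intro p i j i' j' h h' hi hj a x
    refine ofRes_injective ?_
    simp only [AddMonoidHom.comp_apply, ofRes_toRes, map_zsmul]
    rw [Hom.map_smul, ofRes_smul, hev_smul g h h' hi hj, ofRes_smul, ofRes_toRes]))
    (fun f g => hom_ext fun i j h x => ofRes_injective (by
      rw [map_add, AddMonoidHom.add_apply, map_add]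
      simp only [hev_mkHom, AddMonoidHom.comp_apply, ofRes_toRes, map_add, AddMonoidHom.add_apply]))

lemma ofRes_hev_restrictHom {q i j : ℤ} (h : i + q = j) (g : (hom (L.baseChange φ) N).X q)
    (x : L.X i) : ofRes (hev h (restrictHom g) x) = hev h g (bmk φ (zero_add i) B.one x) := rfl

lemma d_restrictHom {q r : ℤ} (h : q + 1 = r) (g : (hom (L.baseChange φ) N).X q) :
    (hom L (res φ N)).d h (restrictHom g) = restrictHom ((hom (L.baseChange φ) N).d h g) :=
  hom_ext fun i j hij x => ofRes_injective (by
    rw [ofRes_hev_restrictHom, d_hev h _ hij rfl (by omega) rfl (by omega),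
      d_hev h _ hij rfl (by omega) rfl (by omega), map_sub, map_zsmul, ofRes_d,
      ofRes_hev_restrictHom, ofRes_hev_restrictHom, d_bmk rfl (zero_add i) rfl rfl (by omega)
      (zero_add _), d_one, map_zero, AddMonoidHom.zero_apply, zero_add, sgn_zero,
      _root_.one_smul])

lemma restrictHom_injective {q : ℤ} : Function.Injective
    (restrictHom : (hom (L.baseChange φ) N).X q →+ (hom L (res φ N)).X q) := fun f g h =>
  hom_ext fun k l hkl t => by
    induction t using bmk_induction with
    | mk i j hij b x =>
      have h₁ := congrArg (fun f => ofRes (hev (rfl : j + q = j + q) f x)) h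
      simp only [ofRes_hev_restrictHom] at h₁
      rw [bmk_eq_smul, hev_smul f rfl hkl hij (by omega), hev_smul g rfl hkl hij (by omega), h₁]
    | add x y hx hy => rw [map_add, map_add, hx, hy]

/-- The components of the extension of a graded homomorphism. -/
def extendApp {q k l : ℤ} (f : (hom L (res φ N)).X q) (h : k + q = l) :
    (L.baseChange φ).X k →+ N.X l :=
  T.lift φ (M := B.self) (N := L) (fun i j hij b x => sgn (q * i) •
      N.smul (by omega : i + (j + q) = l) (ofSelf b) (ofRes (hev rfl f x)))
    (by intros; simp) (by intros; simp) (by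
      intro p i j pi pj hi hj h h' a b x
      rw [map_zsmul, ofSelf_smul, B.comm (by omega : i + p = pi) hi, smul_smul (sgn (i * p)),
        sgn_mul_self, _root_.one_smul, N.mul_smul _ _ (by omega : p + (j + q) = pj + q) (by omega),
        hev_smul f rfl rfl hj (by omega), map_zsmul, ofRes_smul, map_zsmul, smul_smul, ← sgn_add]
      congr 1
      apply sgn_congr; subst hi; exact ⟨0, by ring⟩)

lemma extendApp_bmk {q i j k l jq : ℤ} (f : (hom L (res φ N)).X q) (h : k + q = l) (hij : i + j = k)
    (hj : j + q = jq) (hl : i + jq = l) (b : B.X i) (x : L.X j) :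
    extendApp f h (bmk φ hij b x) = sgn (q * i) • N.smul hl b (ofRes (hev hj f x)) := by
  subst hj
  exact T.lift_mk φ _ _ _ _ hij (toSelf b) x

lemma restrictHom_surjective {q : ℤ} : Function.Surjective
    (restrictHom : (hom (L.baseChange φ) N).X q →+ (hom L (res φ N)).X q) := fun f => by
  refine ⟨mkHom (fun k l h => extendApp f h) ?_, hom_ext fun i j h x => ofRes_injective ?_⟩
  · intro p k l k' l' h h' hk hl b t
    induction t using bmk_induction with
    | mk i j hij c x =>
      rw [smul_bmk hk hij rfl (by omega), extendApp_bmk f h' _ rfl (by omega),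
        extendApp_bmk f h hij rfl (by omega), N.mul_smul _ _ (by omega : i + (j + q) = l) hl,
        map_zsmul, smul_smul, ← sgn_add]
      congr 1
      apply sgn_congr; exact ⟨0, by ring⟩
    | add x y hx hy => simp only [map_add, smul_add, hx, hy]
  · rw [ofRes_hev_restrictHom, hev_mkHom, extendApp_bmk f h _ h (zero_add j), mul_zero, sgn_zero,
      _root_.one_smul, N.one_smul]

lemma bc_hom_ext {f g : L.baseChange φ ⟶ N} (h : ∀ i (x : L.X i),
    f.app i (bmk φ (zero_add i) B.one x) = g.app i (bmk φ (zero_add i) B.one x)) : f = g :=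
  toHom_injective (restrictHom_injective (hom_ext fun i j hij x => ofRes_injective (by
    obtain rfl : i = j := by omega
    rw [ofRes_hev_restrictHom, ofRes_hev_restrictHom, hev_toHom, hev_toHom, h])))

lemma exists_bcDesc (f : L ⟶ res φ N) : ∃ g : L.baseChange φ ⟶ N, ∀ i (x : L.X i),
    g.app i (bmk φ (zero_add i) B.one x) = ofRes (f.app i x) := by
  obtain ⟨g, hg⟩ := restrictHom_surjective (φ := φ) (N := N) (toHom f)
  refine ⟨ofHom g (restrictHom_injective ?_), fun i x => ?_⟩
  · rw [← d_restrictHom, hg, d_toHom, map_zero]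
  · rw [ofHom_app, ← ofRes_hev_restrictHom, hg, hev_toHom]

variable (φ) in
/-- The functoriality of base change. -/
noncomputable def bcMap (u : L ⟶ L') : L.baseChange φ ⟶ L'.baseChange φ :=
  (exists_bcDesc (u ≫ bcUnit φ L')).choose

lemma bcMap_bmk (u : L ⟶ L') {i j k : ℤ} (h : i + j = k) (b : B.X i) (x : L.X j) :
    (bcMap φ u).app k (bmk φ h b x) = bmk φ h b (u.app j x) := by
  rw [bmk_eq_smul, Hom.map_smul, bcMap, (exists_bcDesc (u ≫ bcUnit φ L')).choose_spec, comp_app,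
    ofRes_bcUnit, ← bmk_eq_smul]

lemma Null.bcMap {u : L ⟶ L'} (hu : Null u) : Null (bcMap φ u) := by
  obtain ⟨s, hs⟩ := hu
  obtain ⟨s', hs'⟩ := restrictHom_surjective (φ := φ) ((DGMod.post L (bcUnit φ L')).app _ s)
  refine ⟨s', restrictHom_injective ?_⟩
  rw [← d_restrictHom, hs', ← Hom.map_d, hs, post_toHom]
  refine hom_ext fun i j hij x => ofRes_injective ?_
  obtain rfl : i = j := by omega
  rw [ofRes_hev_restrictHom, hev_toHom, hev_toHom, bcMap_bmk, comp_app, ofRes_bcUnit]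

lemma Cofib.baseChange (hL : Cofib L) : Cofib (L.baseChange φ) := by
  intro M N p hp hs f
  obtain ⟨g, hg⟩ := hL (resMap p) (quasiIso_resMap_iff.2 hp) hs (bcUnit φ L ≫ resMap f)
  obtain ⟨g', hg'⟩ := exists_bcDesc g
  refine ⟨g', bc_hom_ext fun i x => ?_⟩
  rw [comp_app, hg', ← ofRes_resMap, ← comp_app, hg, comp_app, ofRes_resMap, ofRes_bcUnit]

lemma IsTrivial.baseChange (hL : L.IsTrivial) : (L.baseChange φ).IsTrivial := fun k t => by
  induction t using bmk_induction with
  | mk i j h b x => rw [hL j x, map_zero]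
  | add x y hx hy => rw [hx, hy, add_zero]

lemma CellExt.baseChange {ι : Type u} {j : L ⟶ L'} {n : ι → ℤ} {e : ∀ b, L'.X (n b)}
    (h : CellExt j n e) :
    CellExt (bcMap φ j) n (fun b => bmk φ (zero_add (n b)) B.one (e b)) := by
  choose z hz using h.d_mem
  have hdz : ∀ b, L.d rfl (z b) = 0 := fun b => h.injective _ (by
    rw [j.map_d, ← hz, d_d, map_zero])
  have hd1 : ∀ {M : DGMod A} {i k : ℤ} (hi : i + 1 = k) (x : M.X i), (M.baseChange φ).d hi
      (bmk φ (zero_add i) B.one x) = bmk φ (zero_add k) B.one (M.d hi x) := fun hi x => by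
    rw [d_bmk hi _ rfl hi (by omega) (zero_add _), d_one, map_zero, AddMonoidHom.zero_apply,
      zero_add, sgn_zero, _root_.one_smul]
  let w : ∀ b, (L.baseChange φ).X (n b + 1) := fun b => bmk φ (zero_add _) B.one (z b)
  have hw : ∀ b, (L.baseChange φ).d rfl (w b) = 0 := fun b => by rw [hd1, hdz, map_zero]
  have hY := attach_cellExt (L.baseChange φ) n w hw
  obtain ⟨f, hf, hfe⟩ := hY.exists_desc (bcMap φ j) w (d_attachCell _ _ _ _)
    (fun b => bmk φ (zero_add (n b)) B.one (e b)) (fun b => by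
      rw [hd1, hz, bcMap_bmk])
  obtain ⟨g₀, hg₀, hg₀e⟩ := h.exists_desc (bcUnit φ L ≫ resMap (attachInl (L.baseChange φ) n w hw))
    z hz (fun b => toRes (attachCell (L.baseChange φ) n w hw b)) (fun b => ofRes_injective (by
      rw [ofRes_d, ofRes_toRes, d_attachCell, comp_app, ofRes_resMap, ofRes_bcUnit]))
  obtain ⟨g, hg⟩ := exists_bcDesc g₀
  have hjg : bcMap φ j ≫ g = attachInl (L.baseChange φ) n w hw := bc_hom_ext fun i x => by
    rw [comp_app, bcMap_bmk, hg, ← comp_app, hg₀, comp_app, ofRes_resMap, ofRes_bcUnit]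
  have hfg : f ≫ g = 𝟙 _ := hY.dg_hom_ext
    (by rw [← Category.assoc, hf, hjg, Category.comp_id])
    (fun b => by rw [comp_app, hfe, hg, hg₀e, ofRes_toRes, id_app])
  have hgf : g ≫ f = 𝟙 _ := bc_hom_ext fun i x => by
    rw [comp_app, hg, id_app]
    have : g₀ ≫ resMap f = bcUnit φ L' := h.dg_hom_ext
      (by
        rw [← Category.assoc, hg₀]
        refine hom_ext_app fun i x => ofRes_injective ?_
        rw [comp_app, comp_app, ofRes_resMap, ofRes_resMap, ← comp_app, hf, comp_app, ofRes_bcUnit,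
          ofRes_bcUnit, bcMap_bmk])
      (fun b => ofRes_injective (by
        rw [comp_app, hg₀e, ofRes_resMap, ofRes_toRes, hfe, ofRes_bcUnit]))
    rw [← ofRes_resMap, ← comp_app, this, ofRes_bcUnit]
  have := hY.of_iso ⟨f, g, hfg, hgf⟩
  simp only [hf, hfe] at this
  exact this

lemma FinCell.baseChange (hL : FinCell L) : FinCell (L.baseChange φ) := by
  induction hL with
  | trivial h => exact .trivial h.baseChange
  | cell j n e h _ ih => exact .cell _ _ _ h.baseChange ih

end Scalars

/-! ### Localization -/

lemma app_zero_smul {M N : DGMod A} (f : M ⟶ N) {i : ℤ} (a : A.X 0) (x : M.X i) :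
    f.app i (a • x) = a • f.app i x :=
  f.map_smul (zero_add i) a x

section Local

/-- `η : M ⟶ R` exhibits `R` as the localization of `M` at `S`. -/
structure IsLocal (S : Submonoid (A.X 0)) {M R : DGMod A} (η : M ⟶ R) : Prop where
  surj : ∀ {i : ℤ} (x : R.X i), ∃ σ ∈ S, ∃ m, σ • x = η.app i m
  inj : ∀ {i : ℤ} (m : M.X i), η.app i m = 0 → ∃ σ ∈ S, σ • m = 0
  bij : ∀ σ ∈ S, ∀ i, Function.Bijective (fun x : R.X i => σ • x)

/-- Every cohomology class of `M` is annihilated by an element of `S`. -/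
def IsTorsionH (S : Submonoid (A.X 0)) (M : DGMod A) : Prop :=
  ∀ (i j k : ℤ) (h : i + 1 = j) (h' : j + 1 = k) (z : M.X j), M.d h' z = 0 →
    ∃ σ ∈ S, ∃ y, M.d h y = σ • z

variable {S S' : Submonoid (A.X 0)} {M N R : DGMod A}

lemma Acyclic.isTorsionH (hM : M.Acyclic) (S : Submonoid (A.X 0)) : IsTorsionH S M :=
  fun i j k h h' z hz => by
    obtain ⟨y, hy⟩ := hM.exists h h' z hz
    exact ⟨1, S.one_mem, y, by rw [hy, _root_.one_smul]⟩

lemma IsTorsionH.cone {f : M ⟶ N} (hM : IsTorsionH S M) (hN : IsTorsionH S N) :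
    IsTorsionH S (DGMod.cone f) := fun i j k h h' z hz => by
  obtain ⟨hz₁, hz₂⟩ := (cone_d_eq_zero_iff f h' rfl z).1 hz
  obtain ⟨σ, hσ, u, hu⟩ := hM _ _ _ h' rfl _ hz₂
  obtain ⟨τ, hτ, v, hv⟩ := hN i j k h h' (σ • coneFst f z + f.app j u) (by
    rw [map_add, d_zero_smul, ← f.map_d, hu, app_zero_smul, ← smul_add, hz₁, smul_zero])
  refine ⟨τ * σ, S.mul_mem hτ hσ, coneMk f h v (-(τ • u)), cone_ext h' ?_ ?_⟩
  · rw [coneFst_d, coneFst_mk, coneSnd_mk, hv, map_neg, app_zero_smul]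
    change _ = coneFst f ((DGMod.cone f).smul (zero_add j) (τ * σ) z)
    rw [coneFst_smul f]
    change _ = (τ * σ) • coneFst f z
    rw [smul_add, ← smul_smul, add_neg_cancel_right]
  · rw [coneSnd_d f h h', coneSnd_mk, map_neg, neg_neg, d_zero_smul, hu]
    change _ = coneSnd f h' ((DGMod.cone f).smul (zero_add j) (τ * σ) z)
    rw [coneSnd_smul f (zero_add j) h' h' (zero_add k), sgn_zero, _root_.one_smul]
    change _ = (τ * σ) • coneSnd f h' z
    rw [← smul_smul]

lemma IsLocal.d_eq_zero {η : M ⟶ R} (hη : IsLocal S η) {i j : ℤ} (h : i + 1 = j) {x : R.X i}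
    {y : R.X j} : R.d h x = y → ∃ σ ∈ S, ∃ m n, σ • x = η.app i m ∧ σ • y = η.app j n ∧
      M.d h m = n := by
  intro hxy
  obtain ⟨σ, hσ, m, hm⟩ := hη.surj x
  exact ⟨σ, hσ, m, M.d h m, hm, by rw [η.map_d, ← hm, d_zero_smul, hxy], rfl⟩

lemma IsLocal.isTorsionH {η : M ⟶ R} (hη : IsLocal S η) (hM : IsTorsionH S' M) :
    IsTorsionH S' R := fun i j k h h' z hz => by
  obtain ⟨σ, hσ, m, n, hm, hn, hmn⟩ := hη.d_eq_zero h' hz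
  rw [smul_zero] at hn
  obtain ⟨τ, hτ, hτn⟩ := hη.inj n hn.symm
  obtain ⟨ρ, hρ, y, hy⟩ := hM i j k h h' (τ • m) (by rw [d_zero_smul, hmn, hτn])
  obtain ⟨w, hw⟩ := (hη.bij _ (S.mul_mem hτ hσ) i).2 (η.app i y)
  refine ⟨ρ, hρ, w, (hη.bij _ (S.mul_mem hτ hσ) j).1 ?_⟩
  change (τ * σ) • w = _ at hw
  change (τ * σ) • R.d h w = (τ * σ) • ρ • z
  rw [← d_zero_smul, hw, ← η.map_d, hy, app_zero_smul, app_zero_smul, ← hm, smul_smul, smul_smul,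
    smul_smul]
  congr 1
  ring

lemma IsLocal.isTorsionH_cone {η : M ⟶ R} (hη : IsLocal S η) : IsTorsionH S (cone η) :=
  fun i j k h h' z hz => by
  obtain ⟨hz₁, hz₂⟩ := (cone_d_eq_zero_iff η h' rfl z).1 hz
  obtain ⟨σ, hσ, m, n, hm, hn, hmn⟩ := hη.d_eq_zero h' (eq_neg_of_add_eq_zero_left hz₁)
  obtain ⟨τ, hτ, hτn⟩ := hη.inj (n + σ • coneSnd η h' z) (by
    rw [map_add, ← hn, app_zero_smul, ← smul_add, neg_add_cancel, smul_zero])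
  refine ⟨τ * σ, S.mul_mem hτ hσ, coneMk η h 0 (τ • m), cone_ext h' ?_ ?_⟩
  · rw [coneFst_d, coneFst_mk, coneSnd_mk, map_zero, zero_add, app_zero_smul, ← hm, smul_smul]
    exact (coneFst_smul η (zero_add j) (τ * σ) z).symm
  · rw [coneSnd_d η h h', coneSnd_mk, d_zero_smul, hmn]
    have h₁ := coneSnd_smul η (zero_add j) h' h' (zero_add k) (τ * σ) z
    rw [sgn_zero, _root_.one_smul] at h₁
    refine Eq.trans ?_ h₁.symm
    change _ = (τ * σ) • coneSnd η h' z
    rw [smul_add, add_comm, ← neg_eq_iff_add_eq_zero, smul_smul] at hτn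
    rw [← hτn, neg_neg]

lemma IsLocal.quasiIso {M' R' : DGMod A} {η : M ⟶ R} {η' : M' ⟶ R'} (hη : IsLocal S η)
    (hη' : IsLocal S η') {f : M ⟶ M'} {F : R ⟶ R'} (hF : η ≫ F = f ≫ η')
    (hf : IsTorsionH S (cone f)) : quasiIso A F := by
  have hF' : ∀ i m, F.app i (η.app i m) = η'.app i (f.app i m) := fun i m => by
    rw [← comp_app, hF, comp_app]
  refine quasiIso_of F (fun i j k h h' z hz => ?_) (fun i j k h h' w y hw hy => ?_)
  · obtain ⟨σ, hσ, m, n, hm, hn, hmn⟩ := hη'.d_eq_zero h' hz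
    rw [smul_zero] at hn
    obtain ⟨τ, hτ, hτn⟩ := hη'.inj n hn.symm
    obtain ⟨ρ, hρ, y, hy⟩ := hf i j k h h' (coneMk f h' (τ • m) 0) ((cone_d_eq_zero_iff f h' rfl _).2
      ⟨by rw [coneFst_mk, coneSnd_mk, map_zero, add_zero, d_zero_smul, hmn, hτn],
        by rw [coneSnd_mk, map_zero]⟩)
    have h₁ := congrArg (coneFst f) hy
    have h₂ := congrArg (coneSnd f h') hy
    rw [coneFst_d] at h₁
    rw [coneSnd_d f h h'] at h₂
    have e₁ : coneFst f (ρ • coneMk f h' (τ • m) 0) = ρ • τ • m :=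
      (coneFst_smul f (zero_add j) ρ _).trans (by rw [coneFst_mk]; rfl)
    have e₂ : coneSnd f h' (ρ • coneMk f h' (τ • m) 0) = 0 :=
      (coneSnd_smul f (zero_add j) h' h' (zero_add k) ρ _).trans (by
        rw [coneSnd_mk, map_zero, smul_zero])
    rw [e₁] at h₁
    rw [e₂, neg_eq_zero] at h₂
    have hρ' : ρ * τ * σ ∈ S := S.mul_mem (S.mul_mem hρ hτ) hσ
    obtain ⟨w, hw⟩ := (hη.bij _ hρ' j).2 (η.app j (coneSnd f h y))
    obtain ⟨v, hv⟩ := (hη'.bij _ hρ' i).2 (η'.app i (coneFst f y))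
    change (ρ * τ * σ) • w = _ at hw
    change (ρ * τ * σ) • v = _ at hv
    refine ⟨w, -v, (hη.bij _ hρ' k).1 ?_, (hη'.bij _ hρ' j).1 ?_⟩
    · change (ρ * τ * σ) • R.d h' w = (ρ * τ * σ) • (0 : R.X k)
      rw [← d_zero_smul, hw, ← η.map_d, h₂, map_zero, smul_zero]
    · change (ρ * τ * σ) • F.app j w = (ρ * τ * σ) • (z + R'.d h (-v))
      rw [← app_zero_smul, hw, hF', smul_add, ← d_zero_smul, smul_neg, hv, ← smul_smul (ρ * τ), hm,
        map_neg, ← η'.map_d, ← sub_eq_add_neg, eq_sub_iff_add_eq, ← map_add, ← app_zero_smul,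
        ← smul_smul, ← h₁, add_comm]
  · obtain ⟨σ, hσ, m, n, hm, hn, hmn⟩ := hη.d_eq_zero h' hw
    obtain ⟨τ, hτ, m', n', hm', hn', hmn'⟩ := hη'.d_eq_zero h hy.symm
    rw [smul_zero] at hn
    obtain ⟨σ₁, hσ₁, hσ₁n⟩ := hη.inj n hn.symm
    obtain ⟨τ₁, hτ₁, hτ₁n⟩ := hη'.inj (τ • f.app j m - σ • n') (by
      rw [map_sub, app_zero_smul, app_zero_smul, ← hF', ← hm, ← hn', app_zero_smul, smul_smul,
        smul_smul, _root_.mul_comm, sub_self])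
    obtain ⟨ρ, hρ, y', hy'⟩ := hf (i - 1) i j (by omega) h (coneMk f h (-((σ₁ * τ₁ * σ) • m'))
      ((σ₁ * τ₁ * τ) • m)) ((cone_d_eq_zero_iff f h h' _).2 ⟨by
        rw [coneFst_mk, coneSnd_mk, map_neg, d_zero_smul, hmn', app_zero_smul, ← smul_smul,
          ← smul_smul _ τ, neg_add_eq_sub, ← smul_sub, ← smul_smul, hτ₁n, smul_zero], by
        rw [coneSnd_mk, d_zero_smul, hmn, show σ₁ * τ₁ * τ = τ₁ * τ * σ₁ by ring, ← smul_smul,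
          hσ₁n, smul_zero]⟩)
    have h₂ := congrArg (coneSnd f h) hy'
    rw [coneSnd_d f (by omega) h] at h₂
    have e₂ : coneSnd f h (ρ • coneMk f h (-((σ₁ * τ₁ * σ) • m')) ((σ₁ * τ₁ * τ) • m)) =
        ρ • (σ₁ * τ₁ * τ) • m :=
      (coneSnd_smul f (zero_add i) h h (zero_add j) ρ _).trans (by
        rw [coneSnd_mk, sgn_zero, _root_.one_smul]; rfl)
    rw [e₂] at h₂
    have hρ' : ρ * (σ₁ * τ₁ * τ) * σ ∈ S :=
      S.mul_mem (S.mul_mem hρ (S.mul_mem (S.mul_mem hσ₁ hτ₁) hτ)) hσ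
    obtain ⟨x, hx⟩ := (hη.bij _ hρ' i).2 (η.app i (-coneSnd f (by omega) y'))
    change (ρ * (σ₁ * τ₁ * τ) * σ) • x = _ at hx
    refine ⟨x, (hη.bij _ hρ' j).1 ?_⟩
    change (ρ * (σ₁ * τ₁ * τ) * σ) • R.d h x = (ρ * (σ₁ * τ₁ * τ) * σ) • w
    rw [← d_zero_smul, hx, ← η.map_d, map_neg, h₂, app_zero_smul, app_zero_smul, ← hm, smul_smul,
      smul_smul]

end Local

section Loc

variable (s : A.H0)

lemma exists_mul_eq_toLoc {i : ℤ} (b : (A.loc s).X i) : ∃ σ ∈ A.powersLift s, ∃ a : A.X i,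
    (A.loc s).mul (zero_add i) ((A.toLoc s).app 0 σ) b = (A.toLoc s).app i a := by
  refine CommDGRing.LocX.induction (P := fun b => ∃ σ ∈ A.powersLift s, ∃ a : A.X i,
    (A.loc s).mul (zero_add i) ((A.toLoc s).app 0 σ) b = (A.toLoc s).app i a) b
    ⟨1, (A.powersLift s).one_mem, 0, (map_zero _).trans (map_zero _).symm⟩ (fun x a => ?_) ?_
  · obtain ⟨r, σ, rfl⟩ := IsLocalization.exists_mk'_eq (A.powersLift s) x
    refine ⟨σ, σ.2, A.mul (zero_add i) r a, ?_⟩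
    change A.locMul s (zero_add i) (CommDGRing.ltmul 1 σ.1) (CommDGRing.ltmul _ a) =
      CommDGRing.ltmul 1 _
    rw [CommDGRing.locMul_ltmul, _root_.one_mul]
    have h₁ := TensorProduct.smul_tmul (R := A.X 0) σ.1
      (IsLocalization.mk' (Localization (A.powersLift s)) r σ) (toSelf a)
    have h₂ := TensorProduct.smul_tmul (R := A.X 0) r
      (1 : Localization (A.powersLift s)) (toSelf a)
    have h₃ : σ.1 • IsLocalization.mk' (Localization (A.powersLift s)) r σ =
        r • (1 : Localization (A.powersLift s)) := by
      rw [Algebra.smul_def, Algebra.smul_def, _root_.mul_one, IsLocalization.mk'_spec']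
    exact h₁.symm.trans ((congrArg (fun x => TensorProduct.tmul (A.X 0) x (toSelf a)) h₃).trans
      h₂)
  · rintro t t' ⟨σ, hσ, a, ha⟩ ⟨τ, hτ, b, hb⟩
    refine ⟨τ * σ, (A.powersLift s).mul_mem hτ hσ, A.mul (zero_add i) τ a + A.mul (zero_add i) σ b,
      ?_⟩
    have h₁ : ∀ (σ τ : A.X 0) t, (A.loc s).mul (zero_add i) ((A.toLoc s).app 0 (σ * τ)) t =
        (A.loc s).mul (zero_add i) ((A.toLoc s).app 0 σ)
          ((A.loc s).mul (zero_add i) ((A.toLoc s).app 0 τ) t) := fun σ τ t => by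
      have := (A.toLoc s).map_mul (add_zero 0) σ τ
      change (A.toLoc s).app 0 (σ * τ) = _ at this
      rw [this, (A.loc s).mul_assoc _ _ (zero_add i) (zero_add i)]
    have h₂ : ∀ t t' : (A.loc s).X i, (A.loc s).mul (zero_add i) ((A.toLoc s).app 0 σ) t =
        (A.toLoc s).app i a → (A.loc s).mul (zero_add i) ((A.toLoc s).app 0 τ) t' =
        (A.toLoc s).app i b → (A.loc s).mul (zero_add i) ((A.toLoc s).app 0 (τ * σ)) (t + t') =
        (A.toLoc s).app i (A.mul (zero_add i) τ a + A.mul (zero_add i) σ b) := fun t t' ha hb => by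
      rw [map_add, map_add, h₁, ha, _root_.mul_comm, h₁, hb, (A.toLoc s).map_mul,
        (A.toLoc s).map_mul]
    exact h₂ t t' ha hb

lemma exists_toLoc_inv {σ : A.X 0} (hσ : σ ∈ A.powersLift s) :
    ∃ b : (A.loc s).X 0, (A.loc s).mul (zero_add 0) b ((A.toLoc s).app 0 σ) = (A.loc s).one := by
  let x := IsLocalization.mk' (Localization (A.powersLift s)) (1 : A.X 0) ⟨σ, hσ⟩
  refine ⟨CommDGRing.ltmul x A.one, ?_⟩
  change A.locMul s _ (CommDGRing.ltmul x A.one) (CommDGRing.ltmul 1 σ) = CommDGRing.ltmul 1 A.one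
  rw [CommDGRing.locMul_ltmul, _root_.mul_one, A.one_mul]
  have h₁ := TensorProduct.smul_tmul (R := A.X 0) σ x (toSelf A.one)
  have h₂ : σ • x = 1 := by
    rw [Algebra.smul_def, IsLocalization.mk'_spec'_mk, map_one]
  rw [h₂] at h₁
  exact Eq.trans (congrArg (fun y => TensorProduct.tmul (A.X 0) x (toSelf y))
    (mul_one' (add_zero 0) σ).symm) h₁.symm

variable {s} (M : DGMod A)

/-- The action of `A_s` with values in a localized module. -/
noncomputable def locAct {i j k : ℤ} (h : i + j = k) (m : M.X j) :
    A.LocX s i →ₗ[A.X 0] LocalizedModule (A.powersLift s) (M.X k) :=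
  TensorProduct.lift (LinearMap.mk₂ (A.X 0) (fun (x : Localization (A.powersLift s))
    (a : A.self.X i) => x • LocalizedModule.mkLinearMap (A.powersLift s) (M.X k)
      (M.smul h (ofSelf a) m))
    (fun x y a => add_smul _ _ _) (fun c x a => smul_assoc _ _ _)
    (fun x a b => by rw [map_add, map_add, AddMonoidHom.add_apply, map_add, smul_add])
    (fun c x a => by
      have : M.smul h (ofSelf (c • a)) m = c • M.smul h (ofSelf a) m :=
        M.mul_smul (zero_add i) h h (zero_add k) c (ofSelf a) m
      rw [this, map_smul, smul_comm]))

lemma locAct_ltmul {i j k : ℤ} (h : i + j = k) (m : M.X j) (x : Localization (A.powersLift s))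
    (a : A.X i) : locAct M h m (CommDGRing.ltmul x a) =
      x • LocalizedModule.mkLinearMap (A.powersLift s) (M.X k) (M.smul h a m) := rfl

/-- The comparison of a localized DG module with the localizations of its components. -/
noncomputable def locComp (k : ℤ) : (M.baseChange (A.toLoc s)).X k →+
    LocalizedModule (A.powersLift s) (M.X k) :=
  T.lift (A.toLoc s) (M := (A.loc s).self) (N := M) (fun i j h b m => locAct M h m b)
    (fun i j h b b' m => map_add _ _ _)
    (fun i j h b m m' => by
      refine CommDGRing.LocX.induction (P := fun b : A.LocX s i => locAct M h (m + m') b =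
        locAct M h m b + locAct M h m' b) b (by simp) (fun x a => ?_) (fun t t' ht ht' => ?_)
      · rw [locAct_ltmul, locAct_ltmul, locAct_ltmul, map_add, map_add, smul_add]
      · rw [map_add, map_add, map_add, ht, ht']; abel)
    (fun p i j pi pj hi hj h h' a b m => by
      refine CommDGRing.LocX.induction (P := fun b : A.LocX s i => locAct M h m (sgn (i * p) •
        A.locMul s hi (CommDGRing.ltmul 1 a) b) = locAct M h' (M.smul hj a m) b) b (by simp)
        (fun x c => ?_) (fun t t' ht ht' => ?_)
      · rw [CommDGRing.locMul_ltmul, ← map_zsmul, locAct_ltmul, locAct_ltmul, _root_.one_mul,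
          A.comm (by omega : i + p = pi) hi c a, smul_smul, sgn_mul_self, _root_.one_smul,
          M.mul_smul _ _ hj h']
      · rw [map_add, smul_add, map_add, map_add, ht, ht'])

lemma locComp_unit {k : ℤ} (m : M.X k) :
    locComp (s := s) M k (bmk _ (zero_add k) (A.loc s).one m) =
      LocalizedModule.mkLinearMap (A.powersLift s) (M.X k) m := by
  refine (T.lift_mk (A.toLoc s) (M := (A.loc s).self) (N := M) _ _ _ _ (zero_add k) _ m).trans ?_
  refine (locAct_ltmul M (zero_add k) m 1 A.one).trans ?_
  rw [_root_.one_smul, M.one_smul]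

lemma isLocal_bcUnit (s : A.H0) (M : DGMod A) :
    IsLocal (A.powersLift s) (bcUnit (A.toLoc s) M) where
  surj {k} x := by
    have key : ∀ t : (M.baseChange (A.toLoc s)).X k, ∃ σ ∈ A.powersLift s, ∃ m : M.X k,
        (M.baseChange (A.toLoc s)).smul (zero_add k) ((A.toLoc s).app 0 σ) t =
          bmk _ (zero_add k) (A.loc s).one m := fun t => by
      induction t using bmk_induction with
      | mk i j h b m =>
        obtain ⟨σ, hσ, a, ha⟩ := exists_mul_eq_toLoc s b
        refine ⟨σ, hσ, M.smul h a m, ?_⟩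
        rw [smul_bmk _ h (zero_add i) h, ha, ← bmk_mul (zero_add i) h h, (A.loc s).one_mul]
      | add x y hx hy =>
        obtain ⟨σ, hσ, m, hm⟩ := hx
        obtain ⟨τ, hτ, n, hn⟩ := hy
        have h₁ : ∀ (σ τ : A.X 0) (t : (M.baseChange (A.toLoc s)).X k) (m : M.X k),
            (M.baseChange (A.toLoc s)).smul (zero_add k) ((A.toLoc s).app 0 τ) t =
            bmk _ (zero_add k) (A.loc s).one m →
            (M.baseChange (A.toLoc s)).smul (zero_add k) ((A.toLoc s).app 0 (σ * τ)) t =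
              bmk _ (zero_add k) (A.loc s).one (σ • m) := fun σ τ t m h =>
          (((res (A.toLoc s) (M.baseChange (A.toLoc s))).mul_smul (add_zero 0) (zero_add k)
            (zero_add k) (zero_add k) σ τ (toRes t)).trans (congrArg (fun x =>
              (M.baseChange (A.toLoc s)).smul (zero_add k) ((A.toLoc s).app 0 σ) x) h)).trans
            ((bcUnit (A.toLoc s) M).map_smul (zero_add k) σ m).symm
        refine ⟨τ * σ, (A.powersLift s).mul_mem hτ hσ, τ • m + σ • n, ?_⟩
        rw [map_add, h₁ τ σ x m hm, map_add, _root_.mul_comm, h₁ σ τ y n hn]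
    exact key (ofRes x)
  inj {k} m hm := by
    have h₁ := locComp_unit (s := s) M m
    have h₂ : bmk (A.toLoc s) (zero_add k) (A.loc s).one m = 0 := hm
    rw [h₂, map_zero] at h₁
    obtain ⟨σ, hσ⟩ := (IsLocalizedModule.eq_zero_iff (A.powersLift s)
      (LocalizedModule.mkLinearMap (A.powersLift s) (M.X k))).1 h₁.symm
    exact ⟨σ, σ.2, hσ⟩
  bij σ hσ i := by
    obtain ⟨b, hb⟩ := exists_toLoc_inv s hσ
    let X := M.baseChange (A.toLoc s)
    have h₁ : ∀ x : X.X i, X.smul (zero_add i) b (X.smul (zero_add i) ((A.toLoc s).app 0 σ) x) = x :=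
      fun x => by rw [← X.mul_smul (zero_add 0) (zero_add i), hb, X.one_smul]
    have h₂ : ∀ x : X.X i, X.smul (zero_add i) ((A.toLoc s).app 0 σ) (X.smul (zero_add i) b x) = x :=
      fun x => by
        rw [← X.mul_smul (zero_add 0) (zero_add i), (A.loc s).comm (zero_add 0) (zero_add 0), hb,
          mul_zero, sgn_zero, _root_.one_smul, X.one_smul]
    exact Function.bijective_iff_has_inverse.2 ⟨fun x => X.smul (zero_add i) b x, h₁, h₂⟩

lemma quasiIso_bcMap_toLoc {M N : DGMod A} {f : M ⟶ N} (hf : IsTorsionH (A.powersLift s) (cone f)) :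
    quasiIso (A.loc s) (bcMap (A.toLoc s) f) := by
  refine quasiIso_resMap_iff.1 ((isLocal_bcUnit s M).quasiIso (isLocal_bcUnit s N) ?_ hf)
  refine hom_ext_app fun i x => ofRes_injective ?_
  rw [comp_app, comp_app, ofRes_resMap, ofRes_bcUnit, ofRes_bcUnit, bcMap_bmk]

end Loc

/-! ### Compactness is local -/

section Cech

lemma gSnd_coneInl {M N : DGMod A} (g : M ⟶ N) {i j : ℤ} (h : i + 1 = j) (y : N.X i) :
    hev h (gSnd g) ((coneInl g).app i y) = 0 := coneSnd_inl g h y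

lemma gSnd_gInr {M N : DGMod A} (g : M ⟶ N) {i j : ℤ} (h : i + -1 = j) (h' : j + 1 = i)
    (x : M.X i) : hev h' (gSnd g) (hev h (gInr g) x) = x := by
  rw [hev_gInr]
  exact coneSnd_mk g h' 0 x

lemma exists_hom_of_cone_eq_d {L M N : DGMod A} (g : M ⟶ N) {q q' q'' : ℤ} (hq : q' + 1 = q)
    (hq' : q'' + 1 = q') (f : (hom L M).X q) (h : (hom L N).X q') (k : (hom L (cone g)).X q'')
    (hk : (hom L (cone g)).d hq' k = (post L (coneInl g)).app q' h -
      gcomp (by omega : q + -1 = q') (gInr g) f) :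
    (hom L M).d hq (gcomp hq' (gSnd g) k) = f := by
  rw [d_gcomp hq' rfl hq' hq (by omega : q'' + (1 + 1) = q) hq, d_gSnd, map_zero,
    AddMonoidHom.zero_apply, zero_add, hk, sgn_one]
  refine hom_ext fun i j hij x => ?_
  rw [map_zsmul, AddMonoidHom.smul_apply, hev_gcomp hq _ _ hij rfl (by omega), map_sub,
    AddMonoidHom.sub_apply, map_sub, hev_post, gSnd_coneInl,
    hev_gcomp _ _ _ rfl hij (by omega : j + -1 = i + q'), gSnd_gInr, zero_sub]
  simp

lemma d_cone_eq_zero {L M N : DGMod A} (g : M ⟶ N) {q q' : ℤ} (hq : q' + 1 = q)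
    (f : (hom L M).X q) (h : (hom L N).X q') (hf : (hom L M).d rfl f = 0)
    (hh : (hom L N).d hq h = (post L g).app q f) :
    (hom L (cone g)).d hq ((post L (coneInl g)).app q' h -
      gcomp (by omega : q + -1 = q') (gInr g) f) = 0 := by
  rw [map_sub, ← (post L (coneInl g)).map_d, hh, post_comp,
    d_gcomp _ (by norm_num : (-1 : ℤ) + 1 = 0) rfl hq (add_zero q) (by omega), d_gInr, hf,
    map_zero, smul_zero, add_zero, gcomp_toHom_left, idx_rfl, sub_self]

variable {L : DGMod A}

lemma Cpt.of_loc {s : A.H0} (hL : Cpt (L.baseChange (A.toLoc s)) fun _ => True)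
    {𝒩 𝒩' : DGMod A → Prop} (h𝒩 : ∀ N, 𝒩 N → 𝒩' (DGMod.cone (bcUnit (A.toLoc s) N)))
    (hc : Cpt L 𝒩') : Cpt L 𝒩 := by
  classical
  intro ι N hN q' q hq f hf hd
  choose F hF using fun z => restrictHom_surjective (φ := A.toLoc s)
    ((post L (bcUnit (A.toLoc s) (N z))).app q (f z))
  have hFl : LocFin F := fun i j h t => by
    induction t using bmk_induction with
    | mk a b hab c x =>
      refine (hf b (b + q) rfl x).subset fun z hz hz' => hz ?_
      have h₁ := congrArg (fun f => ofRes (hev (rfl : b + q = b + q) f x)) (hF z)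
      simp only [ofRes_hev_restrictHom] at h₁
      rw [bmk_eq_smul, hev_smul (F z) rfl h hab (by omega), h₁, hev_post, hz', map_zero, map_zero,
        map_zero, smul_zero]
    | add x y hx hy =>
      refine (hx.union hy).subset fun z hz => ?_
      by_contra hxy
      simp only [Set.mem_union, Set.mem_ofPred_eq, not_or, not_not] at hxy
      exact hz (by rw [map_add, hxy.1, hxy.2, add_zero])
  obtain ⟨T₁, hT₁, H, hH, hHd⟩ := hL ι _ (fun _ => _root_.trivial) q' q hq F hFl (fun z =>
    restrictHom_injective (by rw [← d_restrictHom, hF, ← Hom.map_d, hd, map_zero, map_zero]))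
  have hh : LocFin (fun z => restrictHom (φ := A.toLoc s) (H z)) := fun i j h x =>
    (hH i j h (bmk _ (zero_add i) (A.loc s).one x)).subset fun z hz hz' => hz (ofRes_injective (by
      rw [ofRes_hev_restrictHom, hz', map_zero]))
  obtain ⟨T₂, hT₂, k, hk, hkd⟩ := hc ι (fun z => DGMod.cone (bcUnit (A.toLoc s) (N z)))
    (fun z => h𝒩 _ (hN z)) (q' - 1) q' (by omega) _
    (((hh.post fun z => coneInl (bcUnit (A.toLoc s) (N z))).sub
      (LocFin.post_comp (by omega : q + -1 = q') (fun z => gInr (bcUnit (A.toLoc s) (N z))) hf)).ite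
      T₁) (fun z => by
    split_ifs with hz
    · exact map_zero _
    · exact (d_eq_zero_iff _ hq rfl _).1 (d_cone_eq_zero _ hq _ _ (hd z) (by
        rw [d_restrictHom, hHd z hz, hF])))
  refine ⟨T₁ ∪ T₂, hT₁.union hT₂, fun z => gcomp (by omega : q' - 1 + 1 = q') (gSnd _) (k z),
    LocFin.post_comp (by omega : q' - 1 + 1 = q') (fun z => gSnd (bcUnit (A.toLoc s) (N z))) hk,
    fun z hz => ?_⟩
  rw [Set.mem_union, not_or] at hz
  refine exists_hom_of_cone_eq_d _ hq _ (f z) (restrictHom (H z)) (k z) ?_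
  rw [hkd z hz.2, if_neg hz.1]

lemma acyclic_of_isTorsionH {n : ℕ} (s : Fin n → A.H0) (hs : Ideal.span (Set.range s) = ⊤)
    {N : DGMod A} (hN : ∀ i, IsTorsionH (A.powersLift (s i)) N) : N.Acyclic := by
  refine acyclic_of N fun i j k h h' z hz => ?_
  obtain rfl := h'
  let J : Ideal A.H0 := LinearMap.ker (LinearMap.toSpanSingleton A.H0 (N.H j) (N.Hmk z hz))
  have hJ : ∀ i, ∃ m : ℕ, s i ^ m ∈ J := fun b => by
    obtain ⟨σ, ⟨m, hm⟩, y, hy⟩ := hN b i j _ h rfl z hz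
    refine ⟨m, ?_⟩
    change s b ^ m = _ at hm
    rw [hm, LinearMap.mem_ker, LinearMap.toSpanSingleton_apply, H0_smul_Hmk, Hmk_eq_zero_iff _ h]
    exact ⟨y, hy⟩
  have hJ' : ∀ x : Set.range s, ∃ m : ℕ, x.1 ^ m ∈ J := by
    rintro ⟨_, b, rfl⟩
    exact hJ b
  choose m hm using hJ'
  have h1 : (1 : A.H0) ∈ J := by
    have : Ideal.span (Set.range fun x : Set.range s => x.1 ^ m x) ≤ J :=
      Ideal.span_le.2 (by rintro _ ⟨x, rfl⟩; exact hm x)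
    exact this ((Ideal.span_range_pow_eq_top _ hs m).symm ▸ Submodule.mem_top)
  rw [LinearMap.mem_ker, LinearMap.toSpanSingleton_apply, _root_.one_smul, Hmk_eq_zero_iff _ h] at h1
  exact h1

lemma cpt_of_cover (hL : L.IsKProjective) {n : ℕ} (s : Fin n → A.H0)
    (hs : Ideal.span (Set.range s) = ⊤)
    (hc : ∀ i, Cpt (L.baseChange (A.toLoc (s i))) fun _ => True) : Cpt L fun _ => True := by
  have key : ∀ T : Finset (Fin n), Cpt L fun N => ∀ i ∉ T, IsTorsionH (A.powersLift (s i)) N := by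
    intro T
    induction T using Finset.induction_on with
    | empty =>
      intro ι N hN
      exact cpt_acyclic hL ι N fun z => acyclic_of_isTorsionH s hs fun i => hN z i (by simp)
    | insert a T _ ih =>
      refine Cpt.of_loc (hc a) (fun N hN i hi => ?_) ih
      by_cases hia : i = a
      · subst hia
        exact (isLocal_bcUnit (s i) N).isTorsionH_cone
      · have hNi := hN i (by simp [hia, hi])
        exact hNi.cone ((isLocal_bcUnit (s a) N).isTorsionH hNi)
  exact fun ι N _ => key Finset.univ ι N fun z i hi => absurd (Finset.mem_univ i) hi

lemma IsGeometricallyPerfect.isCompactObject {P : DGMod A} (hP : P.IsGeometricallyPerfect) :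
    P.IsCompactObject := by
  obtain ⟨n, s, hs, h⟩ := hP
  obtain ⟨L, g, hL, hg⟩ := exists_cofib_resolution P
  refine Cpt.isCompactObject hL.isKProjective hg (cpt_of_cover hL.isKProjective s hs fun i => ?_)
  obtain ⟨P', hP', ⟨e⟩⟩ := h i
  have := isIso_of_quasiIso (quasiIso_bcMap_toLoc (s := s i)
    (((quasiIso_iff_acyclic_cone g).1 hg).isTorsionH _))
  have e' := asIso ((Q (A.loc (s i))).map (bcMap (A.toLoc (s i)) g))
  exact (hP'.finCell.isAlgebraicallyPerfect.of_iso (e'.trans e).symm).isCompactObject.cpt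
    (g := 𝟙 _) (Cofib.isKProjective (Cofib.baseChange hL)) (quasiIso_of_bijective _ fun _ => Function.bijective_id)

end Cech

/-! ### Base change of K-flat resolutions -/

section KFlat

lemma quasiIso_of_comp_left {M N P : DGMod A} {f : M ⟶ N} {g : N ⟶ P}
    (hf : quasiIso A f) (hfg : quasiIso A (f ≫ g)) : quasiIso A g := fun i => by
  have : ⇑(Hmap (f ≫ g) i) = Hmap g i ∘ Hmap f i := funext (Hmap_comp f g i)
  have h := hfg i
  rw [this] at h
  exact (Function.Bijective.of_comp_iff _ (hf i)).1 h

lemma quasiIso_of_null_sub {M N : DGMod A} {f g : M ⟶ N} (hg : quasiIso A g) (h : Null (f - g)) :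
    quasiIso A f := by
  have := isIso_of_quasiIso hg
  rw [← Q_map_eq_of_null h] at this
  exact quasiIso_of_isIso this

variable {M M' N : DGMod A}

lemma quasiIso_tensMap (r : M ⟶ M') (h : (tens (cone r) N).Acyclic) :
    quasiIso A (tensMap r N) := by
  have hs : ∀ {i j k : ℤ} (hij : i + 1 = j) (hjk : j + 1 = k) (t : (tens (cone r) N).X i),
      (tens M N).d hjk (hev hij (tensLeft N (gSnd r)) t) =
        -hev hjk (tensLeft N (gSnd r)) ((tens (cone r) N).d hij t) := fun hij hjk t => by
    have h₁ := d_tensLeft (N := N) rfl (gSnd r)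
    rw [d_gSnd, tensLeft_zero] at h₁
    have h₂ := d_hev rfl (tensLeft N (gSnd r)) (by omega) hij hjk hij hjk t
    rw [h₁, map_zero, AddMonoidHom.zero_apply, sgn_one] at h₂
    rw [neg_smul, _root_.one_smul, sub_neg_eq_add] at h₂
    exact eq_neg_of_add_eq_zero_left h₂.symm
  have hp : ∀ {i j : ℤ} (hij : i + 1 = j) (t : (tens (cone r) N).X i),
      (tens M' N).d hij (hev (add_zero i) (tensLeft N (gFst r)) t) =
        hev (add_zero j) (tensLeft N (gFst r)) ((tens (cone r) N).d hij t) -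
          (tensMap r N).app j (hev hij (tensLeft N (gSnd r)) t) := fun {i j} hij t => by
    have h₁ := d_tensLeft (N := N) (by norm_num : (0 : ℤ) + 1 = 1) (gFst r)
    have h₂ := d_hev (by norm_num : (0 : ℤ) + 1 = 1) (tensLeft N (gFst r)) hij (add_zero i) hij hij
      (add_zero j) t
    have h₃ : tensLeft N (-(post (cone r) r).app 1 (gSnd r)) =
        -(post (tens (cone r) N) (tensMap r N)).app 1 (tensLeft N (gSnd r)) :=
      tens_hom_hom_ext fun a b k l hab hkl c n => by
        rw [hev_tensLeft _ hkl hab rfl (by omega), map_neg, map_neg, AddMonoidHom.neg_apply,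
          AddMonoidHom.neg_apply, map_neg, AddMonoidHom.neg_apply, hev_post, hev_post,
          hev_tensLeft _ hkl hab rfl (by omega), tensMap_tmk]
    rw [h₁, d_gFst, h₃, map_neg, AddMonoidHom.neg_apply, hev_post, sgn_zero,
      _root_.one_smul] at h₂
    rw [← sub_add_cancel ((tens M' N).d hij _) (hev (add_zero j) _ _), ← h₂]
    abel
  have hr : ∀ {i j k : ℤ} (hij : i + -1 = j) (hik : i + 1 = k) (hji : j + 1 = i)
      (hki : k + -1 = i) (x : (tens M N).X i),
      (tens (cone r) N).d hji (hev hij (tensLeft N (gInr r)) x) =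
        (tensMap (coneInl r) N).app i ((tensMap r N).app i x) -
          hev hki (tensLeft N (gInr r)) ((tens M N).d hik x) := fun {i j k} hij hik hji hki x => by
    have h₁ := d_tensLeft (N := N) (by norm_num : (-1 : ℤ) + 1 = 0) (gInr r)
    have h₂ := d_hev (by norm_num : (-1 : ℤ) + 1 = 0) (tensLeft N (gInr r)) (add_zero i) hij hji
      hik hki x
    have h₃ : tensLeft N (toHom (r ≫ coneInl r)) = toHom (tensMap r N ≫ tensMap (coneInl r) N) :=
      tens_hom_hom_ext fun a b k l hab hkl c n => by
        obtain rfl : k = l := by omega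
        rw [hev_tensLeft _ hkl hab (add_zero a) (by omega), hev_toHom, hev_toHom, comp_app, comp_app,
          tensMap_tmk, tensMap_tmk]
    rw [h₁, d_gInr, h₃, hev_toHom, comp_app, sgn_odd (by decide), neg_smul, _root_.one_smul,
      sub_neg_eq_add] at h₂
    rw [h₂, add_sub_cancel_right]
  have pinl : ∀ {i : ℤ} (y : (tens M' N).X i),
      hev (add_zero i) (tensLeft N (gFst r)) ((tensMap (coneInl r) N).app i y) = y := fun y => by
    induction y using tens_induction with
    | mk a b hab c n =>
      rw [tensMap_tmk, hev_tensLeft _ _ hab (add_zero a) hab]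
      exact congrArg (fun m => tmk hab m n) (coneFst_inl r c)
    | add x y hx hy => rw [map_add, map_add, hx, hy]
  have sinl : ∀ {i j : ℤ} (h : i + 1 = j) (y : (tens M' N).X i),
      hev h (tensLeft N (gSnd r)) ((tensMap (coneInl r) N).app i y) = 0 := fun h y => by
    induction y using tens_induction with
    | mk a b hab c n =>
      rw [tensMap_tmk, hev_tensLeft _ h hab rfl (by omega), gSnd_coneInl, map_zero,
        AddMonoidHom.zero_apply]
    | add x y hx hy => rw [map_add, map_add, hx, hy, add_zero]
  have sinr : ∀ {i j : ℤ} (h : i + -1 = j) (h' : j + 1 = i) (x : (tens M N).X i),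
      hev h' (tensLeft N (gSnd r)) (hev h (tensLeft N (gInr r)) x) = x := fun h h' x => by
    induction x using tens_induction with
    | mk a b hab c n =>
      rw [hev_tensLeft _ h hab rfl (by omega), hev_tensLeft _ h' _ (by omega : a + -1 + 1 = a) hab,
        gSnd_gInr]
    | add x y hx hy => rw [map_add, map_add, hx, hy]
  refine quasiIso_of _ (fun i j k hij hjk z hz => ?_) (fun i j k hij hjk w y hw hy => ?_)
  · obtain ⟨t, ht⟩ := h.exists hij hjk ((tensMap (coneInl r) N).app j z)
      (by rw [← Hom.map_d, hz, map_zero])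
    refine ⟨hev hij (tensLeft N (gSnd r)) t, -hev (add_zero i) (tensLeft N (gFst r)) t, ?_, ?_⟩
    · rw [hs, ht, sinl, neg_zero]
    · rw [map_neg, hp hij, ht, pinl]
      abel
  · have hji : j + -1 = i := by omega
    obtain ⟨t, ht⟩ := h.exists (by omega : i - 1 + 1 = i) hij
      ((tensMap (coneInl r) N).app i y - hev hji (tensLeft N (gInr r)) w) (by
        rw [map_sub, ← Hom.map_d, ← hy, hr hji hjk hij (by omega), hw, map_zero, sub_zero, sub_self])
    refine ⟨hev (by omega) (tensLeft N (gSnd r)) t, ?_⟩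
    rw [hs _ hij, ht, map_sub, sinl, sinr hji hij]
    simp

variable {B : CommDGRing.{u}} (φ : A.Hom B)

/-- The base change, as a tensor product of DG `A`-modules. -/
def tensToBC (L : DGMod A) : tens (res φ B.self) L ⟶ res φ (L.baseChange φ) :=
  tensHom (fun i j k h => AddMonoidHom.mk' (fun b => toRes.comp (bmk φ h (ofSelf (ofRes b))))
      (fun b c => AddMonoidHom.ext fun x => by simp))
    (fun p i j pi pj k hi hj h h' a m n => ofRes_injective (by
      simp only [AddMonoidHom.mk'_apply, AddMonoidHom.comp_apply, ofRes_toRes, map_zsmul]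
      rw [ofRes_smul, ofSelf_smul, B.comm (by omega : i + p = pi) hi, map_zsmul,
        AddMonoidHom.smul_apply, bmk_mul _ hj h h']))
    (fun p i j k pi pk h hi hk h' a m n => ofRes_injective (by
      simp only [AddMonoidHom.mk'_apply, AddMonoidHom.comp_apply, ofRes_toRes]
      rw [ofRes_smul, ofSelf_smul, ofRes_smul, ofRes_toRes, smul_bmk hk h hi h']))
    (fun i j k i' j' k' h hi hj hk h₁ h₂ m n => ofRes_injective (by
      simp only [AddMonoidHom.mk'_apply, AddMonoidHom.comp_apply, ofRes_toRes, map_add, map_zsmul]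
      rw [ofRes_d, ofRes_toRes, ofRes_d, ofSelf_d, d_bmk hk h hi hj h₁ h₂]))

lemma tensToBC_tmk {L : DGMod A} {i j k : ℤ} (h : i + j = k) (b : (res φ B.self).X i) (x : L.X j) :
    ofRes ((tensToBC φ L).app k (tmk h b x)) = bmk φ h (ofSelf (ofRes b)) x := by
  rw [tensToBC, tensHom_tmk]
  rfl

lemma quasiIso_tensToBC (L : DGMod A) : quasiIso A (tensToBC φ L) :=
  quasiIso_of_bijective _ fun k => by
    let g : (L.baseChange φ).X k →+ (tens (res φ B.self) L).X k :=
      T.lift φ (M := B.self) (N := L) (fun i j h b x => tmk h (toRes b : (res φ B.self).X i) x)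
        (by intros; simp) (by intros; simp)
        (fun p i j pi pj hi hj h h' a m n => by
          have := tmk_balance hi hj h h' a (toRes m : (res φ B.self).X i) n
          rw [map_zsmul, map_zsmul, AddMonoidHom.smul_apply]
          exact (congrArg (fun t => sgn (i * p) • t) this).trans (by
            rw [smul_smul, sgn_mul_self, _root_.one_smul]))
    have hg : ∀ {i j : ℤ} (h : i + j = k) (b : B.X i) (x : L.X j),
        g (bmk φ h b x) = tmk h (toRes (toSelf b) : (res φ B.self).X i) x :=
      fun h b x => T.lift_mk φ _ _ _ _ h (toSelf b) x
    refine Function.bijective_iff_has_inverse.2 ⟨fun t => g (ofRes t), fun t => ?_, fun t => ?_⟩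
    · induction t using tens_induction with
      | mk i j h b x => exact (congrArg g (tensToBC_tmk φ h b x)).trans (hg h _ x)
      | add x y hx hy => simp only [map_add] at hx hy ⊢; rw [hx, hy]
    · have : ∀ t : (L.baseChange φ).X k, ofRes ((tensToBC φ L).app k (g t)) = t := fun t => by
        induction t using bmk_induction with
        | mk i j h b x => rw [hg, tensToBC_tmk]; rfl
        | add x y hx hy => simp only [map_add, hx, hy]
      exact ofRes_injective (this (ofRes t))

lemma quasiIso_bcMap {L F : DGMod A} (hL : L.IsKFlat) (hF : F.IsKFlat) {θ : L ⟶ F}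
    (hθ : quasiIso A θ) : quasiIso B (bcMap φ θ) := by
  obtain ⟨N, r, hN, hr⟩ := exists_kprojective_resolution (res φ B.self)
  have hr' := (quasiIso_iff_acyclic_cone r).1 hr
  have h₁ : quasiIso A (tensMap θ N) := quasiIso_tensMap θ
    (Acyclic.of_quasiIso (quasiIso_tensSwap _ _)
      (hN.tens_acyclic ((quasiIso_iff_acyclic_cone θ).1 hθ)))
  have h₂ : ∀ {X : DGMod A}, X.IsKFlat → quasiIso A (tensMap r X ≫ tensToBC φ X) := fun hX =>
    quasiIso_comp (quasiIso_tensMap r (hX _ hr')) (quasiIso_tensToBC φ _)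
  have h₃ := quasiIso_comp (quasiIso_comp (quasiIso_comp (quasiIso_tensSwap N L) h₁)
    (quasiIso_tensSwap F N)) (h₂ hF)
  refine quasiIso_resMap_iff.1 (quasiIso_of_comp_left (h₂ hL) (g := resMap (φ := φ) (bcMap φ θ)) ?_)
  convert h₃ using 1
  refine tens_dg_hom_ext fun i j k h m n => ofRes_injective ?_
  simp only [comp_app]
  rw [ofRes_resMap, tensMap_tmk, tensToBC_tmk, bcMap_bmk, tensSwap_tmk h (by omega : j + i = k),
    map_zsmul, map_zsmul, map_zsmul, map_zsmul, tensMap_tmk, tensSwap_tmk (by omega) h, map_zsmul,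
    map_zsmul, map_zsmul, map_zsmul, smul_smul, _root_.mul_comm j i, sgn_mul_self, _root_.one_smul, tensMap_tmk,
    tensToBC_tmk]

end KFlat

/-! ### Functionals with values in a module over `H^0(A)` -/

/-- A closed functional, in terms of a retraction up to homotopy. -/
lemma functional_eq_of_null {L G : DGMod A} {M : Type u} [AddCommGroup M] {u : L ⟶ G} {v : G ⟶ L} (huv : Null (u ≫ v - 𝟙 L)) :
    ∃ s : (hom L L).X (-1), ∀ {m : ℤ} (θ : L.X m →+ M),
      (∀ {i : ℤ} (h : i + 1 = m) (x : L.X i), θ (L.d h x) = 0) → ∀ x,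
      θ x = θ (v.app m (u.app m x)) - θ (hev (by omega : m + 1 + -1 = m) s (L.d rfl x)) := by
  obtain ⟨s, hs⟩ := huv
  refine ⟨s, fun {m} θ hθ x => ?_⟩
  have h₁ := d_hev (by norm_num : (-1 : ℤ) + 1 = 0) s (add_zero m) (rfl : m + -1 = m + -1)
    (by omega) rfl (by omega) x
  rw [hs, hev_toHom, sub_app, id_app, comp_app, sgn_odd (by decide), neg_smul, _root_.one_smul,
    sub_neg_eq_add] at h₁
  have h₂ := congrArg θ h₁
  rw [map_sub, map_add, hθ, zero_add] at h₂
  rw [← h₂, sub_sub_cancel]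

section Functional

variable {K L G : DGMod A} {M M' : Type u} [AddCommGroup M] [Module A.H0 M] [AddCommGroup M']
  [Module A.H0 M']

/-- An additive map `K^i → M` that is the component of an `A`-linear map from `K` to the module `M`
placed in a single degree. -/
structure IsFunctional {i : ℤ} (θ : K.X i →+ M) : Prop where
  smul_deg_zero : ∀ (a : A.X 0) (x : K.X i), θ (a • x) = Ideal.Quotient.mk A.boundaryIdeal a • θ x
  smul_deg_ne : ∀ {p j : ℤ} (h : p + j = i), p ≠ 0 → ∀ (a : A.X p) (x : K.X j), θ (K.smul h a x) = 0

lemma IsFunctional.add {i : ℤ} {θ η : K.X i →+ M} (hθ : IsFunctional θ) (hη : IsFunctional η) :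
    IsFunctional (θ + η) where
  smul_deg_zero a x := by
    rw [AddMonoidHom.add_apply, AddMonoidHom.add_apply, hθ.smul_deg_zero, hη.smul_deg_zero, smul_add]
  smul_deg_ne h hp a x := by
    rw [AddMonoidHom.add_apply, hθ.smul_deg_ne h hp, hη.smul_deg_ne h hp, add_zero]

lemma IsFunctional.sub {i : ℤ} {θ η : K.X i →+ M} (hθ : IsFunctional θ) (hη : IsFunctional η) :
    IsFunctional (θ - η) where
  smul_deg_zero a x := by
    rw [AddMonoidHom.sub_apply, AddMonoidHom.sub_apply, hθ.smul_deg_zero, hη.smul_deg_zero, smul_sub]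
  smul_deg_ne h hp a x := by
    rw [AddMonoidHom.sub_apply, hθ.smul_deg_ne h hp, hη.smul_deg_ne h hp, sub_zero]

lemma IsFunctional.post {i : ℤ} {θ : K.X i →+ M} (hθ : IsFunctional θ) (f : M →ₗ[A.H0] M') :
    IsFunctional (f.toAddMonoidHom.comp θ) where
  smul_deg_zero a x := by
    change f (θ _) = _ • f (θ x)
    rw [hθ.smul_deg_zero, map_smul]
  smul_deg_ne h hp a x := by
    change f (θ _) = 0
    rw [hθ.smul_deg_ne h hp, map_zero]

lemma IsFunctional.comp_app {i : ℤ} {θ : K.X i →+ M} (hθ : IsFunctional θ) (f : L ⟶ K) :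
    IsFunctional (θ.comp (f.app i)) where
  smul_deg_zero a x := by
    rw [AddMonoidHom.comp_apply, app_zero_smul, hθ.smul_deg_zero, AddMonoidHom.comp_apply]
  smul_deg_ne h hp a x := by
    rw [AddMonoidHom.comp_apply, f.map_smul, hθ.smul_deg_ne h hp]

lemma IsFunctional.comp_hev {i j q : ℤ} {θ : K.X j →+ M} (hθ : IsFunctional θ)
    (f : (hom L K).X q) (h : i + q = j) : IsFunctional (θ.comp (hev h f)) where
  smul_deg_zero a x := by
    have := hev_smul f h h (zero_add i) (zero_add j) a x
    rw [mul_zero, sgn_zero, _root_.one_smul] at this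
    exact (congrArg θ this).trans (hθ.smul_deg_zero a _)
  smul_deg_ne {p k} hk hp a x := by
    rw [AddMonoidHom.comp_apply, hev_smul f rfl h hk (by omega), map_zsmul,
      hθ.smul_deg_ne (by omega) hp, smul_zero]

lemma IsFunctional.comp_d {i j : ℤ} {θ : K.X j →+ M} (hθ : IsFunctional θ) (h : i + 1 = j) :
    IsFunctional (θ.comp (K.d h)) where
  smul_deg_zero a x := (congrArg θ (d_zero_smul K h a x)).trans (hθ.smul_deg_zero a _)
  smul_deg_ne {p k} hk hp a x := by
    rw [AddMonoidHom.comp_apply]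
    by_cases hp' : p + 1 = 0
    · rw [K.leibniz hk hp' rfl h (by omega) (by omega), map_add, map_zsmul, hθ.smul_deg_ne _ hp,
        smul_zero, add_zero]
      obtain rfl : p = -1 := by omega
      obtain rfl : k = j := by omega
      refine (hθ.smul_deg_zero (A.d hp' a) x).trans ?_
      rw [Ideal.Quotient.eq_zero_iff_mem.2 (show A.d hp' a ∈ A.boundaryIdeal from ⟨a, rfl⟩),
        zero_smul]
    · rw [K.leibniz hk rfl rfl h (by omega) (by omega), map_add, map_zsmul, hθ.smul_deg_ne _ hp,
        smul_zero, add_zero, hθ.smul_deg_ne _ hp']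

variable (K) in
/-- Every closed functional of degree `m` is exact. -/
def FunExact (m : ℤ) : Prop :=
  ∀ (M : Type u) [AddCommGroup M] [Module A.H0 M] (θ : K.X m →+ M), IsFunctional θ →
    (∀ {i : ℤ} (h : i + 1 = m) (x : K.X i), θ (K.d h x) = 0) →
    ∃ θ' : K.X (m + 1) →+ M, IsFunctional θ' ∧ ∀ x, θ x = θ' (K.d rfl x)

variable (K) in
/-- Every closed functional of degree `m` differs from one with values in a finite submodule by an
exact functional. -/
def FunFinite (m : ℤ) : Prop :=
  ∀ (M : Type u) [AddCommGroup M] [Module A.H0 M] (θ : K.X m →+ M), IsFunctional θ →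
    (∀ {i : ℤ} (h : i + 1 = m) (x : K.X i), θ (K.d h x) = 0) →
    ∃ θ' : K.X (m + 1) →+ M, IsFunctional θ' ∧ ∃ T : Set M, T.Finite ∧
      ∀ x, θ x - θ' (K.d rfl x) ∈ Submodule.span A.H0 T

variable (K) in
/-- Every functional of degree `m` vanishes. -/
def FunZero (m : ℤ) : Prop :=
  ∀ (M : Type u) [AddCommGroup M] [Module A.H0 M] (θ : K.X m →+ M), IsFunctional θ → ∀ x, θ x = 0

variable (K) in
/-- Every functional of degree `m` has values in a finite submodule. -/
def FunSpan (m : ℤ) : Prop :=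
  ∀ (M : Type u) [AddCommGroup M] [Module A.H0 M] (θ : K.X m →+ M), IsFunctional θ →
    ∃ T : Set M, T.Finite ∧ ∀ x, θ x ∈ Submodule.span A.H0 T

lemma FunZero.funExact {m : ℤ} (h : FunZero K m) : FunExact K m := fun M _ _ θ hθ _ =>
  ⟨0, ⟨fun _ _ => (smul_zero _).symm, fun _ _ _ _ => rfl⟩, fun x => h M θ hθ x⟩

lemma FunSpan.funFinite {m : ℤ} (h : FunSpan K m) : FunFinite K m := fun M _ _ θ hθ _ => by
  obtain ⟨T, hT, h⟩ := h M θ hθ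
  exact ⟨0, ⟨fun _ _ => (smul_zero _).symm, fun _ _ _ _ => rfl⟩, T, hT, fun x => by
    rw [AddMonoidHom.zero_apply, sub_zero]; exact h x⟩

lemma FunExact.of_retract {m : ℤ} (hG : FunExact G m) {u : L ⟶ G} {v : G ⟶ L}
    (huv : Null (u ≫ v - 𝟙 L)) : FunExact L m := fun M _ _ θ hθ hd => by
  obtain ⟨s, hs⟩ := functional_eq_of_null (M := M) huv
  obtain ⟨θ', hθ', h⟩ := hG M _ (hθ.comp_app v) (fun h x => by
    rw [AddMonoidHom.comp_apply, v.map_d, hd])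
  refine ⟨_, (hθ'.comp_app u).sub (hθ.comp_hev s (by omega)), fun x => ?_⟩
  rw [hs θ hd x, AddMonoidHom.sub_apply, AddMonoidHom.comp_apply, AddMonoidHom.comp_apply, u.map_d,
    ← h]
  rfl

lemma FunFinite.of_retract {m : ℤ} (hG : FunFinite G m) {u : L ⟶ G} {v : G ⟶ L}
    (huv : Null (u ≫ v - 𝟙 L)) : FunFinite L m := fun M _ _ θ hθ hd => by
  obtain ⟨s, hs⟩ := functional_eq_of_null (M := M) huv
  obtain ⟨θ', hθ', T, hT, h⟩ := hG M _ (hθ.comp_app v) (fun h x => by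
    rw [AddMonoidHom.comp_apply, v.map_d, hd])
  refine ⟨_, (hθ'.comp_app u).sub (hθ.comp_hev s (by omega)), T, hT, fun x => ?_⟩
  have := h (u.app m x)
  rw [AddMonoidHom.comp_apply, ← u.map_d] at this
  rw [hs θ hd x, AddMonoidHom.sub_apply, AddMonoidHom.comp_apply, AddMonoidHom.comp_apply,
    sub_sub_sub_cancel_right]
  exact this

variable {X X' : DGMod A} {ι : Type u} {j : X ⟶ X'} {n : ι → ℤ} {e : ∀ b, X'.X (n b)}

lemma CellExt.funZero {m : ℤ} (h : CellExt j n e) (hn : ∀ b, n b ≠ m) (hX : FunZero X m) :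
    FunZero X' m := fun M _ _ θ hθ x => by
  induction x using h.induction with
  | hj x => exact hX M _ (hθ.comp_app j) x
  | he b p hp a => exact hθ.smul_deg_ne hp (by rintro rfl; exact hn b (by omega)) a (e b)
  | hadd x y hx hy => rw [map_add, hx, hy, add_zero]

lemma CellExt.funSpan [Finite ι] {m : ℤ} (h : CellExt j n e) (hX : FunSpan X m) :
    FunSpan X' m := fun M _ _ θ hθ => by
  obtain ⟨T, hT, hT'⟩ := hX M _ (hθ.comp_app j)
  let w : ι → M := fun b => if hb : n b = m then θ (X'.idx hb (e b)) else 0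
  refine ⟨T ∪ Set.range w, hT.union (Set.finite_range w), fun x => ?_⟩
  induction x using h.induction with
  | hj x => exact Submodule.span_mono Set.subset_union_left (hT' x)
  | he b p hp a =>
    by_cases hp' : p = 0
    · subst hp'
      have hb : n b = m := by omega
      have hw : θ (X'.smul hp a (e b)) = Ideal.Quotient.mk A.boundaryIdeal a • w b := by
        simp only [w, dif_pos hb]
        rw [← hθ.smul_deg_zero, zero_smul_def, smul_idx]
      rw [hw]
      exact Submodule.smul_mem _ _ (Submodule.subset_span (Or.inr ⟨b, rfl⟩))
    · rw [hθ.smul_deg_ne hp hp']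
      exact Submodule.zero_mem _
  | hadd x y hx hy =>
    rw [map_add]
    exact Submodule.add_mem _ hx hy

lemma IsTrivial.funZero (hX : X.IsTrivial) (m : ℤ) : FunZero X m := fun M _ _ θ _ x => by
  rw [hX m x, map_zero]

lemma FunZero.funSpan {m : ℤ} (h : FunZero K m) : FunSpan K m := fun M _ _ θ hθ =>
  ⟨∅, Set.finite_empty, fun x => by rw [h M θ hθ x]; exact Submodule.zero_mem _⟩

lemma FinCell.funSpan (hX : FinCell X) (m : ℤ) : FunSpan X m := by
  induction hX with
  | trivial h => exact (h.funZero m).funSpan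
  | cell j n e h _ ih => exact h.funSpan ih

lemma FinCell.exists_funZero (hX : FinCell X) : ∃ a : ℤ, ∀ m < a, FunZero X m := by
  induction hX with
  | trivial h => exact ⟨0, fun m _ => h.funZero m⟩
  | cell j n e h _ ih =>
    obtain ⟨a, ha⟩ := ih
    exact ⟨min a n, fun m hm => h.funZero (fun _ => by have := min_le_right a n; omega)
      (ha m (lt_of_lt_of_le hm (min_le_left a n)))⟩

/-! ### Truncation -/

/-- The truncation of a DG module above a degree. -/
def truncAbove (X : DGMod A) (n : ℤ) : X.Sub where
  carrier i :=
    { carrier := {x | (n < i → x = 0) ∧ (i = n → X.d rfl x = 0)}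
      zero_mem' := ⟨fun _ => rfl, fun _ => map_zero _⟩
      add_mem' := fun {x y} hx hy =>
        ⟨fun h => by rw [hx.1 h, hy.1 h, add_zero],
          fun h => by rw [map_add, hx.2 h, hy.2 h, add_zero]⟩
      neg_mem' := fun {x} hx => ⟨fun h => by rw [hx.1 h, neg_zero],
        fun h => by rw [map_neg, hx.2 h, neg_zero]⟩ }
  smul_mem {p j k} h a {x} hx := by
    rcases lt_trichotomy p 0 with hp | hp | hp
    · refine ⟨fun hk => ?_, fun hk => ?_⟩
      · rw [hx.1 (by omega), map_zero]
      · rw [hx.1 (by omega), map_zero, map_zero]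
    · subst hp
      obtain rfl : j = k := by omega
      refine ⟨fun hk => by rw [hx.1 hk, map_zero], fun hk => ?_⟩
      have := d_zero_smul X rfl a x
      rw [hx.2 hk, smul_zero] at this
      exact this
    · have h₀ : X.smul h a x = 0 := by rw [A.nonpos p hp a, map_zero, AddMonoidHom.zero_apply]
      exact ⟨fun _ => h₀, fun _ => by rw [h₀, map_zero]⟩
  d_mem {i j} h {x} hx := by
    subst h
    refine ⟨fun hi => ?_, fun _ => X.d_d _ _ _⟩
    by_cases hn : i = n
    · exact hx.2 hn
    · rw [hx.1 (by omega), map_zero]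

lemma quasiIso_truncAbove {X : DGMod A} {n : ℤ} (hX : ∀ i, n < i → Subsingleton (X.H i)) :
    quasiIso A (truncAbove X n).incl := by
  refine quasiIso_of _ (fun i j k h h' z hz => ?_) (fun i j k h h' w y hw hy => ?_)
  · by_cases hj : n < j
    · obtain ⟨y, hy⟩ := (X.subsingleton_H_iff h h').1 (hX j hj) z hz
      exact ⟨0, -y, map_zero _, by rw [map_zero, map_neg, hy, add_neg_cancel]⟩
    · subst h'
      exact ⟨⟨z, fun h => absurd h hj, fun _ => hz⟩, 0, Subtype.ext hz, by
        rw [map_zero, add_zero]; rfl⟩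
  · by_cases hj : n < j
    · exact ⟨0, Subtype.ext (by rw [map_zero]; exact (w.2.1 hj).symm)⟩
    · exact ⟨⟨y, fun h => by omega, fun h => by omega⟩, Subtype.ext hy.symm⟩

/-- The top cohomology classes of a K-projective DG module are detected by a closed functional. -/
lemma exists_functional_class {X : DGMod A} (hK : K.IsKProjective) (g : K ⟶ X) {n : ℤ}
    (hX : ∀ i, n < i → Subsingleton (X.H i)) :
    ∃ θ : K.X n →+ X.H n, IsFunctional θ ∧
      (∀ {i : ℤ} (h : i + 1 = n) (x : K.X i), θ (K.d h x) = 0) ∧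
      ∀ (x : K.X n) (hx : K.d rfl x = 0), θ x = Hmap g n (K.Hmk x hx) := by
  obtain ⟨f, hf⟩ := exists_lift_null _ hK (quasiIso_truncAbove hX) g
  let θ : K.X n →+ X.H n := AddMonoidHom.mk' (fun x => X.Hmk (f.app n x).1 ((f.app n x).2.2 rfl))
    (fun x y => by rw [Hmk_add]; congr 1; rw [map_add]; rfl)
  refine ⟨θ, ⟨fun a x => ?_, fun {p j} h hp a x => ?_⟩, fun {i} h x => ?_, fun x hx => ?_⟩
  · refine Eq.trans ?_ (H0_smul_Hmk X a _ ((f.app n x).2.2 rfl)).symm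
    change X.Hmk _ _ = X.Hmk _ _
    congr 1
    rw [app_zero_smul]
    rfl
  · refine (Hmk_eq_zero_iff X (sub_add_cancel n 1) _ _).2 ⟨0, ?_⟩
    rw [f.map_smul, map_zero]
    change 0 = X.smul h a (f.app j x).1
    rcases lt_or_gt_of_ne hp with hp | hp
    · rw [(f.app j x).2.1 (by omega), map_zero]
    · rw [A.nonpos p hp a, map_zero, AddMonoidHom.zero_apply]
  · refine (Hmk_eq_zero_iff X h _ _).2 ⟨(f.app i x).1, ?_⟩
    rw [f.map_d]
    rfl
  · obtain ⟨y, hy⟩ := hf.exists_app (sub_add_cancel n 1) rfl x hx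
    rw [Hmap_Hmk]
    exact (Hmk_eq_iff X (sub_add_cancel n 1) _ _ _ _).2 ⟨y, hy⟩

/-! ### Modules placed in a single degree -/

variable (A M) in
/-- The components of a module placed in degree `m`. -/
def concX (m i : ℤ) : AddSubgroup M where
  carrier := {x | i ≠ m → x = 0}
  zero_mem' := fun _ => rfl
  add_mem' := fun ha hb h => by rw [ha h, hb h, add_zero]
  neg_mem' := fun ha h => by rw [ha h, neg_zero]

variable (A M) in
/-- The `H^0(A)`-module `M` placed in degree `m`. -/
noncomputable def conc (m : ℤ) : DGMod A where
  X i := concX M m i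
  smul {p j k} h := AddMonoidHom.mk' (fun a => AddMonoidHom.mk'
      (fun x => (⟨(A.toH0App p a).1 • x.1, fun hk => by
        by_cases hp : p = 0
        · rw [x.2 (by omega), _root_.smul_zero]
        · rw [CommDGRing.ofRingX_zero hp (A.toH0App p a)]; exact zero_smul _ _⟩ : concX M m k))
      (fun x y => Subtype.ext (smul_add _ x.1 y.1)))
    (fun a b => AddMonoidHom.ext fun x => Subtype.ext (by
      rw [map_add]; exact add_smul _ _ _))
  d _ := 0
  one_smul h x := Subtype.ext (by
    change (A.toH0App 0 A.one).1 • x.1 = x.1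
    rw [CommDGRing.toH0App_zero]
    exact _root_.one_smul A.H0 x.1)
  mul_smul h₁ h₂ h₃ h₄ a b x := Subtype.ext (by
    change (A.toH0App _ (A.mul h₁ a b)).1 • x.1 = (A.toH0App _ a).1 • (A.toH0App _ b).1 • x.1
    rw [CommDGRing.toH0App_mul, smul_smul]
    rfl)
  d_d _ _ _ := rfl
  leibniz {i j k i' j' k'} h hi hj hk h₁ h₂ a x := Subtype.ext (by
    rw [AddMonoidHom.zero_apply, AddMonoidHom.zero_apply, map_zero, _root_.smul_zero, add_zero]
    change (0 : M) = (A.toH0App _ (A.d hi a)).1 • x.1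
    rw [CommDGRing.toH0App_d]
    exact (zero_smul A.H0 x.1).symm)

/-- The elements of a module placed in a single degree. -/
def ofConc {m i : ℤ} : (conc A M m).X i →+ M := (concX M m i).subtype

/-- The elements of a module placed in a single degree. -/
def toConc {m i : ℤ} (h : i = m) : M →+ (conc A M m).X i :=
  (AddMonoidHom.id M).codRestrict (concX M m i) (fun _ h' => absurd h h')

lemma ofConc_injective {m i : ℤ} : Function.Injective (ofConc : (conc A M m).X i →+ M) :=
  Subtype.val_injective

lemma ofConc_eq_zero {m i : ℤ} (h : i ≠ m) (x : (conc A M m).X i) : ofConc x = 0 := x.2 h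

lemma ofConc_smul {m p j k : ℤ} (h : p + j = k) (a : A.X p) (x : (conc A M m).X j) :
    ofConc ((conc A M m).smul h a x) = (A.toH0App p a).1 • ofConc x := rfl

lemma conc_d {m i j : ℤ} (h : i + 1 = j) (x : (conc A M m).X i) : (conc A M m).d h x = 0 := rfl

/-- The graded homomorphism attached to a functional. -/
noncomputable def IsFunctional.toHom {m : ℤ} {θ : K.X m →+ M} (hθ : IsFunctional θ) :
    (hom K (conc A M m)).X 0 :=
  mkHom (fun i j h => if hi : i = m then (toConc (by omega)).comp (θ.comp (K.idx hi)) else 0) (by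
    intro p i j i' j' h h' hi hj a x
    rw [zero_mul, sgn_zero, _root_.one_smul]
    refine ofConc_injective ?_
    rw [ofConc_smul]
    by_cases hp : p = 0
    · subst hp
      obtain rfl : i = i' := by omega
      by_cases him : i = m
      · subst him
        rw [dif_pos rfl, dif_pos rfl, CommDGRing.toH0App_zero]
        exact hθ.smul_deg_zero a x
      · rw [dif_neg him, dif_neg him, AddMonoidHom.zero_apply, map_zero, AddMonoidHom.zero_apply,
          map_zero, _root_.smul_zero]
    · rw [CommDGRing.ofRingX_zero hp (A.toH0App p a)]
      refine Eq.trans ?_ (zero_smul A.H0 _).symm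
      split_ifs with him
      · subst him
        exact hθ.smul_deg_ne hi hp a x
      · rfl)

lemma IsFunctional.hev_toHom {m : ℤ} {θ : K.X m →+ M} (hθ : IsFunctional θ) (x : K.X m) :
    ofConc (hev (add_zero m) hθ.toHom x) = θ x := by
  rw [IsFunctional.toHom, hev_mkHom, dif_pos rfl]
  rfl

lemma isFunctional_hev {m q i j : ℤ} (f : (hom K (conc A M m)).X q) (h : i + q = j) :
    IsFunctional (ofConc.comp (hev h f)) where
  smul_deg_zero a x := by
    have h₁ := hev_smul f h h (zero_add i) (zero_add j) a x
    rw [mul_zero, sgn_zero, _root_.one_smul] at h₁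
    rw [← CommDGRing.toH0App_zero]
    exact (congrArg ofConc h₁).trans (ofConc_smul _ _ _)
  smul_deg_ne {p k} hk hp a x := by
    rw [AddMonoidHom.comp_apply, hev_smul f rfl h hk (by omega), map_zsmul, ofConc_smul,
      CommDGRing.ofRingX_zero hp (A.toH0App p a)]
    refine Eq.trans (congrArg _ (zero_smul A.H0 _)) (smul_zero _)

variable (A) in
/-- The functoriality of modules placed in a single degree. -/
noncomputable def concMap (f : M →ₗ[A.H0] M') (m : ℤ) : conc A M m ⟶ conc A M' m :=
  { app := fun i => (f.toAddMonoidHom.comp ofConc).codRestrict (concX M' m i) (fun x hi => by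
      change f (ofConc x) = 0
      rw [ofConc_eq_zero hi, map_zero])
    map_smul := fun h a x => Subtype.ext (map_smul f _ x.1)
    map_d := fun h x => Subtype.ext (map_zero f) }

lemma ofConc_concMap (f : M →ₗ[A.H0] M') {m i : ℤ} (x : (conc A M m).X i) :
    ofConc ((concMap A f m).app i x) = f (ofConc x) := rfl

lemma Cofib.exists_functional_lift (hL : Cofib L) {f : M →ₗ[A.H0] M'} (hf : Function.Surjective f)
    {m : ℤ} {θ : L.X m →+ M'} (hθ : IsFunctional θ) :
    ∃ θ' : L.X m →+ M, IsFunctional θ' ∧ ∀ x, f (θ' x) = θ x := by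
  obtain ⟨ψ, hψ⟩ := Cofib.exists_lift hL (g := concMap A f m) (fun i y => by
    by_cases hi : i = m
    · obtain ⟨x, hx⟩ := hf (ofConc y)
      exact ⟨toConc hi x, ofConc_injective hx⟩
    · exact ⟨0, ofConc_injective (by rw [map_zero, map_zero, ofConc_eq_zero hi])⟩) hθ.toHom
  refine ⟨_, isFunctional_hev ψ (add_zero m), fun x => ?_⟩
  rw [AddMonoidHom.comp_apply, ← ofConc_concMap, ← hev_post, hψ, hθ.hev_toHom]

end Functional

end DGMod

end DG

namespace DG

open CategoryTheory

/-! ### Local freeness of finite projective modules -/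

lemma exists_localization_free {R : Type u} [CommRing R] (Q : Type u) [AddCommGroup Q] [Module R Q]
    [Module.Finite R Q] [Module.Projective R Q] (p : Ideal R) [hp : p.IsPrime] :
    ∃ s, s ∉ p ∧ ∃ (r : ℕ) (α : (Fin r → R) →ₗ[R] Q) (β : Q →ₗ[R] (Fin r → R)),
      (∀ q, α (β q) = s • q) ∧ ∀ x, β (α x) = s • x := by
  have : Module.FinitePresentation R Q := Module.finitePresentation_of_projective R Q
  let S := p.primeCompl
  let f := LocalizedModule.mkLinearMap S Q
  have hfree : Module.Free (Localization S) (LocalizedModule S Q) := by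
    have : (⟨p, hp⟩ : PrimeSpectrum R) ∈ Module.freeLocus R Q := by
      rw [Module.freeLocus_eq_univ]
      exact Set.mem_univ _
    exact this
  have hfin : Module.Finite (Localization S) (LocalizedModule S Q) :=
    Module.Finite.of_isLocalizedModule S f
  let e' := (Module.finBasis (Localization S) (LocalizedModule S Q)).equivFun
  let r := Module.finrank (Localization S) (LocalizedModule S Q)
  let e : LocalizedModule S Q ≃ₗ[R] (Fin r → Localization S) := e'.restrictScalars R
  let g : (Fin r → R) →ₗ[R] (Fin r → Localization S) :=
    .pi fun i => (Algebra.linearMap R (Localization S)) ∘ₗ .proj i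
  obtain ⟨β, s₁, hβ⟩ := Module.FinitePresentation.exists_lift_of_isLocalizedModule S g
    (e.toLinearMap ∘ₗ f)
  obtain ⟨α, s₂, hα⟩ := Module.FinitePresentation.exists_lift_of_isLocalizedModule S f
    (e.symm.toLinearMap ∘ₗ g)
  have hβ' : ∀ q, g (β q) = s₁ • e (f q) := fun q => LinearMap.congr_fun hβ q
  have hα' : ∀ x, f (α x) = s₂ • e.symm (g x) := fun x => LinearMap.congr_fun hα x
  obtain ⟨s₃, h₃⟩ := Module.Finite.exists_smul_of_comp_eq_of_isLocalizedModule S g (β ∘ₗ α)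
    ((s₁ * s₂) • LinearMap.id) (LinearMap.ext fun x => by
      simp [hβ', hα', Submonoid.smul_def, smul_smul])
  obtain ⟨s₄, h₄⟩ := Module.Finite.exists_smul_of_comp_eq_of_isLocalizedModule S f (α ∘ₗ β)
    ((s₁ * s₂) • LinearMap.id) (LinearMap.ext fun x => by
      simp [hβ', hα', Submonoid.smul_def, smul_smul, _root_.mul_comm])
  have h₃' : ∀ x, s₃ • β (α x) = s₃ • (s₁ * s₂) • x := fun x => LinearMap.congr_fun h₃ x
  have h₄' : ∀ q, s₄ • α (β q) = s₄ • (s₁ * s₂) • q := fun q => LinearMap.congr_fun h₄ q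
  refine ⟨(s₃ * s₄ * (s₁ * s₂)).1, (s₃ * s₄ * (s₁ * s₂)).2, r, (s₃ * s₄).1 • α, β, fun q => ?_,
    fun x => ?_⟩
  · change (s₃ * s₄) • α (β q) = (s₃ * s₄ * (s₁ * s₂)) • q
    rw [← smul_smul, h₄', smul_smul, smul_smul, _root_.mul_assoc]
  · rw [LinearMap.smul_apply, map_smul]
    change (s₃ * s₄) • β (α x) = (s₃ * s₄ * (s₁ * s₂)) • x
    rw [_root_.mul_comm s₃, ← smul_smul, h₃', smul_smul, smul_smul, _root_.mul_assoc]

end DG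

namespace DG

open CategoryTheory

namespace DGMod

variable {A : CommDGRing.{u}}

/-! ### Linear maps on cohomology -/

lemma smul_eq_mk_smul {M : DGMod A} {i : ℤ} (a : A.X 0) (ξ : M.H i) :
    a • ξ = Ideal.Quotient.mk A.boundaryIdeal a • ξ := by
  obtain ⟨z, hz, rfl⟩ := M.Hmk_surjective ξ
  rw [Hmk_smul, H0_smul_Hmk]

/-- The linear map induced on cohomology. -/
def HmapLin {M N : DGMod A} (f : M ⟶ N) (i : ℤ) : M.H i →ₗ[A.H0] N.H i :=
  { Hmap f i with
    map_smul' := fun r ξ => by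
      obtain ⟨a, rfl⟩ := Ideal.Quotient.mk_surjective r
      obtain ⟨z, hz, rfl⟩ := M.Hmk_surjective ξ
      change Hmap f i _ = Ideal.Quotient.mk A.boundaryIdeal a • Hmap f i _
      rw [H0_smul_Hmk, Hmap_Hmk, Hmap_Hmk, H0_smul_Hmk]
      congr 1
      exact app_zero_smul f a z }

lemma HmapLin_apply {M N : DGMod A} (f : M ⟶ N) {i : ℤ} (ξ : M.H i) :
    HmapLin f i ξ = Hmap f i ξ := rfl

/-- A closed functional induces a linear map on cohomology. -/
lemma IsFunctional.exists_desc {K : DGMod A} {M : Type u} [AddCommGroup M] [Module A.H0 M] {m : ℤ}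
    {θ : K.X m →+ M} (hθ : IsFunctional θ)
    (hd : ∀ {i : ℤ} (h : i + 1 = m) (x : K.X i), θ (K.d h x) = 0) :
    ∃ f : K.H m →ₗ[A.H0] M, ∀ z hz, f (K.Hmk z hz) = θ z := by
  let f₀ : K.H m →+ M := QuotientAddGroup.lift _ (θ.comp (K.cocycles m).toAddSubgroup.subtype) (by
    rintro ⟨z, hz⟩ ⟨y, rfl⟩
    exact hd _ y)
  have hf₀ : ∀ z hz, f₀ (K.Hmk z hz) = θ z := fun z hz => rfl
  refine ⟨{ f₀ with map_smul' := fun r ξ => ?_ }, hf₀⟩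
  obtain ⟨a, rfl⟩ := Ideal.Quotient.mk_surjective r
  obtain ⟨z, hz, rfl⟩ := K.Hmk_surjective ξ
  change f₀ _ = Ideal.Quotient.mk A.boundaryIdeal a • f₀ _
  rw [H0_smul_Hmk, hf₀, hf₀, hθ.smul_deg_zero]

/-! ### Cones of extensions -/

section Cone

variable {F F' L : DGMod A}

/-- The homomorphism of cones induced by an extension of the source. -/
def coneExt {j : F ⟶ F'} {g : F ⟶ L} {g' : F' ⟶ L} (hj : j ≫ g' = g) : cone g ⟶ cone g' :=
  coneMap g g' j (𝟙 L) 0 (by rw [map_zero, hj, Category.comp_id, ← toHom_zero]; congr 1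
                             exact hom_ext_app fun i x => by simp)

variable {j : F ⟶ F'} {g : F ⟶ L} {g' : F' ⟶ L} (hj : j ≫ g' = g)

lemma coneFst_coneExt {i : ℤ} (z : (cone g).X i) :
    coneFst g' ((coneExt hj).app i z) = coneFst g z := add_zero _

lemma coneSnd_coneExt {i k : ℤ} (h : i + 1 = k) (z : (cone g).X i) :
    coneSnd g' h ((coneExt hj).app i z) = j.app k (coneSnd g h z) := by
  subst h; rfl

lemma CellExt.bijective_app {ι : Type u} {n : ℤ} {e : ι → F'.X n}
    (hc : CellExt j (fun _ => n) e) {k : ℤ} (hk : n < k) : Function.Bijective (j.app k) := by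
  refine ⟨hc.injective k, fun x => ?_⟩
  induction x using hc.induction with
  | hj x => exact ⟨x, rfl⟩
  | he b p hp a =>
    refine ⟨0, ?_⟩
    rw [A.nonpos p (by omega) a, map_zero, map_zero, AddMonoidHom.zero_apply]
  | hadd x y hx hy =>
    obtain ⟨x, rfl⟩ := hx
    obtain ⟨y, rfl⟩ := hy
    exact ⟨x + y, map_add _ _ _⟩

lemma CellExt.surjective_Hmap {ι : Type u} {n : ℤ} {e : ι → F'.X n}
    (hc : CellExt j (fun _ => n) e) {k : ℤ} (hk : n ≤ k) :
    Function.Surjective (Hmap (coneExt hj) k) := fun ξ => by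
  obtain ⟨z, hz, rfl⟩ := (cone g').Hmk_surjective ξ
  obtain ⟨x, hx⟩ := (hc.bijective_app (by omega : n < k + 1)).2 (coneSnd g' rfl z)
  have hxz : (coneExt hj).app k (coneMk g rfl (coneFst g' z) x) = z :=
    cone_ext rfl (by rw [coneFst_coneExt, coneFst_mk]) (by rw [coneSnd_coneExt, coneSnd_mk, hx])
  have hd : (cone g).d rfl (coneMk g rfl (coneFst g' z) x) = 0 := by
    obtain ⟨h₁, h₂⟩ := (cone_d_eq_zero_iff g' rfl rfl z).1 hz
    refine (cone_d_eq_zero_iff g rfl rfl _).2 ⟨?_, hc.injective _ ?_⟩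
    · rw [coneFst_mk, coneSnd_mk, ← hj, comp_app, hx, h₁]
    · rw [coneSnd_mk, j.map_d, hx, h₂, map_zero]
  exact ⟨(cone g).Hmk _ hd, by rw [Hmap_Hmk]; congr 1⟩

/-- The cohomology of `M` is torsion in the degrees above `n`. -/
def IsTorsionAbove (S : Submonoid (A.X 0)) (M : DGMod A) (n : ℤ) : Prop :=
  ∀ i, n < i → ∀ ξ : M.H i, ∃ σ ∈ S, σ • ξ = 0

/-- Killing cohomology classes of the cone by attaching cells of degree `n`. -/
lemma exists_attach_cells {S : Submonoid (A.X 0)} {n : ℤ} (hF : FinCell F)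
    (hS : IsTorsionAbove S (cone g) n) {ι : Type u} [Finite ι] (q : ι → (cone g).H n)
    (hq : ∀ ξ, ∃ σ ∈ S, σ • ξ ∈ Submodule.span A.H0 (Set.range q)) :
    ∃ (F' : DGMod A) (j : F ⟶ F') (g' : F' ⟶ L) (hj : j ≫ g' = g) (e : ι → F'.X n)
      (c : ι → (cone g).X n), CellExt j (fun _ => n) e ∧ FinCell F' ∧
      IsTorsionAbove S (cone g') (n - 1) ∧ (∀ t, ∃ hc, (cone g).Hmk (c t) hc = q t) ∧
      ∀ t, (cone g').d (sub_add_cancel n 1) (coneMk g' (sub_add_cancel n 1) 0 (e t)) =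
        -(coneExt hj).app n (c t) := by
  choose c hc hcq using fun t => (cone g).Hmk_surjective (q t)
  have hc' := fun t => (cone_d_eq_zero_iff g rfl rfl (c t)).1 (hc t)
  let z : ι → F.X (n + 1) := fun t => coneSnd g rfl (c t)
  obtain ⟨g', hg', hge⟩ := (attach_cellExt F (fun _ : ι => n) z fun t => (hc' t).2).exists_desc g z
    (fun t => d_attachCell F _ z _ t) (fun t => -coneFst g (c t)) (fun t => by
      rw [map_neg, ← eq_neg_of_add_eq_zero_right (hc' t).1])
  have hcell := attach_cellExt F (fun _ : ι => n) z fun t => (hc' t).2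
  have hd : ∀ t, (cone g').d (sub_add_cancel n 1) (coneMk g' (sub_add_cancel n 1) 0
      (attachCell F (fun _ : ι => n) z (fun t => (hc' t).2) t)) =
        -(coneExt hg').app n (c t) := fun t => by
    refine cone_ext rfl ?_ ?_
    · rw [coneFst_d, coneFst_mk, coneSnd_mk, map_zero, zero_add, hge, map_neg, coneFst_coneExt]
    · rw [coneSnd_d g' _ rfl, coneSnd_mk, d_attachCell, map_neg, coneSnd_coneExt]
  refine ⟨_, _, g', hg', _, c, hcell, FinCell.of_cellExt hcell hF, fun i hi ξ => ?_,
    fun t => ⟨hc t, hcq t⟩, hd⟩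
  obtain ⟨ξ, rfl⟩ := hcell.surjective_Hmap hg' (by omega) ξ
  by_cases hin : i = n
  · subst hin
    obtain ⟨σ, hσ, h⟩ := hq ξ
    refine ⟨σ, hσ, ?_⟩
    have hle : Submodule.span A.H0 (Set.range q) ≤ LinearMap.ker (HmapLin (coneExt hg') i) := by
      rw [Submodule.span_le]
      rintro _ ⟨t, rfl⟩
      rw [SetLike.mem_coe, LinearMap.mem_ker, HmapLin_apply, ← hcq, Hmap_Hmk]
      exact (Hmk_eq_zero_iff _ (sub_add_cancel i 1) _ _).2 ⟨-coneMk g' (sub_add_cancel i 1) 0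
        (attachCell F (fun _ : ι => i) z (fun t => (hc' t).2) t), by rw [map_neg, hd, neg_neg]⟩
    have := hle h
    rw [LinearMap.mem_ker, smul_eq_mk_smul, map_smul] at this
    rw [smul_eq_mk_smul]
    exact this
  · obtain ⟨σ, hσ, h⟩ := hS i (by omega) ξ
    refine ⟨σ, hσ, ?_⟩
    rw [smul_eq_mk_smul] at h ⊢
    rw [← HmapLin_apply, ← map_smul, h, map_zero]

/-! ### Functionals on cones -/

lemma cone_eq_add (g : F ⟶ L) {i k : ℤ} (h : i + 1 = k) (z : (cone g).X i) :
    z = (coneInl g).app i (coneFst g z) + coneMk g h 0 (coneSnd g h z) :=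
  cone_ext h (by simp) (by simp)

variable {M : Type u} [AddCommGroup M] [Module A.H0 M]

lemma IsFunctional.comp_coneFst {i : ℤ} {θ : L.X i →+ M} (hθ : IsFunctional θ) (g : F ⟶ L) :
    IsFunctional (θ.comp (coneFst g)) := hθ.comp_hev (gFst g) (add_zero i)

lemma IsFunctional.comp_coneSnd {i k : ℤ} {θ : F.X k →+ M} (hθ : IsFunctional θ) (g : F ⟶ L)
    (h : i + 1 = k) : IsFunctional (θ.comp (coneSnd g h)) := hθ.comp_hev (gSnd g) h

lemma IsFunctional.exists_comp_inr {g : F ⟶ L} {i k : ℤ} {θ : (cone g).X i →+ M}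
    (hθ : IsFunctional θ) (h : i + 1 = k) :
    ∃ η : F.X k →+ M, IsFunctional η ∧ ∀ x, η x = θ (coneMk g h 0 x) :=
  ⟨_, hθ.comp_hev (gInr g) (by omega : k + -1 = i), fun x => by
    rw [AddMonoidHom.comp_apply, hev_gInr]⟩

/-- A closed functional on a cone is the sum of an exact one and one on the source. -/
lemma exists_functional_cone {m : ℤ} (hL : FunExact L m) {θ : (cone g).X m →+ M}
    (hθ : IsFunctional θ)
    (hd : ∀ {i : ℤ} (h : i + 1 = m) (x : (cone g).X i), θ ((cone g).d h x) = 0) :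
    ∃ (θ' : (cone g).X (m + 1) →+ M) (η : F.X (m + 1) →+ M), IsFunctional θ' ∧ IsFunctional η ∧
      ∀ z, θ z = θ' ((cone g).d rfl z) + η (coneSnd g rfl z) := by
  obtain ⟨θ', hθ', h⟩ := hL M _ (hθ.comp_app (coneInl g)) (fun h x => by
    rw [AddMonoidHom.comp_apply, (coneInl g).map_d, hd])
  obtain ⟨η, hη, h'⟩ := hθ.exists_comp_inr (rfl : m + 1 = m + 1)
  refine ⟨_, _, hθ'.comp_coneFst g, hη.sub (hθ'.comp_app g), fun z => ?_⟩
  have h₁ := h (coneFst g z)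
  rw [AddMonoidHom.comp_apply] at h₁
  rw [AddMonoidHom.comp_apply, coneFst_d, AddMonoidHom.sub_apply, h', AddMonoidHom.comp_apply,
    map_add, add_add_sub_cancel, ← h₁, ← map_add, ← cone_eq_add]

lemma FunExact.cone {m : ℤ} (hL : FunExact L m) (hF : FunZero F (m + 1)) :
    FunExact (cone g) m := fun M _ _ θ hθ hd => by
  obtain ⟨θ', η, hθ', hη, h⟩ := exists_functional_cone hL hθ hd
  exact ⟨θ', hθ', fun x => by rw [h, hF M η hη, add_zero]⟩

lemma exists_functional_lift_cone {M' : Type u} [AddCommGroup M'] [Module A.H0 M'] (hF : Cofib F)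
    (hL : Cofib L) {f : M →ₗ[A.H0] M'} (hf : Function.Surjective f) {m : ℤ}
    {θ : (cone g).X m →+ M'} (hθ : IsFunctional θ) :
    ∃ θ' : (cone g).X m →+ M, IsFunctional θ' ∧ ∀ x, f (θ' x) = θ x := by
  obtain ⟨θ₁, h₁, e₁⟩ := Cofib.exists_functional_lift hL hf (hθ.comp_app (coneInl g))
  obtain ⟨η, hη, hη'⟩ := hθ.exists_comp_inr (rfl : m + 1 = m + 1)
  obtain ⟨θ₂, h₂, e₂⟩ := Cofib.exists_functional_lift hF hf hη
  refine ⟨_, (h₁.comp_coneFst g).add (h₂.comp_coneSnd g rfl), fun z => ?_⟩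
  rw [AddMonoidHom.add_apply, map_add, AddMonoidHom.comp_apply, AddMonoidHom.comp_apply, e₁, e₂,
    AddMonoidHom.comp_apply, hη', ← map_add, ← cone_eq_add]

end Cone

lemma IsFunctional.comp_idx {K : DGMod A} {M : Type u} [AddCommGroup M] [Module A.H0 M] {i k : ℤ}
    {θ : K.X k →+ M} (hθ : IsFunctional θ) (h : i = k) : IsFunctional (θ.comp (K.idx h)) := by
  subst h
  exact hθ

section Top

variable {F L : DGMod A} {g : F ⟶ L}

/-- The top cohomology of the cone is projective. -/
lemma projective_top {a : ℤ} (hF : Cofib F) (hL : Cofib L)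
    (hC : ∀ i, a < i → Subsingleton ((cone g).H i)) (he : FunExact (cone g) (a - 1))
    [Module.Finite A.H0 ((cone g).H a)] : Module.Projective A.H0 ((cone g).H a) := by
  obtain ⟨r, π, hπ⟩ := Module.Finite.exists_fin' A.H0 ((cone g).H a)
  obtain ⟨θ, hθ, hd, hcls⟩ := exists_functional_class
    (isKProjective_cone g (Cofib.isKProjective hF) (Cofib.isKProjective hL)) (𝟙 (cone g)) hC
  obtain ⟨θ₁, hθ₁, hlift⟩ := exists_functional_lift_cone (g := g) hF hL hπ hθ
  let φ : (cone g).X (a - 1) →+ LinearMap.ker π :=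
    (θ₁.comp ((cone g).d (sub_add_cancel a 1))).codRestrict (LinearMap.ker π).toAddSubgroup
      (fun x => (hlift _).trans (hd _ x))
  have hφ : IsFunctional φ :=
    ⟨fun b x => Subtype.ext ((hθ₁.comp_d (sub_add_cancel a 1)).smul_deg_zero b x),
      fun h hp b x => Subtype.ext ((hθ₁.comp_d (sub_add_cancel a 1)).smul_deg_ne h hp b x)⟩
  obtain ⟨ψ, hψ, hψφ⟩ := he _ φ hφ (fun h x => Subtype.ext (by
    change θ₁ ((cone g).d _ ((cone g).d _ x)) = 0
    rw [(cone g).d_d, map_zero]))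
  have hψ' := hψ.comp_idx (sub_add_cancel a 1).symm
  have hψφ' : ∀ x, φ x = (ψ.comp ((cone g).idx (sub_add_cancel a 1).symm))
      ((cone g).d (sub_add_cancel a 1) x) := fun x => by
    rw [AddMonoidHom.comp_apply, idx_d, ← hψφ]
  have hclosed : ∀ {i : ℤ} (h : i + 1 = a) (x : (cone g).X i),
      (θ₁ - (LinearMap.ker π).subtype.toAddMonoidHom.comp
        (ψ.comp ((cone g).idx (sub_add_cancel a 1).symm))) ((cone g).d h x) = 0 := by
    intro i h x
    obtain rfl : i = a - 1 := by omega
    rw [AddMonoidHom.sub_apply, AddMonoidHom.comp_apply, ← hψφ']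
    exact sub_self _
  obtain ⟨σ, hσ⟩ := (hθ₁.sub (hψ'.post (LinearMap.ker π).subtype)).exists_desc hclosed
  refine Module.Projective.of_split σ π (LinearMap.ext fun ξ => ?_)
  obtain ⟨z, hz, rfl⟩ := (cone g).Hmk_surjective ξ
  rw [LinearMap.comp_apply, hσ, AddMonoidHom.sub_apply, map_sub, hlift, hcls z hz, Hmap_id]
  exact (congrArg _ (ψ _).2).trans (sub_zero _)

/-- Localizing a torsion cohomology module gives zero. -/
lemma IsLocal.subsingleton_H {S : Submonoid (A.X 0)} {M R : DGMod A} {η : M ⟶ R} (hη : IsLocal S η)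
    {j : ℤ} (hM : ∀ ξ : M.H j, ∃ σ ∈ S, σ • ξ = 0) : Subsingleton (R.H j) := by
  refine (R.subsingleton_H_iff (sub_add_cancel j 1) rfl).2 fun z hz => ?_
  obtain ⟨σ, hσ, m, n, hm, hn, hmn⟩ := hη.d_eq_zero rfl hz
  rw [smul_zero] at hn
  obtain ⟨τ, hτ, hτn⟩ := hη.inj n hn.symm
  obtain ⟨ρ, hρ, h⟩ := hM (M.Hmk (τ • m) (by rw [d_zero_smul, hmn, hτn]))
  rw [Hmk_smul, Hmk_eq_zero_iff _ (sub_add_cancel j 1)] at h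
  obtain ⟨y, hy⟩ := h
  obtain ⟨w, hw⟩ := (hη.bij _ (S.mul_mem hρ (S.mul_mem hτ hσ)) _).2 (η.app _ y)
  refine ⟨w, (hη.bij _ (S.mul_mem hρ (S.mul_mem hτ hσ)) j).1 ?_⟩
  change (ρ * (τ * σ)) • R.d _ w = (ρ * (τ * σ)) • z
  change (ρ * (τ * σ)) • w = _ at hw
  rw [← d_zero_smul, hw, ← η.map_d, hy, app_zero_smul, app_zero_smul, ← hm, smul_smul, smul_smul,
    _root_.mul_assoc]

/-- A localized torsion cohomology module is torsion. -/
lemma IsLocal.exists_smul_eq_zero {S : Submonoid (A.X 0)} {M R : DGMod A} {η : M ⟶ R}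
    (hη : IsLocal S η) {j : ℤ} (ξ : M.H j) (hξ : Hmap η j ξ = 0) : ∃ σ ∈ S, σ • ξ = 0 := by
  obtain ⟨z, hz, rfl⟩ := M.Hmk_surjective ξ
  rw [Hmap_Hmk, Hmk_eq_zero_iff _ (sub_add_cancel j 1)] at hξ
  obtain ⟨x, hx⟩ := hξ
  obtain ⟨σ, hσ, m, n, hm, hn, hmn⟩ := hη.d_eq_zero _ hx
  obtain ⟨τ, hτ, hτn⟩ := hη.inj (σ • z - n) (by rw [map_sub, app_zero_smul, hn, sub_self])
  refine ⟨τ * σ, S.mul_mem hτ hσ, ?_⟩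
  rw [Hmk_smul, Hmk_eq_zero_iff _ (sub_add_cancel j 1)]
  refine ⟨τ • m, ?_⟩
  rw [d_zero_smul, hmn]
  rw [smul_sub, sub_eq_zero] at hτn
  rw [← hτn, smul_smul]

lemma IsLocal.smul_surjective_H {S : Submonoid (A.X 0)} {M R : DGMod A} {η : M ⟶ R}
    (hη : IsLocal S η) {σ : A.X 0} (hσ : σ ∈ S) {j : ℤ} (ξ : R.H j) : ∃ ζ : R.H j, σ • ζ = ξ := by
  obtain ⟨z, hz, rfl⟩ := R.Hmk_surjective ξ
  obtain ⟨w, hw⟩ := (hη.bij σ hσ j).2 z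
  change σ • w = z at hw
  refine ⟨R.Hmk w ((hη.bij σ hσ _).1 ?_), ?_⟩
  · change σ • R.d _ w = σ • (0 : R.X _)
    rw [← d_zero_smul, hw, hz, smul_zero]
  · rw [Hmk_smul]
    congr 1

/-- If closed functionals of degree `m` are exact, then torsion propagates to degree `m`. -/
lemma IsTorsionAbove.of_funExact {X : DGMod A} {s : A.H0} (hX : X.IsKProjective) {m : ℤ}
    (hT : IsTorsionAbove (A.powersLift s) X m)
    (he : ∀ θ : X.X m →+ (res (A.toLoc s) (X.baseChange (A.toLoc s))).H m, IsFunctional θ →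
      (∀ {i : ℤ} (h : i + 1 = m) (x : X.X i), θ (X.d h x) = 0) →
      ∀ x, X.d rfl x = 0 → θ x = 0) :
    IsTorsionAbove (A.powersLift s) X (m - 1) := fun i hi ξ => by
  by_cases him : i = m
  · subst him
    obtain ⟨θ, hθ, hd, hcls⟩ := exists_functional_class hX (bcUnit (A.toLoc s) X)
      (fun i hi => (isLocal_bcUnit s X).subsingleton_H (hT i hi))
    obtain ⟨z, hz, rfl⟩ := X.Hmk_surjective ξ
    exact (isLocal_bcUnit s X).exists_smul_eq_zero _ (by rw [← hcls, he θ hθ hd z hz])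
  · exact hT i (by omega) ξ

end Top

/-! ### Local splitting -/

section Split

variable {F F' L : DGMod A} {j : F ⟶ F'} {g : F ⟶ L} {g' : F' ⟶ L} (hj : j ≫ g' = g)
  {M : Type u} [AddCommGroup M] [Module A.H0 M]

/-- Extending a closed functional along the attachment of cells. -/
lemma exists_functional_coneExt {ι : Type u} {a : ℤ} {e : ι → F'.X a}
    (hc : CellExt j (fun _ => a) e) (hF : FunZero F a) {c : ι → (cone g).X a}
    (hec : ∀ t, (cone g').d (sub_add_cancel a 1) (coneMk g' (sub_add_cancel a 1) 0 (e t)) =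
        -(coneExt hj).app a (c t)) {f : (cone g).X a →+ M} (hf : IsFunctional f)
    (hd : ∀ {i : ℤ} (h : i + 1 = a) (x : (cone g).X i), f ((cone g).d h x) = 0)
    {η : F'.X a →+ M} (hη : IsFunctional η) (hηc : ∀ t, f (c t) = -η (e t)) :
    ∃ f' : (cone g').X a →+ M, IsFunctional f' ∧ ∀ z,
      f' ((cone g').d (sub_add_cancel a 1) z) = η (coneSnd g' (sub_add_cancel a 1) z) := by
  obtain ⟨C⟩ := hc.nonempty_coords
  obtain ⟨ζ, hζ, hζ'⟩ := hf.exists_comp_inr (rfl : a + 1 = a + 1)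
  let f' : (cone g').X a →+ M := (f.comp ((coneInl g).app a)).comp (coneFst g') +
    (ζ.comp (hev (add_zero _) C.ρ)).comp (coneSnd g' rfl)
  have hf' : IsFunctional f' := ((hf.comp_app _).comp_coneFst g').add
    ((hζ.comp_hev C.ρ (add_zero _)).comp_coneSnd g' rfl)
  have hext : ∀ w, f' ((coneExt hj).app a w) = f w := fun w => by
    simp only [f', AddMonoidHom.add_apply, AddMonoidHom.comp_apply]
    rw [coneFst_coneExt, coneSnd_coneExt, C.ρ_inl, hζ', ← map_add, ← cone_eq_add]
  have hdext : ∀ w, f' ((cone g').d (sub_add_cancel a 1) ((coneExt hj).app _ w)) = 0 := fun w => by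
    rw [← (coneExt hj).map_d, hext, hd]
  refine ⟨f', hf', fun z => ?_⟩
  have hinl : (coneInl g').app (a - 1) (coneFst g' z) =
      (coneExt hj).app _ ((coneInl g).app _ (coneFst g' z)) :=
    cone_ext rfl (by rw [coneFst_coneExt, coneFst_inl, coneFst_inl])
      (by rw [coneSnd_coneExt, coneSnd_inl, coneSnd_inl, map_zero])
  rw [cone_eq_add g' (sub_add_cancel a 1) z, map_add, map_add, hinl, hdext, zero_add, map_add,
    coneSnd_coneExt, coneSnd_inl, map_zero, zero_add, coneSnd_mk]
  generalize coneSnd g' (sub_add_cancel a 1) z = x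
  induction x using hc.induction with
  | hj x =>
    have hinr : coneMk g' (sub_add_cancel a 1) 0 (j.app a x) =
        (coneExt hj).app _ (coneMk g (sub_add_cancel a 1) 0 x) :=
      cone_ext (sub_add_cancel a 1) (by rw [coneFst_coneExt, coneFst_mk, coneFst_mk])
        (by rw [coneSnd_coneExt, coneSnd_mk, coneSnd_mk])
    rw [hinr, hdext]
    exact (hF M _ (hη.comp_app j) x).symm
  | he b p hp r =>
    obtain rfl : p = 0 := by omega
    have hsm : coneMk g' (sub_add_cancel a 1) 0 (F'.smul hp r (e b)) =
        r • coneMk g' (sub_add_cancel a 1) 0 (e b) := by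
      refine cone_ext (sub_add_cancel a 1) ?_ ?_
      · refine Eq.trans ?_ (coneFst_smul g' (zero_add _) r _).symm
        rw [coneFst_mk, coneFst_mk, map_zero]
      · refine Eq.trans ?_ (coneSnd_smul g' (zero_add _) (sub_add_cancel a 1) (sub_add_cancel a 1)
          hp r _).symm
        rw [coneSnd_mk, coneSnd_mk, sgn_zero, _root_.one_smul]
    rw [hsm, d_zero_smul, hf'.smul_deg_zero, hec, map_neg, hext, hηc, neg_neg]
    exact (hη.smul_deg_zero r (e b)).symm
  | hadd x y hx hy =>
    have hadd : coneMk g' (sub_add_cancel a 1) 0 (x + y) =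
        coneMk g' (sub_add_cancel a 1) 0 x + coneMk g' (sub_add_cancel a 1) 0 y :=
      cone_ext (sub_add_cancel a 1) (by simp) (by simp)
    rw [hadd, map_add, map_add, hx, hy, map_add]

end Split

/-- Around each prime, a DG module whose closed functionals are exact in low degrees is finite
semi-free. -/
lemma exists_local_splitting {F L : DGMod A} {g : F ⟶ L} {a : ℤ} (hF : FinCell F) (hL : Cofib L)
    (hF₀ : ∀ m ≤ a, FunZero F m) (hL₀ : ∀ m < a, FunExact L m)
    (hC : ∀ i, a < i → Subsingleton ((cone g).H i)) [Module.Finite A.H0 ((cone g).H a)]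
    (p : Ideal A.H0) [p.IsPrime] :
    ∃ s, s ∉ p ∧ ∃ (F' : DGMod A) (g' : F' ⟶ L), FinCell F' ∧
      IsTorsionH (A.powersLift s) (cone g') := by
  have hproj : Module.Projective A.H0 ((cone g).H a) := projective_top hF.cofib hL hC
    ((hL₀ _ (by omega)).cone (hF₀ _ (by omega)))
  obtain ⟨s, hs, r, α, β, hαβ, hβα⟩ := exists_localization_free ((cone g).H a) p
  obtain ⟨σ, rfl⟩ := Ideal.Quotient.mk_surjective s
  have hσ : σ ∈ A.powersLift (Ideal.Quotient.mk A.boundaryIdeal σ) := Submonoid.mem_powers _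
  obtain ⟨F', j, g', hj, e, c, hcell, hF', hT, hcq, hec⟩ := exists_attach_cells
    (S := A.powersLift (Ideal.Quotient.mk A.boundaryIdeal σ)) hF
    (fun i hi ξ => ⟨1, Submonoid.one_mem _, (hC i hi).elim _ _⟩)
    (fun t : ULift.{u} (Fin r) => α (Pi.single t.down 1)) (fun ξ => ⟨σ, hσ, by
      rw [smul_eq_mk_smul, ← hαβ, ← Finset.univ_sum_single (β ξ), map_sum]
      refine Submodule.sum_mem _ fun t _ => ?_
      rw [← _root_.mul_one (β ξ t), ← smul_eq_mul, Pi.single_smul, map_smul]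
      exact Submodule.smul_mem _ _ (Submodule.subset_span ⟨⟨t⟩, rfl⟩)⟩)
  have hF'₀ : ∀ m < a, FunZero F' m := fun m hm =>
    hcell.funZero (fun _ => by omega) (hF₀ m hm.le)
  have hK : (cone g').IsKProjective := isKProjective_cone g' hF'.isKProjective
    (Cofib.isKProjective hL)
  have hT' : IsTorsionAbove (A.powersLift (Ideal.Quotient.mk A.boundaryIdeal σ)) (cone g')
      (a - 1 - 1) := by
    refine hT.of_funExact hK fun θ hθ hd z hz => ?_
    obtain ⟨θ', η, hθ', hη, h⟩ := exists_functional_cone (hL₀ (a - 1) (by omega)) hθ hd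
    obtain ⟨θ₀, hθ₀, hd₀, hcls⟩ := exists_functional_class
      (isKProjective_cone g hF.isKProjective (Cofib.isKProjective hL)) (𝟙 (cone g)) hC
    have hη' := hη.comp_idx (sub_add_cancel a 1).symm
    choose ζ hζ using fun t : Fin r => (isLocal_bcUnit (Ideal.Quotient.mk A.boundaryIdeal σ)
      (cone g')).smul_surjective_H hσ (η (F'.idx (sub_add_cancel a 1).symm (e ⟨t⟩)))
    let μ := Fintype.linearCombination A.H0 fun t => -ζ t
    obtain ⟨f', hf', hff⟩ := exists_functional_coneExt hj hcell (hF₀ a le_rfl) hec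
      (hθ₀.post (μ ∘ₗ β)) (fun h x => by
        rw [AddMonoidHom.comp_apply, hd₀, map_zero]) hη' (fun t => by
        obtain ⟨hc, hct⟩ := hcq t
        change μ (β (θ₀ (c t))) = -η _
        rw [hcls (c t) hc, Hmap_id, hct, hβα, map_smul, ← hζ, smul_eq_mk_smul]
        simp [μ, Fintype.linearCombination_apply_single])
    rw [h, hz, map_zero, zero_add]
    have h₁ := hff z
    rw [AddMonoidHom.comp_apply, (d_eq_zero_iff (cone g') _ rfl z).2 hz, map_zero] at h₁
    rw [h₁]
    congr 1
    exact hev_idx_right (sub_add_cancel a 1) rfl (sub_add_cancel a 1).symm (gSnd g') z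
  refine ⟨_, hs, F', g', hF', ?_⟩
  have hall : ∀ m ≤ a - 1 - 1, IsTorsionAbove
      (A.powersLift (Ideal.Quotient.mk A.boundaryIdeal σ)) (cone g') m := by
    refine Int.leInductionDown hT' fun m hm ih => ih.of_funExact hK fun θ hθ hd z hz => ?_
    obtain ⟨θ', -, h⟩ := (hL₀ m (by omega)).cone (hF'₀ (m + 1) (by omega)) _ θ hθ hd
    rw [h, hz, map_zero]
  intro i k l h h' z hz
  have hz' := (d_eq_zero_iff (cone g') h' rfl z).1 hz
  obtain ⟨τ, hτ, hτz⟩ := hall (min (a - 1 - 1) i) (min_le_left _ _) k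
    (by have := min_le_right (a - 1 - 1) i; omega) ((cone g').Hmk z hz')
  rw [Hmk_smul, Hmk_eq_zero_iff _ h] at hτz
  exact ⟨τ, hτ, hτz⟩

/-- The first nonvanishing cohomology of the cone of a homomorphism from a finite cell module is
finite. -/
def HasFiniteTops (L : DGMod A) : Prop :=
  ∀ (F : DGMod A) (g : F ⟶ L) (n : ℤ), FinCell F → (∀ i, n < i → Subsingleton ((cone g).H i)) →
    Module.Finite A.H0 ((cone g).H n)

lemma HasFiniteTops.exists_approx {L : DGMod A} (hL : HasFiniteTops L) {b : ℤ}
    (hb : ∀ i, b < i → Subsingleton (L.H i)) (n : ℤ) (hn : n ≤ b) :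
    ∃ (F : DGMod A) (g : F ⟶ L), FinCell F ∧ (∀ m ≤ n, FunZero F m) ∧
      ∀ i, n < i → Subsingleton ((cone g).H i) := by
  revert n hn
  refine Int.leInductionDown ?_ fun n hn ih => ?_
  · refine ⟨zeroMod A, 0, .trivial isTrivial_zeroMod, fun m _ => isTrivial_zeroMod.funZero m,
      fun i hi => ?_⟩
    have hq : quasiIso A (coneInl (0 : zeroMod A ⟶ L)) := quasiIso_of_bijective _ fun k =>
      ⟨fun x y hxy => by simpa using congrArg (coneFst _) hxy, fun z => ⟨coneFst _ z,
        cone_ext rfl (by rw [coneFst_inl]) ((isTrivial_zeroMod _ _).trans (isTrivial_zeroMod _ _).symm)⟩⟩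
    have := hb i hi
    exact (hq i).2.subsingleton
  · obtain ⟨F, g, hF, hF₀, hC⟩ := ih
    have := hL F g n hF hC
    obtain ⟨T, hT⟩ := this.fg_top
    obtain ⟨F', j, g', hj, e, c, hcell, hF', hS, -, -⟩ := exists_attach_cells (S := ⊥) hF
      (fun i hi ξ => ⟨1, Submonoid.one_mem _, (hC i hi).elim _ _⟩) (fun t : T => t.1)
      (fun ξ => ⟨1, Submonoid.one_mem _, by
        have : Set.range (fun t : T => t.1) = T := Subtype.range_coe
        rw [this, hT]; exact Submodule.mem_top⟩)
    refine ⟨F', g', hF', fun m hm => hcell.funZero (fun _ => by omega) (hF₀ m (by omega)),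
      fun i hi => subsingleton_of_forall_eq 0 fun ξ => ?_⟩
    obtain ⟨σ, hσ, h⟩ := hS i hi ξ
    rwa [Submonoid.mem_bot.1 hσ, _root_.one_smul] at h

/-- A criterion for geometric perfection in terms of functionals. -/
lemma isGeometricallyPerfect_of_functionals {L P : DGMod A} (hL : Cofib L) {g₀ : L ⟶ P}
    (hg₀ : quasiIso A g₀) {a b : ℤ} (hb : ∀ i, b < i → Subsingleton (L.H i))
    (ha : ∀ m < a, FunExact L m) (hfin : HasFiniteTops L) : P.IsGeometricallyPerfect := by
  obtain ⟨F, g, hF, hF₀, hC⟩ := hfin.exists_approx hb (min a b) (min_le_right a b)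
  have := hfin F g _ hF hC
  let T : Set A.H0 := {s | ∃ (F' : DGMod A) (g' : F' ⟶ L), FinCell F' ∧
    IsTorsionH (A.powersLift s) (cone g')}
  have hT : Ideal.span T = ⊤ := by
    by_contra h
    obtain ⟨p, hp, hle⟩ := Ideal.exists_le_maximal _ h
    obtain ⟨s, hs, hF'⟩ := exists_local_splitting hF hL hF₀
      (fun m hm => ha m (hm.trans_le (min_le_left a b))) hC p
    exact hs (hle (Ideal.subset_span hF'))
  obtain ⟨T', hT', hspan⟩ := (Ideal.span_eq_top_iff_finite T).1 hT
  refine ⟨T'.card, fun i => (T'.equivFin.symm i).1, ?_, fun i => ?_⟩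
  · rw [← hspan]
    congr 1
    ext x
    exact ⟨fun ⟨i, hi⟩ => hi ▸ (T'.equivFin.symm i).2, fun hx => ⟨T'.equivFin ⟨x, hx⟩, by simp⟩⟩
  · obtain ⟨F', g', hF', hg'⟩ := hT' (T'.equivFin.symm i).2
    refine ⟨F'.baseChange (A.toLoc (T'.equivFin.symm i).1), (FinCell.baseChange hF').isFiniteSemiFree, ?_⟩
    have := isIso_of_quasiIso (quasiIso_bcMap_toLoc hg')
    have := isIso_of_quasiIso (quasiIso_bcMap_toLoc (s := (T'.equivFin.symm i).1)
      ((quasiIso_iff_acyclic_cone g₀).1 hg₀ |>.isTorsionH _))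
    exact ⟨(asIso ((Q _).map (bcMap _ g₀))).symm ≪≫ (asIso ((Q _).map (bcMap _ g'))).symm⟩

/-! ### Geometric perfection of compact objects -/

lemma FunFinite.hasFiniteTops {L : DGMod A} (hL : Cofib L) (h : ∀ m, FunFinite L m) :
    HasFiniteTops L := fun F g n hF hC => by
  obtain ⟨θ, hθ, hd, hcls⟩ := exists_functional_class
    (isKProjective_cone g hF.isKProjective (Cofib.isKProjective hL)) (𝟙 (cone g)) hC
  obtain ⟨θ', hθ', T, hT, h₁⟩ := h n _ _ (hθ.comp_app (coneInl g)) (fun h x => by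
    rw [AddMonoidHom.comp_apply, (coneInl g).map_d, hd])
  obtain ⟨η, hη, h₂⟩ := hθ.exists_comp_inr (rfl : n + 1 = n + 1)
  obtain ⟨T', hT', h₃⟩ := hF.funSpan (n + 1) _ _ (hη.sub (hθ'.comp_app g))
  refine ⟨Submodule.fg_def.2 ⟨T ∪ T', hT.union hT', top_le_iff.1 fun ξ _ => ?_⟩⟩
  obtain ⟨z, hz, rfl⟩ := (cone g).Hmk_surjective ξ
  have hsum : (cone g).Hmk z hz = (θ ((coneInl g).app n (coneFst g z)) -
      θ' (L.d rfl (coneFst g z))) + (η (coneSnd g rfl z) - θ' (g.app _ (coneSnd g rfl z))) := by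
    have := hcls z hz
    rw [Hmap_id] at this
    rw [← this, eq_neg_of_add_eq_zero_left ((cone_d_eq_zero_iff g rfl rfl z).1 hz).1, map_neg,
      sub_neg_eq_add, h₂, add_add_sub_cancel, ← map_add, ← cone_eq_add]
  rw [hsum]
  exact Submodule.add_mem _ (Submodule.span_mono Set.subset_union_left (h₁ _))
    (Submodule.span_mono Set.subset_union_right (h₃ _))

lemma Hmap_of_null {L M : DGMod A} {f g : L ⟶ M} (h : Null (f - g)) (i : ℤ) (ξ : L.H i) :
    Hmap f i ξ = Hmap g i ξ := by
  obtain ⟨z, hz, rfl⟩ := L.Hmk_surjective ξ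
  rw [Hmap_Hmk, Hmap_Hmk, Hmk_eq_iff _ (sub_add_cancel i 1)]
  exact h.exists_app _ rfl z hz

lemma surjective_Hmap_of_retract {L G : DGMod A} {u : L ⟶ G} {v : G ⟶ L}
    (huv : Null (u ≫ v - 𝟙 L)) (i : ℤ) : Function.Surjective (Hmap v i) := fun ξ =>
  ⟨Hmap u i ξ, by rw [← Hmap_comp, Hmap_of_null huv, Hmap_id]⟩

lemma FinCell.exists_eq_zero {X : DGMod A} (hX : FinCell X) :
    ∃ b : ℤ, ∀ i, b < i → ∀ x : X.X i, x = 0 := by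
  induction hX with
  | trivial h => exact ⟨0, fun i _ => h i⟩
  | cell j n e h _ ih =>
    obtain ⟨b, hb⟩ := ih
    refine ⟨max b n, fun i hi x => ?_⟩
    have h₁ := le_max_left b n
    have h₂ := le_max_right b n
    induction x using h.induction with
    | hj x => rw [hb i (by omega) x, map_zero]
    | he b p hp a => rw [A.nonpos p (by omega) a, map_zero, AddMonoidHom.zero_apply]
    | hadd x y hx hy => rw [hx, hy, add_zero]

lemma FinCell.exists_subsingleton_H {L G : DGMod A} (hG : FinCell G) {u : L ⟶ G} {v : G ⟶ L}
    (huv : Null (u ≫ v - 𝟙 L)) : L.IsCohBddAbove := by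
  obtain ⟨b, hb⟩ := hG.exists_eq_zero
  refine ⟨b, fun i hi => ?_⟩
  have : Subsingleton (G.H i) := (G.subsingleton_H_iff (sub_add_cancel i 1) rfl).2 fun z _ =>
    ⟨0, by rw [map_zero, hb i hi z]⟩
  exact (surjective_Hmap_of_retract huv i).subsingleton

lemma FinCell.exists_funExact {L G : DGMod A} (hG : FinCell G) {u : L ⟶ G} {v : G ⟶ L}
    (huv : Null (u ≫ v - 𝟙 L)) : ∃ a : ℤ, ∀ m < a, FunExact L m := by
  obtain ⟨a, ha⟩ := hG.exists_funZero
  exact ⟨a, fun m hm => (ha m hm).funExact.of_retract huv⟩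

lemma FinCell.funFinite_of_retract {L G : DGMod A} (hG : FinCell G) {u : L ⟶ G} {v : G ⟶ L}
    (huv : Null (u ≫ v - 𝟙 L)) (m : ℤ) : FunFinite L m :=
  (hG.funSpan m).funFinite.of_retract huv

lemma IsFinCellRetract.isGeometricallyPerfect {P : DGMod A} (hP : P.IsFinCellRetract) :
    P.IsGeometricallyPerfect := by
  obtain ⟨L, G, g, u, v, hL, hg, hG, huv⟩ := hP
  obtain ⟨b, hb⟩ := hG.exists_subsingleton_H huv
  obtain ⟨a, ha⟩ := hG.exists_funExact huv
  exact isGeometricallyPerfect_of_functionals hL hg hb ha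
    (FunFinite.hasFiniteTops hL (hG.funFinite_of_retract huv))

lemma IsFinCellRetract.exists_retract {L : DGMod A} (hL : Cofib L) (h : L.IsFinCellRetract) :
    ∃ (G : DGMod A) (u : L ⟶ G) (v : G ⟶ L), FinCell G ∧ Null (u ≫ v - 𝟙 L) := by
  obtain ⟨L₁, G, g, u, v, -, hg, hG, huv⟩ := h
  obtain ⟨k, hk⟩ := exists_lift_null _ (Cofib.isKProjective hL) hg (𝟙 L)
  refine ⟨G, k ≫ u, v ≫ g, hG, ?_⟩
  have h₁ := (huv.post_sub g).pre_sub k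
  rw [Category.id_comp] at h₁
  have := h₁.trans hk
  rwa [Category.assoc] at this ⊢

/-! ### Reduction to the cohomology ring -/

section Reduction

lemma bcMap_comp_sub_id {B : CommDGRing.{u}} (φ : A.Hom B) {L G : DGMod A} (u : L ⟶ G) (v : G ⟶ L) :
    bcMap φ u ≫ bcMap φ v - 𝟙 _ = bcMap φ (u ≫ v - 𝟙 L) :=
  bc_hom_ext fun i x => by
    rw [sub_app, comp_app, bcMap_bmk, bcMap_bmk, bcMap_bmk, id_app, sub_app, id_app, comp_app,
      map_sub]

lemma quasiIso_id (M : DGMod A) : quasiIso A (𝟙 M) :=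
  quasiIso_of_bijective _ fun _ => Function.bijective_id

lemma IsCohBddAbove.of_quasiIso {M N : DGMod A} {f : M ⟶ N} (hf : quasiIso A f)
    (hM : M.IsCohBddAbove) : N.IsCohBddAbove := by
  obtain ⟨b, hb⟩ := hM
  exact ⟨b, fun i hi => by
    have := hb i hi
    exact (hf i).2.subsingleton⟩

lemma IsFinCellRetract.isCohBddAbove {P : DGMod A} (hP : P.IsFinCellRetract) :
    P.IsCohBddAbove := by
  obtain ⟨L, G, g, u, v, hL, hg, hG, huv⟩ := hP
  exact (hG.exists_subsingleton_H huv).of_quasiIso hg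

lemma IsFinCellRetract.hasPerfectReduction {P : DGMod A} (hP : P.IsFinCellRetract) :
    P.HasPerfectReduction := by
  obtain ⟨L, G, g, u, v, hL, hg, hG, huv⟩ := hP
  refine ⟨⟨L, g, hg, (Cofib.isKProjective hL).isKFlat⟩,
    IsFinCellRetract.isGeometricallyPerfect ⟨_, _, 𝟙 _, bcMap _ u, bcMap _ v,
      Cofib.baseChange hL, quasiIso_id _, hG.baseChange, ?_⟩⟩
  rw [bcMap_comp_sub_id]
  exact huv.bcMap

variable {L : DGMod A} {M : Type u} [AddCommGroup M] [Module A.H0 M]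

/-- The ring of degree `0` cohomology of a ring is the ring itself. -/
def ofRingH0 (R : Type u) [CommRing R] : (CommDGRing.ofRing R).H0 →+* R :=
  Ideal.Quotient.lift _
    { toFun := fun x => x.1, map_one' := rfl, map_mul' := fun _ _ => rfl, map_zero' := rfl
      map_add' := fun _ _ => rfl } (by rintro _ ⟨b, rfl⟩; rfl)

variable (M) in
/-- An `H^0(A)`-module, as a module over the degree `0` cohomology of the DG ring `H^0(A)`. -/
@[reducible] def moduleOfRing : Module (CommDGRing.ofRing A.H0).H0 M :=
  Module.compHom M (ofRingH0 A.H0)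

attribute [local instance] moduleOfRing

lemma ofRing_eq_zero {R : Type u} [CommRing R] {p : ℤ} (hp : p ≠ 0)
    (r : (CommDGRing.ofRing R).X p) : r = 0 := CommDGRing.ofRingX_zero hp r

lemma mk_smul_ofRing (r : (CommDGRing.ofRing A.H0).X 0) (x : M) :
    Ideal.Quotient.mk (CommDGRing.ofRing A.H0).boundaryIdeal r • x = r.1 • x := rfl

lemma toH0App_smul_ofRing {p : ℤ} (r : (CommDGRing.ofRing A.H0).X p) (x : M) :
    ((CommDGRing.ofRing A.H0).toH0App p r).1 • x = r.1 • x := by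
  by_cases hp : p = 0
  · subst hp
    rw [CommDGRing.toH0App_zero (CommDGRing.ofRing A.H0), mk_smul_ofRing]
  · rw [ofRing_eq_zero hp r, map_zero]
    exact (zero_smul (CommDGRing.ofRing A.H0).H0 x).trans (zero_smul A.H0 x).symm

variable (M) in
/-- A module placed in a single degree, as a restriction of scalars. -/
noncomputable def concRes (m : ℤ) : conc A M m ⟶ res A.toH0 (conc (CommDGRing.ofRing A.H0) M m) :=
  { app := fun i => AddMonoidHom.id (concX M m i)
    map_smul := fun {p j k} h a x => Subtype.ext (toH0App_smul_ofRing (A.toH0App p a) x.1).symm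
    map_d := fun h x => rfl }

lemma IsFunctional.restrict {m : ℤ} {θ : (L.baseChange A.toH0).X m →+ M} (hθ : IsFunctional θ) :
    ∃ θ' : L.X m →+ M, IsFunctional θ' ∧ ∀ x, θ' x = θ (bmk A.toH0 (zero_add m)
      (CommDGRing.ofRing A.H0).one x) := by
  have key : ∀ {p j k : ℤ} (h : p + j = k) (a : A.X p) (x : L.X j),
      bmk A.toH0 (zero_add k) (CommDGRing.ofRing A.H0).one (L.smul h a x) =
        (L.baseChange A.toH0).smul h (A.toH0App p a)
          (bmk A.toH0 (zero_add j) (CommDGRing.ofRing A.H0).one x) := fun {p j k} h a x => by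
    have := ((bcUnit A.toH0 L).map_smul h a x)
    have h₁ := congrArg ofRes this
    rw [ofRes_smul, ofRes_bcUnit, ofRes_bcUnit] at h₁
    exact h₁
  refine ⟨θ.comp (bmk A.toH0 (zero_add m) (CommDGRing.ofRing A.H0).one), ⟨fun a x => ?_,
    fun h hp a x => ?_⟩, fun x => rfl⟩
  · refine (congrArg θ (key (zero_add m) a x)).trans ((hθ.smul_deg_zero _ _).trans ?_)
    exact congrArg (fun r : A.H0 => r • θ _) (A.toH0App_zero a)
  · exact (congrArg θ (key h a x)).trans (hθ.smul_deg_ne h hp _ _)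

lemma IsFunctional.extend {m : ℤ} {θ : L.X m →+ M} (hθ : IsFunctional θ)
    (hd : ∀ {i : ℤ} (h : i + 1 = m) (x : L.X i), θ (L.d h x) = 0) :
    ∃ θ' : (L.baseChange A.toH0).X m →+ M, IsFunctional θ' ∧
      (∀ {i : ℤ} (h : i + 1 = m) x, θ' ((L.baseChange A.toH0).d h x) = 0) ∧
      ∀ x, θ' (bmk A.toH0 (zero_add m) (CommDGRing.ofRing A.H0).one x) = θ x := by
  obtain ⟨ψ, hψ⟩ := restrictHom_surjective ((DGMod.post L (concRes M m)).app 0 hθ.toHom)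
  have hunit : ∀ x, ofConc (hev (add_zero m) ψ (bmk A.toH0 (zero_add m)
      (CommDGRing.ofRing A.H0).one x)) = θ x := fun x => by
    rw [← ofRes_hev_restrictHom, hψ, hev_post, ← hθ.hev_toHom]
    rfl
  have hfun := isFunctional_hev ψ (add_zero m)
  refine ⟨_, hfun, fun {i} h x => ?_, hunit⟩
  induction x using bmk_induction with
  | mk p j hij b x =>
    by_cases hp : p = 0
    · subst hp
      rw [d_bmk h hij rfl rfl (by omega) (by omega : 0 + (j + 1) = m),
        show (CommDGRing.ofRing A.H0).d rfl b = 0 from rfl, map_zero, AddMonoidHom.zero_apply,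
        zero_add, sgn_zero, _root_.one_smul]
      obtain rfl : j + 1 = m := by omega
      rw [bmk_eq_smul]
      refine (hfun.smul_deg_zero b _).trans ?_
      rw [AddMonoidHom.comp_apply, hunit, hd, smul_zero]
    · rw [ofRing_eq_zero hp b, map_zero, AddMonoidHom.zero_apply, map_zero, map_zero]
  | add x y hx hy => rw [map_add, map_add, hx, hy, add_zero]

lemma bmk_d_one {i k : ℤ} (h : i + 1 = k) (x : L.X i) :
    bmk A.toH0 (zero_add k) (CommDGRing.ofRing A.H0).one (L.d h x) =
      (L.baseChange A.toH0).d h (bmk A.toH0 (zero_add i) (CommDGRing.ofRing A.H0).one x) := by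
  have h₁ := congrArg ofRes ((bcUnit A.toH0 L).map_d h x)
  rw [ofRes_d, ofRes_bcUnit, ofRes_bcUnit] at h₁
  exact h₁

lemma FunExact.of_baseChange {m : ℤ} (h : FunExact (L.baseChange A.toH0) m) : FunExact L m :=
  fun M _ _ θ hθ hd => by
  obtain ⟨Θ, hΘ, hΘd, hΘθ⟩ := hθ.extend hd
  obtain ⟨Θ', hΘ', h'⟩ := h M Θ hΘ hΘd
  obtain ⟨θ', hθ', h''⟩ := hΘ'.restrict
  exact ⟨θ', hθ', fun x => by rw [h'', bmk_d_one, ← h', hΘθ]⟩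

lemma FunFinite.of_baseChange {m : ℤ} (h : FunFinite (L.baseChange A.toH0) m) : FunFinite L m :=
  fun M _ _ θ hθ hd => by
  obtain ⟨Θ, hΘ, hΘd, hΘθ⟩ := hθ.extend hd
  obtain ⟨Θ', hΘ', T, hT, h'⟩ := h M Θ hΘ hΘd
  obtain ⟨θ', hθ', h''⟩ := hΘ'.restrict
  refine ⟨θ', hθ', T, hT, fun x => ?_⟩
  rw [h'', bmk_d_one, ← hΘθ]
  have := h' (bmk A.toH0 (zero_add m) (CommDGRing.ofRing A.H0).one x)
  generalize Θ _ - Θ' _ = y at this ⊢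
  induction this using Submodule.span_induction with
  | mem x hx => exact Submodule.subset_span hx
  | zero => exact Submodule.zero_mem _
  | add x y _ _ hx hy => exact Submodule.add_mem _ hx hy
  | smul r x _ hx => exact Submodule.smul_mem _ (ofRingH0 A.H0 r) hx

end Reduction

lemma HasPerfectReduction.isGeometricallyPerfect {P : DGMod A} (hP : P.HasPerfectReduction)
    (hb : P.IsCohBddAbove) : P.IsGeometricallyPerfect := by
  obtain ⟨F, hF⟩ := hP
  obtain ⟨L, g, hL, hg⟩ := exists_cofib_resolution P
  have hK := Cofib.isKProjective hL
  obtain ⟨θ, hθ⟩ := exists_lift_null _ hK F.quasiIso g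
  have hθ' : quasiIso A θ := quasiIso_of_comp_right F.quasiIso (quasiIso_of_null_sub hg hθ)
  have hbc := quasiIso_bcMap A.toH0 hK.isKFlat F.isKFlat hθ'
  have hK' := Cofib.isKProjective (Cofib.baseChange (φ := A.toH0) hL)
  have hc : (L.baseChange A.toH0).IsCompactObject :=
    (hF.isCompactObject.cpt hK' hbc).isCompactObject hK' (quasiIso_id _)
  obtain ⟨G, u, v, hG, huv⟩ :=
    IsFinCellRetract.exists_retract (Cofib.baseChange hL) hc.exists_finCell
  obtain ⟨a, ha⟩ := hG.exists_funExact huv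
  obtain ⟨b, hb⟩ := hb
  exact isGeometricallyPerfect_of_functionals hL hg
    (fun i hi => by
      have := hb i hi
      exact (hg i).1.subsingleton)
    (fun m hm => (ha m hm).of_baseChange)
    (FunFinite.hasFiniteTops hL fun m => (hG.funFinite_of_retract huv m).of_baseChange)

/-! ### Finiteness of cohomology -/

lemma exists_H_lin {X Y : DGMod A} {i k : ℤ} (f : X.X i →+ Y.X k)
    (hcl : ∀ z, X.d rfl z = 0 → Y.d rfl (f z) = 0)
    (hb : ∀ {l : ℤ} (h : l + 1 = i) (x : X.X l), ∃ y, Y.d (sub_add_cancel k 1) y = f (X.d h x))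
    (hsmul : ∀ (a : A.X 0) x, f (a • x) = a • f x) :
    ∃ F : X.H i →ₗ[A.H0] Y.H k, ∀ z hz, F (X.Hmk z hz) = Y.Hmk (f z) (hcl z hz) := by
  let F₀ : X.H i →+ Y.H k := QuotientAddGroup.lift _
    (AddMonoidHom.mk' (fun z : (X.cocycles i).toAddSubgroup => Y.Hmk (f z.1) (hcl z.1 z.2))
      (fun z w => by
        rw [Hmk_add]
        congr 1
        exact map_add f z.1 w.1)) (by
    rintro ⟨z, hz⟩ ⟨y, rfl⟩
    exact (Hmk_eq_zero_iff Y (sub_add_cancel k 1) _ _).2 (hb _ y))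
  have hF₀ : ∀ z hz, F₀ (X.Hmk z hz) = Y.Hmk (f z) (hcl z hz) := fun z hz => rfl
  refine ⟨{ F₀ with map_smul' := fun r ξ => ?_ }, hF₀⟩
  obtain ⟨a, rfl⟩ := Ideal.Quotient.mk_surjective r
  obtain ⟨z, hz, rfl⟩ := X.Hmk_surjective ξ
  change F₀ _ = Ideal.Quotient.mk A.boundaryIdeal a • F₀ _
  rw [H0_smul_Hmk, hF₀, hF₀, H0_smul_Hmk]
  congr 1
  exact hsmul a z

lemma finite_H_cone [IsNoetherianRing A.H0] {F L : DGMod A} (g : F ⟶ L) {i k : ℤ} (h : i + 1 = k)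
    [Module.Finite A.H0 (F.H k)] [Module.Finite A.H0 (L.H i)] :
    Module.Finite A.H0 ((cone g).H i) := by
  obtain ⟨δ, hδ⟩ := exists_H_lin (Y := F) (coneSnd g h)
    (fun z hz => ((cone_d_eq_zero_iff g rfl rfl z).1 hz |>.2 |> fun h' => by subst h; exact h'))
    (fun {l} hl x => ⟨-F.idx (by omega) (coneSnd g rfl x), by
      subst hl h; rw [map_neg, d_idx', coneSnd_d g rfl rfl]⟩)
    (fun a z => by
      have := coneSnd_smul g (zero_add i) h h (zero_add k) a z
      rw [sgn_zero, _root_.one_smul] at this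
      exact this)
  refine ⟨Submodule.fg_of_fg_map_of_fg_inf_ker δ (IsNoetherian.noetherian _) ?_⟩
  rw [top_inf_eq]
  have hfg : (LinearMap.range (HmapLin (coneInl g) i)).FG := by
    rw [LinearMap.range_eq_map]
    exact Module.Finite.fg_top.map _
  refine hfg.of_le fun ξ hξ => ?_
  obtain ⟨z, hz, rfl⟩ := (cone g).Hmk_surjective ξ
  rw [LinearMap.mem_ker, hδ, Hmk_eq_zero_iff _ h] at hξ
  obtain ⟨x, hx⟩ := hξ
  have hy : L.d rfl (coneFst g z + g.app i x) = 0 := by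
    subst h
    rw [map_add, ← g.map_d, hx, ((cone_d_eq_zero_iff g rfl rfl z).1 hz).1]
  refine ⟨L.Hmk _ hy, ?_⟩
  rw [HmapLin_apply, Hmap_Hmk, Hmk_eq_iff _ (sub_add_cancel i 1)]
  refine ⟨coneMk g (sub_add_cancel i 1) 0 x, cone_ext h ?_ ?_⟩
  · rw [coneFst_d, coneFst_mk, coneSnd_mk, map_zero, zero_add, map_sub, coneFst_inl,
      add_sub_cancel_left]
  · rw [coneSnd_d g _ h, coneSnd_mk, map_sub, coneSnd_inl, zero_sub, hx]

lemma finite_H_shift {M : DGMod A} {m i k : ℤ} (h : m + i = k) [Module.Finite A.H0 (M.H k)] :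
    Module.Finite A.H0 ((M.shift m).H i) := by
  have hd : ∀ z : M.X k, M.d rfl z = 0 → (M.shift m).d rfl (toShift h z) = 0 := fun z hz => by
    refine ofShift_injective (by omega : m + (i + 1) = k + 1) ?_
    rw [ofShift_d rfl h _ rfl, ofShift_toShift, hz, smul_zero, map_zero]
  obtain ⟨f, hf⟩ := exists_H_lin (toShift h) hd (fun {l} hl x =>
      ⟨sgn m • toShift (by omega : m + (i - 1) = l) x, by
        rw [map_zsmul, toShift_d hl _ h (sub_add_cancel i 1)]⟩) (fun a x => by
      refine ofShift_injective h ?_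
      have := ofShift_smul (zero_add i) h h (zero_add k) a (toShift h x : (M.shift m).X i)
      rw [zero_mul, sgn_zero, _root_.one_smul, ofShift_toShift] at this
      rw [ofShift_toShift]
      exact this.symm)
  refine Module.Finite.of_surjective f fun ξ => ?_
  obtain ⟨w, hw, rfl⟩ := (M.shift m).Hmk_surjective ξ
  refine ⟨M.Hmk (ofShift h w) ?_, ?_⟩
  · have := ofShift_d rfl h (by omega : m + (i + 1) = k + 1) rfl w
    rw [hw, map_zero] at this
    exact zsmul_sgn_eq_zero.1 this.symm
  · rw [hf]
    congr 1
    exact toShift_ofShift h w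

lemma finite_H_of_surjective {M N : DGMod A} {f : M ⟶ N} {i : ℤ}
    (hf : Function.Surjective (Hmap f i)) [Module.Finite A.H0 (M.H i)] :
    Module.Finite A.H0 (N.H i) := Module.Finite.of_surjective (HmapLin f i) hf

lemma FinCell.isCohFinite (hA : A.IsCohPseudoNoetherian) {X : DGMod A} (hX : FinCell X) :
    X.IsCohFinite := by
  have := hA.1
  induction hX with
  | trivial h =>
    intro i
    have : Subsingleton (DGMod.H _ i) := (subsingleton_H_iff _ (sub_add_cancel i 1) rfl).2
      fun z _ => ⟨0, by rw [map_zero, h i z]⟩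
    infer_instance
  | cell j n e h _ ih =>
    intro i
    obtain ⟨z, hz, -, ⟨α⟩⟩ := h.exists_iso_attach
    have hsum : ∀ k, Module.Finite A.H0
        ((directSum fun _ : PUnit.{u + 1} => A.self.shift (-n - 1)).H k) := fun k => by
      have := hA.2 (-n - 1 + k)
      have : Module.Finite A.H0 ((A.self.shift (-n - 1)).H k) := finite_H_shift rfl
      refine finite_H_of_surjective (f := dsIncl (fun _ : PUnit.{u + 1} => A.self.shift (-n - 1)) ⟨⟩)
        (quasiIso_of_bijective _ (fun l => ⟨fun x y hxy => ?_, fun x => ?_⟩) k).2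
      · have := congrArg ((dsProj _ ⟨⟩).app l) hxy
        rwa [dsProj_incl_same, dsProj_incl_same] at this
      · exact ⟨(dsProj _ ⟨⟩).app l x, directSum_ext fun b => by rw [dsProj_incl_same]⟩
    have := hsum (i + 1)
    have := ih i
    have : Module.Finite A.H0 ((DGMod.attach _ _ z hz).H i) := finite_H_cone _ rfl
    exact finite_H_of_surjective (f := α.hom) fun ξ => ⟨Hmap α.inv i ξ, by
      rw [← Hmap_comp, α.inv_hom_id, Hmap_id]⟩

lemma IsFinCellRetract.isCohFinite (hA : A.IsCohPseudoNoetherian) {P : DGMod A}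
    (hP : P.IsFinCellRetract) : P.IsCohFinite := fun i => by
  obtain ⟨L, G, g, u, v, -, hg, hG, huv⟩ := hP
  have := hG.isCohFinite hA i
  have := finite_H_of_surjective (surjective_Hmap_of_retract huv i)
  exact finite_H_of_surjective (hg i).2

/-! ### Projective dimension -/

lemma FinCell.exists_displacement {X : DGMod A} (hX : FinCell X) : ∃ d₀ d₁ : ℤ, d₀ ≤ d₁ ∧
    ∀ (N : DGMod A) (q : ℤ), (∀ i, q + d₀ ≤ i → i ≤ q + d₁ → Subsingleton (N.H i)) →
      Subsingleton ((hom X N).H q) := by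
  induction hX with
  | trivial h =>
    refine ⟨0, 0, le_rfl, fun N q _ => ((hom _ N).subsingleton_H_iff (sub_add_cancel q 1) rfl).2
      fun φ _ => ⟨0, ?_⟩⟩
    rw [map_zero]
    exact hom_ext fun i k hik x => by rw [h i x, map_zero, map_zero]
  | @cell X X' j n e h _ ih =>
    obtain ⟨d₀, d₁, hd, ih⟩ := ih
    refine ⟨min d₀ n, max d₁ n, (min_le_left _ _).trans (hd.trans (le_max_left _ _)),
      fun N q hN => ((hom _ N).subsingleton_H_iff (sub_add_cancel q 1) rfl).2 fun φ hφ => ?_⟩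
    have h₁ := min_le_left d₀ n
    have h₂ := min_le_right d₀ n
    have h₃ := le_max_left d₁ n
    have h₄ := le_max_right d₁ n
    obtain ⟨ψ, hψ⟩ := ((hom X N).subsingleton_H_iff (sub_add_cancel q 1) rfl).1
      (ih N q fun i hi hi' => hN i (by omega) (by omega)) ((preComp j N).app q φ)
      (by rw [← (preComp j N).map_d, hφ, map_zero])
    obtain ⟨ψ', hψ', -⟩ := h.exists_extend ψ fun _ => 0
    have hres : ∀ (i k : ℤ) (hik : i + q = k) (x : X.X i),
        hev hik ((hom X' N).d (sub_add_cancel q 1) ψ') (j.app i x) = hev hik φ (j.app i x) := by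
      intro i k hik x
      rw [d_hev _ ψ' hik (rfl : i + (q - 1) = i + (q - 1)) (by omega) rfl (by omega), hψ',
        ← j.map_d, hψ', ← hev_preComp j hik φ, ← hψ,
        d_hev _ ψ hik (rfl : i + (q - 1) = i + (q - 1)) (by omega) rfl (by omega)]
    obtain ⟨z, hz⟩ := h.d_mem ⟨⟩
    obtain ⟨w, hw⟩ : ∃ w, N.d (by omega : n + (q - 1) + 1 = n + q) w =
        hev rfl (φ - (hom X' N).d (sub_add_cancel q 1) ψ') e := by
      refine (N.subsingleton_H_iff _ rfl).1 (hN (n + q) (by omega) (by omega)) _ ?_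
      have h₅ := d_hev (rfl : q + 1 = q + 1) (φ - (hom X' N).d (sub_add_cancel q 1) ψ')
        (rfl : n + (q + 1) = n + (q + 1)) rfl (by omega) (rfl : n + 1 = n + 1) (by omega) e
      rw [map_sub, hφ, (hom X' N).d_d, sub_zero, map_zero, AddMonoidHom.zero_apply] at h₅
      have h₆ : hev (by omega : n + 1 + q = n + (q + 1))
          (φ - (hom X' N).d (sub_add_cancel q 1) ψ') (X'.d rfl e) = 0 := by
        rw [hz, map_sub, AddMonoidHom.sub_apply, hres, sub_self]
      rw [h₆, smul_zero, sub_zero] at h₅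
      exact (d_eq_zero_iff N _ rfl _).1 h₅.symm
    obtain ⟨χ, hχ, hχe⟩ := h.exists_extend (0 : (hom X N).X (q - 1)) fun _ => w
    refine ⟨ψ' + χ, h.hom_ext (fun i k hik x => ?_) fun _ => ?_⟩
    · rw [map_add, map_add, AddMonoidHom.add_apply, hres,
        d_hev _ χ hik (rfl : i + (q - 1) = i + (q - 1)) (by omega) rfl (by omega), hχ, ← j.map_d,
        hχ]
      simp
    · rw [map_add, map_add, AddMonoidHom.add_apply,
        d_hev _ χ (rfl : n + q = n + q) rfl (by omega) rfl (by omega) e, hχe ⟨⟩, hz, hχ, hw,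
        map_sub, AddMonoidHom.sub_apply]
      simp

open scoped Pointwise in
lemma con_subset {S T : Set ℤ} {d₀ d₁ : ℤ}
    (h : ∀ q ∈ S, ∃ i ∈ T, q + d₀ ≤ i ∧ i ≤ q + d₁) : con S ⊆ con T + Set.Icc (-d₁) (-d₀) := by
  rintro q ⟨q₁, hq₁, q₂, hq₂, h₁, h₂⟩
  obtain ⟨i₁, hi₁, h₃, h₄⟩ := h q₁ hq₁
  obtain ⟨i₂, hi₂, h₅, h₆⟩ := h q₂ hq₂
  refine Set.mem_add.2 ⟨max (q + d₀) (min i₁ i₂), ?_, q - max (q + d₀) (min i₁ i₂), ⟨?_, ?_⟩,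
    by ring⟩
  · rcases le_total i₁ i₂ with hi | hi
    · exact ⟨i₁, hi₁, i₂, hi₂, by omega, by omega⟩
    · exact ⟨i₂, hi₂, i₁, hi₁, by omega, by omega⟩
  · omega
  · omega

lemma IsFinCellRetract.hasFiniteProjDim {P : DGMod A} (hP : P.IsFinCellRetract) :
    P.HasFiniteProjDim := by
  obtain ⟨L, G, g, u, v, hL, hg, hG, huv⟩ := hP
  obtain ⟨d₀, d₁, hd, h⟩ := hG.exists_displacement
  refine ⟨⟨L, g, hg, Cofib.isKProjective hL⟩, d₀, d₁, hd, fun N => con_subset fun q hq => ?_⟩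
  by_contra! hN
  have := h N q fun i hi hi' => not_nontrivial_iff_subsingleton.1 fun hi'' => by
    have := hN i hi'' hi
    omega
  exact not_nontrivial_iff_subsingleton.2 ((surjective_Hmap_of_retract (huv.preComp_retract N) q).subsingleton) hq

lemma HasFiniteProjDim.exists_funExact {P : DGMod A} (hP : P.HasFiniteProjDim) {L : DGMod A}
    (hL : Cofib L) {g : L ⟶ P} (hg : quasiIso A g) : ∃ a : ℤ, ∀ m < a, FunExact L m := by
  obtain ⟨L₀, d₀, d₁, -, h⟩ := hP
  have := isIso_of_quasiIso hg
  have := isIso_of_quasiIso L₀.quasiIso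
  obtain ⟨u, v, huv⟩ := exists_null_of_retract (Cofib.isKProjective hL) L₀.isKProjective
    (Retract.ofIso (asIso ((Q A).map g) ≪≫ (asIso ((Q A).map L₀.map)).symm))
  refine ⟨d₀, fun m hm => FunExact.of_retract (fun M _ _ θ hθ hd => ?_) huv⟩
  have h₀ : Subsingleton ((hom L₀.obj (conc A M m)).H 0) := by
    rw [← not_nontrivial_iff_subsingleton]
    intro hn
    obtain ⟨t, ⟨i, hi, k, hk, hit, htk⟩, w, ⟨hw, hw'⟩, htw⟩ :=
      Set.mem_add.1 (h (conc A M m) ⟨0, hn, 0, hn, le_rfl, le_rfl⟩)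
    have hsupp : ∀ i ∈ (conc A M m).cohSupport, i = m := fun i hi => by
      by_contra him
      refine not_nontrivial_iff_subsingleton.2
        (((conc A M m).subsingleton_H_iff (sub_add_cancel i 1) rfl).2 fun z _ => ⟨0, ?_⟩) hi
      exact ofConc_injective (by rw [map_zero, map_zero, ofConc_eq_zero him])
    have := hsupp i hi
    have := hsupp k hk
    omega
  obtain ⟨ψ, hψ⟩ := ((hom L₀.obj (conc A M m)).subsingleton_H_iff (neg_add_cancel 1)
    (zero_add 1)).1 h₀ hθ.toHom (hom_ext fun i k hik x => by
      rw [d_hev _ hθ.toHom hik (add_zero i) hik rfl (by omega), conc_d, sgn_zero, _root_.one_smul,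
        zero_sub, map_zero, AddMonoidHom.zero_apply, neg_eq_zero]
      subst hik
      refine ofConc_injective ?_
      by_cases hi : i + 1 = m
      · subst hi
        rw [hev_idx_right (add_zero _) _ rfl]
        exact (hθ.hev_toHom _).trans (hd _ x)
      · rw [map_zero, ofConc_eq_zero hi])
  refine ⟨_, isFunctional_hev ψ (by omega : m + 1 + -1 = m), fun x => ?_⟩
  have h₁ := d_hev (neg_add_cancel 1) ψ (add_zero m) (rfl : m + -1 = m + -1) (by omega)
    (rfl : m + 1 = m + 1) (by omega) x
  rw [hψ] at h₁
  rw [← hθ.hev_toHom, h₁, conc_d, sgn_odd (by decide), neg_smul, _root_.one_smul, zero_sub, neg_neg]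
  rfl

lemma isGeometricallyPerfect_of_hasFiniteProjDim (hA : A.IsCohPseudoNoetherian) {P : DGMod A}
    (hb : P.IsCohBddAbove) (hf : P.IsCohFinite) (hP : P.HasFiniteProjDim) :
    P.IsGeometricallyPerfect := by
  have := hA.1
  obtain ⟨L, g, hL, hg⟩ := exists_cofib_resolution P
  obtain ⟨a, ha⟩ := hP.exists_funExact hL hg
  obtain ⟨b, hb⟩ := hb
  refine isGeometricallyPerfect_of_functionals hL hg
    (fun i hi => by
      have := hb i hi
      exact (hg i).1.subsingleton) ha fun F f n hF _ => ?_
  have := hf n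
  have := hF.isCohFinite hA (n + 1)
  have : Module.Finite A.H0 (L.H n) :=
    Module.Finite.of_injective (HmapLin g n) (hg n).1
  exact finite_H_cone f rfl

end DGMod

end DG

theorem theorem0p1 (A : DG.CommDGRing.{u}) (P : DG.DGMod A) :
    List.TFAE
      [P.IsGeometricallyPerfect,
       P.IsCohBddAbove ∧ P.HasPerfectReduction,
       P.IsTensorEvalInvertible,
       P.IsAlgebraicallyPerfect,
       P.IsCompactObject] ∧
    (A.IsCohPseudoNoetherian →
      (P.IsGeometricallyPerfect ↔
        (P.IsCohBddAbove ∧ P.IsCohFinite) ∧ P.HasFiniteProjDim)) := by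
  have h₁₅ : P.IsGeometricallyPerfect → P.IsCompactObject :=
    DG.DGMod.IsGeometricallyPerfect.isCompactObject
  have hr : P.IsCompactObject → P.IsFinCellRetract := fun h => h.exists_finCell
  refine ⟨?_, fun hA => ⟨fun h => ?_, fun h =>
    DG.DGMod.isGeometricallyPerfect_of_hasFiniteProjDim hA h.1.1 h.1.2 h.2⟩⟩
  · tfae_have 1 → 5 := h₁₅
    tfae_have 5 → 3 := fun h => (hr h).isTensorEvalInvertible
    tfae_have 3 → 5 := fun h => h.isCompactObject
    tfae_have 5 → 4 := fun h => (hr h).isAlgebraicallyPerfect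
    tfae_have 4 → 5 := fun h => h.isCompactObject
    tfae_have 5 → 2 := fun h => ⟨(hr h).isCohBddAbove, (hr h).hasPerfectReduction⟩
    tfae_have 2 → 1 := fun h => h.2.isGeometricallyPerfect h.1
    tfae_finish
  · have h' := hr (h₁₅ h)
    exact ⟨⟨h'.isCohBddAbove, h'.isCohFinite hA⟩, h'.hasFiniteProjDim⟩
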